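/- **Setting.** Let $p\in\mathbb N\cup\{\infty\}$. A target $\mathbf w^*\in\mathbb R^p$ is drawn from a prior with $\mathbb E[\mathbf w^*\mathbf w^{*\top}]=\mathbf I$; independently, $\mathbf x\in\mathbb R^p$ is drawn with covariance $\mathbf H=\mathbb E[\mathbf x\mathbf x^\top]$ of finite trace, and $y\in\mathbb R$ is a square-integrable response with $\mathbb E[y\mid\mathbf x,\mathbf w^*]=\mathbf x^\top\mathbf w^*$ and $\sigma^2:=\mathbb E[(y-\mathbf x^\top\mathbf w^*)^2]$ (for $p=\infty$, $\mathbf x^\top\mathbf w^*$ is the $L^2$-limit of its partial sums). The nonincreasing eigenvalues of $\mathbf H$ satisfy $c_{\rm lo}\,i^{-a}\le\lambda_i\le c_{\rm hi}\,i^{-a}$ for all $i\ge 1$ (up to $p$), where $a>1$ and $0<c_{\rm lo}\le c_{\rm hi}$. The sketch $\mathbf S\in\mathbb R^{M\times p}$ has independent $\mathcal N(0,1/M)$ entries. The population risk is $\mathcal R_M(\mathbf v)=\frac12\mathbb E[(\langle\mathbf S\mathbf x,\mathbf v\rangle-y)^2\mid\mathbf w^*]$, $\mathbf v\in\mathbb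 R^M$. Below, all expectations are conditional on $\mathbf S$. **Quantizers.** $\mathcal Q_d,\mathcal Q_s,\mathcal Q_f,\mathcal Q_l,\mathcal Q_p,\mathcal Q_a,\mathcal Q_o$ are random maps (quantizing data, sketch, feature, label, parameter, activation, output gradient), with fresh independent randomness at every use, and unbiased: $\mathbb E[\mathcal Q_i(\mathbf u)\mid\mathbf u]=\mathbf u$ for all $\mathbf u$; $\mathcal Q_l(y)$ is square integrable. For $i\in\{s,d,f,p,a,o\}$ and some $\overline\epsilon_i\ge0$, $\mathcal Q_i$ is $\overline\epsilon_i$-multiplicative: $\mathbb E[(\mathcal Q_i(\mathbf u)-\mathbf u)(\mathcal Q_i(\mathbf u)-\mathbf u)^\top\mid\mathbf u]\preceq\overline\epsilon_i\mathbf u\mathbf u^\top$ for every vector (or scalar) $\mathbf u$, and, for matrices ($i=s$), $\mathbb E[(\mathcal Q_s(\mathbf X)-\mathbf X)\mathbf A(\mathcal Q_s(\mathbf X)-\mathbf X)^\top\mid\mathbf X]\preceq\overline\epsilon_s\mathbf X\mathbf A\mathbf X^\top$ for every $\mathbf X$ and every PSD $\mathbf A$. Put $$\overline\epsilon_2^{(M)}=(1+\overline\epsilon_o)\bigl(1+\overline\epsilon_p+(1+\overline\epsilon_p)\overline\epsilon_a\bigr)-1,\qquad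 \overline\epsilon_3^{(M)}=1-\frac1{(1+\overline\epsilon_d)(1+\overline\epsilon_f)(1+\overline\epsilon_s)}.$$ **Algorithm.** Given $\mathbf w^*$ and independent samples $(\mathbf x_t,y_t)$, $t=1,\dots,N$, let $\mathbf v_0=0$ and $$\mathbf v_t=\mathbf v_{t-1}+\gamma g_t\tilde{\mathbf x}_t,\quad \tilde{\mathbf x}_t=\mathcal Q_f\bigl(\mathcal Q_s(\mathbf S)\mathcal Q_d(\mathbf x_t)\bigr),\quad g_t=\mathcal Q_o\Bigl(\mathcal Q_l(y_t)-\mathcal Q_a\bigl(\tilde{\mathbf x}_t^\top\mathcal Q_p(\mathbf v_{t-1})\bigr)\Bigr),$$ with output $\overline{\mathbf v}_N=\frac1N\sum_{t=0}^{N-1}\mathbf v_t$. Let $\tilde{\mathbf x}=\mathcal Q_f(\mathcal Q_s(\mathbf S)\mathcal Q_d(\mathbf x))$ and $\mathbf H_f^{(q)}=\mathbb E[\tilde{\mathbf x}\tilde{\mathbf x}^\top]$. **Conditions on $\mathbf S$.** Let $\alpha,\beta,\underline\sigma,\overline\sigma>0$ be constants. Consider the conditions: 1. $\tilde{\mathbf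 x}$ has finite fourth moments, and for all PSD $\mathbf A$, $$\mathbf H_f^{(q)}\mathbf A\mathbf H_f^{(q)}+\beta\operatorname{tr}(\mathbf H_f^{(q)}\mathbf A)\mathbf H_f^{(q)}\preceq\mathbb E[\tilde{\mathbf x}\tilde{\mathbf x}^\top\mathbf A\tilde{\mathbf x}\tilde{\mathbf x}^\top]\preceq\alpha\operatorname{tr}(\mathbf H_f^{(q)}\mathbf A)\mathbf H_f^{(q)}.$$ 2. With $\mathbf v^{(q)*}$ a minimizer of $\mathbf v\mapsto\frac12\mathbb E[(\langle\tilde{\mathbf x},\mathbf v\rangle-\mathcal Q_l(y))^2\mid\mathbf w^*]$ (measurable in $\mathbf w^*$) and $\xi=\mathcal Q_l(y)-\langle\mathbf v^{(q)*},\tilde{\mathbf x}\rangle$, the matrix $\mathbb E[\xi^2\tilde{\mathbf x}\tilde{\mathbf x}^\top]$ is finite and $\underline\sigma^2\mathbf H_f^{(q)}\preceq\mathbb E[\xi^2\tilde{\mathbf x}\tilde{\mathbf x}^\top]\preceq\overline\sigma^2\mathbf H_f^{(q)}$. 3. $\gamma<\dfrac1{(1+\overline\epsilon_2^{(M)})\,\alpha\operatorname{tr}(\mathbf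 H_f^{(q)})}$. 4. $\mathbf H_f^{(q)}$ and $\mathbf S\mathbf H\mathbf S^\top$ commute. **Theorem (scaling law under multiplicative quantization, an upper bound).** For all $a>1$ and $c_{\rm lo},c_{\rm hi},\alpha,\beta,\underline\sigma,\overline\sigma,\gamma_0>0$ there are constants $C,c>0$, depending only on these numbers, such that for all $p$, all $M,N\ge1$, all data distributions, priors, quantizers and levels $\overline\epsilon_i\ge0$ as above, and every stepsize $\gamma\ge\gamma_0$, the following holds with probability at least $1-e^{-cM}$ over $\mathbf S$: if conditions 1–4 hold, then $$\mathbb E\,\mathcal R_M(\overline{\mathbf v}_N)\le C\left(\frac1{M_{\rm eff}^{a-1}}+\frac1{N_{\rm eff}^{(a-1)/a}}+\sigma^2+\overline\epsilon_3^{(M)}\right),$$ where $$M_{\rm eff}=M,\qquad N_{\rm eff}=N\left[\frac{1+\overline\epsilon_2^{(M)}}{(1-\overline\epsilon_3^{(M)})^{1/a}}\right]^{-a/(a-1)}.$$ -/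

import Mathlib

open MeasureTheory ProbabilityTheory Filter Topology
open scoped ENNReal NNReal Matrix

noncomputable section

namespace QuantSGD

/-- Coordinates of the data space: `{0, …, p - 1}` for finite `p`, all of `ℕ` for `p = ∞`. -/
abbrev Coord (p : ℕ∞) : Type := {j : ℕ // (j : ℕ∞) < p}

/-- Vectors indexed by the coordinates of the data space (data points and targets). -/
abbrev DataVec (p : ℕ∞) : Type := Coord p → ℝ

/-- Vectors of the sketched space `ℝ^M` (features and trainable parameters). -/
abbrev FeatVec (M : ℕ) : Type := Fin M → ℝ

/-- `M × p` matrices; the number of columns may be infinite. -/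
abbrev SketchMat (M : ℕ) (p : ℕ∞) : Type := Fin M → Coord p → ℝ

/-- The coordinates `j < n`. -/
def firstCoords (p : ℕ∞) (n : ℕ) : Finset (Coord p) :=
  (Finset.range n).subtype (fun j : ℕ => (j : ℕ∞) < p)

/-- The product `T u` of an `M × p` matrix and a vector. For `p = ∞` each row is the ordered
(possibly only conditionally convergent) series `∑_j T i j * u j`. -/
def sketchApply {M : ℕ} {p : ℕ∞} (T : SketchMat M p) (u : DataVec p) : FeatVec M :=
  fun i => limUnder atTop (fun n : ℕ => ∑ j ∈ firstCoords p n, T i j * u j)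

theorem measurable_sketchApply {M : ℕ} {p : ℕ∞} :
    Measurable (fun z : SketchMat M p × DataVec p => sketchApply z.1 z.2) := by
  refine measurable_pi_lambda _ (fun i => ?_)
  refine (StronglyMeasurable.limUnder (l := atTop)
    (f := fun (n : ℕ) (z : SketchMat M p × DataVec p) =>
      ∑ j ∈ firstCoords p n, z.1 i j * z.2 j) (fun n => ?_)).measurable
  refine Measurable.stronglyMeasurable ?_
  fun_prop

/-- Law of the Gaussian sketch: independent `N(0, 1/M)` entries. -/
def gaussianSketch (M : ℕ) (p : ℕ∞) : Measure (SketchMat M p) :=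
  Measure.pi (fun _ : Fin M =>
    Measure.infinitePi (fun _ : Coord p => gaussianReal 0 ((M : ℝ≥0)⁻¹)))

/-! ### Data model -/

/-- The target `w*` is drawn from `prior`; independently the data vector `x` is drawn from `law`;
given `(w*, x)`, the response `y` is drawn from `label (w*, x)`. -/
structure DataModel (p : ℕ∞) where
  prior : Measure (DataVec p)
  law : Measure (DataVec p)
  label : Kernel (DataVec p × DataVec p) ℝ
  [prob_prior : IsProbabilityMeasure prior]
  [prob_law : IsProbabilityMeasure law]
  [markov_label : IsMarkovKernel label]

attribute [instance] DataModel.prob_prior DataModel.prob_law DataModel.markov_label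

namespace DataModel

variable {p : ℕ∞} (D : DataModel p)

/-- Joint law of `((w*, x), y)`. -/
def joint : Measure ((DataVec p × DataVec p) × ℝ) := (D.prior.prod D.law) ⊗ₘ D.label

/-- Conditional law of `(x, y)` given `w*`. -/
def sampleXY : Kernel (DataVec p) (DataVec p × ℝ) := Kernel.const (DataVec p) D.law ⊗ₖ D.label

instance : IsMarkovKernel D.sampleXY := by unfold sampleXY; infer_instance

/-- The regression function `E[y | w*, x]`. -/
def regression (z : DataVec p × DataVec p) : ℝ := ∫ y, y ∂(D.label z)

/-- `σ² = E[(y - E[y | w*, x])²]`. -/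
def noiseVar : ℝ := ∫ z, (z.2 - D.regression z.1) ^ 2 ∂D.joint

/-- Data covariance `H = E[x xᵀ]`. -/
def cov (k l : Coord p) : ℝ := ∫ x, x k * x l ∂D.law

/-- Finite second moments and finite trace of `H`. -/
def FiniteTrace : Prop :=
  (∀ k, MemLp (fun x : DataVec p => x k) 2 D.law) ∧ Summable (fun k => D.cov k k)

/-- `H` has a complete orthonormal system of eigenvectors in `ℓ²` whose eigenvalues
`ev 0 ≥ ev 1 ≥ …` (all of them positive as soon as `0 < cLo`) satisfy `ev i ≍ (i + 1)^(-a)`. -/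
def PowerLawSpectrum (a cLo cHi : ℝ) : Prop :=
  ∃ (b : HilbertBasis (Coord p) ℝ (lp (fun _ : Coord p => ℝ) 2)) (ev : Coord p → ℝ),
    Antitone ev ∧
    (∀ i k, ∑' l, D.cov k l * b i l = ev i * b i k) ∧
    ∀ i, cLo * ((i.1 : ℝ) + 1) ^ (-a) ≤ ev i ∧ ev i ≤ cHi * ((i.1 : ℝ) + 1) ^ (-a)

/-- `E[w* w*ᵀ] = I`. -/
def IsotropicPrior : Prop :=
  ∀ k l, Integrable (fun w : DataVec p => w k * w l) D.prior ∧
    ∫ w, w k * w l ∂D.prior = if k = l then 1 else 0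

/-- `y` is square integrable and `E[y | w*, x] = ⟨x, w*⟩`. For `p = ∞` the target `w*` is not in
`ℓ²`, and `⟨x, w*⟩` is the limit of its partial sums in `L²`; for finite `p` this is the equality
`E[y | w*, x] = ∑_j x j * w* j` almost surely. -/
def WellSpecified : Prop :=
  MemLp (fun z : (DataVec p × DataVec p) × ℝ => z.2) 2 D.joint ∧
  Tendsto (fun n : ℕ => eLpNorm
      (fun z : DataVec p × DataVec p =>
        D.regression z - ∑ j ∈ firstCoords p n, z.2 j * z.1 j) 2 (D.prior.prod D.law))
    atTop (𝓝 0)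

/-- Population risk `R_M(v) = E[(⟨S x, v⟩ - y)²] / 2` for a given target `w*` and sketch `S`. -/
def popRisk {M : ℕ} (S : SketchMat M p) (w : DataVec p) (v : FeatVec M) : ℝ≥0∞ :=
  ∫⁻ z, ENNReal.ofReal ((1 / 2) * (sketchApply S z.1 ⬝ᵥ v - z.2) ^ 2) ∂(D.sampleXY w)

/-- `S H Sᵀ`, the limit of `∑_{k,l<n} S i k * H k l * S j l`. -/
def sketchedCov {M : ℕ} (S : SketchMat M p) : Matrix (Fin M) (Fin M) ℝ :=
  Matrix.of fun i j => limUnder atTop (fun n : ℕ =>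
    ∑ k ∈ firstCoords p n, ∑ l ∈ firstCoords p n, S i k * D.cov k l * S j l)

end DataModel

/-! ### Stochastic quantizers

A stochastic quantizer is a Markov kernel: `K u` is the law of the quantized value of `u`. -/

/-- `E[Q(u) | u] = u`, vectors. -/
def UnbiasedVec {ι : Type} (K : Kernel (ι → ℝ) (ι → ℝ)) : Prop :=
  ∀ u j, Integrable (fun v : ι → ℝ => v j) (K u) ∧ ∫ v, v j ∂(K u) = u j

/-- `E[(Q(u) - u)(Q(u) - u)ᵀ | u] ≼ ε u uᵀ`, tested against all finitely supported vectors `c`. -/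
def MultiplicativeVec {ι : Type} (K : Kernel (ι → ℝ) (ι → ℝ)) (ε : ℝ) : Prop :=
  ∀ (u : ι → ℝ) (c : ι →₀ ℝ),
    ∫⁻ v, ENNReal.ofReal ((c.sum fun j t => t * (v j - u j)) ^ 2) ∂(K u) ≤
      ENNReal.ofReal (ε * (c.sum fun j t => t * u j) ^ 2)

/-- `E[Q(u) | u] = u`, scalars. -/
def UnbiasedScalar (K : Kernel ℝ ℝ) : Prop :=
  ∀ u, Integrable (fun v : ℝ => v) (K u) ∧ ∫ v, v ∂(K u) = u

/-- `E[(Q(u) - u)² | u] ≤ ε u²`, scalars. -/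
def MultiplicativeScalar (K : Kernel ℝ ℝ) (ε : ℝ) : Prop :=
  ∀ u, ∫⁻ v, ENNReal.ofReal ((v - u) ^ 2) ∂(K u) ≤ ENNReal.ofReal (ε * u ^ 2)

/-- `E[Q(X) | X] = X`, matrices. -/
def UnbiasedMat {m ι : Type} (K : Kernel (m → ι → ℝ) (m → ι → ℝ)) : Prop :=
  ∀ X i j, Integrable (fun T : m → ι → ℝ => T i j) (K X) ∧ ∫ T, T i j ∂(K X) = X i j

/-- `bᵀ X`, restricted to the columns in `s`. -/
def rowComb {m ι : Type} [Fintype m] (s : Finset ι) (b : m → ℝ) (X : m → ι → ℝ) : s → ℝ :=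
  fun k => ∑ i, b i * X i k

/-- `E[(Q(X) - X) A (Q(X) - X)ᵀ | X] ≼ ε X A Xᵀ` for all positive semidefinite `A` (supported on
finitely many coordinates), tested against all vectors `b`. -/
def MultiplicativeMat {m ι : Type} [Fintype m] (K : Kernel (m → ι → ℝ) (m → ι → ℝ))
    (ε : ℝ) : Prop :=
  ∀ (X : m → ι → ℝ) (s : Finset ι) (A : Matrix s s ℝ), A.PosSemidef → ∀ b : m → ℝ,
    ∫⁻ T, ENNReal.ofReal (rowComb s b (T - X) ⬝ᵥ A *ᵥ rowComb s b (T - X)) ∂(K X) ≤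
      ENNReal.ofReal (ε * (rowComb s b X ⬝ᵥ A *ᵥ rowComb s b X))

/-- The quantizers for data, sketch, feature, label, parameter, activation, output gradient. -/
structure Quantizers (M : ℕ) (p : ℕ∞) where
  data : Kernel (DataVec p) (DataVec p)
  sketch : Kernel (SketchMat M p) (SketchMat M p)
  feature : Kernel (FeatVec M) (FeatVec M)
  label : Kernel ℝ ℝ
  param : Kernel (FeatVec M) (FeatVec M)
  activation : Kernel ℝ ℝ
  outGrad : Kernel ℝ ℝ
  [markov_data : IsMarkovKernel data]
  [markov_sketch : IsMarkovKernel sketch]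
  [markov_feature : IsMarkovKernel feature]
  [markov_label : IsMarkovKernel label]
  [markov_param : IsMarkovKernel param]
  [markov_activation : IsMarkovKernel activation]
  [markov_outGrad : IsMarkovKernel outGrad]

attribute [instance] Quantizers.markov_data Quantizers.markov_sketch Quantizers.markov_feature
  Quantizers.markov_label Quantizers.markov_param Quantizers.markov_activation
  Quantizers.markov_outGrad

/-- Upper multiplicative error levels `ε̄_i` (data, sketch, feature, param, activation, outGrad). -/
structure ErrorLevels where
  data : ℝ
  sketch : ℝ
  feature : ℝ
  param : ℝ
  activation : ℝ
  outGrad : ℝ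

namespace ErrorLevels

/-- All levels are nonnegative. -/
def Nonneg (e : ErrorLevels) : Prop :=
  0 ≤ e.data ∧ 0 ≤ e.sketch ∧ 0 ≤ e.feature ∧ 0 ≤ e.param ∧ 0 ≤ e.activation ∧ 0 ≤ e.outGrad

/-- Noise amplification `ε̄₂ = (1 + ε̄_o)(1 + ε̄_p + (1 + ε̄_p) ε̄_a) - 1`. -/
def amplification (e : ErrorLevels) : ℝ :=
  (1 + e.outGrad) * (1 + (e.param + (1 + e.param) * e.activation)) - 1

/-- Spectral distortion `ε̄₃ = 1 - 1 / ((1 + ε̄_d)(1 + ε̄_f)(1 + ε̄_s))`. -/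
def distortion (e : ErrorLevels) : ℝ :=
  1 - 1 / ((1 + e.data) * (1 + e.feature) * (1 + e.sketch))

end ErrorLevels

namespace Quantizers

variable {M : ℕ} {p : ℕ∞} (Q : Quantizers M p)

/-- All seven quantizers are unbiased. -/
def Unbiased : Prop :=
  UnbiasedVec Q.data ∧ UnbiasedMat Q.sketch ∧ UnbiasedVec Q.feature ∧ UnbiasedScalar Q.label ∧
    UnbiasedVec Q.param ∧ UnbiasedScalar Q.activation ∧ UnbiasedScalar Q.outGrad

/-- All quantizers except the label quantizer are multiplicative with levels `e`. -/
def Multiplicative (e : ErrorLevels) : Prop :=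
  MultiplicativeVec Q.data e.data ∧ MultiplicativeMat Q.sketch e.sketch ∧
    MultiplicativeVec Q.feature e.feature ∧ MultiplicativeVec Q.param e.param ∧
    MultiplicativeScalar Q.activation e.activation ∧ MultiplicativeScalar Q.outGrad e.outGrad

/-- Given `x`, the law of `x̃ = Q_f(Q_s(S) Q_d(x))`, with fresh independent quantizers. -/
def featureKernel (S : SketchMat M p) : Kernel (DataVec p) (FeatVec M) :=
  Q.feature ∘ₖ
    ((Kernel.const (DataVec p) (Q.sketch S) ×ₖ Q.data).map fun z => sketchApply z.1 z.2)

instance (S : SketchMat M p) : IsMarkovKernel (Q.featureKernel S) := by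
  have : IsMarkovKernel ((Kernel.const (DataVec p) (Q.sketch S) ×ₖ Q.data).map
      fun z => sketchApply z.1 z.2) :=
    Kernel.IsMarkovKernel.map _ measurable_sketchApply
  unfold featureKernel; infer_instance

/-- Given `w*`, the law of the quantized sample `(x̃, Q_l(y))`. -/
def sample (D : DataModel p) (S : SketchMat M p) : Kernel (DataVec p) (FeatVec M × ℝ) :=
  (Q.featureKernel S ∥ₖ Q.label) ∘ₖ D.sampleXY

instance (D : DataModel p) (S : SketchMat M p) : IsMarkovKernel (Q.sample D S) := by
  unfold sample; infer_instance

/-- Given `(v, (f, z))` with `z` a quantized label, the law of `Q_a(fᵀ Q_p(v))`. -/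
def activationKernel : Kernel (FeatVec M × (FeatVec M × ℝ)) ℝ :=
  Kernel.snd (Q.param.comap (fun t : FeatVec M × (FeatVec M × ℝ) => t.1) measurable_fst ⊗ₖ
    Q.activation.comap
      (fun t : (FeatVec M × (FeatVec M × ℝ)) × FeatVec M => t.1.2.1 ⬝ᵥ t.2)
      (by unfold dotProduct; fun_prop))

instance : IsMarkovKernel Q.activationKernel := by unfold activationKernel; infer_instance

/-- Given `(v, (f, z))`, the law of the quantized output gradient `Q_o(z - Q_a(fᵀ Q_p(v)))`. -/
def outGradKernel : Kernel (FeatVec M × (FeatVec M × ℝ)) ℝ :=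
  Kernel.snd (Q.activationKernel ⊗ₖ
    Q.outGrad.comap (fun t : (FeatVec M × (FeatVec M × ℝ)) × ℝ => t.1.2.2 - t.2)
      (by fun_prop))

instance : IsMarkovKernel Q.outGradKernel := by unfold outGradKernel; infer_instance

/-- Given `(w*, v)`, the law of `((v, (f, z)), g)`: current parameter, fresh quantized sample,
output gradient. -/
def gradStep (D : DataModel p) (S : SketchMat M p) :
    Kernel (DataVec p × FeatVec M) ((FeatVec M × (FeatVec M × ℝ)) × ℝ) :=
  (Kernel.deterministic (fun t : DataVec p × FeatVec M => t.2) measurable_snd ×ₖ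
      (Q.sample D S).comap (fun t : DataVec p × FeatVec M => t.1) measurable_fst) ⊗ₖ
    Q.outGradKernel.comap
      (fun t : (DataVec p × FeatVec M) × (FeatVec M × (FeatVec M × ℝ)) => t.2) measurable_snd

instance (D : DataModel p) (S : SketchMat M p) : IsMarkovKernel (Q.gradStep D S) := by
  unfold gradStep; infer_instance

/-- Given `(w*, v_{t-1})`, the law of `v_t = v_{t-1} + γ g f`. -/
def sgdStep (D : DataModel p) (S : SketchMat M p) (γ : ℝ) :
    Kernel (DataVec p × FeatVec M) (FeatVec M) :=
  (Q.gradStep D S).map fun t => t.1.1 + (γ * t.2) • t.1.2.1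

instance (D : DataModel p) (S : SketchMat M p) (γ : ℝ) : IsMarkovKernel (Q.sgdStep D S γ) := by
  unfold sgdStep; exact Kernel.IsMarkovKernel.map _ (by fun_prop)

/-- Given `w*`, the joint law of `(v_t, ∑_{s<t} v_s)` for quantized SGD with `v_0 = 0`. -/
def trajectory (D : DataModel p) (S : SketchMat M p) (γ : ℝ) :
    ℕ → Kernel (DataVec p) (FeatVec M × FeatVec M)
  | 0 => Kernel.const (DataVec p) (Measure.dirac (0, 0))
  | t + 1 =>
    ((trajectory D S γ t) ⊗ₖ
      (Q.sgdStep D S γ).comap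
        (fun r : DataVec p × (FeatVec M × FeatVec M) => (r.1, r.2.1)) (by fun_prop)).map
      fun r => (r.2, r.1.2 + r.1.1)

instance (D : DataModel p) (S : SketchMat M p) (γ : ℝ) (t : ℕ) :
    IsMarkovKernel (Q.trajectory D S γ t) := by
  induction t with
  | zero => unfold trajectory; infer_instance
  | succ t ih => unfold trajectory; exact Kernel.IsMarkovKernel.map _ (by fun_prop)

/-- `E[R_M(v̄_N)]`, `v̄_N = (1/N) ∑_{t<N} v_t`: expectation over the target, the training data and
all quantizers, for a given sketch `S`. -/
def expectedRisk (D : DataModel p) (S : SketchMat M p) (γ : ℝ) (N : ℕ) : ℝ≥0∞ :=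
  ∫⁻ w, ∫⁻ r, D.popRisk S w ((N : ℝ)⁻¹ • r.2) ∂(Q.trajectory D S γ N w) ∂D.prior

/-- The law of the quantized feature `x̃`. -/
def featureLaw (D : DataModel p) (S : SketchMat M p) : Measure (FeatVec M) :=
  Q.featureKernel S ∘ₘ D.law

/-- The quantized feature covariance `H_f = E[x̃ x̃ᵀ]`. -/
def featureCov (D : DataModel p) (S : SketchMat M p) : Matrix (Fin M) (Fin M) ℝ :=
  Matrix.of fun i j => ∫ f, f i * f j ∂(Q.featureLaw D S)

/-- `E[x̃ x̃ᵀ A x̃ x̃ᵀ]`. -/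
def featureFourth (D : DataModel p) (S : SketchMat M p) (A : Matrix (Fin M) (Fin M) ℝ) :
    Matrix (Fin M) (Fin M) ℝ :=
  Matrix.of fun i j => ∫ f, (f ⬝ᵥ A *ᵥ f) * (f i * f j) ∂(Q.featureLaw D S)

/-- Finite fourth moment and
`H_f A H_f + β tr(H_f A) H_f ≼ E[x̃ x̃ᵀ A x̃ x̃ᵀ] ≼ α tr(H_f A) H_f` for all `A ≽ 0`. -/
def FourthMoment (D : DataModel p) (S : SketchMat M p) (α β : ℝ) : Prop :=
  (∀ i, MemLp (fun f : FeatVec M => f i) 4 (Q.featureLaw D S)) ∧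
  ∀ A : Matrix (Fin M) (Fin M) ℝ, A.PosSemidef →
    (Q.featureFourth D S A -
      (Q.featureCov D S * A * Q.featureCov D S +
        (β * (Q.featureCov D S * A).trace) • Q.featureCov D S)).PosSemidef ∧
    ((α * (Q.featureCov D S * A).trace) • Q.featureCov D S - Q.featureFourth D S A).PosSemidef

/-- Quantized risk `E[(⟨x̃, v⟩ - Q_l(y))²] / 2` for a given target `w*`. -/
def quantRisk (D : DataModel p) (S : SketchMat M p) (w : DataVec p) (v : FeatVec M) : ℝ≥0∞ :=
  ∫⁻ z, ENNReal.ofReal ((1 / 2) * (z.1 ⬝ᵥ v - z.2) ^ 2) ∂(Q.sample D S w)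

/-- `E[ξ² x̃ x̃ᵀ]` with `ξ = Q_l(y) - ⟨vq(w*), x̃⟩`. -/
def noiseCov (D : DataModel p) (S : SketchMat M p) (vq : DataVec p → FeatVec M) :
    Matrix (Fin M) (Fin M) ℝ :=
  Matrix.of fun i j =>
    ∫ r, (r.2.2 - vq r.1 ⬝ᵥ r.2.1) ^ 2 * (r.2.1 i * r.2.1 j) ∂(D.prior ⊗ₘ Q.sample D S)

/-- With `vq(w*)` a minimizer of the quantized risk and `ξ = Q_l(y) - ⟨vq(w*), x̃⟩`:
`σLo² H_f ≼ E[ξ² x̃ x̃ᵀ] ≼ σHi² H_f`. -/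
def NoiseCondition (D : DataModel p) (S : SketchMat M p) (σLo σHi : ℝ) : Prop :=
  ∃ vq : DataVec p → FeatVec M, Measurable vq ∧
    (∀ᵐ w ∂D.prior, ∀ v, Q.quantRisk D S w (vq w) ≤ Q.quantRisk D S w v) ∧
    (∀ i j, Integrable
      (fun r : DataVec p × (FeatVec M × ℝ) =>
        (r.2.2 - vq r.1 ⬝ᵥ r.2.1) ^ 2 * (r.2.1 i * r.2.1 j)) (D.prior ⊗ₘ Q.sample D S)) ∧
    (Q.noiseCov D S vq - σLo ^ 2 • Q.featureCov D S).PosSemidef ∧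
    (σHi ^ 2 • Q.featureCov D S - Q.noiseCov D S vq).PosSemidef

/-- The quantized label has a finite second moment. -/
def LabelSquareIntegrable (D : DataModel p) : Prop :=
  MemLp (fun z : ℝ => z) 2 (Q.label ∘ₘ (D.joint.map Prod.snd))

end Quantizers

/-- Effective model size. -/
def effModel (M : ℕ) : ℝ := M

/-- Effective data size `N [(1 + ε̄₂) / (1 - ε̄₃)^(1/a)]^(-a/(a-1))`. -/
def effData (a : ℝ) (e : ErrorLevels) (N : ℕ) : ℝ :=
  N * ((1 + e.amplification) / (1 - e.distortion) ^ (1 / a)) ^ (-(a / (a - 1)))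

end QuantSGD

end

open QuantSGD

noncomputable section

namespace QuantSGD

section

/-! ### Gaussian rows -/

/-! The proof compares the iterate with a predictor living on a low-dimensional part of the data,
whose dimension `k` satisfies `2 * k ≤ M` and is chosen at the end. Truncating the first `k`
eigenvectors of `H` to finitely many coordinates and orthonormalizing gives a finite family whose
orthogonal residual of `x` has energy of order `(k + 1) ^ (1 - a)`. Three Gaussian events then
suffice: the sketch shrinks no vector of the span below the factor `10 ^ (-7)`, it multiplies the
residual energy bound by at most 20, and it keeps a constant fraction of the energy of the data.
Each fails with probability at most a multiple of `e ^ (-4 M)`, by exponential moments and, for the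
smallest singular value, a volume argument (`gaussianSketch_energy_gt_le`,
`gaussianSketch_energy_lt_le`, `gaussianSketch_exists_mulVec_lt_le`). Everything else is
deterministic in the sketch.

Quantization. A multiplicative unbiased quantizer multiplies a given vector by a random scalar
(`exists_scalar_of_multiplicative`). Hence in every direction `b` the feature has mean `⟨b, S x⟩`
and variance at most `(Φ - 1) ⟨b, S x⟩²`, with `Φ = 1 / (1 - ε̄₃)`, and the feature covariance `G`
lies between `S H Sᵀ` and `Φ` times it. The quantized risk is the population risk plus a label term
independent of the parameter plus the feature variance. Evaluating it at a comparator shrunk by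
`Φ⁻¹` costs only `ε̄₃ E[y²] / 2`, so the population risk of any `v` is at most half the squared
`G`-distance from `v` to the quantized minimizer plus the comparator risk
(`quad_le_comparatorRisk_and_popRisk_le`). The comparator applies a pseudo-inverse of the transposed
sketched family to the coordinates of the target (`exists_comparator`): its risk is of the order of
noise plus residual, and its mean square norm is of order `k`.

Optimization. Along each eigenvector of `G` the mean square error of SGD obeys a scalar recursion,
the directions being coupled only through the total excess risk in the noise. The stepsize condition
absorbs this coupling. Averaging then gives a sum weighted by `min (g i) (1 / (γ N))`:
Cauchy–Schwarz serves the small eigenvalues, a martingale identity the large ones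
(`averaged_recursion_bound`, `lintegral_quad_average_le`). Its bias part is again bounded by the
comparator, and its variance part by `∑ min (g i) (1 / (γ N))`, which is at most `k / (γ N)` plus
the sketched residual energy plus a multiple of `ε̄₃` (`sum_min_le_of_residual`).

Since `γ ≥ γ₀` and `tr G` is bounded below, the stepsize condition bounds both `γ (1 + ε̄₂)` and `tr
G` by constants, so no amplification remains. As `N_eff ≤ N`, it is enough to reach the rate in `N`,
and `k = min (M / 2) ⌈N ^ (1 / a)⌉` balances `k ^ (1 - a)` with `k / N`. -/

theorem lintegral_exp_sq_gaussianReal (t : ℝ) (v : ℝ≥0) (h : 2 * t * v < 1) :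
    ∫⁻ x, ENNReal.ofReal (Real.exp (t * x ^ 2)) ∂(gaussianReal 0 v) =
      ENNReal.ofReal (√(1 - 2 * t * v))⁻¹ := by
  by_cases hv : v = 0
  · subst hv
    rw [gaussianReal_zero_var, lintegral_dirac' _ (by fun_prop)]
    simp
  have hv' : (0 : ℝ) < v := by positivity
  have hb : 0 < (1 - 2 * t * v) / (2 * v) := by
    apply div_pos <;> linarith
  rw [gaussianReal_of_var_ne_zero _ hv, lintegral_withDensity_eq_lintegral_mul₀ (by fun_prop)
    (by fun_prop)]
  have h1 : ∀ x : ℝ, (gaussianPDF 0 v * fun x => ENNReal.ofReal (Real.exp (t * x ^ 2))) x =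
      ENNReal.ofReal ((√(2 * Real.pi * v))⁻¹ *
        Real.exp (-((1 - 2 * t * v) / (2 * v)) * x ^ 2)) := by
    intro x
    simp only [Pi.mul_apply, gaussianPDF, gaussianPDFReal]
    rw [← ENNReal.ofReal_mul (by positivity), mul_assoc, ← Real.exp_add]
    congr 3
    field_simp
    ring
  simp_rw [h1]
  rw [← ofReal_integral_eq_lintegral_ofReal ((integrable_exp_neg_mul_sq hb).const_mul _)
    (Eventually.of_forall fun x => by positivity), integral_const_mul, integral_gaussian,
    ← Real.sqrt_inv, ← Real.sqrt_mul (by positivity), ← Real.sqrt_inv]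
  congr 2
  have := Real.pi_pos
  field_simp

variable {p : ℕ∞}

/-- Law of one row of the Gaussian sketch, for entries of variance `v`. -/
abbrev gaussianRow (p : ℕ∞) (v : ℝ≥0) : Measure (DataVec p) :=
  Measure.infinitePi (fun _ : Coord p => gaussianReal 0 v)

theorem map_sum_gaussianRow (v : ℝ≥0) (u : DataVec p) (F : Finset (Coord p)) :
    (gaussianRow p v).map (fun s => ∑ j ∈ F, s j * u j) =
      gaussianReal 0 (v * ∑ j ∈ F, (u j ^ 2).toNNReal) := by
  classical
  have hind : iIndepFun (fun (j : Coord p) (s : DataVec p) => s j * u j) (gaussianRow p v) :=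
    iIndepFun_infinitePi (X := fun j x => x * u j) (by fun_prop)
  induction F using Finset.induction_on with
  | empty => simp [gaussianReal_zero_var]
  | insert a F ha ih =>
    have h2 : (gaussianRow p v).map (fun s => s a * u a) =
        gaussianReal 0 (v * (u a ^ 2).toNNReal) := by
      have h3 : (gaussianRow p v).map (fun s => s a) = gaussianReal 0 v :=
        Measure.infinitePi_map_eval _ a
      have h4 := gaussianReal_map_mul_const (μ := 0) (v := v) (u a)
      rw [← h3, Measure.map_map (by fun_prop) (by fun_prop)] at h4
      simp only [Function.comp_def] at h4
      rw [h4, mul_zero, mul_comm]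
      congr 2
      ext
      simp [Real.coe_toNNReal _ (sq_nonneg (u a))]
    have h5 := gaussianReal_add_gaussianReal_of_indepFun
      (hind.indepFun_finsetSum_of_notMem (by fun_prop) ha).symm h2
      (by convert ih using 2; ext s; simp)
    rw [Finset.sum_insert ha, mul_add]
    convert h5 using 2
    · ext s; simp [Finset.sum_insert ha]
    · simp

theorem monotone_firstCoords : Monotone (firstCoords p) := by
  intro m n h j hj
  simp only [firstCoords, Finset.mem_subtype, Finset.mem_range] at *
  omega

theorem tendsto_firstCoords : Tendsto (firstCoords p) atTop atTop := by
  refine tendsto_atTop_finset_of_monotone monotone_firstCoords fun j => ⟨j.1 + 1, ?_⟩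
  simp [firstCoords]

theorem integrable_eval_gaussianRow (v : ℝ≥0) (j : Coord p) :
    Integrable (fun s : DataVec p => s j) (gaussianRow p v) := by
  have h : Integrable (id : ℝ → ℝ) ((gaussianRow p v).map (fun s => s j)) := by
    rw [show (gaussianRow p v).map (fun s => s j) = gaussianReal 0 v from
      Measure.infinitePi_map_eval _ j]
    exact (memLp_id_gaussianReal 1).integrable (by simp)
  exact h.comp_measurable (by fun_prop)

theorem integral_eval_gaussianRow (v : ℝ≥0) (j : Coord p) :
    ∫ s, s j ∂(gaussianRow p v) = 0 := by
  have h : ∫ x, x ∂((gaussianRow p v).map (fun s => s j)) = 0 := by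
    rw [show (gaussianRow p v).map (fun s => s j) = gaussianReal 0 v from
      Measure.infinitePi_map_eval _ j]
    exact integral_id_gaussianReal
  rwa [integral_map (measurable_pi_apply j).aemeasurable (by fun_prop)] at h

/-- The filtration generated by the first coordinates. -/
def coordFiltration (p : ℕ∞) : Filtration ℕ (inferInstance : MeasurableSpace (DataVec p)) where
  seq n := MeasurableSpace.comap (fun (s : DataVec p) (j : firstCoords p n) => s j) inferInstance
  mono' := by
    intro m n h
    have hsub := monotone_firstCoords (p := p) h
    have : (fun (s : DataVec p) (j : firstCoords p m) => s j) =
        (fun (r : firstCoords p n → ℝ) (j : firstCoords p m) => r ⟨j.1, hsub j.2⟩) ∘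
          (fun (s : DataVec p) (j : firstCoords p n) => s j) := rfl
    dsimp only
    rw [this, ← MeasurableSpace.comap_comp]
    exact MeasurableSpace.comap_mono (Measurable.comap_le (by fun_prop))
  le' n := Measurable.comap_le (by fun_prop)

/-- The increments are centred and independent of the earlier coordinates; for finite `p` they
vanish once the coordinates are exhausted. -/
theorem martingale_gaussianRow (v : ℝ≥0) (u : DataVec p) :
    Martingale (fun n (s : DataVec p) => ∑ j ∈ firstCoords p n, s j * u j) (coordFiltration p)
      (gaussianRow p v) := by
  classical
  have hint : ∀ n, Integrable (fun s : DataVec p => ∑ j ∈ firstCoords p n, s j * u j)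
      (gaussianRow p v) := fun n =>
    integrable_finsetSum _ fun j _ => (integrable_eval_gaussianRow v j).mul_const _
  refine martingale_of_condExp_sub_eq_zero_nat (fun n => ?_) hint fun n => ?_
  · have h1 : Measurable[(coordFiltration p) n]
        (fun (s : DataVec p) (j : firstCoords p n) => s j) := comap_measurable _
    have h2 : Measurable (fun r : firstCoords p n → ℝ => ∑ j, r j * u j) := by fun_prop
    have h3 := (h2.comp h1).stronglyMeasurable
    convert h3 using 2 with s
    rw [Function.comp, Finset.sum_coe_sort (firstCoords p n) (fun j => s j * u j)]
  · by_cases hn : (n : ℕ∞) < p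
    · have hi : (⟨n, hn⟩ : Coord p) ∉ firstCoords p n := by simp [firstCoords]
      have hs : firstCoords p (n + 1) = insert ⟨n, hn⟩ (firstCoords p n) := by
        ext j
        simp only [firstCoords, Finset.mem_subtype, Finset.mem_range, Finset.mem_insert,
          Subtype.ext_iff]
        omega
      have he : ((fun s : DataVec p => ∑ j ∈ firstCoords p (n + 1), s j * u j) -
          fun s => ∑ j ∈ firstCoords p n, s j * u j) = fun s => s ⟨n, hn⟩ * u ⟨n, hn⟩ := by
        ext s
        simp [hs, Finset.sum_insert hi]
      rw [he]
      have hind : iIndepFun (fun (j : Coord p) (s : DataVec p) => s j) (gaussianRow p v) :=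
        iIndepFun_infinitePi (X := fun j x => x) (by fun_prop)
      have h1 := hind.indepFun_finset {⟨n, hn⟩} (firstCoords p n)
        (by simpa using hi) (by fun_prop)
      have h2 := condExp_indep_eq (f := fun s : DataVec p => s ⟨n, hn⟩ * u ⟨n, hn⟩)
        (Measurable.comap_le (by fun_prop)) ((coordFiltration p).le n) ?_ h1
      · refine h2.trans (Eventually.of_forall fun s => ?_)
        simp [integral_mul_const, integral_eval_gaussianRow]
      · have h3 : Measurable[MeasurableSpace.comap
            (fun (s : DataVec p) (j : ({⟨n, hn⟩} : Finset (Coord p))) => s j) inferInstance]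
            (fun (s : DataVec p) (j : ({⟨n, hn⟩} : Finset (Coord p))) => s j) :=
          comap_measurable _
        have h4 : Measurable (fun r : ({⟨n, hn⟩} : Finset (Coord p)) → ℝ =>
            r ⟨⟨n, hn⟩, by simp⟩ * u ⟨n, hn⟩) := by fun_prop
        exact (h4.comp h3).stronglyMeasurable
    · have hs : firstCoords p (n + 1) = firstCoords p n := by
        ext j
        have hj := j.2
        simp only [firstCoords, Finset.mem_subtype, Finset.mem_range]
        constructor
        · intro h
          rcases Nat.lt_succ_iff_lt_or_eq.mp h with h | h
          · exact h
          · rw [h] at hj; exact absurd hj hn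
        · omega
      rw [hs, sub_self, condExp_zero]

theorem lintegral_sq_gaussianReal (v : ℝ≥0) :
    ∫⁻ x, ENNReal.ofReal (x ^ 2) ∂(gaussianReal 0 v) = v := by
  have h := variance_fun_id_gaussianReal (μ := 0) (v := v)
  rw [variance_eq_integral (by fun_prop)] at h
  simp only [integral_id_gaussianReal, sub_zero] at h
  rw [← ofReal_integral_eq_lintegral_ofReal, h]
  · simp
  · exact (memLp_id_gaussianReal 2).integrable_sq
  · exact Eventually.of_forall fun x => sq_nonneg x

/-- The second moments of the partial sums are bounded by the squared `ℓ²` norm, so `|x| ≤ 1 + x²`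
makes the martingale bounded in `L¹` and martingale convergence applies. Only on convergent series
does the `limUnder` defining the sketched vector have a meaning. -/
theorem ae_exists_tendsto_gaussianRow (v : ℝ≥0) {u : DataVec p} (hu : Summable fun j => u j ^ 2) :
    ∀ᵐ s ∂(gaussianRow p v), ∃ l, Tendsto (fun n => ∑ j ∈ firstCoords p n, s j * u j)
      atTop (𝓝 l) := by
  have hb : ∀ n, eLpNorm (fun s : DataVec p => ∑ j ∈ firstCoords p n, s j * u j) 1
      (gaussianRow p v) ≤ ((1 + v * (∑' j, u j ^ 2).toNNReal : ℝ≥0) : ℝ≥0∞) := by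
    intro n
    rw [eLpNorm_one_eq_lintegral_enorm]
    calc ∫⁻ s, ‖∑ j ∈ firstCoords p n, s j * u j‖ₑ ∂(gaussianRow p v)
        ≤ ∫⁻ s, (1 + ENNReal.ofReal ((∑ j ∈ firstCoords p n, s j * u j) ^ 2))
            ∂(gaussianRow p v) := by
          refine lintegral_mono fun s => ?_
          rw [← ofReal_norm, ← ENNReal.ofReal_one,
            ← ENNReal.ofReal_add zero_le_one (sq_nonneg _)]
          refine ENNReal.ofReal_le_ofReal ?_
          rw [Real.norm_eq_abs, ← sq_abs]
          nlinarith [sq_nonneg (|∑ j ∈ firstCoords p n, s j * u j| - 1)]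
      _ = 1 + ∫⁻ x, ENNReal.ofReal (x ^ 2)
            ∂((gaussianRow p v).map (fun s => ∑ j ∈ firstCoords p n, s j * u j)) := by
          rw [lintegral_add_left (by fun_prop), lintegral_map (by fun_prop) (by fun_prop)]
          simp
      _ ≤ _ := by
          rw [map_sum_gaussianRow, lintegral_sq_gaussianReal]
          push_cast
          gcongr
          rw [← ENNReal.ofNNReal_finsetSum, ENNReal.coe_le_coe]
          rw [← Real.toNNReal_sum_of_nonneg (fun _ _ => sq_nonneg _)]
          exact Real.toNNReal_le_toNNReal (hu.sum_le_tsum _ fun _ _ => sq_nonneg _)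
  exact (martingale_gaussianRow v u).submartingale.exists_ae_tendsto_of_bdd hb

/-- Fatou's lemma carries the exact formula for finite sums to the limit; the resulting upper bound
is all that Markov's inequality needs. The parameter `t` may have either sign, which serves both the
upper and the lower tail. -/
theorem lintegral_exp_sq_limUnder_gaussianRow (v : ℝ≥0) {u : DataVec p}
    (hu : Summable fun j => u j ^ 2) (t : ℝ) (ht : 2 * t * (v * ∑' j, u j ^ 2) < 1) :
    ∫⁻ s, ENNReal.ofReal (Real.exp
        (t * (limUnder atTop fun n => ∑ j ∈ firstCoords p n, s j * u j) ^ 2)) ∂(gaussianRow p v) ≤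
      ENNReal.ofReal (√(1 - 2 * t * (v * ∑' j, u j ^ 2)))⁻¹ := by
  set q := ∑' j, u j ^ 2
  have hq : Tendsto (fun n => ∑ j ∈ firstCoords p n, u j ^ 2) atTop (𝓝 q) :=
    hu.hasSum.comp tendsto_firstCoords
  calc _ = ∫⁻ s, liminf (fun n => ENNReal.ofReal (Real.exp
        (t * (∑ j ∈ firstCoords p n, s j * u j) ^ 2))) atTop ∂(gaussianRow p v) := by
        refine lintegral_congr_ae ?_
        filter_upwards [ae_exists_tendsto_gaussianRow v hu] with s hs
        have h1 := tendsto_nhds_limUnder hs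
        refine (Tendsto.liminf_eq ?_).symm
        exact (ENNReal.continuous_ofReal.comp (Real.continuous_exp.comp
          (continuous_const.mul (continuous_pow 2)))).continuousAt.tendsto.comp h1
    _ ≤ liminf (fun n => ∫⁻ s, ENNReal.ofReal (Real.exp
        (t * (∑ j ∈ firstCoords p n, s j * u j) ^ 2)) ∂(gaussianRow p v)) atTop :=
        lintegral_liminf_le fun n => by fun_prop
    _ = _ := by
        refine Tendsto.liminf_eq ?_
        have h2 : Tendsto (fun n => ENNReal.ofReal
            (√(1 - 2 * t * (v * ∑ j ∈ firstCoords p n, u j ^ 2)))⁻¹) atTop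
            (𝓝 (ENNReal.ofReal (√(1 - 2 * t * (v * q)))⁻¹)) := by
          refine (ENNReal.continuous_ofReal.tendsto _).comp ?_
          refine Tendsto.inv₀ ?_ (Real.sqrt_ne_zero'.mpr (by linarith))
          exact (Real.continuous_sqrt.tendsto _).comp
            (tendsto_const_nhds.sub ((hq.const_mul _).const_mul _))
        have hlt : ∀ᶠ n in atTop, 2 * t * (v * ∑ j ∈ firstCoords p n, u j ^ 2) < 1 :=
          ((hq.const_mul _).const_mul _).eventually (gt_mem_nhds ht)
        refine h2.congr' ?_
        filter_upwards [hlt] with n hn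
        have h3 : (v * ∑ j ∈ firstCoords p n, (u j ^ 2).toNNReal : ℝ≥0) =
            (v : ℝ) * ∑ j ∈ firstCoords p n, u j ^ 2 := by
          push_cast
          congr 1
          exact Finset.sum_congr rfl fun j _ => Real.coe_toNNReal _ (sq_nonneg _)
        have h4 := lintegral_exp_sq_gaussianReal t
          (v * ∑ j ∈ firstCoords p n, (u j ^ 2).toNNReal) (by rw [h3]; exact hn)
        rw [← map_sum_gaussianRow, lintegral_map (by fun_prop) (by fun_prop), h3] at h4
        exact h4.symm

/-! ### The Gaussian sketch -/

instance (M : ℕ) (p : ℕ∞) : IsProbabilityMeasure (gaussianSketch M p) := by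
  unfold gaussianSketch; infer_instance

variable {M : ℕ}

/-- All the row series of `T u` converge. -/
def SketchConverges (T : SketchMat M p) (u : DataVec p) : Prop :=
  ∀ i, ∃ l, Tendsto (fun n => ∑ j ∈ firstCoords p n, T i j * u j) atTop (𝓝 l)

theorem SketchConverges.tendsto {T : SketchMat M p} {u : DataVec p} (h : SketchConverges T u)
    (i : Fin M) :
    Tendsto (fun n => ∑ j ∈ firstCoords p n, T i j * u j) atTop (𝓝 (sketchApply T u i)) :=
  tendsto_nhds_limUnder (h i)

/-- Joint measurability allows exchanging "for almost every sketch" with "for almost every data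
point". -/
theorem measurableSet_sketchConverges :
    MeasurableSet {z : SketchMat M p × DataVec p | SketchConverges z.1 z.2} := by
  have : {z : SketchMat M p × DataVec p | SketchConverges z.1 z.2} =
      ⋂ i, {z | ∃ l, Tendsto (fun n => ∑ j ∈ firstCoords p n, z.1 i j * z.2 j) atTop (𝓝 l)} := by
    ext z; simp [SketchConverges]
  rw [this]
  refine MeasurableSet.iInter fun i => measurableSet_exists_tendsto fun n => ?_
  have h : Measurable fun z : SketchMat M p × DataVec p =>
      ∑ j ∈ firstCoords p n, z.1 i j * z.2 j := by fun_prop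
  exact h

theorem ae_sketchConverges {u : DataVec p} (hu : Summable fun j => u j ^ 2) :
    ∀ᵐ S ∂(gaussianSketch M p), SketchConverges S u := by
  unfold SketchConverges
  rw [ae_all_iff]
  intro i
  have h := ae_exists_tendsto_gaussianRow ((M : ℝ≥0)⁻¹) hu
  exact (Measure.quasiMeasurePreserving_eval
    (fun _ : Fin M => gaussianRow p ((M : ℝ≥0)⁻¹)) i).ae h

/-- The rows are independent, so the exponential moment factors. The resulting power `M` is the
source of all probabilities exponentially small in `M`. -/
theorem lintegral_exp_sq_sketchApply {u : DataVec p} (hu : Summable fun j => u j ^ 2)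
    (t : ℝ) (ht : 2 * t * ((M : ℝ)⁻¹ * ∑' j, u j ^ 2) < 1) :
    ∫⁻ S, ENNReal.ofReal (Real.exp (t * ∑ i, sketchApply S u i ^ 2)) ∂(gaussianSketch M p) ≤
      ENNReal.ofReal (√(1 - 2 * t * ((M : ℝ)⁻¹ * ∑' j, u j ^ 2)))⁻¹ ^ M := by
  have hm : Measurable fun s : DataVec p => ENNReal.ofReal (Real.exp
        (t * (limUnder atTop fun n => ∑ j ∈ firstCoords p n, s j * u j) ^ 2)) := by
    have : Measurable fun s : DataVec p =>
        (limUnder atTop fun n => ∑ j ∈ firstCoords p n, s j * u j) := by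
      refine (StronglyMeasurable.limUnder (l := atTop)
        (f := fun (n : ℕ) (s : DataVec p) => ∑ j ∈ firstCoords p n, s j * u j)
        (fun n => ?_)).measurable
      exact Measurable.stronglyMeasurable (by fun_prop)
    fun_prop
  have hme (i : Fin M) : Measurable fun S : SketchMat M p => S i := measurable_pi_apply i
  have h1 := lintegral_prod_eq_prod_lintegral_of_indepFun (μ := gaussianSketch M p) Finset.univ
    (fun (i : Fin M) (S : SketchMat M p) => ENNReal.ofReal (Real.exp
        (t * (limUnder atTop fun n => ∑ j ∈ firstCoords p n, S i j * u j) ^ 2)))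
    (iIndepFun_pi (X := fun (_ : Fin M) (s : DataVec p) => ENNReal.ofReal (Real.exp
        (t * (limUnder atTop fun n => ∑ j ∈ firstCoords p n, s j * u j) ^ 2)))
      fun i => hm.aemeasurable) (fun i => hm.comp (hme i))
  calc _ = _ := by
        refine lintegral_congr fun S => ?_
        rw [Finset.mul_sum, Real.exp_sum, ENNReal.ofReal_prod_of_nonneg
          (fun _ _ => (Real.exp_pos _).le)]
        rfl
    _ = _ := h1
    _ ≤ ∏ _i : Fin M, ENNReal.ofReal (√(1 - 2 * t * ((M : ℝ)⁻¹ * ∑' j, u j ^ 2)))⁻¹ := by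
        refine Finset.prod_le_prod' fun i _ => ?_
        have h2 := lintegral_exp_sq_limUnder_gaussianRow ((M : ℝ≥0)⁻¹) hu t (by simpa using ht)
        rw [← (measurePreserving_eval (fun _ : Fin M => gaussianRow p ((M : ℝ≥0)⁻¹)) i).map_eq,
          lintegral_map hm (measurable_pi_apply i)] at h2
        exact h2
    _ = _ := by simp

end

/-! ### Concentration of the energy of a sketched random vector -/

section

variable {p : ℕ∞} {M : ℕ}

theorem sketchApply_zero (S : SketchMat M p) : sketchApply S (0 : DataVec p) = 0 := by
  funext i
  exact (tendsto_const_nhds.congr fun n => by simp).limUnder_eq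

/-- Squared norm of a sketched vector. -/
def sketchNormSq (S : SketchMat M p) (u : DataVec p) : ℝ := ∑ i, sketchApply S u i ^ 2

theorem sketchNormSq_nonneg (S : SketchMat M p) (u : DataVec p) : 0 ≤ sketchNormSq S u :=
  Finset.sum_nonneg fun _ _ => sq_nonneg _

theorem measurable_sketchNormSq {α : Type*} [MeasurableSpace α] {f : α → SketchMat M p}
    {g : α → DataVec p} (hf : Measurable f) (hg : Measurable g) :
    Measurable fun a => sketchNormSq (f a) (g a) := by
  have h := (measurable_sketchApply (M := M) (p := p)).comp (hf.prodMk hg)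
  have h' : ∀ i, Measurable fun a => sketchApply (f a) (g a) i := fun i =>
    measurable_pi_iff.mp h i
  unfold sketchNormSq
  exact Finset.measurable_fun_sum _ fun i _ => (h' i).pow_const 2

attribute [irreducible] sketchNormSq

/-- Squared `ℓ²` norm. -/
def normSq (u : DataVec p) : ℝ := ∑' j, u j ^ 2

theorem normSq_nonneg (u : DataVec p) : 0 ≤ normSq u := tsum_nonneg fun _ => sq_nonneg _

theorem ofReal_normSq {u : DataVec p} (hu : Summable fun j => u j ^ 2) :
    ENNReal.ofReal (normSq u) = ∑' j, ENNReal.ofReal (u j ^ 2) :=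
  ENNReal.ofReal_tsum_of_nonneg (fun _ => sq_nonneg _) hu

/-- A divergent real series has `tsum` zero and an infinite extended sum has `toReal` zero, so no
summability is needed. The right-hand side is visibly measurable. -/
theorem normSq_eq_toReal (u : DataVec p) :
    normSq u = (∑' j, ENNReal.ofReal (u j ^ 2)).toReal := by
  by_cases h : ∑' j, ENNReal.ofReal (u j ^ 2) = ∞
  · rw [h, ENNReal.toReal_top]
    refine tsum_eq_zero_of_not_summable fun hs => ?_
    rw [← ofReal_normSq hs] at h
    exact ENNReal.ofReal_ne_top h
  · rw [ENNReal.tsum_toReal_eq fun j => ENNReal.ofReal_ne_top]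
    exact tsum_congr fun j => (ENNReal.toReal_ofReal (sq_nonneg _)).symm

theorem measurable_normSq : Measurable (normSq : DataVec p → ℝ) := by
  have : (normSq : DataVec p → ℝ) = fun u => (∑' j, ENNReal.ofReal (u j ^ 2)).toReal :=
    funext normSq_eq_toReal
  rw [this]
  refine Measurable.ennreal_toReal (Measurable.tsum fun j => ?_)
  exact ((measurable_pi_apply j).pow_const 2).ennreal_ofReal

theorem lintegral_exp_sketchNormSq {u : DataVec p} (hu : Summable fun j => u j ^ 2)
    {t : ℝ} (ht : 2 * t * ((M : ℝ)⁻¹ * normSq u) < 1) :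
    ∫⁻ S, ENNReal.ofReal (Real.exp (t * sketchNormSq S u)) ∂(gaussianSketch M p) ≤
      ENNReal.ofReal (√(1 - 2 * t * ((M : ℝ)⁻¹ * normSq u)))⁻¹ ^ M := by
  unfold sketchNormSq
  exact lintegral_exp_sq_sketchApply hu t ht

theorem sketchNormSq_zero (S : SketchMat M p) : sketchNormSq S (0 : DataVec p) = 0 := by
  simp [sketchNormSq, sketchApply_zero]

theorem eq_zero_of_normSq_eq_zero {u : DataVec p} (hu : Summable fun j => u j ^ 2)
    (h : normSq u = 0) : u = 0 := by
  funext j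
  have h2 := (hasSum_zero_iff_of_nonneg (fun j => sq_nonneg (u j))).mp
    (show HasSum (fun j => u j ^ 2) 0 from h ▸ hu.hasSum)
  simpa using congrFun h2 j

attribute [irreducible] normSq

section Averaging

variable {X : Type*} [MeasurableSpace X] {law : Measure X} {φ : X → DataVec p}

theorem measurable_weighted_exp (hφ : Measurable φ) (τ t : ℝ) :
    Measurable fun z : SketchMat M p × X => ENNReal.ofReal (normSq (φ z.2) / τ) *
      ENNReal.ofReal (Real.exp (t / normSq (φ z.2) * sketchNormSq z.1 (φ z.2))) := by
  have h1 : Measurable fun z : SketchMat M p × X => sketchNormSq z.1 (φ z.2) :=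
    measurable_sketchNormSq measurable_fst (hφ.comp measurable_snd)
  have h2 : Measurable fun z : SketchMat M p × X => normSq (φ z.2) :=
    (measurable_normSq.comp hφ).comp measurable_snd
  exact (h2.div_const τ).ennreal_ofReal.mul ((h2.const_div t).mul h1).exp.ennreal_ofReal

/-- Dividing the sketched energy by `normSq (φ x)` in the exponent gives every data point the same
Gaussian moment, and the weight `normSq (φ x) / τ` has total mass at most one. After Fubini the
bound no longer depends on the law of the data. -/
theorem lintegral_weighted_exp_le [SFinite law] (hφ : Measurable φ)
    (hs : ∀ᵐ x ∂law, Summable fun j => φ x j ^ 2) {τ : ℝ} (hτ : 0 < τ)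
    (hint : ∫⁻ x, ENNReal.ofReal (normSq (φ x)) ∂law ≤ ENNReal.ofReal τ) {t : ℝ}
    (ht : 2 * t * (M : ℝ)⁻¹ < 1) :
    ∫⁻ S, ∫⁻ x, ENNReal.ofReal (normSq (φ x) / τ) * ENNReal.ofReal (Real.exp
        (t / normSq (φ x) * sketchNormSq S (φ x))) ∂law ∂(gaussianSketch M p) ≤
      ENNReal.ofReal (√(1 - 2 * t * (M : ℝ)⁻¹))⁻¹ ^ M := by
  have h2 : Measurable fun x => normSq (φ x) := measurable_normSq.comp hφ
  rw [lintegral_lintegral_swap (measurable_weighted_exp hφ τ t).aemeasurable]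
  set C := ENNReal.ofReal (√(1 - 2 * t * (M : ℝ)⁻¹))⁻¹ ^ M
  calc _ ≤ ∫⁻ x, ENNReal.ofReal (normSq (φ x) / τ) * C ∂law := by
        refine lintegral_mono_ae ?_
        filter_upwards [hs] with x hx
        have h3 : Measurable fun S : SketchMat M p => sketchNormSq S (φ x) :=
          measurable_sketchNormSq measurable_id measurable_const
        rw [lintegral_const_mul _ (h3.const_mul _).exp.ennreal_ofReal]
        rcases (normSq_nonneg (φ x)).eq_or_lt with h0 | h0
        · simp [← h0]
        · gcongr
          have h4 : (2 : ℝ) * (t / normSq (φ x)) * ((M : ℝ)⁻¹ * normSq (φ x)) = 2 * t * (M : ℝ)⁻¹ := by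
            field_simp
          have h5 := lintegral_exp_sketchNormSq (M := M) hx (t := t / normSq (φ x)) (by rwa [h4])
          rwa [h4] at h5
    _ ≤ 1 * C := by
        rw [lintegral_mul_const _ (by fun_prop)]
        gcongr
        simp_rw [div_eq_mul_inv, ENNReal.ofReal_mul (normSq_nonneg _)]
        rw [lintegral_mul_const _ (by fun_prop)]
        calc _ ≤ ENNReal.ofReal τ * ENNReal.ofReal τ⁻¹ := by gcongr
          _ = 1 := by rw [← ENNReal.ofReal_mul hτ.le, mul_inv_cancel₀ hτ.ne', ENNReal.ofReal_one]
    _ = C := one_mul C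

/-- The weight undoes the normalization. Where the norm vanishes the vector itself is zero, hence so
is its sketch. -/
theorem lintegral_weighted_quotient (hs : ∀ᵐ x ∂law, Summable fun j => φ x j ^ 2) {τ : ℝ}
    (hτ : 0 < τ) (S : SketchMat M p) :
    ∫⁻ x, ENNReal.ofReal (normSq (φ x) / τ) *
        ENNReal.ofReal (sketchNormSq S (φ x) / normSq (φ x)) ∂law =
      ENNReal.ofReal τ⁻¹ * ∫⁻ x, ENNReal.ofReal (sketchNormSq S (φ x)) ∂law := by
  rw [← lintegral_const_mul' _ _ ENNReal.ofReal_ne_top]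
  refine lintegral_congr_ae ?_
  filter_upwards [hs] with x hx
  rw [← ENNReal.ofReal_mul (by have := normSq_nonneg (φ x); positivity),
    ← ENNReal.ofReal_mul (by positivity)]
  congr 1
  by_cases h0 : normSq (φ x) = 0
  · have h1 := eq_zero_of_normSq_eq_zero hx h0
    rw [h1]
    simp [sketchNormSq_zero]
  · field_simp

theorem lintegral_weight_le (hφ : Measurable φ) {τ : ℝ} (hτ : 0 < τ) :
    ∫⁻ x, ENNReal.ofReal (normSq (φ x) / τ) ∂law =
      (∫⁻ x, ENNReal.ofReal (normSq (φ x)) ∂law) / ENNReal.ofReal τ := by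
  have h2 : Measurable fun x => normSq (φ x) := measurable_normSq.comp hφ
  simp_rw [ENNReal.ofReal_div_of_pos hτ, ENNReal.div_eq_inv_mul]
  rw [lintegral_const_mul _ (by fun_prop)]

/-- Upper deviation of the energy of a sketched random vector. -/
theorem gaussianSketch_energy_gt_le [SFinite law] (hM : 1 ≤ M) (hφ : Measurable φ)
    (hs : ∀ᵐ x ∂law, Summable fun j => φ x j ^ 2) {τ K : ℝ} (hτ : 0 < τ) (hK : 4 ≤ K)
    (hint : ∫⁻ x, ENNReal.ofReal (normSq (φ x)) ∂law ≤ ENNReal.ofReal τ) :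
    gaussianSketch M p {S | ENNReal.ofReal (K * τ) <
        ∫⁻ x, ENNReal.ofReal (sketchNormSq S (φ x)) ∂law} ≤
      ENNReal.ofReal ((√2 * Real.exp (-(K / 4))) ^ M) := by
  have hM0 : (0 : ℝ) < M := by exact_mod_cast hM
  have hM1 : (1 : ℝ) ≤ M := by exact_mod_cast hM
  -- This value makes `2 t / M = 1 / 2`, so each row contributes a factor `√2`. The assumption `4 ≤
  -- K` gives `t K ≥ 1`, which keeps the constants below nonnegative and hence usable in `ℝ≥0∞`.
  set t : ℝ := M / 4 with ht
  have ht0 : 0 < t := by positivity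
  have htK : 1 ≤ t * K := by rw [ht]; nlinarith
  have h2t : 2 * t * (M : ℝ)⁻¹ = 1 / 2 := by rw [ht]; field_simp; norm_num
  set Z : SketchMat M p → ℝ≥0∞ := fun S =>
    ∫⁻ x, ENNReal.ofReal (normSq (φ x) / τ) * ENNReal.ofReal (Real.exp
        (t / normSq (φ x) * sketchNormSq S (φ x))) ∂law with hZ
  have hZm : Measurable Z := (measurable_weighted_exp hφ τ (t)).lintegral_prod_right'
  have hq : Measurable fun x => normSq (φ x) := measurable_normSq.comp hφ
  have hsub : {S | ENNReal.ofReal (K * τ) < ∫⁻ x, ENNReal.ofReal (sketchNormSq S (φ x)) ∂law} ⊆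
      {S | ENNReal.ofReal (Real.exp (t * K)) ≤ Z S} := by
    intro S hS
    have hSm : Measurable fun x => sketchNormSq S (φ x) :=
      measurable_sketchNormSq measurable_const hφ
    have hA (t : ℝ) : Measurable fun x => ENNReal.ofReal (normSq (φ x) / τ) *
        ENNReal.ofReal (Real.exp (t / normSq (φ x) * sketchNormSq S (φ x))) :=
      (measurable_weighted_exp hφ τ t).comp measurable_prodMk_left
    have hB : Measurable fun x => ENNReal.ofReal (normSq (φ x) / τ) *
        ENNReal.ofReal (sketchNormSq S (φ x) / normSq (φ x)) :=
      (hq.div_const τ).ennreal_ofReal.mul (hSm.div hq).ennreal_ofReal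
    simp only [Set.mem_ofPred_eq] at hS ⊢
    -- The tangent line of `exp` at `t K`, integrated against the weight, replaces Jensen's
    -- inequality. Its constant term is moved to the right side, so a weight of mass at most one
    -- suffices.
    have hpt : ∀ x, ENNReal.ofReal (Real.exp (t * K) * t) * (ENNReal.ofReal (normSq (φ x) / τ) *
          ENNReal.ofReal (sketchNormSq S (φ x) / normSq (φ x))) ≤
        ENNReal.ofReal (normSq (φ x) / τ) * ENNReal.ofReal (Real.exp
          (t / normSq (φ x) * sketchNormSq S (φ x))) +
        ENNReal.ofReal (Real.exp (t * K) * (t * K - 1)) * ENNReal.ofReal (normSq (φ x) / τ) := by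
      intro x
      have hn := normSq_nonneg (φ x)
      have hn' := sketchNormSq_nonneg S (φ x)
      rw [mul_left_comm, mul_comm (ENNReal.ofReal (Real.exp (t * K) * (t * K - 1))), ← mul_add]
      gcongr
      rw [← ENNReal.ofReal_mul (by positivity), ← ENNReal.ofReal_add (by positivity)
        (mul_nonneg (Real.exp_pos _).le (by linarith))]
      refine ENNReal.ofReal_le_ofReal ?_
      set g := sketchNormSq S (φ x) / normSq (φ x)
      have hg : t / normSq (φ x) * sketchNormSq S (φ x) = t * g := by
        simp only [g]; ring
      rw [hg]
      have h1 := Real.add_one_le_exp (t * g - t * K)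
      have h2 : Real.exp (t * g) = Real.exp (t * K) * Real.exp (t * g - t * K) := by
        rw [← Real.exp_add]; congr 1; ring
      rw [h2]
      nlinarith [Real.exp_pos (t * K)]
    have h3 := lintegral_mono (μ := law) hpt
    rw [lintegral_const_mul _ hB, lintegral_weighted_quotient hs hτ,
      lintegral_add_left (hA t),
      lintegral_const_mul _ (by fun_prop),
      lintegral_weight_le hφ hτ] at h3
    have h4 : (∫⁻ x, ENNReal.ofReal (normSq (φ x)) ∂law) / ENNReal.ofReal τ ≤ 1 :=
      ENNReal.div_le_of_le_mul (by simpa using hint)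
    have h5 : ENNReal.ofReal (Real.exp (t * K) * (t * K)) ≤
        Z S + ENNReal.ofReal (Real.exp (t * K) * (t * K - 1)) := by
      calc ENNReal.ofReal (Real.exp (t * K) * (t * K))
          = ENNReal.ofReal (Real.exp (t * K) * t) *
              (ENNReal.ofReal τ⁻¹ * ENNReal.ofReal (K * τ)) := by
            rw [← ENNReal.ofReal_mul (by positivity), ← ENNReal.ofReal_mul (by positivity)]
            congr 1; field_simp
        _ ≤ _ := by gcongr
        _ ≤ _ := h3
        _ ≤ Z S + ENNReal.ofReal (Real.exp (t * K) * (t * K - 1)) * 1 := by gcongr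
        _ = _ := by rw [mul_one]
    have h6 : ENNReal.ofReal (Real.exp (t * K) * (t * K)) = ENNReal.ofReal (Real.exp (t * K)) +
        ENNReal.ofReal (Real.exp (t * K) * (t * K - 1)) := by
      rw [← ENNReal.ofReal_add (Real.exp_pos _).le
        (mul_nonneg (Real.exp_pos _).le (by linarith))]
      congr 1; ring
    rw [h6] at h5
    exact (ENNReal.add_le_add_iff_right ENNReal.ofReal_ne_top).mp h5
  calc _ ≤ gaussianSketch M p {S | ENNReal.ofReal (Real.exp (t * K)) ≤ Z S} := measure_mono hsub
    _ ≤ (∫⁻ S, Z S ∂(gaussianSketch M p)) / ENNReal.ofReal (Real.exp (t * K)) :=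
        meas_ge_le_lintegral_div hZm.aemeasurable (by simp [Real.exp_pos]) ENNReal.ofReal_ne_top
    _ ≤ ENNReal.ofReal (√(1 - 2 * t * (M : ℝ)⁻¹))⁻¹ ^ M / ENNReal.ofReal (Real.exp (t * K)) := by
        gcongr
        exact lintegral_weighted_exp_le hφ hs hτ hint (by rw [h2t]; norm_num)
    _ = _ := by
        rw [← ENNReal.ofReal_pow (by positivity), ← ENNReal.ofReal_div_of_pos (Real.exp_pos _), h2t]
        congr 1
        rw [mul_pow, ← Real.exp_nat_mul, div_eq_mul_inv, ← Real.exp_neg, ← Real.sqrt_inv]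
        congr 2
        · norm_num
        · rw [ht]; ring

/-- Lower deviation of the energy of a sketched random vector. -/
theorem gaussianSketch_energy_lt_le [SFinite law] (hM : 1 ≤ M) (hφ : Measurable φ)
    (hs : ∀ᵐ x ∂law, Summable fun j => φ x j ^ 2) {τ ρ : ℝ} (hτ : 0 < τ) (hρ : 0 < ρ)
    (hint : ∫⁻ x, ENNReal.ofReal (normSq (φ x)) ∂law = ENNReal.ofReal τ) :
    gaussianSketch M p {S | ∫⁻ x, ENNReal.ofReal (sketchNormSq S (φ x)) ∂law <
        ENNReal.ofReal (ρ * τ)} ≤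
      ENNReal.ofReal ((Real.exp 1 * √(ρ / 2)) ^ M) := by
  have hM0 : (0 : ℝ) < M := by exact_mod_cast hM
  -- The exponent is now `-s`. With `s ρ = M` the Markov threshold is `e ^ (-M)`, and each row
  -- contributes `(1 + 2 / ρ) ^ (-1/2) ≤ √(ρ / 2)`.
  set s : ℝ := M / ρ with hs'
  have hs0 : 0 < s := by positivity
  have hsρ : s * ρ = M := by rw [hs']; field_simp
  have h2t : 1 - 2 * (-s) * (M : ℝ)⁻¹ = 1 + 2 / ρ := by rw [hs']; field_simp; ring
  set Z : SketchMat M p → ℝ≥0∞ := fun S =>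
    ∫⁻ x, ENNReal.ofReal (normSq (φ x) / τ) * ENNReal.ofReal (Real.exp
        (-s / normSq (φ x) * sketchNormSq S (φ x))) ∂law with hZ
  have hZm : Measurable Z := (measurable_weighted_exp hφ τ (-s)).lintegral_prod_right'
  have hq : Measurable fun x => normSq (φ x) := measurable_normSq.comp hφ
  have hsub : {S | ∫⁻ x, ENNReal.ofReal (sketchNormSq S (φ x)) ∂law < ENNReal.ofReal (ρ * τ)} ⊆
      {S | ENNReal.ofReal (Real.exp (-M)) ≤ Z S} := by
    intro S hS
    have hSm : Measurable fun x => sketchNormSq S (φ x) :=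
      measurable_sketchNormSq measurable_const hφ
    have hA (t : ℝ) : Measurable fun x => ENNReal.ofReal (normSq (φ x) / τ) *
        ENNReal.ofReal (Real.exp (t / normSq (φ x) * sketchNormSq S (φ x))) :=
      (measurable_weighted_exp hφ τ t).comp measurable_prodMk_left
    have hB : Measurable fun x => ENNReal.ofReal (normSq (φ x) / τ) *
        ENNReal.ofReal (sketchNormSq S (φ x) / normSq (φ x)) :=
      (hq.div_const τ).ennreal_ofReal.mul (hSm.div hq).ennreal_ofReal
    simp only [Set.mem_ofPred_eq] at hS ⊢
    -- Tangent line again, at the value `-M`. Its constant term `1 + M` stands on the smaller side,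
    -- so the weight must have mass exactly one; this is why the energy is prescribed by an
    -- equality.
    have hpt : ∀ x, ENNReal.ofReal (Real.exp (-M) * (1 + M)) * ENNReal.ofReal (normSq (φ x) / τ) ≤
        ENNReal.ofReal (normSq (φ x) / τ) * ENNReal.ofReal (Real.exp
          (-s / normSq (φ x) * sketchNormSq S (φ x))) +
        ENNReal.ofReal (Real.exp (-M) * s) * (ENNReal.ofReal (normSq (φ x) / τ) *
          ENNReal.ofReal (sketchNormSq S (φ x) / normSq (φ x))) := by
      intro x
      have hn := normSq_nonneg (φ x)
      have hn' := sketchNormSq_nonneg S (φ x)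
      rw [mul_comm, mul_left_comm (ENNReal.ofReal (Real.exp (-M) * s)), ← mul_add]
      gcongr
      rw [← ENNReal.ofReal_mul (by positivity), ← ENNReal.ofReal_add (by positivity)
        (by positivity)]
      refine ENNReal.ofReal_le_ofReal ?_
      set g := sketchNormSq S (φ x) / normSq (φ x)
      have hg : -s / normSq (φ x) * sketchNormSq S (φ x) = -s * g := by
        simp only [g]; ring
      rw [hg]
      have h1 := Real.add_one_le_exp (-s * g + M)
      have h2 : Real.exp (-s * g) = Real.exp (-M) * Real.exp (-s * g + M) := by
        rw [← Real.exp_add]; congr 1; ring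
      rw [h2]
      nlinarith [Real.exp_pos (-M : ℝ)]
    have h3 := lintegral_mono (μ := law) hpt
    rw [lintegral_const_mul _ (by fun_prop),
      lintegral_add_left (hA (-s)),
      lintegral_const_mul _ hB,
      lintegral_weighted_quotient hs hτ, lintegral_weight_le hφ hτ, hint, ENNReal.div_self (by simpa using hτ) ENNReal.ofReal_ne_top,
      mul_one] at h3
    have h5 : ENNReal.ofReal (Real.exp (-M) * (1 + M)) ≤
        Z S + ENNReal.ofReal (Real.exp (-M) * M) := by
      calc _ ≤ _ := h3
        _ ≤ Z S + ENNReal.ofReal (Real.exp (-M) * s) *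
              (ENNReal.ofReal τ⁻¹ * ENNReal.ofReal (ρ * τ)) := by gcongr
        _ = _ := by
            rw [← ENNReal.ofReal_mul (by positivity), ← ENNReal.ofReal_mul (by positivity), ← hsρ]
            congr 2; field_simp
    rw [mul_add, mul_one, ENNReal.ofReal_add (by positivity) (by positivity)] at h5
    exact (ENNReal.add_le_add_iff_right ENNReal.ofReal_ne_top).mp h5
  calc _ ≤ gaussianSketch M p {S | ENNReal.ofReal (Real.exp (-M)) ≤ Z S} := measure_mono hsub
    _ ≤ (∫⁻ S, Z S ∂(gaussianSketch M p)) / ENNReal.ofReal (Real.exp (-M)) :=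
        meas_ge_le_lintegral_div hZm.aemeasurable (by simp [Real.exp_pos]) ENNReal.ofReal_ne_top
    _ ≤ ENNReal.ofReal (√(1 - 2 * (-s) * (M : ℝ)⁻¹))⁻¹ ^ M / ENNReal.ofReal (Real.exp (-M)) := by
        gcongr
        refine lintegral_weighted_exp_le hφ hs hτ hint.le ?_
        have : 0 < 2 * s * (M : ℝ)⁻¹ := by positivity
        linarith
    _ = ENNReal.ofReal ((Real.exp 1 * (√(1 + 2 / ρ))⁻¹) ^ M) := by
        rw [← ENNReal.ofReal_pow (by positivity), ← ENNReal.ofReal_div_of_pos (Real.exp_pos _), h2t]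
        congr 1
        rw [mul_pow, ← Real.exp_nat_mul, div_eq_mul_inv, ← Real.exp_neg, mul_comm]
        congr 2
        ring
    _ ≤ _ := by
        gcongr
        rw [← Real.sqrt_inv]
        refine Real.sqrt_le_sqrt ?_
        have h : ρ / 2 = (2 / ρ)⁻¹ := by field_simp
        rw [h]
        gcongr
        linarith

end Averaging

/-- The energy estimate for a law concentrated at one point. -/
theorem gaussianSketch_normSq_gt_le (hM : 1 ≤ M) {u : DataVec p}
    (hu : Summable fun j => u j ^ 2) {K : ℝ} (hK : 4 ≤ K) :
    gaussianSketch M p {S | K * normSq u < sketchNormSq S u} ≤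
      ENNReal.ofReal ((√2 * Real.exp (-(K / 4))) ^ M) := by
  rcases (normSq_nonneg u).eq_or_lt with h0 | h0
  · have h1 := eq_zero_of_normSq_eq_zero hu h0.symm
    subst h1
    simp [← h0, sketchNormSq_zero]
  · have h := gaussianSketch_energy_gt_le (law := Measure.dirac ()) (φ := fun _ => u) hM
      measurable_const (by simpa using hu) h0 hK (by simp)
    refine le_trans (measure_mono fun S hS => ?_) h
    simp only [Set.mem_ofPred_eq, lintegral_dirac] at hS ⊢
    exact (ENNReal.ofReal_lt_ofReal_iff_of_nonneg (by positivity)).mpr hS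

theorem gaussianSketch_normSq_lt_le (hM : 1 ≤ M) {u : DataVec p}
    (hu : Summable fun j => u j ^ 2) {ρ : ℝ} (hρ : 0 < ρ) :
    gaussianSketch M p {S | sketchNormSq S u < ρ * normSq u} ≤
      ENNReal.ofReal ((Real.exp 1 * √(ρ / 2)) ^ M) := by
  rcases (normSq_nonneg u).eq_or_lt with h0 | h0
  · have : {S : SketchMat M p | sketchNormSq S u < ρ * normSq u} = ∅ := by
      ext S
      simp [← h0, sketchNormSq_nonneg S u]
    simp [this]
  · have h := gaussianSketch_energy_lt_le (law := Measure.dirac ()) (φ := fun _ => u) hM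
      measurable_const (by simpa using hu) h0 hρ (by simp)
    refine le_trans (measure_mono fun S hS => ?_) h
    simp only [Set.mem_ofPred_eq, lintegral_dirac] at hS ⊢
    exact (ENNReal.ofReal_lt_ofReal_iff_of_nonneg (sketchNormSq_nonneg _ _)).mpr hS

end

/-! ### Smallest singular value of the sketch on a low-dimensional space -/

section

section SmallBall

variable {Ω : Type*} [MeasurableSpace Ω] {P : Measure Ω} [SFinite P] {k : ℕ}
  {F : Type*} [NormedAddCommGroup F] [NormedSpace ℝ F]

/-- If every fixed vector is bad with probability at most `δ`, and each `ω ∈ E` has a whole ball of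
radius `r` of bad vectors inside the ball of radius `2`, then `P E ≤ (2 / r)^k δ`. -/
theorem measure_le_of_bad_ball {B : Set (Ω × EuclideanSpace ℝ (Fin k))} (hB : MeasurableSet B)
    {δ : ℝ≥0∞} (hδ : ∀ c, P {ω | (ω, c) ∈ B} ≤ δ) {E : Set Ω} {r : ℝ} (hr : 0 < r)
    (hE : ∀ ω ∈ E, ∃ c₀, Metric.ball c₀ r ⊆ Metric.ball 0 2 ∧
      ∀ c ∈ Metric.ball c₀ r, (ω, c) ∈ B) :
    P E ≤ ENNReal.ofReal ((2 / r) ^ k) * δ := by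
  set μ : Measure (EuclideanSpace ℝ (Fin k)) := volume
  set V := μ (Metric.ball 0 1)
  have hV0 : V ≠ 0 := (Metric.measure_ball_pos μ 0 one_pos).ne'
  have hVt : V ≠ ∞ := measure_ball_lt_top.ne
  have hball : ∀ (x : EuclideanSpace ℝ (Fin k)) {r : ℝ}, 0 < r →
      μ (Metric.ball x r) = ENNReal.ofReal (r ^ k) * V := fun x r hr => by
    rw [Measure.addHaar_ball_of_pos μ x hr]; simp [V]
  -- `Z ω` is the volume of the bad vectors in the ball of radius 2. Its mean is at most `δ` times
  -- the volume of that ball by Fubini, while on `E` it is at least the volume of a ball of radius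
  -- `r`. This plays the role of a covering argument.
  set Z : Ω → ℝ≥0∞ := fun ω => ∫⁻ c in Metric.ball 0 2, B.indicator 1 (ω, c) ∂μ
  have hBm : Measurable (B.indicator (1 : Ω × EuclideanSpace ℝ (Fin k) → ℝ≥0∞)) :=
    measurable_one.indicator hB
  have hZm : Measurable Z := hBm.lintegral_prod_right'
  have hrk : 0 < r ^ k := by positivity
  have hlow : ENNReal.ofReal (r ^ k) * V ≠ 0 := by simp [hV0, hrk]
  have hlow' : ENNReal.ofReal (r ^ k) * V ≠ ∞ := ENNReal.mul_ne_top ENNReal.ofReal_ne_top hVt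
  have hsub : E ⊆ {ω | ENNReal.ofReal (r ^ k) * V ≤ Z ω} := by
    intro ω hω
    obtain ⟨c₀, h1, h2⟩ := hE ω hω
    rw [Set.mem_ofPred_eq, ← hball c₀ hr]
    calc μ (Metric.ball c₀ r) = ∫⁻ c in Metric.ball c₀ r, 1 ∂μ := by simp
      _ ≤ ∫⁻ c in Metric.ball c₀ r, B.indicator 1 (ω, c) ∂μ :=
          setLIntegral_mono' measurableSet_ball fun c hc => by simp [h2 c hc]
      _ ≤ Z ω := lintegral_mono_set h1
  calc P E ≤ P {ω | ENNReal.ofReal (r ^ k) * V ≤ Z ω} := measure_mono hsub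
    _ ≤ (∫⁻ ω, Z ω ∂P) / (ENNReal.ofReal (r ^ k) * V) :=
        meas_ge_le_lintegral_div hZm.aemeasurable hlow hlow'
    _ ≤ (ENNReal.ofReal (2 ^ k) * V * δ) / (ENNReal.ofReal (r ^ k) * V) := by
        gcongr
        rw [lintegral_lintegral_swap (f := fun ω c => B.indicator 1 (ω, c)) hBm.aemeasurable]
        calc _ ≤ ∫⁻ _ in Metric.ball 0 2, δ ∂μ := by
              refine lintegral_mono fun c => ?_
              refine le_trans (le_of_eq ?_) (hδ c)
              have hm : MeasurableSet {ω | (ω, c) ∈ B} := measurable_prodMk_right hB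
              rw [← lintegral_indicator_one hm]
              rfl
          _ = _ := by rw [setLIntegral_const, hball 0 two_pos, mul_comm]
    _ = _ := by
        rw [mul_right_comm, ENNReal.mul_div_mul_right _ _ hV0 hVt, div_pow,
          ENNReal.ofReal_div_of_pos hrk, ENNReal.mul_div_right_comm]

/-- A random linear map that expands no fixed vector by more than `5` and shrinks no fixed vector
by more than `4 s`, up to small probabilities, shrinks no vector at all by more than `s`. -/
theorem measure_exists_norm_lt_le {A : Ω → EuclideanSpace ℝ (Fin k) →L[ℝ] F}
    (hA : Measurable fun z : Ω × EuclideanSpace ℝ (Fin k) => ‖A z.1 z.2‖) {δ₁ δ₂ : ℝ≥0∞} {s : ℝ}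
    (hs : 0 < s) (hs1 : s ≤ 1) (h1 : ∀ c, P {ω | 5 * ‖c‖ < ‖A ω c‖} ≤ δ₁)
    (h2 : ∀ c, P {ω | ‖A ω c‖ < 4 * s * ‖c‖} ≤ δ₂) :
    P {ω | ∃ c, ‖A ω c‖ < s * ‖c‖} ≤
      ENNReal.ofReal (8 ^ k) * δ₁ + ENNReal.ofReal ((40 / s) ^ k) * δ₂ := by
  have hB1 : MeasurableSet {z : Ω × EuclideanSpace ℝ (Fin k) | 5 * ‖z.2‖ < ‖A z.1 z.2‖} :=
    measurableSet_lt (by fun_prop) hA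
  have hB2 : MeasurableSet {z : Ω × EuclideanSpace ℝ (Fin k) | ‖A z.1 z.2‖ < 4 * s * ‖z.2‖} :=
    measurableSet_lt hA (by fun_prop)
  -- Around a near-maximizer `c₀` of the operator norm, a radius of `1 / 4` still leaves `‖A c‖ ≥
  -- 0.65 ‖A‖ > 13`, whereas `5 ‖c‖ < 6.25`.
  have hE1 : P {ω | 20 < ‖A ω‖} ≤ ENNReal.ofReal (8 ^ k) * δ₁ := by
    have h := measure_le_of_bad_ball hB1 h1 (E := {ω | 20 < ‖A ω‖}) (r := 1 / 4) (by norm_num) ?_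
    · norm_num at h ⊢; exact h
    intro ω hω
    rw [Set.mem_ofPred_eq] at hω
    obtain ⟨c₀, hc₀, hc₁⟩ := (A ω).exists_lt_apply_of_lt_opNorm
      (show 0.9 * ‖A ω‖ < ‖A ω‖ by linarith)
    refine ⟨c₀, Metric.ball_subset_ball' (by rw [dist_zero_right]; linarith), fun c hc => ?_⟩
    rw [Metric.mem_ball, dist_eq_norm] at hc
    rw [Set.mem_ofPred_eq]
    have h3 : ‖c‖ ≤ ‖c - c₀‖ + ‖c₀‖ := by simpa using norm_add_le (c - c₀) c₀
    have h4 : ‖A ω c₀‖ ≤ ‖A ω c‖ + ‖A ω (c - c₀)‖ := by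
      have := norm_sub_le (A ω c) (A ω (c - c₀))
      rwa [← map_sub, sub_sub_cancel] at this
    have h5 := (A ω).le_opNorm (c - c₀)
    nlinarith
  -- Around a unit vector with `‖A c₀‖ < s`, a radius of `s / 20` moves the image by less than `s`
  -- because `‖A‖ ≤ 20`. Hence `‖A c‖ < 2 s < 4 s ‖c‖`, as `‖c‖ ≥ 19 / 20`.
  have hE2 : P {ω | ‖A ω‖ ≤ 20 ∧ ∃ c, ‖A ω c‖ < s * ‖c‖} ≤
      ENNReal.ofReal ((40 / s) ^ k) * δ₂ := by
    have h := measure_le_of_bad_ball hB2 h2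
      (E := {ω | ‖A ω‖ ≤ 20 ∧ ∃ c, ‖A ω c‖ < s * ‖c‖}) (r := s / 20) (by positivity) ?_
    · rwa [show 2 / (s / 20) = 40 / s by field_simp; norm_num] at h
    rintro ω ⟨hω, c', hc'⟩
    have hc0 : 0 < ‖c'‖ := by
      by_contra h0
      have h0' : ‖c'‖ = 0 := le_antisymm (not_lt.mp h0) (norm_nonneg _)
      rw [h0', mul_zero] at hc'
      exact absurd hc' (norm_nonneg _).not_gt
    have hu : ‖(‖c'‖⁻¹ • c')‖ = 1 := by
      rw [norm_smul, norm_inv, norm_norm, inv_mul_cancel₀ hc0.ne']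
    have hu' : ‖A ω (‖c'‖⁻¹ • c')‖ < s := by
      rw [map_smul, norm_smul, norm_inv, norm_norm, inv_mul_lt_iff₀ hc0]
      linarith
    generalize ‖c'‖⁻¹ • c' = c₀ at hu hu'
    refine ⟨c₀, Metric.ball_subset_ball' (by rw [dist_zero_right]; linarith), fun c hc => ?_⟩
    rw [Metric.mem_ball, dist_eq_norm] at hc
    rw [Set.mem_ofPred_eq]
    have h3 : ‖c₀‖ ≤ ‖c‖ + ‖c - c₀‖ := by simpa using norm_sub_le c (c - c₀)
    have h4 : ‖A ω c‖ ≤ ‖A ω c₀‖ + ‖A ω (c - c₀)‖ := by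
      have := norm_add_le (A ω c₀) (A ω (c - c₀))
      rwa [← map_add, add_sub_cancel] at this
    have h5 := (A ω).le_opNorm (c - c₀)
    nlinarith [norm_nonneg (c - c₀)]
  calc _ ≤ P ({ω | 20 < ‖A ω‖} ∪ {ω | ‖A ω‖ ≤ 20 ∧ ∃ c, ‖A ω c‖ < s * ‖c‖}) := by
        refine measure_mono fun ω hω => ?_
        rcases lt_or_ge 20 ‖A ω‖ with h | h
        · exact Or.inl h
        · exact Or.inr ⟨h, hω⟩
    _ ≤ _ := (measure_union_le _ _).trans (add_le_add hE1 hE2)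

end SmallBall

variable {p : ℕ∞} {M k : ℕ}

theorem tendsto_sum_firstCoords_of_support {F : Finset (Coord p)} {u : DataVec p}
    (hu : ∀ j ∉ F, u j = 0) (s : DataVec p) :
    Tendsto (fun n => ∑ j ∈ firstCoords p n, s j * u j) atTop (𝓝 (∑ j ∈ F, s j * u j)) := by
  have h : HasSum (fun j => s j * u j) (∑ j ∈ F, s j * u j) :=
    hasSum_sum_of_ne_finset_zero fun j hj => by rw [hu j hj, mul_zero]
  exact h.comp tendsto_firstCoords

theorem sketchApply_eq_sum {F : Finset (Coord p)} {u : DataVec p} (hu : ∀ j ∉ F, u j = 0)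
    (S : SketchMat M p) (i : Fin M) : sketchApply S u i = ∑ j ∈ F, S i j * u j :=
  (tendsto_sum_firstCoords_of_support hu (S i)).limUnder_eq

/-- A finite family of finitely supported orthonormal vectors. -/
structure FiniteOrthonormal (f : Fin k → DataVec p) (F : Finset (Coord p)) : Prop where
  support : ∀ l, ∀ j ∉ F, f l j = 0
  orthonormal : ∀ l m, ∑ j ∈ F, f l j * f m j = if l = m then 1 else 0

/-- The sketched family `S f_l`, as a matrix. -/
def sketchedFamily (S : SketchMat M p) (f : Fin k → DataVec p) : Matrix (Fin M) (Fin k) ℝ :=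
  Matrix.of fun i l => sketchApply S (f l) i

theorem FiniteOrthonormal.support_sum {f : Fin k → DataVec p} {F : Finset (Coord p)}
    (hf : FiniteOrthonormal f F) (c : Fin k → ℝ) : ∀ j ∉ F, (∑ l, c l * f l j) = 0 :=
  fun j hj => Finset.sum_eq_zero fun l _ => by rw [hf.support l j hj, mul_zero]

theorem FiniteOrthonormal.sketchApply_sum {f : Fin k → DataVec p} {F : Finset (Coord p)}
    (hf : FiniteOrthonormal f F) (S : SketchMat M p) (c : Fin k → ℝ) :
    sketchApply S (fun j => ∑ l, c l * f l j) = sketchedFamily S f *ᵥ c := by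
  funext i
  rw [sketchApply_eq_sum (hf.support_sum c)]
  simp only [sketchedFamily, Matrix.mulVec, dotProduct, Matrix.of_apply]
  simp_rw [sketchApply_eq_sum (hf.support _), Finset.mul_sum, Finset.sum_mul]
  rw [Finset.sum_comm]
  exact Finset.sum_congr rfl fun l _ => Finset.sum_congr rfl fun j _ => by ring

theorem FiniteOrthonormal.sum_sq {f : Fin k → DataVec p} {F : Finset (Coord p)}
    (hf : FiniteOrthonormal f F) (c : Fin k → ℝ) :
    ∑ j ∈ F, (∑ l, c l * f l j) ^ 2 = ∑ l, c l ^ 2 := by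
  calc ∑ j ∈ F, (∑ l, c l * f l j) ^ 2
      = ∑ j ∈ F, ∑ l, ∑ m, c l * c m * (f l j * f m j) := by
        refine Finset.sum_congr rfl fun j _ => ?_
        rw [sq, Finset.sum_mul_sum]
        exact Finset.sum_congr rfl fun l _ => Finset.sum_congr rfl fun m _ => by ring
    _ = ∑ l, ∑ m, c l * c m * ∑ j ∈ F, f l j * f m j := by
        rw [Finset.sum_comm]
        refine Finset.sum_congr rfl fun l _ => ?_
        rw [Finset.sum_comm]
        exact Finset.sum_congr rfl fun m _ => by rw [Finset.mul_sum]
    _ = _ := by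
        simp_rw [hf.orthonormal]
        exact Finset.sum_congr rfl fun l _ => by simp [sq]

theorem summable_sq_of_support {F : Finset (Coord p)} {u : DataVec p} (hu : ∀ j ∉ F, u j = 0) :
    Summable fun j => u j ^ 2 :=
  summable_of_ne_finset_zero (s := F) fun j hj => by rw [hu j hj]; simp

theorem normSq_of_support {F : Finset (Coord p)} {u : DataVec p} (hu : ∀ j ∉ F, u j = 0) :
    normSq u = ∑ j ∈ F, u j ^ 2 := by
  unfold normSq
  exact tsum_eq_sum fun j hj => by rw [hu j hj]; simp

/-- Smallest singular value of the sketch restricted to a `k`-dimensional space, `2 k ≤ M`. -/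
theorem gaussianSketch_exists_mulVec_lt_le (hM : 1 ≤ M) (hk : 2 * k ≤ M) {f : Fin k → DataVec p}
    {F : Finset (Coord p)} (hf : FiniteOrthonormal f F) :
    gaussianSketch M p {S | ∃ c : Fin k → ℝ, ∑ i, (sketchedFamily S f *ᵥ c) i ^ 2 <
        (1 / 10 ^ 7) ^ 2 * ∑ l, c l ^ 2} ≤
      ENNReal.ofReal (2 * Real.exp (-(4 * M))) := by
  -- The value is small enough for `√(40 / s) * √(8 s²) = √(320 s)` to be at most `1 / 160`, which
  -- beats `e ^ 5`: one factor `e` comes from the lower deviation and four from the target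
  -- probability `e ^ (-4 M)`.
  set s : ℝ := 1 / 10 ^ 7 with hs
  set A : SketchMat M p → EuclideanSpace ℝ (Fin k) →L[ℝ] EuclideanSpace ℝ (Fin M) :=
    fun S => (Matrix.toLpLin 2 2 (sketchedFamily S f)).toContinuousLinearMap with hAdef
  have hAn : ∀ S c, ‖A S c‖ = √(∑ i, (sketchedFamily S f *ᵥ c.ofLp) i ^ 2) := fun S c => by
    rw [EuclideanSpace.norm_eq]
    congr 1
    exact Finset.sum_congr rfl fun i _ => by simp [A]
  have hcn : ∀ c : EuclideanSpace ℝ (Fin k), ‖c‖ = √(∑ l, c l ^ 2) := fun c => by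
    rw [EuclideanSpace.norm_eq]; simp
  have hsk : ∀ (S : SketchMat M p) (c : Fin k → ℝ), ∑ i, (sketchedFamily S f *ᵥ c) i ^ 2 =
      sketchNormSq S (fun j => ∑ l, c l * f l j) := fun S c => by
    unfold sketchNormSq; rw [hf.sketchApply_sum S c]
  have hnq : ∀ c : Fin k → ℝ, normSq (fun j => ∑ l, c l * f l j) = ∑ l, c l ^ 2 := fun c => by
    rw [normSq_of_support (hf.support_sum c), hf.sum_sq]
  have hcol : ∀ l, Measurable fun S : SketchMat M p => sketchApply S (f l) := fun l => by
    have := (measurable_sketchApply (M := M) (p := p)).comp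
      (measurable_id.prodMk (measurable_const (a := f l)))
    exact this
  have hAm : Measurable fun z : SketchMat M p × EuclideanSpace ℝ (Fin k) => ‖A z.1 z.2‖ := by
    simp_rw [hAn]
    refine Measurable.sqrt (Finset.measurable_fun_sum _ fun i _ => Measurable.pow_const ?_ 2)
    simp only [Matrix.mulVec, dotProduct, sketchedFamily, Matrix.of_apply]
    refine Finset.measurable_fun_sum _ fun l _ => Measurable.mul ?_ (by fun_prop)
    exact (measurable_pi_iff.mp (hcol l) i).comp measurable_fst
  have h := measure_exists_norm_lt_le (P := gaussianSketch M p) hAm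
    (δ₁ := ENNReal.ofReal ((√2 * Real.exp (-(25 / 4))) ^ M))
    (δ₂ := ENNReal.ofReal ((Real.exp 1 * √(16 * s ^ 2 / 2)) ^ M)) (s := s)
    (by positivity) (by rw [hs]; norm_num) ?_ ?_
  rotate_left
  · intro c
    refine le_trans (measure_mono fun S hS => ?_) (gaussianSketch_normSq_gt_le hM
      (summable_sq_of_support (hf.support_sum c.ofLp)) (K := 25) (by norm_num))
    rw [Set.mem_ofPred_eq] at hS ⊢
    rw [hnq, ← hsk]
    rw [hAn, hcn, show (5 : ℝ) = √25 by
      rw [show (25 : ℝ) = 5 ^ 2 by norm_num, Real.sqrt_sq (by norm_num)],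
      ← Real.sqrt_mul (by norm_num)] at hS
    exact lt_of_not_ge fun h => absurd (Real.sqrt_le_sqrt h) hS.not_ge
  · intro c
    refine le_trans (measure_mono fun S hS => ?_) (gaussianSketch_normSq_lt_le hM
      (summable_sq_of_support (hf.support_sum c.ofLp)) (ρ := 16 * s ^ 2) (by positivity))
    rw [Set.mem_ofPred_eq] at hS ⊢
    rw [hnq, ← hsk]
    rw [hAn, hcn, show 4 * s = √(16 * s ^ 2) by
      rw [show 16 * s ^ 2 = (4 * s) ^ 2 by ring, Real.sqrt_sq (by positivity)],
      ← Real.sqrt_mul (by positivity)] at hS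
    exact lt_of_not_ge fun h => absurd (Real.sqrt_le_sqrt h) hS.not_ge
  have hsubset : {S | ∃ c : Fin k → ℝ, ∑ i, (sketchedFamily S f *ᵥ c) i ^ 2 <
      s ^ 2 * ∑ l, c l ^ 2} ⊆ {S | ∃ c, ‖A S c‖ < s * ‖c‖} := by
    rintro S ⟨c, hc⟩
    refine ⟨WithLp.toLp 2 c, ?_⟩
    rw [hAn, hcn, show s = √(s ^ 2) by rw [Real.sqrt_sq (by positivity)],
      ← Real.sqrt_mul (by positivity)]
    refine Real.sqrt_lt_sqrt (Finset.sum_nonneg fun _ _ => sq_nonneg _) ?_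
    exact hc
  refine (measure_mono hsubset).trans (h.trans ?_)
  rw [← ENNReal.ofReal_mul (by positivity), ← ENNReal.ofReal_mul (by positivity),
    ← ENNReal.ofReal_add (by positivity) (by positivity)]
  refine ENNReal.ofReal_le_ofReal ?_
  have he1 : (2.7 : ℝ) ≤ Real.exp 1 := by have := Real.exp_one_gt_d9; linarith
  have he2 : Real.exp 1 ≤ 2.72 := by have := Real.exp_one_lt_d9; linarith
  -- Since `2 k ≤ M`, the volume factor `b ^ k` is at most `(√b) ^ M` and is absorbed by deviation
  -- probabilities of the form `q ^ M`.
  have hpow : ∀ b : ℝ, 1 ≤ b → b ^ (2 * k) ≤ b ^ M := fun b hb => pow_le_pow_right₀ hb hk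
  have h8 : (8 : ℝ) ^ k ≤ (√8) ^ M := by
    have := hpow (√8) (by rw [Real.one_le_sqrt]; norm_num)
    rwa [pow_mul, Real.sq_sqrt (by norm_num)] at this
  have h40 : (40 / s) ^ k ≤ (√(40 / s)) ^ M := by
    have := hpow (√(40 / s)) (by rw [Real.one_le_sqrt, hs]; norm_num)
    rwa [pow_mul, Real.sq_sqrt (by rw [hs]; norm_num)] at this
  have hexp : Real.exp (-(4 * M)) = Real.exp (-4) ^ M := by
    rw [← Real.exp_nat_mul]; congr 1; ring
  have hE4 : Real.exp (-4) = (Real.exp 1 ^ 4)⁻¹ := by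
    rw [Real.exp_neg, ← Real.exp_nat_mul]; norm_num
  rw [hexp, two_mul]
  refine add_le_add ?_ ?_
  · calc _ ≤ (√8) ^ M * (√2 * Real.exp (-(25 / 4))) ^ M := by gcongr
      _ = (√8 * (√2 * Real.exp (-(25 / 4)))) ^ M := by rw [← mul_pow]
      _ ≤ _ := by
        refine pow_le_pow_left₀ (by positivity) ?_ M
        rw [← mul_assoc, ← Real.sqrt_mul (by norm_num),
          show (8 * 2 : ℝ) = 4 ^ 2 by norm_num, Real.sqrt_sq (by norm_num)]
        have h4 : (4 : ℝ) ≤ Real.exp (9 / 4) := by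
          have h5 : Real.exp 2 ≤ Real.exp (9 / 4) := Real.exp_le_exp.mpr (by norm_num)
          have h6 : Real.exp 2 = Real.exp 1 ^ 2 := by rw [← Real.exp_nat_mul]; norm_num
          nlinarith
        calc 4 * Real.exp (-(25 / 4)) ≤ Real.exp (9 / 4) * Real.exp (-(25 / 4)) := by gcongr
          _ = _ := by rw [← Real.exp_add]; norm_num
  · calc _ ≤ (√(40 / s)) ^ M * (Real.exp 1 * √(16 * s ^ 2 / 2)) ^ M := by gcongr
      _ = (√(40 / s) * (Real.exp 1 * √(16 * s ^ 2 / 2))) ^ M := by rw [← mul_pow]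
      _ ≤ _ := by
        refine pow_le_pow_left₀ (by positivity) ?_ M
        rw [mul_left_comm, ← Real.sqrt_mul (by positivity), hE4]
        have h7 : √(40 / s * (16 * s ^ 2 / 2)) ≤ 1 / 160 := by
          rw [Real.sqrt_le_left (by norm_num), hs]; norm_num
        rw [← one_div, le_div_iff₀ (by positivity)]
        calc Real.exp 1 * √(40 / s * (16 * s ^ 2 / 2)) * Real.exp 1 ^ 4
            ≤ Real.exp 1 * (1 / 160) * Real.exp 1 ^ 4 := by gcongr
          _ ≤ 2.72 * (1 / 160) * 2.72 ^ 4 := by gcongr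
          _ ≤ 1 := by norm_num

end

/-! ### Mean and variance through successive quantizations -/

section

/-- `X` has mean `m` and variance at most `V` under `ν`. -/
structure MeanVar {α : Type*} [MeasurableSpace α] (ν : Measure α) (X : α → ℝ) (m V : ℝ) : Prop where
  aesm : AEStronglyMeasurable X ν
  nonneg : 0 ≤ V
  mean : ∫ a, X a ∂ν = m
  variance : ∫⁻ a, ENNReal.ofReal ((X a - m) ^ 2) ∂ν ≤ ENNReal.ofReal V

theorem memLp_two_of_lintegral_sq_lt_top {α : Type*} [MeasurableSpace α] {ν : Measure α}
    {X : α → ℝ} (hX : AEStronglyMeasurable X ν)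
    (h : ∫⁻ a, ENNReal.ofReal (X a ^ 2) ∂ν < ∞) :
    MemLp X 2 ν := by
  rw [memLp_two_iff_integrable_sq hX]
  refine ⟨hX.pow 2, ?_⟩
  rw [hasFiniteIntegral_iff_ofReal (Eventually.of_forall fun _ => sq_nonneg _)]
  exact h

theorem lintegral_sq_eq_ofReal {α : Type*} [MeasurableSpace α] {ν : Measure α}
    {X : α → ℝ} (hX : MemLp X 2 ν) :
    ∫⁻ a, ENNReal.ofReal (X a ^ 2) ∂ν = ENNReal.ofReal (∫ a, X a ^ 2 ∂ν) :=
  (ofReal_integral_eq_lintegral_ofReal hX.integrable_sq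
    (Eventually.of_forall fun _ => sq_nonneg _)).symm

namespace MeanVar

theorem of_integrable {α : Type*} [MeasurableSpace α] {ν : Measure α} {X : α → ℝ} {m V : ℝ}
    (hX : Integrable X ν) (hm : ∫ a, X a ∂ν = m) (hV : 0 ≤ V)
    (h : ∫⁻ a, ENNReal.ofReal ((X a - m) ^ 2) ∂ν ≤ ENNReal.ofReal V) : MeanVar ν X m V :=
  ⟨hX.1, hV, hm, h⟩

variable {α : Type*} [MeasurableSpace α] {ν : Measure α} [IsProbabilityMeasure ν] {X : α → ℝ}
  {m V : ℝ}

theorem memLp (h : MeanVar ν X m V) : MemLp X 2 ν := by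
  have h1 : MemLp (fun a => X a - m) 2 ν :=
    memLp_two_of_lintegral_sq_lt_top (h.aesm.sub aestronglyMeasurable_const)
      (h.variance.trans_lt ENNReal.ofReal_lt_top)
  exact (h1.add (memLp_const m)).congr_norm h.aesm (Eventually.of_forall fun a => by simp)

theorem integrable (h : MeanVar ν X m V) : Integrable X ν := h.memLp.integrable (by norm_num)

theorem lintegral_sq_sub_le (h : MeanVar ν X m V) (c : ℝ) :
    ∫⁻ a, ENNReal.ofReal ((X a - c) ^ 2) ∂ν ≤ ENNReal.ofReal ((m - c) ^ 2 + V) := by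
  have h1 : MemLp (fun a => X a - m) 2 ν := h.memLp.sub (memLp_const m)
  have h2 : MemLp (fun a => X a - c) 2 ν := h.memLp.sub (memLp_const c)
  have h3 := h.variance
  rw [lintegral_sq_eq_ofReal h1, ENNReal.ofReal_le_ofReal_iff h.nonneg] at h3
  rw [lintegral_sq_eq_ofReal h2]
  refine ENNReal.ofReal_le_ofReal ?_
  have h4 : ∫ a, (X a - c) ^ 2 ∂ν = ∫ a, ((X a - m) ^ 2 + (2 * (m - c) * X a +
      ((m - c) ^ 2 - 2 * (m - c) * m))) ∂ν := by
    congr 1; ext a; ring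
  have hi := h.integrable.const_mul (2 * (m - c))
  have hj : Integrable (fun a => 2 * (m - c) * X a + ((m - c) ^ 2 - 2 * (m - c) * m)) ν :=
    hi.add (integrable_const _)
  rw [h4, integral_add h1.integrable_sq hj,
    integral_add (h.integrable.const_mul _) (integrable_const _), integral_const_mul, h.mean]
  simp only [integral_const, probReal_univ, smul_eq_mul, one_mul]
  linarith

theorem lintegral_sq_le (h : MeanVar ν X m V) :
    ∫⁻ a, ENNReal.ofReal (X a ^ 2) ∂ν ≤ ENNReal.ofReal (m ^ 2 + V) := by
  simpa using h.lintegral_sq_sub_le 0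

theorem le_lintegral_sq (h : MeanVar ν X m V) :
    ENNReal.ofReal (m ^ 2) ≤ ∫⁻ a, ENNReal.ofReal (X a ^ 2) ∂ν := by
  rw [lintegral_sq_eq_ofReal h.memLp]
  refine ENNReal.ofReal_le_ofReal ?_
  have h1 : 0 ≤ ∫ a, (X a - m) ^ 2 ∂ν := integral_nonneg fun a => sq_nonneg _
  have h4 : ∫ a, (X a - m) ^ 2 ∂ν = ∫ a, (X a ^ 2 + (-(2 * m) * X a + m ^ 2)) ∂ν := by
    congr 1; ext a; ring
  have hj : Integrable (fun a => -(2 * m) * X a + m ^ 2) ν :=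
    (h.integrable.const_mul _).add (integrable_const _)
  rw [h4, integral_add h.memLp.integrable_sq hj,
    integral_add (h.integrable.const_mul _) (integrable_const _), integral_const_mul, h.mean] at h1
  simp only [integral_const, probReal_univ, smul_eq_mul, one_mul] at h1
  linarith

/-- Law of total variance for a noise whose conditional variance is at most `ε (X - s)²`. -/
theorem bind {β : Type*} [MeasurableSpace β] (h : MeanVar ν X m V) {η : Kernel α β}
    [IsMarkovKernel η] {Y : β → ℝ} (hY : Measurable Y) {ε s : ℝ} (hε : 0 ≤ ε)
    (hη : ∀ᵐ a ∂ν, MeanVar (η a) Y (X a) (ε * (X a - s) ^ 2)) :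
    MeanVar (ν.bind η) Y m (V + ε * ((m - s) ^ 2 + V)) := by
  have hVn := h.nonneg
  have h0 : ∫⁻ b, ENNReal.ofReal ((Y b - m) ^ 2) ∂(ν.bind η) ≤
      ENNReal.ofReal (V + ε * ((m - s) ^ 2 + V)) := by
    rw [Measure.lintegral_bind η.aemeasurable (by fun_prop)]
    calc _ ≤ ∫⁻ a, (ENNReal.ofReal ((X a - m) ^ 2) +
            ENNReal.ofReal ε * ENNReal.ofReal ((X a - s) ^ 2)) ∂ν := by
          refine lintegral_mono_ae ?_
          filter_upwards [hη] with a ha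
          refine (ha.lintegral_sq_sub_le m).trans_eq ?_
          rw [ENNReal.ofReal_add (sq_nonneg _) (by positivity), ENNReal.ofReal_mul hε]
      _ = ∫⁻ a, ENNReal.ofReal ((X a - m) ^ 2) ∂ν +
            ENNReal.ofReal ε * ∫⁻ a, ENNReal.ofReal ((X a - s) ^ 2) ∂ν := by
          have hXm := h.aesm.aemeasurable
          rw [lintegral_add_left' (by fun_prop), lintegral_const_mul' _ _ ENNReal.ofReal_ne_top]
      _ ≤ ENNReal.ofReal V + ENNReal.ofReal ε * ENNReal.ofReal ((m - s) ^ 2 + V) := by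
          gcongr
          · exact h.variance
          · exact h.lintegral_sq_sub_le s
      _ = _ := by
          rw [← ENNReal.ofReal_mul hε, ← ENNReal.ofReal_add hVn (by positivity)]
  have hp : IsProbabilityMeasure (ν.bind η) := inferInstance
  have h1 : MemLp (fun b => Y b - m) 2 (ν.bind η) :=
    memLp_two_of_lintegral_sq_lt_top (hY.sub_const m).aestronglyMeasurable
      (h0.trans_lt ENNReal.ofReal_lt_top)
  have h2 : MemLp Y 2 (ν.bind η) := by
    exact (h1.add (memLp_const m)).congr_norm hY.aestronglyMeasurable
      (Eventually.of_forall fun a => by simp)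
  refine of_integrable (h2.integrable (by norm_num)) ?_ (by positivity) h0
  have h3 := h2.integrable (by norm_num)
  rw [Measure.comp_eq_comp_const_apply] at h3 ⊢
  rw [Kernel.integral_comp h3, Kernel.const_apply, ← h.mean]
  refine integral_congr_ae ?_
  filter_upwards [hη] with a ha using ha.mean

end MeanVar

/-- Discarding the intermediate variable leaves a `bind`, so `MeanVar.bind` treats one quantization
stage at a time. -/
theorem snd_compProd_apply {α β γ : Type*} [MeasurableSpace α] [MeasurableSpace β]
    [MeasurableSpace γ] (κ : Kernel α β) [IsSFiniteKernel κ] (η : Kernel (α × β) γ)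
    [IsSFiniteKernel η] (a : α) :
    Kernel.snd (κ ⊗ₖ η) a = (κ a).bind (η.comap (Prod.mk a) measurable_prodMk_left) := by
  ext s hs
  rw [Kernel.snd_apply' _ _ hs, Kernel.compProd_apply (measurable_snd hs),
    Measure.bind_apply hs (Kernel.aemeasurable _)]
  rfl

section Quantizers

variable {ι : Type}

theorem UnbiasedScalar.meanVar {K : Kernel ℝ ℝ} [IsMarkovKernel K] {ε : ℝ} (hε : 0 ≤ ε)
    (hK : UnbiasedScalar K) (hK' : MultiplicativeScalar K ε) (u : ℝ) :
    MeanVar (K u) (fun v => v) u (ε * u ^ 2) :=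
  .of_integrable (hK u).1 (hK u).2 (by positivity) (hK' u)

theorem UnbiasedVec.meanVar_finsupp {K : Kernel (ι → ℝ) (ι → ℝ)} [IsMarkovKernel K] {ε : ℝ}
    (hε : 0 ≤ ε) (hK : UnbiasedVec K) (hK' : MultiplicativeVec K ε) (u : ι → ℝ) (c : ι →₀ ℝ) :
    MeanVar (K u) (fun v => c.sum fun j t => t * v j) (c.sum fun j t => t * u j)
      (ε * (c.sum fun j t => t * u j) ^ 2) := by
  refine .of_integrable (integrable_finsetSum _ fun j _ => ((hK u j).1.const_mul _)) ?_
    (by positivity) ?_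
  · simp only [Finsupp.sum]
    rw [integral_finsetSum _ fun j _ => ((hK u j).1.const_mul _)]
    exact Finset.sum_congr rfl fun j _ => by rw [integral_const_mul, (hK u j).2]
  · refine le_trans (le_of_eq ?_) (hK' u c)
    refine lintegral_congr fun v => ?_
    simp only [Finsupp.sum, mul_sub, Finset.sum_sub_distrib]

theorem UnbiasedVec.meanVar [Fintype ι] {K : Kernel (ι → ℝ) (ι → ℝ)} [IsMarkovKernel K] {ε : ℝ}
    (hε : 0 ≤ ε) (hK : UnbiasedVec K) (hK' : MultiplicativeVec K ε) (u b : ι → ℝ) :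
    MeanVar (K u) (fun v => b ⬝ᵥ v) (b ⬝ᵥ u) (ε * (b ⬝ᵥ u) ^ 2) := by
  have h := hK.meanVar_finsupp hε hK' u (Finsupp.equivFunOnFinite.symm b)
  simpa [Finsupp.sum_fintype, dotProduct] using h

/-- A multiplicative quantizer acts on a given vector by a random scalar. -/
theorem exists_scalar_of_multiplicative [Countable ι] {ν : Measure (ι → ℝ)} [IsProbabilityMeasure ν]
    {u : ι → ℝ} {ε : ℝ} (hε : 0 ≤ ε)
    (h : ∀ c : ι →₀ ℝ, MeanVar ν (fun v => c.sum fun j t => t * v j) (c.sum fun j t => t * u j)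
      (ε * (c.sum fun j t => t * u j) ^ 2)) :
    ∃ η : (ι → ℝ) → ℝ, Measurable η ∧ (∀ᵐ v ∂ν, ∀ j, v j = η v * u j) ∧ MeanVar ν η 1 ε := by
  by_cases hu : ∃ i, u i ≠ 0
  · obtain ⟨i, hi⟩ := hu
    refine ⟨fun v => (u i)⁻¹ * v i, by fun_prop, ?_, ?_⟩
    · rw [ae_all_iff]
      intro j
      -- The test vector `u i e_j - u j e_i` is orthogonal to `u`, so its pairing with the quantized
      -- vector has variance zero. All coordinates are thus proportional to `u`, with ratio `v i / u
      -- i`.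
      have hj := h (Finsupp.single j (u i) - Finsupp.single i (u j))
      have hsum : ∀ v : ι → ℝ, ((Finsupp.single j (u i) - Finsupp.single i (u j)).sum
          fun l t => t * v l) = u i * v j - u j * v i := by
        intro v
        rw [Finsupp.sum_sub_index (fun l a b => by ring), Finsupp.sum_single_index (by simp),
          Finsupp.sum_single_index (by simp)]
      have hv := hj.variance
      simp only [hsum] at hv
      have h0 : u i * u j - u j * u i = 0 := by ring
      rw [h0] at hv
      simp only [sub_zero, ne_eq, OfNat.ofNat_ne_zero, not_false_eq_true, zero_pow, mul_zero,
        ENNReal.ofReal_zero, nonpos_iff_eq_zero] at hv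
      rw [lintegral_eq_zero_iff (by fun_prop)] at hv
      filter_upwards [hv] with v hv
      have h1 : (u i * v j - u j * v i) ^ 2 ≤ 0 := by simpa using hv
      have h2 : u i * v j - u j * v i = 0 := pow_eq_zero_iff two_ne_zero |>.mp
        (le_antisymm h1 (sq_nonneg _))
      field_simp
      linarith
    · have hc := h (Finsupp.single i (u i)⁻¹)
      simpa [Finsupp.sum_single_index, hi] using hc
  -- A zero vector is quantized to zero almost surely, so the scalar can be taken constant.
  · push Not at hu
    refine ⟨fun _ => 1, measurable_const, ?_, ?_⟩
    · rw [ae_all_iff]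
      intro j
      have hc := (h (Finsupp.single j 1)).variance
      simp only [Finsupp.sum_single_index, zero_mul, one_mul, hu j] at hc
      simp only [sub_zero, ne_eq, OfNat.ofNat_ne_zero, not_false_eq_true, zero_pow, mul_zero,
        ENNReal.ofReal_zero, nonpos_iff_eq_zero] at hc
      rw [lintegral_eq_zero_iff (by fun_prop)] at hc
      filter_upwards [hc] with v hv
      have h1 : v j ^ 2 ≤ 0 := by simpa using hv
      rw [hu j, pow_eq_zero_iff two_ne_zero |>.mp (le_antisymm h1 (sq_nonneg _))]
      simp
    · exact .of_integrable (integrable_const _) (by simp) hε (by simp)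

end Quantizers

namespace ErrorLevels

variable (e : ErrorLevels)

/-- Relative variance of the quantized activation. -/
def activationNoise : ℝ := e.param + (1 + e.param) * e.activation

theorem one_add_amplification :
    1 + e.amplification = (1 + e.outGrad) * (1 + e.activationNoise) := by
  unfold amplification activationNoise; ring

/-- The product of the feature distortion factors. -/
def featureFactor : ℝ := (1 + e.data) * (1 + e.feature) * (1 + e.sketch)

theorem one_sub_distortion : 1 - e.distortion = 1 / e.featureFactor := by
  unfold distortion featureFactor; ring

variable {e}

theorem Nonneg.activationNoise_nonneg (h : e.Nonneg) : 0 ≤ e.activationNoise := by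
  obtain ⟨-, -, -, h4, h5, -⟩ := h
  unfold activationNoise; positivity

theorem Nonneg.one_le_featureFactor (h : e.Nonneg) : 1 ≤ e.featureFactor := by
  obtain ⟨h1, h2, h3, -⟩ := h
  unfold featureFactor
  have : 1 ≤ (1 + e.data) * (1 + e.feature) := by nlinarith
  nlinarith

end ErrorLevels

namespace Quantizers

variable {M : ℕ} {p : ℕ∞} {Q : Quantizers M p} {e : ErrorLevels}

/-- Both errors are relative. Parameter quantization contributes `ε̄_p` times the squared
prediction, and activation quantization `ε̄_a` times the second moment `(1 + ε̄_p)` of what it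
receives. -/
theorem meanVar_activationKernel (hQ : Q.Unbiased) (he : e.Nonneg) (hm : Q.Multiplicative e)
    (v f : FeatVec M) (z : ℝ) :
    MeanVar (Q.activationKernel (v, (f, z))) (fun a => a) (f ⬝ᵥ v)
      (e.activationNoise * (f ⬝ᵥ v) ^ 2) := by
  obtain ⟨-, -, -, hep, hea, -⟩ := he
  unfold activationKernel
  rw [snd_compProd_apply]
  have h1 : MeanVar (Q.param v) (fun u => f ⬝ᵥ u) (f ⬝ᵥ v) (e.param * (f ⬝ᵥ v) ^ 2) :=
    hQ.2.2.2.2.1.meanVar hep hm.2.2.2.1 v f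
  have h2 := h1.bind (Y := fun a : ℝ => a) measurable_id hea (s := 0)
    (η := (Q.activation.comap
      (fun t : (FeatVec M × (FeatVec M × ℝ)) × FeatVec M => t.1.2.1 ⬝ᵥ t.2)
      (by unfold dotProduct; fun_prop)).comap (Prod.mk (v, (f, z))) measurable_prodMk_left)
    (Eventually.of_forall fun u => by
      have := hQ.2.2.2.2.2.1.meanVar hea hm.2.2.2.2.1 (f ⬝ᵥ u)
      simpa using this)
  convert h2 using 1
  · rfl
  · unfold ErrorLevels.activationNoise
    ring

/-- The activation error is centred, so the residual keeps its mean and inherits the activation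
variance; the last quantizer adds `ε̄_o` times the second moment of that residual. -/
theorem meanVar_outGradKernel (hQ : Q.Unbiased) (he : e.Nonneg) (hm : Q.Multiplicative e)
    (v f : FeatVec M) (z : ℝ) :
    MeanVar (Q.outGradKernel (v, (f, z))) (fun g => g) (z - f ⬝ᵥ v)
      (e.activationNoise * (f ⬝ᵥ v) ^ 2 + e.outGrad * ((z - f ⬝ᵥ v) ^ 2 +
        e.activationNoise * (f ⬝ᵥ v) ^ 2)) := by
  have h1 := meanVar_activationKernel hQ he hm v f z
  obtain ⟨-, -, -, -, -, heo⟩ := he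
  unfold outGradKernel
  rw [snd_compProd_apply]
  have h1' : MeanVar (Q.activationKernel (v, (f, z))) (fun a => z - a) (z - f ⬝ᵥ v)
      (e.activationNoise * (f ⬝ᵥ v) ^ 2) := by
    refine .of_integrable ((integrable_const z).sub h1.integrable) ?_ h1.nonneg ?_
    · rw [integral_sub (integrable_const z) h1.integrable, h1.mean]; simp
    · refine le_trans (le_of_eq ?_) h1.variance
      exact lintegral_congr fun a => by congr 1; ring
  have h2 := h1'.bind (Y := fun a : ℝ => a) measurable_id heo (s := 0)
    (η := (Q.outGrad.comap (fun t : (FeatVec M × (FeatVec M × ℝ)) × ℝ => t.1.2.2 - t.2)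
      (by fun_prop)).comap (Prod.mk (v, (f, z))) measurable_prodMk_left)
    (Eventually.of_forall fun a => by
      have := hQ.2.2.2.2.2.2.meanVar heo hm.2.2.2.2.2 (z - a)
      simpa using this)
  simpa using h2

theorem lintegral_sq_outGradKernel_le (hQ : Q.Unbiased) (he : e.Nonneg) (hm : Q.Multiplicative e)
    (v f : FeatVec M) (z : ℝ) :
    ∫⁻ g, ENNReal.ofReal (g ^ 2) ∂(Q.outGradKernel (v, (f, z))) ≤
      ENNReal.ofReal ((1 + e.outGrad) *
        ((z - f ⬝ᵥ v) ^ 2 + e.activationNoise * (f ⬝ᵥ v) ^ 2)) := by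
  refine (meanVar_outGradKernel hQ he hm v f z).lintegral_sq_le.trans_eq ?_
  congr 1; ring

end Quantizers

end

/-! ### Second and fourth moments of the quantized features -/

section

namespace Quantizers

variable {M : ℕ} {p : ℕ∞} {Q : Quantizers M p} {D : DataModel p} {S : SketchMat M p}

theorem _root_.QuantSGD.DataModel.lintegral_sampleXY (D : DataModel p) (w : DataVec p)
    {F : DataVec p × ℝ → ℝ≥0∞} (hF : Measurable F) :
    ∫⁻ t, F t ∂(D.sampleXY w) = ∫⁻ x, ∫⁻ y, F (x, y) ∂(D.label (w, x)) ∂D.law := by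
  unfold DataModel.sampleXY
  rw [Kernel.lintegral_compProd _ _ _ hF]
  simp

theorem lintegral_sample (w : DataVec p) {F : FeatVec M × ℝ → ℝ≥0∞} (hF : Measurable F) :
    ∫⁻ t, F t ∂(Q.sample D S w) = ∫⁻ x, ∫⁻ y, ∫⁻ f, ∫⁻ z, F (f, z) ∂(Q.label y)
      ∂(Q.featureKernel S x) ∂(D.label (w, x)) ∂D.law := by
  unfold sample
  rw [Kernel.lintegral_comp _ _ _ hF, D.lintegral_sampleXY w hF.lintegral_kernel]
  refine lintegral_congr fun x => lintegral_congr fun y => ?_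
  rw [Kernel.parallelComp_apply, lintegral_prod _ hF.aemeasurable]

theorem lintegral_featureLaw {F : FeatVec M → ℝ≥0∞} (hF : Measurable F) :
    ∫⁻ f, F f ∂(Q.featureLaw D S) = ∫⁻ x, ∫⁻ f, F f ∂(Q.featureKernel S x) ∂D.law := by
  unfold featureLaw
  rw [Measure.lintegral_bind (Kernel.aemeasurable _) hF.aemeasurable]

instance : IsProbabilityMeasure (Q.featureLaw D S) := by unfold featureLaw; infer_instance

/-- The data are independent of the target, so conditioning on the target does not change the law of
the feature. -/
theorem map_fst_sample (w : DataVec p) :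
    (Q.sample D S w).map Prod.fst = Q.featureLaw D S := by
  refine Measure.ext_of_lintegral _ fun F hF => ?_
  rw [lintegral_map hF measurable_fst, lintegral_sample (F := fun t => F t.1) w
    (hF.comp measurable_fst), lintegral_featureLaw hF]
  simp

theorem measurePreserving_fst_sample (w : DataVec p) :
    MeasurePreserving Prod.fst (Q.sample D S w) (Q.featureLaw D S) :=
  ⟨measurable_fst, map_fst_sample w⟩

/-- `uᵀ G u`. -/
def quad (G : Matrix (Fin M) (Fin M) ℝ) (u : FeatVec M) : ℝ := u ⬝ᵥ G *ᵥ u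

theorem measurable_dotProduct_left (u : FeatVec M) : Measurable fun f : FeatVec M => f ⬝ᵥ u := by
  unfold dotProduct; fun_prop

theorem memLp_dotProduct (h2 : ∀ i, MemLp (fun f : FeatVec M => f i) 2 (Q.featureLaw D S))
    (u : FeatVec M) : MemLp (fun f => f ⬝ᵥ u) 2 (Q.featureLaw D S) := by
  unfold dotProduct
  exact memLp_finsetSum _ fun i _ => (h2 i).mul_const (u i)

theorem integral_dotProduct_mul_dotProduct
    (h2 : ∀ i, MemLp (fun f : FeatVec M => f i) 2 (Q.featureLaw D S)) (u d : FeatVec M) :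
    ∫ f, (f ⬝ᵥ u) * (f ⬝ᵥ d) ∂(Q.featureLaw D S) = u ⬝ᵥ Q.featureCov D S *ᵥ d := by
  have hi : ∀ i j, Integrable (fun f : FeatVec M => u i * d j * (f i * f j))
      (Q.featureLaw D S) := fun i j => ((h2 i).integrable_mul (h2 j)).const_mul _
  calc _ = ∫ f, ∑ i, ∑ j, u i * d j * (f i * f j) ∂(Q.featureLaw D S) := by
        congr 1; ext f
        unfold dotProduct
        rw [Finset.sum_mul_sum]
        exact Finset.sum_congr rfl fun i _ => Finset.sum_congr rfl fun j _ => by ring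
    _ = ∑ i, ∑ j, u i * d j * Q.featureCov D S i j := by
        rw [integral_finsetSum _ fun i _ => integrable_finsetSum _ fun j _ => hi i j]
        refine Finset.sum_congr rfl fun i _ => ?_
        rw [integral_finsetSum _ fun j _ => hi i j]
        exact Finset.sum_congr rfl fun j _ => by rw [integral_const_mul]; rfl
    _ = _ := by
        simp only [dotProduct, Matrix.mulVec, Finset.mul_sum]
        exact Finset.sum_congr rfl fun i _ => Finset.sum_congr rfl fun j _ => by ring

theorem integral_dotProduct_sq
    (h2 : ∀ i, MemLp (fun f : FeatVec M => f i) 2 (Q.featureLaw D S)) (u : FeatVec M) :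
    ∫ f, (f ⬝ᵥ u) ^ 2 ∂(Q.featureLaw D S) = quad (Q.featureCov D S) u := by
  simp_rw [sq]
  exact integral_dotProduct_mul_dotProduct h2 u u

theorem lintegral_dotProduct_sq
    (h2 : ∀ i, MemLp (fun f : FeatVec M => f i) 2 (Q.featureLaw D S)) (u : FeatVec M) :
    ∫⁻ f, ENNReal.ofReal ((f ⬝ᵥ u) ^ 2) ∂(Q.featureLaw D S) =
      ENNReal.ofReal (quad (Q.featureCov D S) u) := by
  rw [lintegral_sq_eq_ofReal (memLp_dotProduct h2 u), integral_dotProduct_sq h2]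

theorem posSemidef_featureCov
    (h2 : ∀ i, MemLp (fun f : FeatVec M => f i) 2 (Q.featureLaw D S)) : (Q.featureCov D S).PosSemidef := by
  refine Matrix.PosSemidef.of_dotProduct_mulVec_nonneg ?_ fun u => ?_
  · ext i j
    simp only [featureCov, Matrix.conjTranspose_apply, Matrix.of_apply, star_trivial]
    simp_rw [mul_comm]
  · have := integral_dotProduct_sq h2 u
    rw [star_trivial]
    change 0 ≤ quad _ u
    rw [← this]
    exact integral_nonneg fun f => sq_nonneg _

theorem FourthMoment.memLp_two {α β : ℝ} (h : Q.FourthMoment D S α β) (i : Fin M) :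
    MemLp (fun f : FeatVec M => f i) 2 (Q.featureLaw D S) :=
  (h.1 i).mono_exponent (by norm_num)

theorem FourthMoment.memLp_four_dotProduct {α β : ℝ} (h : Q.FourthMoment D S α β)
    (u : FeatVec M) : MemLp (fun f => f ⬝ᵥ u) 4 (Q.featureLaw D S) := by
  unfold dotProduct
  exact memLp_finsetSum _ fun i _ => (h.1 i).mul_const (u i)

theorem memLp_mul_of_four {α : Type*} [MeasurableSpace α] {ν : Measure α} {X Y : α → ℝ}
    (hX : MemLp X 4 ν) (hY : MemLp Y 4 ν) : MemLp (fun a => X a * Y a) 2 ν := by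
  have : ENNReal.HolderTriple 4 4 2 := ⟨by
    rw [show (4 : ℝ≥0∞) = 2 * 2 by norm_num, ENNReal.mul_inv (by simp) (by simp), ← mul_add,
      ENNReal.inv_two_add_inv_two, mul_one]⟩
  exact hY.mul hX

/-- This is the upper fourth moment condition for the rank-one matrix `d dᵀ`, tested against `u`. -/
theorem FourthMoment.lintegral_le {α β : ℝ} (h : Q.FourthMoment D S α β) (u d : FeatVec M) :
    ∫⁻ f, ENNReal.ofReal ((f ⬝ᵥ d) ^ 2 * (f ⬝ᵥ u) ^ 2) ∂(Q.featureLaw D S) ≤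
      ENNReal.ofReal (α * quad (Q.featureCov D S) d * quad (Q.featureCov D S) u) := by
  set G := Q.featureCov D S
  have h22 : MemLp (fun f : FeatVec M => (f ⬝ᵥ d) * (f ⬝ᵥ u)) 2 (Q.featureLaw D S) :=
    memLp_mul_of_four (h.memLp_four_dotProduct d) (h.memLp_four_dotProduct u)
  simp_rw [← mul_pow]
  rw [lintegral_sq_eq_ofReal h22]
  refine ENNReal.ofReal_le_ofReal ?_
  have hA : (Matrix.vecMulVec d d).PosSemidef := by
    simpa using Matrix.posSemidef_vecMulVec_self_star d
  have h1 := (h.2 _ hA).2.dotProduct_mulVec_nonneg u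
  rw [star_trivial, Matrix.sub_mulVec, dotProduct_sub, Matrix.smul_mulVec, dotProduct_smul] at h1
  have htr : (G * Matrix.vecMulVec d d).trace = quad G d := by
    rw [Matrix.mul_vecMulVec, Matrix.trace_vecMulVec, dotProduct_comm]; rfl
  have hfo : u ⬝ᵥ Q.featureFourth D S (Matrix.vecMulVec d d) *ᵥ u =
      ∫ f, ((f ⬝ᵥ d) * (f ⬝ᵥ u)) ^ 2 ∂(Q.featureLaw D S) := by
    have hq : ∀ f : FeatVec M, f ⬝ᵥ Matrix.vecMulVec d d *ᵥ f = (f ⬝ᵥ d) ^ 2 := fun f => by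
      rw [Matrix.vecMulVec_mulVec, dotProduct_smul, op_smul_eq_smul, smul_eq_mul,
        dotProduct_comm d f, sq]
    have hi : ∀ i j, Integrable (fun f : FeatVec M => u i * u j *
        ((f ⬝ᵥ d) ^ 2 * (f i * f j))) (Q.featureLaw D S) := fun i j => by
      have h3 := (memLp_mul_of_four (h.memLp_four_dotProduct d) (h.1 i)).integrable_mul
        (memLp_mul_of_four (h.memLp_four_dotProduct d) (h.1 j))
      refine (h3.congr (Eventually.of_forall fun f => ?_)).const_mul _
      simp only [Pi.mul_apply]; ring
    symm
    calc _ = ∫ f, ∑ i, ∑ j, u i * u j * ((f ⬝ᵥ d) ^ 2 * (f i * f j)) ∂(Q.featureLaw D S) := by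
          congr 1; ext f
          rw [mul_pow, sq (f ⬝ᵥ u)]
          conv_lhs => rw [dotProduct, dotProduct, Finset.sum_mul_sum, Finset.mul_sum]
          refine Finset.sum_congr rfl fun i _ => ?_
          rw [Finset.mul_sum]
          exact Finset.sum_congr rfl fun j _ => by unfold dotProduct; ring
      _ = ∑ i, ∑ j, u i * u j * Q.featureFourth D S (Matrix.vecMulVec d d) i j := by
          rw [integral_finsetSum _ fun i _ => integrable_finsetSum _ fun j _ => hi i j]
          refine Finset.sum_congr rfl fun i _ => ?_
          rw [integral_finsetSum _ fun j _ => hi i j]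
          refine Finset.sum_congr rfl fun j _ => ?_
          rw [integral_const_mul]
          simp only [featureFourth, Matrix.of_apply, hq]
      _ = _ := by
          simp only [dotProduct, Matrix.mulVec, Finset.mul_sum]
          exact Finset.sum_congr rfl fun i _ => Finset.sum_congr rfl fun j _ => by ring
  rw [htr, hfo] at h1
  simpa [quad, G] using h1

end Quantizers

end

/-! ### Normal equations and moments of one SGD step -/

section

theorem eq_zero_of_forall_quadratic_nonneg {b c : ℝ} (h : ∀ t : ℝ, 0 ≤ 2 * t * b + t ^ 2 * c) :
    b = 0 := by
  have hc : 0 ≤ c := by have h1 := h 1; have h2 := h (-1); linarith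
  -- The minimizing value would be `-b / c`; adding one to the denominator also covers `c = 0`.
  have h1 := h (-b / (c + 1))
  have h2 : 2 * (-b / (c + 1)) * b + (-b / (c + 1)) ^ 2 * c = -(b ^ 2 * (c + 2)) / (c + 1) ^ 2 := by
    field_simp; ring
  rw [h2, div_nonneg_iff] at h1
  have h3 : b ^ 2 * (c + 2) ≤ 0 := by
    rcases h1 with h1 | h1
    · linarith
    · have : 0 < (c + 1) ^ 2 := by positivity
      linarith
  have h4 : b ^ 2 ≤ 0 := by nlinarith [sq_nonneg b]
  exact pow_eq_zero_iff two_ne_zero |>.mp (le_antisymm h4 (sq_nonneg b))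

/-- The residual of a least squares minimizer is orthogonal to every direction. -/
theorem integral_mul_eq_zero_of_minimizer {α : Type*} [MeasurableSpace α] {ν : Measure α}
    {e g : α → ℝ} (he : MemLp e 2 ν) (hg : MemLp g 2 ν)
    (h : ∀ t : ℝ, ∫ a, e a ^ 2 ∂ν ≤ ∫ a, (e a + t * g a) ^ 2 ∂ν) : ∫ a, e a * g a ∂ν = 0 := by
  refine eq_zero_of_forall_quadratic_nonneg (c := ∫ a, g a ^ 2 ∂ν) fun t => ?_
  have h1 : ∫ a, (e a + t * g a) ^ 2 ∂ν =
      ∫ a, (e a ^ 2 + (2 * t * (e a * g a) + t ^ 2 * g a ^ 2)) ∂ν := by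
    congr 1; ext a; ring
  have h2 : Integrable (fun a => 2 * t * (e a * g a)) ν := (he.integrable_mul hg).const_mul _
  have h3 : Integrable (fun a => t ^ 2 * g a ^ 2) ν := hg.integrable_sq.const_mul _
  have h23 : Integrable (fun a => 2 * t * (e a * g a) + t ^ 2 * g a ^ 2) ν := h2.add h3
  have h4 := h t
  rw [h1, integral_add he.integrable_sq h23, integral_add h2 h3, integral_const_mul,
    integral_const_mul] at h4
  linarith

theorem _root_.QuantSGD.DataModel.lintegral_joint {p : ℕ∞} (D : DataModel p)
    {F : (DataVec p × DataVec p) × ℝ → ℝ≥0∞} (hF : Measurable F) :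
    ∫⁻ t, F t ∂D.joint = ∫⁻ w, ∫⁻ x, ∫⁻ y, F ((w, x), y) ∂(D.label (w, x)) ∂D.law ∂D.prior := by
  unfold DataModel.joint
  rw [Measure.lintegral_compProd hF, lintegral_prod _ hF.lintegral_kernel_prod_right'.aemeasurable]

namespace Quantizers

variable {M : ℕ} {p : ℕ∞} {Q : Quantizers M p} {D : DataModel p} {S : SketchMat M p}

theorem lintegral_sample_label_sq_lt_top (h : Q.LabelSquareIntegrable D) :
    ∫⁻ w, ∫⁻ t, ENNReal.ofReal (t.2 ^ 2) ∂(Q.sample D S w) ∂D.prior < ∞ := by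
  have h1 : ∫⁻ z, ENNReal.ofReal (z ^ 2) ∂(Q.label ∘ₘ (D.joint.map Prod.snd)) < ∞ := by
    rw [lintegral_sq_eq_ofReal h]
    exact ENNReal.ofReal_lt_top
  rw [Measure.lintegral_bind (Kernel.aemeasurable _) (by fun_prop),
    lintegral_map (Measurable.lintegral_kernel (by fun_prop)) measurable_snd,
    D.lintegral_joint (F := fun t => ∫⁻ z, ENNReal.ofReal (z ^ 2) ∂(Q.label t.2))
      ((Measurable.lintegral_kernel (κ := Q.label) (f := fun z => ENNReal.ofReal (z ^ 2))
        (by fun_prop)).comp measurable_snd)] at h1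
  refine lt_of_eq_of_lt (lintegral_congr fun w => ?_) h1
  rw [lintegral_sample (F := fun t => ENNReal.ofReal (t.2 ^ 2)) w (by fun_prop)]
  simp

/-- The second moment of the label is finite on average over the target, hence finite for almost
every target. -/
theorem ae_memLp_label (h : Q.LabelSquareIntegrable D) :
    ∀ᵐ w ∂D.prior, MemLp (fun t : FeatVec M × ℝ => t.2) 2 (Q.sample D S w) := by
  have h1 := ae_lt_top (Measurable.lintegral_kernel (κ := Q.sample D S)
    (f := fun t => ENNReal.ofReal (t.2 ^ 2)) (by fun_prop))
    (lintegral_sample_label_sq_lt_top (S := S) h).ne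
  filter_upwards [h1] with w hw
  exact memLp_two_of_lintegral_sq_lt_top (by fun_prop) hw

theorem memLp_dotProduct_sample
    (h2 : ∀ i, MemLp (fun f : FeatVec M => f i) 2 (Q.featureLaw D S)) (w : DataVec p)
    (u : FeatVec M) : MemLp (fun t : FeatVec M × ℝ => t.1 ⬝ᵥ u) 2 (Q.sample D S w) :=
  (memLp_dotProduct h2 u).comp_measurePreserving (measurePreserving_fst_sample w)

theorem integral_sample_fst (w : DataVec p) {F : FeatVec M → ℝ} (hF : Measurable F) :
    ∫ t, F t.1 ∂(Q.sample D S w) = ∫ f, F f ∂(Q.featureLaw D S) := by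
  rw [← map_fst_sample (Q := Q) (D := D) (S := S) w,
    integral_map measurable_fst.aemeasurable hF.aestronglyMeasurable]

theorem lintegral_sample_fst (w : DataVec p) {F : FeatVec M → ℝ≥0∞} (hF : Measurable F) :
    ∫⁻ t, F t.1 ∂(Q.sample D S w) = ∫⁻ f, F f ∂(Q.featureLaw D S) := by
  rw [← map_fst_sample (Q := Q) (D := D) (S := S) w, lintegral_map hF measurable_fst]

/-- The normal equations of the quantized least squares problem. -/
theorem integral_label_mul_dotProduct
    (h2 : ∀ i, MemLp (fun f : FeatVec M => f i) 2 (Q.featureLaw D S)) {w : DataVec p}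
    {vq : FeatVec M} (hz : MemLp (fun t : FeatVec M × ℝ => t.2) 2 (Q.sample D S w))
    (hmin : ∀ v, Q.quantRisk D S w vq ≤ Q.quantRisk D S w v) (u : FeatVec M) :
    ∫ t, t.2 * (t.1 ⬝ᵥ u) ∂(Q.sample D S w) = u ⬝ᵥ Q.featureCov D S *ᵥ vq := by
  have hf := memLp_dotProduct_sample h2 w
  have he : ∀ v, MemLp (fun t : FeatVec M × ℝ => t.1 ⬝ᵥ v - t.2) 2 (Q.sample D S w) :=
    fun v => (hf v).sub hz
  have hr : ∀ v, Q.quantRisk D S w v =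
      ENNReal.ofReal ((1 / 2) * ∫ t, (t.1 ⬝ᵥ v - t.2) ^ 2 ∂(Q.sample D S w)) := fun v => by
    unfold quantRisk
    simp_rw [ENNReal.ofReal_mul (show (0 : ℝ) ≤ 1 / 2 by norm_num)]
    rw [lintegral_const_mul' _ _ ENNReal.ofReal_ne_top, lintegral_sq_eq_ofReal (he v)]
  have h0 := integral_mul_eq_zero_of_minimizer (he vq) (hf u) fun t => by
    have h1 := hmin (vq + t • u)
    rw [hr, hr, ENNReal.ofReal_le_ofReal_iff (by positivity)] at h1
    have h3 : ∀ s : FeatVec M × ℝ, s.1 ⬝ᵥ (vq + t • u) - s.2 =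
        s.1 ⬝ᵥ vq - s.2 + t * (s.1 ⬝ᵥ u) := fun s => by
      rw [dotProduct_add, dotProduct_smul, smul_eq_mul]; ring
    simp_rw [h3] at h1
    linarith
  have h4 : ∫ t, (t.1 ⬝ᵥ u) * (t.1 ⬝ᵥ vq) ∂(Q.sample D S w) = u ⬝ᵥ Q.featureCov D S *ᵥ vq := by
    rw [← integral_dotProduct_mul_dotProduct h2]
    exact integral_sample_fst w
      ((measurable_dotProduct_left u).mul (measurable_dotProduct_left vq))
  have hA : Integrable (fun t : FeatVec M × ℝ => t.2 * (t.1 ⬝ᵥ u)) (Q.sample D S w) :=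
    hz.integrable_mul (hf u)
  have hB : Integrable (fun t : FeatVec M × ℝ => (t.1 ⬝ᵥ u) * (t.1 ⬝ᵥ vq)) (Q.sample D S w) :=
    (hf u).integrable_mul (hf vq)
  rw [← h4, ← sub_eq_zero, ← integral_sub hA hB, ← neg_eq_zero, ← integral_neg, ← h0]
  congr 1; ext t; ring

/-- The noise term of the direction `u`, given the target. -/
def directionNoise (Q : Quantizers M p) (D : DataModel p) (S : SketchMat M p)
    (vq : DataVec p → FeatVec M) (u : FeatVec M) (w : DataVec p) : ℝ≥0∞ :=
  ∫⁻ t, ENNReal.ofReal ((t.2 - vq w ⬝ᵥ t.1) ^ 2 * (t.1 ⬝ᵥ u) ^ 2) ∂(Q.sample D S w)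

theorem measurable_directionNoise_integrand {vq : DataVec p → FeatVec M} (hvq : Measurable vq)
    (u : FeatVec M) : Measurable fun r : DataVec p × (FeatVec M × ℝ) =>
      ENNReal.ofReal ((r.2.2 - vq r.1 ⬝ᵥ r.2.1) ^ 2 * (r.2.1 ⬝ᵥ u) ^ 2) := by
  unfold dotProduct; fun_prop

theorem measurable_directionNoise {vq : DataVec p → FeatVec M} (hvq : Measurable vq)
    (u : FeatVec M) : Measurable (Q.directionNoise D S vq u) :=
  (measurable_directionNoise_integrand hvq u).lintegral_kernel_prod_right'

/-- The noise condition concerns an expectation that includes the target, so the bound holds only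
after integrating over the prior. The recursion for SGD is accordingly run jointly with the target.
-/
theorem lintegral_directionNoise_le {vq : DataVec p → FeatVec M} (hvq : Measurable vq) {σHi : ℝ}
    (hint : ∀ i j, Integrable (fun r : DataVec p × (FeatVec M × ℝ) =>
      (r.2.2 - vq r.1 ⬝ᵥ r.2.1) ^ 2 * (r.2.1 i * r.2.1 j)) (D.prior ⊗ₘ Q.sample D S))
    (hle : (σHi ^ 2 • Q.featureCov D S - Q.noiseCov D S vq).PosSemidef) (u : FeatVec M) :
    ∫⁻ w, Q.directionNoise D S vq u w ∂D.prior ≤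
      ENNReal.ofReal (σHi ^ 2 * quad (Q.featureCov D S) u) := by
  unfold directionNoise
  rw [← Measure.lintegral_compProd (measurable_directionNoise_integrand hvq u)]
  have hi : ∀ i j, Integrable (fun r : DataVec p × (FeatVec M × ℝ) => u i * u j *
      ((r.2.2 - vq r.1 ⬝ᵥ r.2.1) ^ 2 * (r.2.1 i * r.2.1 j))) (D.prior ⊗ₘ Q.sample D S) :=
    fun i j => (hint i j).const_mul _
  have heq : ∀ r : DataVec p × (FeatVec M × ℝ), (r.2.2 - vq r.1 ⬝ᵥ r.2.1) ^ 2 *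
      (r.2.1 ⬝ᵥ u) ^ 2 = ∑ i, ∑ j, u i * u j *
        ((r.2.2 - vq r.1 ⬝ᵥ r.2.1) ^ 2 * (r.2.1 i * r.2.1 j)) := fun r => by
    rw [sq (r.2.1 ⬝ᵥ u), show r.2.1 ⬝ᵥ u = ∑ i, r.2.1 i * u i from rfl, Finset.sum_mul_sum,
      Finset.mul_sum]
    refine Finset.sum_congr rfl fun i _ => ?_
    rw [Finset.mul_sum]
    exact Finset.sum_congr rfl fun j _ => by ring
  have hI : Integrable (fun r : DataVec p × (FeatVec M × ℝ) => (r.2.2 - vq r.1 ⬝ᵥ r.2.1) ^ 2 *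
      (r.2.1 ⬝ᵥ u) ^ 2) (D.prior ⊗ₘ Q.sample D S) := by
    simp_rw [heq]
    exact integrable_finsetSum _ fun i _ => integrable_finsetSum _ fun j _ => hi i j
  rw [← ofReal_integral_eq_lintegral_ofReal hI (Eventually.of_forall fun r => by positivity)]
  refine ENNReal.ofReal_le_ofReal ?_
  have h1 : ∫ r, (r.2.2 - vq r.1 ⬝ᵥ r.2.1) ^ 2 * (r.2.1 ⬝ᵥ u) ^ 2 ∂(D.prior ⊗ₘ Q.sample D S) =
      u ⬝ᵥ Q.noiseCov D S vq *ᵥ u := by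
    have hR : u ⬝ᵥ Q.noiseCov D S vq *ᵥ u = ∑ i, ∑ j, u i * (Q.noiseCov D S vq i j * u j) := by
      simp only [dotProduct, Matrix.mulVec, Finset.mul_sum]
    rw [hR]
    simp_rw [heq]
    rw [integral_finsetSum _ fun i _ => integrable_finsetSum _ fun j _ => hi i j]
    refine Finset.sum_congr rfl fun i _ => ?_
    rw [integral_finsetSum _ fun j _ => hi i j]
    refine Finset.sum_congr rfl fun j _ => ?_
    rw [integral_const_mul]
    simp only [noiseCov, Matrix.of_apply]
    ring
  have h2 := hle.dotProduct_mulVec_nonneg u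
  rw [star_trivial, Matrix.sub_mulVec, dotProduct_sub, Matrix.smul_mulVec, dotProduct_smul,
    smul_eq_mul] at h2
  rw [h1]
  unfold quad
  linarith

/-- With the current parameter frozen, the step is a function of one fresh sample and one output
gradient. -/
theorem sgdStep_apply (γ : ℝ) (w : DataVec p) (v : FeatVec M) :
    Q.sgdStep D S γ (w, v) = ((Q.sample D S w) ⊗ₘ
      (Q.outGradKernel.comap (Prod.mk v) measurable_prodMk_left)).map
        fun t => v + (γ * t.2) • t.1.1 := by
  refine Measure.ext_of_lintegral _ fun F hF => ?_
  have hm : Measurable fun t : (FeatVec M × ℝ) × ℝ => v + (γ * t.2) • t.1.1 := by fun_prop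
  have hm' : Measurable fun t : (FeatVec M × (FeatVec M × ℝ)) × ℝ =>
      t.1.1 + (γ * t.2) • t.1.2.1 := by fun_prop
  have hFm : Measurable fun t : (FeatVec M × ℝ) × ℝ => F (v + (γ * t.2) • t.1.1) := hF.comp hm
  have hFm' : Measurable fun t : (FeatVec M × (FeatVec M × ℝ)) × ℝ =>
      F (t.1.1 + (γ * t.2) • t.1.2.1) := hF.comp hm'
  rw [lintegral_map hF hm, Measure.lintegral_compProd hFm]
  unfold sgdStep
  rw [Kernel.map_apply _ hm', lintegral_map hF hm']
  unfold gradStep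
  rw [Kernel.lintegral_compProd _ _ _ hFm', Kernel.prod_apply,
    Kernel.deterministic_apply, Kernel.comap_apply]
  have h3 : Measurable fun b : FeatVec M × (FeatVec M × ℝ) =>
      ∫⁻ g, F (b.1 + (γ * g) • b.2.1) ∂(Q.outGradKernel b) :=
    Measurable.lintegral_kernel_prod_right' (κ := Q.outGradKernel)
      (f := fun t : (FeatVec M × (FeatVec M × ℝ)) × ℝ => F (t.1.1 + (γ * t.2) • t.1.2.1))
      hFm'
  simp only [Kernel.comap_apply]
  rw [lintegral_prod _ h3.aemeasurable, lintegral_dirac' _ h3.lintegral_prod_right']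

/-- Second moment of one step in the direction `u`. -/
theorem lintegral_sgdStep_sq_le {e : ErrorLevels} {α β γ : ℝ} (hQ : Q.Unbiased) (he : e.Nonneg)
    (hm : Q.Multiplicative e) (h4 : Q.FourthMoment D S α β) (vq : DataVec p → FeatVec M)
    (w : DataVec p) (u v : FeatVec M) :
    ∫⁻ v', ENNReal.ofReal ((u ⬝ᵥ (v' - v)) ^ 2) ∂(Q.sgdStep D S γ (w, v)) ≤
      ENNReal.ofReal (γ ^ 2) *
        (ENNReal.ofReal (3 / 2 * (1 + e.amplification) * α * quad (Q.featureCov D S) (v - vq w) *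
            quad (Q.featureCov D S) u) +
          (ENNReal.ofReal (3 * (1 + e.amplification)) * Q.directionNoise D S vq u w +
            ENNReal.ofReal (3 * (1 + e.amplification) * α * quad (Q.featureCov D S) (vq w) *
              quad (Q.featureCov D S) u))) := by
  have hκ := he.activationNoise_nonneg
  have heo : 0 ≤ e.outGrad := he.2.2.2.2.2
  have hamp := e.one_add_amplification
  set κ := e.activationNoise
  set G := Q.featureCov D S
  have hqn : ∀ d, 0 ≤ quad G d := fun d => by
    have := (posSemidef_featureCov h4.memLp_two).dotProduct_mulVec_nonneg d
    rwa [star_trivial] at this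
  have hamp0 : 0 ≤ 1 + e.amplification := by rw [hamp]; positivity
  have hmf : Measurable fun t : (FeatVec M × ℝ) × ℝ => v + (γ * t.2) • t.1.1 := by fun_prop
  have hdot : ∀ t : FeatVec M × ℝ, ∀ g : ℝ, u ⬝ᵥ (v + (γ * g) • t.1 - v) = γ * g * (t.1 ⬝ᵥ u) :=
    fun t g => by
      rw [add_sub_cancel_left, dotProduct_smul, smul_eq_mul, dotProduct_comm]
  have hdm : Measurable fun v' : FeatVec M => ENNReal.ofReal ((u ⬝ᵥ (v' - v)) ^ 2) := by
    unfold dotProduct; fun_prop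
  have hdmf : Measurable fun t : (FeatVec M × ℝ) × ℝ =>
      ENNReal.ofReal ((u ⬝ᵥ (v + (γ * t.2) • t.1.1 - v)) ^ 2) := hdm.comp hmf
  rw [sgdStep_apply, lintegral_map hdm hmf, Measure.lintegral_compProd hdmf]
  simp only [hdot, Kernel.comap_apply]
  have hD : ∀ d : FeatVec M, Measurable fun t : FeatVec M × ℝ =>
      ENNReal.ofReal ((t.1 ⬝ᵥ d) ^ 2 * (t.1 ⬝ᵥ u) ^ 2) := fun d => by
    unfold dotProduct; fun_prop
  have hN : Measurable fun t : FeatVec M × ℝ =>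
      ENNReal.ofReal ((t.2 - vq w ⬝ᵥ t.1) ^ 2 * (t.1 ⬝ᵥ u) ^ 2) := by
    unfold dotProduct; fun_prop
  calc _ ≤ ∫⁻ t, ENNReal.ofReal (γ ^ 2) * (ENNReal.ofReal (3 / 2 * (1 + e.amplification)) *
          ENNReal.ofReal ((t.1 ⬝ᵥ (v - vq w)) ^ 2 * (t.1 ⬝ᵥ u) ^ 2) +
        (ENNReal.ofReal (3 * (1 + e.amplification)) *
          ENNReal.ofReal ((t.2 - vq w ⬝ᵥ t.1) ^ 2 * (t.1 ⬝ᵥ u) ^ 2) +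
        ENNReal.ofReal (3 * (1 + e.amplification)) *
          ENNReal.ofReal ((t.1 ⬝ᵥ vq w) ^ 2 * (t.1 ⬝ᵥ u) ^ 2))) ∂(Q.sample D S w) := by
        refine lintegral_mono fun t => ?_
        have h1 : ∀ g : ℝ, ENNReal.ofReal ((γ * g * (t.1 ⬝ᵥ u)) ^ 2) =
            ENNReal.ofReal (γ ^ 2 * (t.1 ⬝ᵥ u) ^ 2) * ENNReal.ofReal (g ^ 2) := fun g => by
          rw [← ENNReal.ofReal_mul (by positivity)]; congr 1; ring
        simp_rw [h1]
        rw [lintegral_const_mul' _ _ ENNReal.ofReal_ne_top]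
        refine (mul_le_mul_right (lintegral_sq_outGradKernel_le hQ he hm v t.1 t.2) _).trans ?_
        rw [← ENNReal.ofReal_mul (by positivity), ← ENNReal.ofReal_mul (by positivity),
          ← ENNReal.ofReal_mul (by positivity), ← ENNReal.ofReal_mul (by positivity),
          ← ENNReal.ofReal_add (by positivity) (by positivity),
          ← ENNReal.ofReal_add (by positivity) (by positivity), ← ENNReal.ofReal_mul (by positivity)]
        refine ENNReal.ofReal_le_ofReal ?_
        have hd : t.1 ⬝ᵥ v = t.1 ⬝ᵥ (v - vq w) + t.1 ⬝ᵥ vq w := by rw [dotProduct_sub]; ring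
        rw [mul_assoc (γ ^ 2), hd, dotProduct_comm (vq w) t.1, hamp]
        set δ := t.1 ⬝ᵥ (v - vq w)
        set q := t.1 ⬝ᵥ vq w
        set U := t.1 ⬝ᵥ u
        set ξ := t.2 - q with hξ
        have h2 : t.2 - (δ + q) = ξ - δ := by rw [hξ]; ring
        rw [h2]
        -- Here `δ` is the predicted deviation from the minimizer, `q` the prediction of the
        -- minimizer and `ξ` its residual. The unequal weights 3/2 and 3 in Young's inequality keep
        -- the coefficient of `δ²` below 2, the contraction that the drift can pay for.
        have h3 : (ξ - δ) ^ 2 + κ * (δ + q) ^ 2 ≤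
            3 / 2 * (1 + κ) * δ ^ 2 + (3 * (1 + κ) * ξ ^ 2 + 3 * (1 + κ) * q ^ 2) := by
          have e1 : (ξ - δ) ^ 2 ≤ 3 / 2 * δ ^ 2 + 3 * ξ ^ 2 := by
            nlinarith [sq_nonneg (δ + 2 * ξ)]
          have e2 : (δ + q) ^ 2 ≤ 3 / 2 * δ ^ 2 + 3 * q ^ 2 := by
            nlinarith [sq_nonneg (δ - 2 * q)]
          have e3 := mul_le_mul_of_nonneg_left e2 hκ
          have e4 : 0 ≤ κ * ξ ^ 2 := by positivity
          have e5 : 0 ≤ q ^ 2 := sq_nonneg q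
          nlinarith
        have h5 : 0 ≤ γ ^ 2 * (U ^ 2 * (1 + e.outGrad)) := by positivity
        have h6 := mul_le_mul_of_nonneg_left h3 h5
        calc _ = γ ^ 2 * (U ^ 2 * (1 + e.outGrad)) * ((ξ - δ) ^ 2 + κ * (δ + q) ^ 2) := by ring
          _ ≤ _ := h6
          _ = _ := by ring
    _ = ENNReal.ofReal (γ ^ 2) * (ENNReal.ofReal (3 / 2 * (1 + e.amplification)) *
          ∫⁻ f, ENNReal.ofReal ((f ⬝ᵥ (v - vq w)) ^ 2 * (f ⬝ᵥ u) ^ 2) ∂(Q.featureLaw D S) +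
        (ENNReal.ofReal (3 * (1 + e.amplification)) * Q.directionNoise D S vq u w +
        ENNReal.ofReal (3 * (1 + e.amplification)) *
          ∫⁻ f, ENNReal.ofReal ((f ⬝ᵥ vq w) ^ 2 * (f ⬝ᵥ u) ^ 2) ∂(Q.featureLaw D S))) := by
        have hF : ∀ d : FeatVec M, ∫⁻ t, ENNReal.ofReal ((t.1 ⬝ᵥ d) ^ 2 * (t.1 ⬝ᵥ u) ^ 2)
            ∂(Q.sample D S w) =
            ∫⁻ f, ENNReal.ofReal ((f ⬝ᵥ d) ^ 2 * (f ⬝ᵥ u) ^ 2) ∂(Q.featureLaw D S) := fun d =>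
          lintegral_sample_fst w
            (F := fun f => ENNReal.ofReal ((f ⬝ᵥ d) ^ 2 * (f ⬝ᵥ u) ^ 2))
            (by unfold dotProduct; fun_prop)
        rw [lintegral_const_mul' _ _ ENNReal.ofReal_ne_top,
          lintegral_add_left ((hD _).const_mul _), lintegral_add_left (hN.const_mul _),
          lintegral_const_mul' _ _ ENNReal.ofReal_ne_top,
          lintegral_const_mul' _ _ ENNReal.ofReal_ne_top,
          lintegral_const_mul' _ _ ENNReal.ofReal_ne_top, hF, hF]
        rfl
    _ ≤ ENNReal.ofReal (γ ^ 2) * (ENNReal.ofReal (3 / 2 * (1 + e.amplification)) *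
          ENNReal.ofReal (α * quad G (v - vq w) * quad G u) +
        (ENNReal.ofReal (3 * (1 + e.amplification)) * Q.directionNoise D S vq u w +
        ENNReal.ofReal (3 * (1 + e.amplification)) *
          ENNReal.ofReal (α * quad G (vq w) * quad G u))) := by
        gcongr
        · exact h4.lintegral_le _ _
        · exact h4.lintegral_le _ _
    _ = _ := by
        rw [← ENNReal.ofReal_mul (by positivity), ← ENNReal.ofReal_mul (by positivity)]
        congr 2
        · congr 1; ring
        · congr 2; ring

/-- Mean of one step in the direction `u`. -/
theorem integral_sgdStep {e : ErrorLevels} {γ : ℝ} (hQ : Q.Unbiased)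
    (he : e.Nonneg) (hm : Q.Multiplicative e)
    (h2 : ∀ i, MemLp (fun f : FeatVec M => f i) 2 (Q.featureLaw D S)) {w : DataVec p}
    {vq : FeatVec M} (hz : MemLp (fun t : FeatVec M × ℝ => t.2) 2 (Q.sample D S w))
    (hmin : ∀ v, Q.quantRisk D S w vq ≤ Q.quantRisk D S w v) {u v : FeatVec M}
    (hfin : ∫⁻ v', ENNReal.ofReal ((u ⬝ᵥ (v' - v)) ^ 2) ∂(Q.sgdStep D S γ (w, v)) < ∞) :
    MemLp (fun v' => u ⬝ᵥ (v' - v)) 2 (Q.sgdStep D S γ (w, v)) ∧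
      ∫ v', u ⬝ᵥ (v' - v) ∂(Q.sgdStep D S γ (w, v)) =
        -(γ * (u ⬝ᵥ Q.featureCov D S *ᵥ (v - vq))) := by
  have hdm : Measurable fun v' : FeatVec M => u ⬝ᵥ (v' - v) := by
    unfold dotProduct; fun_prop
  have hL := memLp_two_of_lintegral_sq_lt_top hdm.aestronglyMeasurable hfin
  refine ⟨hL, ?_⟩
  have hmf : Measurable fun t : (FeatVec M × ℝ) × ℝ => v + (γ * t.2) • t.1.1 := by fun_prop
  have hi := hL.integrable (by norm_num)
  have hdot : ∀ t : (FeatVec M × ℝ) × ℝ,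
      u ⬝ᵥ (v + (γ * t.2) • t.1.1 - v) = γ * (t.1.1 ⬝ᵥ u) * t.2 :=
    fun t => by
      rw [add_sub_cancel_left, dotProduct_smul, smul_eq_mul, dotProduct_comm]; ring
  rw [sgdStep_apply] at hi ⊢
  rw [integrable_map_measure hdm.aestronglyMeasurable hmf.aemeasurable] at hi
  rw [integral_map hmf.aemeasurable hdm.aestronglyMeasurable]
  simp only [Function.comp_def, hdot] at hi ⊢
  rw [Measure.integral_compProd hi]
  have hg : ∀ t : FeatVec M × ℝ, ∫ g, g ∂(Q.outGradKernel.comap (Prod.mk v)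
      measurable_prodMk_left t) = t.2 - t.1 ⬝ᵥ v := fun t =>
    (meanVar_outGradKernel hQ he hm v t.1 t.2).mean
  have hin : ∀ t : FeatVec M × ℝ, ∫ g, γ * (t.1 ⬝ᵥ u) * g ∂(Q.outGradKernel.comap (Prod.mk v)
      measurable_prodMk_left t) = γ * (t.1 ⬝ᵥ u) * (t.2 - t.1 ⬝ᵥ v) := fun t => by
    rw [integral_const_mul, hg]
  simp only [hin]
  have hf := memLp_dotProduct_sample h2 w
  have hA : Integrable (fun t : FeatVec M × ℝ => t.2 * (t.1 ⬝ᵥ u)) (Q.sample D S w) :=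
    hz.integrable_mul (hf u)
  have hB : Integrable (fun t : FeatVec M × ℝ => (t.1 ⬝ᵥ u) * (t.1 ⬝ᵥ v)) (Q.sample D S w) :=
    (hf u).integrable_mul (hf v)
  have h5 : ∀ t : FeatVec M × ℝ, γ * (t.1 ⬝ᵥ u) * (t.2 - t.1 ⬝ᵥ v) =
      γ * (t.2 * (t.1 ⬝ᵥ u) - (t.1 ⬝ᵥ u) * (t.1 ⬝ᵥ v)) := fun t => by ring
  simp_rw [h5]
  have h6 : ∫ t, (t.1 ⬝ᵥ u) * (t.1 ⬝ᵥ v) ∂(Q.sample D S w) = u ⬝ᵥ Q.featureCov D S *ᵥ v := by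
    rw [← integral_dotProduct_mul_dotProduct h2]
    exact integral_sample_fst w
      ((measurable_dotProduct_left u).mul (measurable_dotProduct_left v))
  rw [integral_const_mul, integral_sub hA hB,
    integral_label_mul_dotProduct h2 hz hmin, h6, Matrix.mulVec_sub, dotProduct_sub]
  ring

end Quantizers

end

/-! ### Capped spectra and eigenbases in finite dimension -/

section

/-- An orthonormal basis of eigenvectors of a positive semidefinite matrix. -/
structure EigenSystem {n : Type*} [Fintype n] [DecidableEq n] (G : Matrix n n ℝ)
    (u : n → n → ℝ) (g : n → ℝ) : Prop where
  nonneg : ∀ i, 0 ≤ g i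
  dotProduct_mulVec : ∀ i d, u i ⬝ᵥ G *ᵥ d = g i * (u i ⬝ᵥ d)
  parseval : ∀ d e : n → ℝ, d ⬝ᵥ e = ∑ i, (u i ⬝ᵥ d) * (u i ⬝ᵥ e)
  norm_eq_one : ∀ i, u i ⬝ᵥ u i = 1
  trace_eq : G.trace = ∑ i, g i

theorem sum_dotProduct_mul_dotProduct {n : Type*} [Fintype n] {ι : Type*} [Fintype ι]
    (b : OrthonormalBasis ι ℝ (EuclideanSpace ℝ n)) (d e : n → ℝ) :
    d ⬝ᵥ e = ∑ i, ((b i).ofLp ⬝ᵥ d) * ((b i).ofLp ⬝ᵥ e) := by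
  have h := b.sum_inner_mul_inner (WithLp.toLp 2 d) (WithLp.toLp 2 e)
  simp only [EuclideanSpace.inner_eq_star_dotProduct, star_trivial] at h
  rw [dotProduct_comm d e, ← h]
  refine Finset.sum_congr rfl fun i _ => ?_
  rw [dotProduct_comm e]

theorem dotProduct_self_orthonormal {n : Type*} [Fintype n] {ι : Type*} [Fintype ι]
    (b : OrthonormalBasis ι ℝ (EuclideanSpace ℝ n)) (i : ι) :
    (b i).ofLp ⬝ᵥ (b i).ofLp = 1 := by
  have h : inner ℝ (b i) (b i) = (1 : ℝ) := by
    rw [real_inner_self_eq_norm_sq, b.orthonormal.1 i, one_pow]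
  rwa [EuclideanSpace.inner_eq_star_dotProduct, star_trivial] at h

theorem exists_eigenSystem {n : Type*} [Fintype n] [DecidableEq n] {G : Matrix n n ℝ}
    (hG : G.PosSemidef) : ∃ u g, EigenSystem G u g := by
  have hH := hG.isHermitian
  refine ⟨fun i => (hH.eigenvectorBasis i).ofLp, hH.eigenvalues, hG.eigenvalues_nonneg,
    fun i d => ?_, sum_dotProduct_mul_dotProduct _, dotProduct_self_orthonormal _, ?_⟩
  · rw [Matrix.dotProduct_mulVec, ← Matrix.mulVec_transpose,
      show Gᵀ = G from by rw [← Matrix.conjTranspose_eq_transpose_of_trivial]; exact hH,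
      hH.mulVec_eigenvectorBasis, smul_dotProduct, smul_eq_mul]
  · simpa using hH.trace_eq_sum_eigenvalues

namespace EigenSystem

variable {n : Type*} [Fintype n] [DecidableEq n] {G : Matrix n n ℝ} {u : n → n → ℝ} {g : n → ℝ}

theorem quad_eq (h : EigenSystem G u g) (d : n → ℝ) :
    d ⬝ᵥ G *ᵥ d = ∑ i, g i * (u i ⬝ᵥ d) ^ 2 := by
  rw [h.parseval]
  refine Finset.sum_congr rfl fun i _ => ?_
  rw [h.dotProduct_mulVec]; ring

theorem quad_self (h : EigenSystem G u g) (i : n) : u i ⬝ᵥ G *ᵥ u i = g i := by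
  rw [h.dotProduct_mulVec, h.norm_eq_one, mul_one]

/-- The quadratic form with eigenvalues capped at `h`. -/
theorem sum_min_mul_le (h : EigenSystem G u g) {η : ℝ} (hη : 0 ≤ η) (v w : n → ℝ) :
    ∑ i, min (g i) η * (u i ⬝ᵥ v) ^ 2 ≤
      2 * ((v - w) ⬝ᵥ G *ᵥ (v - w)) + 2 * η * (w ⬝ᵥ w) := by
  rw [h.quad_eq, h.parseval w w, Finset.mul_sum, Finset.mul_sum, ← Finset.sum_add_distrib]
  refine Finset.sum_le_sum fun i _ => ?_
  have h1 : u i ⬝ᵥ v = u i ⬝ᵥ (v - w) + u i ⬝ᵥ w := by rw [dotProduct_sub]; ring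
  rw [h1]
  set x := u i ⬝ᵥ (v - w)
  set y := u i ⬝ᵥ w
  have h2 : 0 ≤ min (g i) η := le_min (h.nonneg i) hη
  have h3 : (x + y) ^ 2 ≤ 2 * x ^ 2 + 2 * y ^ 2 := by nlinarith [sq_nonneg (x - y)]
  have h4 := mul_le_mul_of_nonneg_left h3 h2
  have h5 := mul_le_mul_of_nonneg_right (min_le_left (g i) η) (sq_nonneg x)
  have h6 := mul_le_mul_of_nonneg_right (min_le_right (g i) η) (sq_nonneg y)
  linarith

theorem sum_min_le_trace (h : EigenSystem G u g) (η : ℝ) : ∑ i, min (g i) η ≤ G.trace := by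
  rw [h.trace_eq]; exact Finset.sum_le_sum fun i _ => min_le_left _ _

/-- The capped trace is controlled by the trace on a subspace of small codimension. -/
theorem sum_min_le (h : EigenSystem G u g) (η : ℝ) {ι : Type*} [Fintype ι]
    [DecidableEq ι]
    (b : OrthonormalBasis ι ℝ (EuclideanSpace ℝ n)) (J : Finset ι) :
    ∑ i, min (g i) η ≤ J.card * η + ∑ j ∈ Jᶜ, (b j).ofLp ⬝ᵥ G *ᵥ (b j).ofLp := by
  have h1 : ∀ i, ∑ j, ((b j).ofLp ⬝ᵥ u i) ^ 2 = 1 := fun i => by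
    rw [← h.norm_eq_one i, sum_dotProduct_mul_dotProduct b]
    exact Finset.sum_congr rfl fun j _ => sq _
  have h2 : ∀ j, ∑ i, ((b j).ofLp ⬝ᵥ u i) ^ 2 = 1 := fun j => by
    rw [← dotProduct_self_orthonormal b j, h.parseval]
    exact Finset.sum_congr rfl fun i _ => by rw [dotProduct_comm, sq]
  -- The squared overlaps of two orthonormal bases form a doubly stochastic matrix. The cap is
  -- bounded by `η` on `J` and by the eigenvalue itself off `J`.
  calc ∑ i, min (g i) η = ∑ i, ∑ j, min (g i) η * ((b j).ofLp ⬝ᵥ u i) ^ 2 :=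
        Finset.sum_congr rfl fun i _ => by rw [← Finset.mul_sum, h1, mul_one]
    _ = ∑ j, ∑ i, min (g i) η * ((b j).ofLp ⬝ᵥ u i) ^ 2 := Finset.sum_comm
    _ = ∑ j ∈ J, ∑ i, min (g i) η * ((b j).ofLp ⬝ᵥ u i) ^ 2 +
        ∑ j ∈ Jᶜ, ∑ i, min (g i) η * ((b j).ofLp ⬝ᵥ u i) ^ 2 :=
        (Finset.sum_add_sum_compl J _).symm
    _ ≤ ∑ j ∈ J, η + ∑ j ∈ Jᶜ, (b j).ofLp ⬝ᵥ G *ᵥ (b j).ofLp := by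
        refine add_le_add (Finset.sum_le_sum fun j _ => ?_) (Finset.sum_le_sum fun j _ => ?_)
        · calc _ ≤ ∑ i, η * ((b j).ofLp ⬝ᵥ u i) ^ 2 := Finset.sum_le_sum fun i _ =>
                mul_le_mul_of_nonneg_right (min_le_right _ _) (sq_nonneg _)
            _ = η := by rw [← Finset.mul_sum, h2, mul_one]
        · rw [h.quad_eq]
          refine Finset.sum_le_sum fun i _ => ?_
          rw [dotProduct_comm]
          exact mul_le_mul_of_nonneg_right (min_le_left _ _) (sq_nonneg _)
    _ = _ := by rw [Finset.sum_const, nsmul_eq_mul]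

end EigenSystem

/-- An orthonormal basis all but at most `k` of whose members are orthogonal to `k` given vectors. -/
theorem exists_orthonormalBasis_orthogonal {M k : ℕ} (q : Fin k → Fin M → ℝ) :
    ∃ (b : OrthonormalBasis (Fin M) ℝ (EuclideanSpace ℝ (Fin M))) (J : Finset (Fin M)),
      J.card ≤ k ∧ ∀ j ∉ J, ∀ l, (b j).ofLp ⬝ᵥ q l = 0 := by
  set W : Submodule ℝ (EuclideanSpace ℝ (Fin M)) :=
    Submodule.span ℝ (Set.range fun l => WithLp.toLp 2 (q l)) with hW
  have hd : Module.finrank ℝ W ≤ k := by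
    have := finrank_range_le_card (R := ℝ) (fun l => WithLp.toLp 2 (q l))
    rwa [Fintype.card_fin] at this
  have hM : Module.finrank ℝ W ≤ M := by simpa using W.finrank_le
  set B := stdOrthonormalBasis ℝ W
  set v : Fin M → EuclideanSpace ℝ (Fin M) :=
    fun i => if h : i.1 < Module.finrank ℝ W then (B ⟨i, h⟩ : EuclideanSpace ℝ (Fin M)) else 0
  have hvi : ∀ (i : Fin M) (h : i.1 < Module.finrank ℝ W), v i = B ⟨i, h⟩ := fun i h => dif_pos h
  set s : Set (Fin M) := {i | i.1 < Module.finrank ℝ W}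
  have hv : Orthonormal ℝ (s.domRestrict v) := by
    have h1 := B.orthonormal.comp (fun i : s => (⟨i.1.1, i.2⟩ : Fin (Module.finrank ℝ W)))
      (fun i j hij => by
        ext; simpa using hij)
    have h2 := h1.comp_linearIsometry W.subtypeₗᵢ
    convert h2 using 1
    ext i : 1
    exact hvi _ i.2
  obtain ⟨b, hb⟩ := hv.exists_orthonormalBasis_extension_of_card_eq (by simp)
  refine ⟨b, Finset.univ.filter fun i : Fin M => i.1 < Module.finrank ℝ W, ?_, fun j hj l => ?_⟩
  · refine le_trans ?_ hd
    rw [Fin.card_filter_val_lt]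
    exact min_le_right _ _
  · have hj' : ¬ j.1 < Module.finrank ℝ W := by simpa using hj
    have hq : WithLp.toLp 2 (q l) ∈ W := Submodule.subset_span ⟨l, rfl⟩
    have hperp : ∀ x ∈ W, inner ℝ (b j) x = 0 := fun x hx => by
      have h3 := B.sum_repr ⟨x, hx⟩
      have h4 : x = ∑ i, B.repr ⟨x, hx⟩ i • (B i : EuclideanSpace ℝ (Fin M)) := by
        have h6 := congrArg Subtype.val h3
        rw [Submodule.coe_sum] at h6
        exact h6.symm
      rw [h4, inner_sum]
      refine Finset.sum_eq_zero fun i _ => ?_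
      have h5 : (B i : EuclideanSpace ℝ (Fin M)) = b ⟨i, i.2.trans_le hM⟩ := by
        rw [hb _ (show (⟨i, i.2.trans_le hM⟩ : Fin M) ∈ s from i.2)]
        exact (hvi ⟨i, i.2.trans_le hM⟩ i.2).symm
      rw [inner_smul_right, h5, b.orthonormal.2, mul_zero]
      rintro rfl
      exact hj' i.2
    have := hperp _ hq
    rw [EuclideanSpace.inner_eq_star_dotProduct, star_trivial] at this
    rw [dotProduct_comm]; exact this

/-! ### The scalar recursion of averaged SGD -/

section Recursion

variable {c b : ℕ → ℝ} {x : ℝ}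

theorem recursion_telescope (h : ∀ t, c (t + 1) + x * c t ≤ c t + b t) (n : ℕ) :
    x * ∑ t ∈ Finset.range n, c t + c n ≤ c 0 + ∑ t ∈ Finset.range n, b t := by
  induction n with
  | zero => simp
  | succ n ih =>
    rw [Finset.sum_range_succ, Finset.sum_range_succ]
    linarith [h n]

/-- Telescoping charges the initial error `c 0` in full; here it is charged `x * n * c 0`, which is
smaller when `x * n < 1`. For `x ≤ 1` the induction adds `1 - x` times the previous bound to `x`
times the telescoped one; for `x > 1` and `n ≥ 1` telescoping alone is enough. -/
theorem recursion_sum_le (hc : ∀ t, 0 ≤ c t) (hb : ∀ t, 0 ≤ b t) (hx : 0 ≤ x)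
    (h : ∀ t, c (t + 1) + x * c t ≤ c t + b t) (n : ℕ) :
    x * ∑ t ∈ Finset.range n, c t ≤ x * (n * c 0) + ∑ t ∈ Finset.range n, b t := by
  rcases le_or_gt x 1 with hx1 | hx1
  · induction n with
    | zero => simp
    | succ n ih =>
      have h1 := recursion_telescope h n
      rw [Finset.sum_range_succ, Finset.sum_range_succ]
      push_cast
      have h2 := mul_le_mul_of_nonneg_left ih (sub_nonneg.mpr hx1)
      have h3 := mul_le_mul_of_nonneg_left h1 hx
      have h4 : 0 ≤ x * (x * (n * c 0)) := by have := hc 0; positivity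
      linarith [hb n]
  · rcases Nat.eq_zero_or_pos n with rfl | hn
    · simp
    · have h1 := recursion_telescope h n
      have h2 : c 0 ≤ x * (n * c 0) := by
        have : (1 : ℝ) ≤ x * n := by
          have : (1 : ℝ) ≤ n := by exact_mod_cast hn
          nlinarith
        nlinarith [hc 0]
      linarith [hc n]

end Recursion

/-- The excess risk of averaged SGD, given the recursions along the eigenvectors. -/
theorem averaged_recursion_bound {ι : Type*} [Fintype ι] {g : ι → ℝ} (hg : ∀ i, 0 ≤ g i)
    {γ A₁ A₂ : ℝ} (hγ : 0 < γ) (hA₁ : 0 ≤ A₁) (hA₂ : 0 ≤ A₂) {N : ℕ} (hN : 1 ≤ N)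
    (htr : γ * A₁ * ∑ i, g i ≤ 3 / 2) {c : ι → ℕ → ℝ} {m D : ι → ℝ} {T : ℕ → ℝ}
    (hc : ∀ i t, 0 ≤ c i t) (hT : ∀ t, T t = ∑ i, g i * c i t)
    (h1 : ∀ i, 0 < g i → ∀ t,
      c i (t + 1) + 2 * γ * g i * c i t ≤ c i t + γ ^ 2 * g i * (A₁ * T t + A₂))
    (h2 : ∀ i, 0 < g i → m i ≤ γ ^ 2 * g i * ∑ t ∈ Finset.range N, (A₁ * T t + A₂))
    (h3 : ∀ i, 0 < g i → D i ≤ N * ∑ t ∈ Finset.range N, c i t)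
    (h4 : ∀ i, 0 < g i → γ ^ 2 * g i ^ 2 * D i ≤ 3 * (m i + c i N + c i 0)) :
    ∑ i, g i * D i / N ^ 2 ≤
      6 * ∑ i, min (g i) (1 / (γ * N)) * (c i 0 + γ * (4 * A₁ * T 0 + 4 * A₂)) := by
  have hN0 : (0 : ℝ) < N := by exact_mod_cast hN
  have hT0 : ∀ t, 0 ≤ T t := fun t => by
    rw [hT]; exact Finset.sum_nonneg fun i _ => mul_nonneg (hg i) (hc i t)
  set B : ℝ := ∑ t ∈ Finset.range N, (A₁ * T t + A₂) with hB
  have hb0 : ∀ t, 0 ≤ A₁ * T t + A₂ := fun t => add_nonneg (mul_nonneg hA₁ (hT0 t)) hA₂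
  have hB0 : 0 ≤ B := Finset.sum_nonneg fun t _ => hb0 t
  have hBS : B = A₁ * ∑ t ∈ Finset.range N, T t + N * A₂ := by
    rw [hB, Finset.sum_add_distrib, ← Finset.mul_sum, Finset.sum_const, Finset.card_range,
      nsmul_eq_mul]
  have hsum : ∀ i, g i * ∑ t ∈ Finset.range N, c i t ≤ g i * (N * c i 0) + γ / 2 * g i * B :=
    fun i => by
    rcases (hg i).eq_or_lt with h | h
    · simp [← h]
    · have h5 := recursion_sum_le (c := c i) (b := fun t => γ ^ 2 * g i * (A₁ * T t + A₂))
        (x := 2 * γ * g i) (hc i) (fun t => mul_nonneg (by positivity) (hb0 t)) (by positivity)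
        (h1 i h) N
      rw [← Finset.mul_sum, ← hB] at h5
      have h6 : 2 * γ * (g i * ∑ t ∈ Finset.range N, c i t) ≤
          2 * γ * (g i * (N * c i 0) + γ / 2 * g i * B) := by linarith
      exact le_of_mul_le_mul_left h6 (by positivity)
  have hTsum : ∑ t ∈ Finset.range N, T t ≤ N * T 0 + γ / 2 * (∑ i, g i) * B := by
    calc ∑ t ∈ Finset.range N, T t = ∑ i, g i * ∑ t ∈ Finset.range N, c i t := by
          simp_rw [hT, Finset.mul_sum]; exact Finset.sum_comm
      _ ≤ ∑ i, (g i * (N * c i 0) + γ / 2 * g i * B) := Finset.sum_le_sum fun i _ => hsum i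
      _ = _ := by
          rw [Finset.sum_add_distrib, hT, Finset.mul_sum, ← Finset.sum_mul, ← Finset.mul_sum]
          congr 1
          exact Finset.sum_congr rfl fun i _ => by ring
  -- The total noise `B` bounds the summed excess risk, which in turn feeds `B`. The trace condition
  -- makes the feedback coefficient at most 3/4, and absorbing it leaves the factor 4.
  have hBle : B ≤ N * (4 * A₁ * T 0 + 4 * A₂) := by
    have h5 := mul_le_mul_of_nonneg_left hTsum hA₁
    have h6 := mul_le_mul_of_nonneg_right htr hB0
    have h7 : A₁ * (N * T 0 + γ / 2 * (∑ i, g i) * B) =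
        N * (A₁ * T 0) + (γ * A₁ * ∑ i, g i) * B / 2 := by ring
    rw [h7] at h5
    linarith
  set E := 4 * A₁ * T 0 + 4 * A₂ with hE
  have hE0 : 0 ≤ E := by have := hT0 0; positivity
  rw [Finset.mul_sum]
  refine Finset.sum_le_sum fun i _ => ?_
  rcases (hg i).eq_or_lt with h | h
  · rw [← h, zero_mul, zero_div, min_eq_left (by positivity)]; simp
  · have hN2 : (0 : ℝ) < N ^ 2 := by positivity
    rw [div_le_iff₀ hN2]
    -- Directions with `γ N g i ≤ 1` are barely contracted, and Cauchy–Schwarz on the average (`h3`)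
    -- is used. In the others the martingale decomposition (`h4`) gains a factor `(γ N g i)⁻²` in
    -- the average.
    rcases le_total (g i) (1 / (γ * N)) with hle | hle
    · rw [min_eq_left hle]
      have h5 := mul_le_mul_of_nonneg_left (h3 i h) h.le
      have h6 := mul_le_mul_of_nonneg_left (hsum i) hN0.le
      have h7 := mul_le_mul_of_nonneg_left hBle (show 0 ≤ N * (γ / 2 * g i) by positivity)
      have h8 : 0 ≤ g i * N ^ 2 * c i 0 := mul_nonneg (by positivity) (hc i 0)
      have h9 : 0 ≤ g i * N ^ 2 * (γ * E) := by positivity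
      nlinarith
    · rw [min_eq_right hle]
      have h5 := recursion_telescope (c := c i) (b := fun t => γ ^ 2 * g i * (A₁ * T t + A₂))
        (x := 2 * γ * g i) (h1 i h) N
      rw [← Finset.mul_sum, ← hB] at h5
      have h6 : 0 ≤ 2 * γ * g i * ∑ t ∈ Finset.range N, c i t :=
        mul_nonneg (by positivity) (Finset.sum_nonneg fun t _ => hc i t)
      have h7 : γ ^ 2 * g i ^ 2 * D i ≤ 6 * (c i 0 + γ ^ 2 * g i * B) := by
        linarith [h4 i h, h2 i h]
      have h8 : 1 ≤ g i * (γ * N) := by rwa [div_le_iff₀ (by positivity)] at hle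
      have h9 : c i 0 + γ ^ 2 * g i * B ≤ g i * (γ * N) * (c i 0 + γ * E) := by
        have e1 : c i 0 ≤ g i * (γ * N) * c i 0 := le_mul_of_one_le_left (hc i 0) h8
        have e2 := mul_le_mul_of_nonneg_left hBle (show 0 ≤ γ ^ 2 * g i by positivity)
        nlinarith
      have h10 : γ ^ 2 * g i * (g i * D i) ≤
          γ ^ 2 * g i * (6 * (1 / (γ * N) * (c i 0 + γ * E)) * N ^ 2) := by
        calc γ ^ 2 * g i * (g i * D i) = γ ^ 2 * g i ^ 2 * D i := by ring
          _ ≤ 6 * (g i * (γ * N) * (c i 0 + γ * E)) := by linarith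
          _ = _ := by field_simp
      exact le_of_mul_le_mul_left h10 (by positivity)

end

/-! ### Second-moment recursions for averaged SGD -/

section

/-- This is the expansion of `E[(y + ζ)²]` with the cross term evaluated by the mean. The
contraction `R` stays on the left to avoid subtraction in `ℝ≥0∞`; if `ζ` has infinite second moment
there is nothing to prove, so the mean is required only otherwise. -/
theorem lintegral_sq_add_le {Ω : Type*} [MeasurableSpace Ω] {ν : Measure Ω}
    [IsProbabilityMeasure ν] {ζ : Ω → ℝ} {s : ℝ}
    (h : ∫⁻ ω, ENNReal.ofReal (ζ ω ^ 2) ∂ν < ∞ → MemLp ζ 2 ν ∧ ∫ ω, ζ ω ∂ν = -s)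
    {y R A : ℝ} (hR : 0 ≤ R) (hA : 0 ≤ A) (hy : y ^ 2 - 2 * y * s + R ≤ A) :
    ∫⁻ ω, ENNReal.ofReal ((y + ζ ω) ^ 2) ∂ν + ENNReal.ofReal R ≤
      ENNReal.ofReal A + ∫⁻ ω, ENNReal.ofReal (ζ ω ^ 2) ∂ν := by
  rcases eq_or_ne (∫⁻ ω, ENNReal.ofReal (ζ ω ^ 2) ∂ν) ∞ with htop | htop
  · rw [htop, add_top]; exact le_top
  obtain ⟨hL, hmean⟩ := h htop.lt_top
  have h1 : MemLp (fun ω => y + ζ ω) 2 ν := (memLp_const y).add hL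
  rw [lintegral_sq_eq_ofReal h1, lintegral_sq_eq_ofReal hL,
    ← ENNReal.ofReal_add (by positivity) hR, ← ENNReal.ofReal_add hA (by positivity)]
  refine ENNReal.ofReal_le_ofReal ?_
  have hi : Integrable ζ ν := hL.integrable (by norm_num)
  have h2 : ∀ ω, (y + ζ ω) ^ 2 = (y ^ 2 + 2 * y * ζ ω) + ζ ω ^ 2 := fun ω => by ring
  have h3 : Integrable (fun ω => 2 * y * ζ ω) ν := hi.const_mul _
  have h4 : Integrable (fun ω => y ^ 2 + 2 * y * ζ ω) ν := (integrable_const _).add h3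
  simp_rw [h2]
  rw [integral_add h4 hL.integrable_sq, integral_add (integrable_const _) h3, integral_const_mul,
    hmean]
  simp only [integral_const, probReal_univ, smul_eq_mul, one_mul]
  linarith

namespace Quantizers

variable {M : ℕ} {p : ℕ∞} {Q : Quantizers M p} {D : DataModel p} {S : SketchMat M p} {γ : ℝ}

/-- Joint law of the target and of `(v_t, ∑_{s<t} v_s)`. -/
def chain (Q : Quantizers M p) (D : DataModel p) (S : SketchMat M p) (γ : ℝ) (t : ℕ) :
    Measure (DataVec p × (FeatVec M × FeatVec M)) :=
  D.prior ⊗ₘ Q.trajectory D S γ t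

theorem lintegral_chain_zero {F : DataVec p × (FeatVec M × FeatVec M) → ℝ≥0∞}
    (hF : Measurable F) : ∫⁻ z, F z ∂(Q.chain D S γ 0) = ∫⁻ w, F (w, (0, 0)) ∂D.prior := by
  unfold chain
  rw [Measure.lintegral_compProd hF]
  refine lintegral_congr fun w => ?_
  have hFw : Measurable fun r : FeatVec M × FeatVec M => F (w, r) := hF.comp measurable_prodMk_left
  rw [trajectory, Kernel.const_apply, lintegral_dirac' _ hFw]

theorem lintegral_chain_fst (t : ℕ) {F : DataVec p → ℝ≥0∞} (hF : Measurable F) :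
    ∫⁻ z, F z.1 ∂(Q.chain D S γ t) = ∫⁻ w, F w ∂D.prior := by
  unfold chain
  rw [Measure.lintegral_compProd (f := fun z => F z.1) (hF.comp measurable_fst)]
  simp

theorem ae_chain_fst (t : ℕ) {P : DataVec p → Prop} (h : ∀ᵐ w ∂D.prior, P w) :
    ∀ᵐ z ∂(Q.chain D S γ t), P z.1 := by
  have h1 : (Q.chain D S γ t).map Prod.fst = D.prior := Measure.fst_compProd _ _
  rw [← h1] at h
  exact ae_of_ae_map measurable_fst.aemeasurable h

theorem lintegral_chain_succ (t : ℕ) {F : DataVec p × (FeatVec M × FeatVec M) → ℝ≥0∞}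
    (hF : Measurable F) : ∫⁻ z, F z ∂(Q.chain D S γ (t + 1)) =
      ∫⁻ z, ∫⁻ v', F (z.1, (v', z.2.2 + z.2.1)) ∂(Q.sgdStep D S γ (z.1, z.2.1))
        ∂(Q.chain D S γ t) := by
  unfold chain
  have hm : Measurable fun r : (FeatVec M × FeatVec M) × FeatVec M => (r.2, r.1.2 + r.1.1) := by
    fun_prop
  have hG : Measurable fun z : DataVec p × (FeatVec M × FeatVec M) =>
      ∫⁻ v', F (z.1, (v', z.2.2 + z.2.1)) ∂(Q.sgdStep D S γ (z.1, z.2.1)) :=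
    Measurable.lintegral_kernel_prod_right' (κ := (Q.sgdStep D S γ).comap
        (fun r : DataVec p × (FeatVec M × FeatVec M) => (r.1, r.2.1)) (by fun_prop))
      (f := fun t : (DataVec p × (FeatVec M × FeatVec M)) × FeatVec M =>
        F (t.1.1, (t.2, t.1.2.2 + t.1.2.1))) (hF.comp (by fun_prop))
  rw [Measure.lintegral_compProd hF, Measure.lintegral_compProd hG]
  refine lintegral_congr fun w => ?_
  have hFw : Measurable fun r : FeatVec M × FeatVec M => F (w, r) := hF.comp measurable_prodMk_left
  have hFm : Measurable fun r : (FeatVec M × FeatVec M) × FeatVec M =>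
      F (w, (r.2, r.1.2 + r.1.1)) := hFw.comp hm
  rw [trajectory, Kernel.map_apply _ hm, lintegral_map hFw hm, Kernel.lintegral_compProd _ _ _ hFm]
  simp only [Kernel.comap_apply]

/-- Mean and second moments of one step: the drift is `-γ G (v - vq)`, the second moment in the
direction `u` is at most `γ² (A₁ ‖v - vq‖²_G + noise) ‖u‖²_G`, the noise being `A₂` on average. -/
structure StepControl (Q : Quantizers M p) (D : DataModel p) (S : SketchMat M p) (γ : ℝ)
    (G : Matrix (Fin M) (Fin M) ℝ) (vq : DataVec p → FeatVec M) (A₁ A₂ : ℝ) : Prop where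
  measurable : Measurable vq
  mean : ∀ᵐ w ∂D.prior, ∀ u v,
    ∫⁻ v', ENNReal.ofReal ((u ⬝ᵥ (v' - v)) ^ 2) ∂(Q.sgdStep D S γ (w, v)) < ∞ →
      MemLp (fun v' => u ⬝ᵥ (v' - v)) 2 (Q.sgdStep D S γ (w, v)) ∧
        ∫ v', u ⬝ᵥ (v' - v) ∂(Q.sgdStep D S γ (w, v)) = -(γ * (u ⬝ᵥ G *ᵥ (v - vq w)))
  second : ∀ u, ∃ n : DataVec p → ℝ≥0∞, Measurable n ∧
    (∫⁻ w, n w ∂D.prior ≤ ENNReal.ofReal (A₂ * quad G u)) ∧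
    ∀ w v, ∫⁻ v', ENNReal.ofReal ((u ⬝ᵥ (v' - v)) ^ 2) ∂(Q.sgdStep D S γ (w, v)) ≤
      ENNReal.ofReal (γ ^ 2) *
        (ENNReal.ofReal (A₁ * quad G u * quad G (v - vq w)) + n w)

namespace StepControl

variable {G : Matrix (Fin M) (Fin M) ℝ} {vq : DataVec p → FeatVec M} {A₁ A₂ : ℝ}

/-- Second moment of the error in a direction. -/
def errMoment (Q : Quantizers M p) (D : DataModel p) (S : SketchMat M p) (γ : ℝ)
    (vq : DataVec p → FeatVec M) (u : FeatVec M) (t : ℕ) : ℝ≥0∞ :=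
  ∫⁻ z, ENNReal.ofReal ((u ⬝ᵥ (z.2.1 - vq z.1)) ^ 2) ∂(Q.chain D S γ t)

/-- Second moment of the accumulated error in a direction. -/
def sumMoment (Q : Quantizers M p) (D : DataModel p) (S : SketchMat M p) (γ : ℝ)
    (vq : DataVec p → FeatVec M) (u : FeatVec M) (t : ℕ) : ℝ≥0∞ :=
  ∫⁻ z, ENNReal.ofReal ((u ⬝ᵥ (z.2.2 - (t : ℝ) • vq z.1)) ^ 2) ∂(Q.chain D S γ t)

/-- Second moment of the martingale part in an eigendirection. -/
def martMoment (Q : Quantizers M p) (D : DataModel p) (S : SketchMat M p) (γ : ℝ)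
    (vq : DataVec p → FeatVec M) (u : FeatVec M) (g : ℝ) (t : ℕ) : ℝ≥0∞ :=
  ∫⁻ z, ENNReal.ofReal ((γ * g * (u ⬝ᵥ (z.2.2 - (t : ℝ) • vq z.1)) + u ⬝ᵥ z.2.1) ^ 2)
    ∂(Q.chain D S γ t)

/-- Second moment of the increment in a direction. -/
def incrMoment (Q : Quantizers M p) (D : DataModel p) (S : SketchMat M p) (γ : ℝ)
    (u : FeatVec M) (t : ℕ) : ℝ≥0∞ :=
  ∫⁻ z, ∫⁻ v', ENNReal.ofReal ((u ⬝ᵥ (v' - z.2.1)) ^ 2) ∂(Q.sgdStep D S γ (z.1, z.2.1))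
    ∂(Q.chain D S γ t)

theorem measurable_err (hvq : Measurable vq) (u : FeatVec M) :
    Measurable fun z : DataVec p × (FeatVec M × FeatVec M) => u ⬝ᵥ (z.2.1 - vq z.1) := by
  unfold dotProduct; fun_prop

theorem measurable_sum (hvq : Measurable vq) (u : FeatVec M) (t : ℝ) :
    Measurable fun z : DataVec p × (FeatVec M × FeatVec M) => u ⬝ᵥ (z.2.2 - t • vq z.1) := by
  unfold dotProduct; fun_prop

theorem measurable_mart (hvq : Measurable vq) (u : FeatVec M) (s t : ℝ) :
    Measurable fun z : DataVec p × (FeatVec M × FeatVec M) =>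
      s * (u ⬝ᵥ (z.2.2 - t • vq z.1)) + u ⬝ᵥ z.2.1 := by
  unfold dotProduct; fun_prop

theorem errMoment_zero (hvq : Measurable vq) (u : FeatVec M) :
    errMoment Q D S γ vq u 0 = ∫⁻ w, ENNReal.ofReal ((u ⬝ᵥ vq w) ^ 2) ∂D.prior := by
  unfold errMoment
  rw [lintegral_chain_zero ((measurable_err hvq u).pow_const 2).ennreal_ofReal]
  simp only [zero_sub, dotProduct_neg, neg_sq]

/-- Along an eigenvector the drift is the scalar `-γ g` times the error, so the cross term of the
squared step is exactly the contraction `2 γ g`; the `γ²` term is contained in the increment. -/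
theorem errMoment_succ_le (h : StepControl Q D S γ G vq A₁ A₂) (hγ : 0 < γ) {u : FeatVec M} {g : ℝ}
    (hg : 0 ≤ g) (hu : ∀ d, u ⬝ᵥ G *ᵥ d = g * (u ⬝ᵥ d)) (t : ℕ) :
    errMoment Q D S γ vq u (t + 1) + ENNReal.ofReal (2 * γ * g) * errMoment Q D S γ vq u t ≤
      errMoment Q D S γ vq u t + incrMoment Q D S γ u t := by
  unfold errMoment incrMoment
  have hm := ((measurable_err h.measurable u).pow_const 2).ennreal_ofReal
  rw [lintegral_chain_succ t hm, ← lintegral_const_mul _ hm,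
    ← lintegral_add_right _ (hm.const_mul _), ← lintegral_add_left hm]
  refine lintegral_mono_ae ?_
  filter_upwards [ae_chain_fst t h.mean] with z hz
  have h1 := lintegral_sq_add_le (hz u z.2.1) (y := u ⬝ᵥ (z.2.1 - vq z.1))
    (R := 2 * γ * g * (u ⬝ᵥ (z.2.1 - vq z.1)) ^ 2) (A := (u ⬝ᵥ (z.2.1 - vq z.1)) ^ 2)
    (by positivity) (by positivity) (by rw [hu]; apply le_of_eq; ring)
  rw [← ENNReal.ofReal_mul (by positivity)]
  refine le_trans (le_of_eq ?_) h1
  congr 1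
  refine lintegral_congr fun v' => ?_
  rw [← dotProduct_add]
  congr 4
  abel

/-- The parameter plus `γ g` times the accumulated error is a martingale along the eigenvector.
Compensating the drift `s` only decreases the second moment of an increment: with `y = m + s`, `y² -
2 y s = m² - s² ≤ m²`. -/
theorem martMoment_succ_le (h : StepControl Q D S γ G vq A₁ A₂) {u : FeatVec M} {g : ℝ}
    (hu : ∀ d, u ⬝ᵥ G *ᵥ d = g * (u ⬝ᵥ d)) (t : ℕ) :
    martMoment Q D S γ vq u g (t + 1) ≤
      martMoment Q D S γ vq u g t + incrMoment Q D S γ u t := by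
  unfold martMoment incrMoment
  have hm := fun s => ((measurable_mart h.measurable u (γ * g) s).pow_const 2).ennreal_ofReal
  rw [lintegral_chain_succ t (hm _), ← lintegral_add_left (hm _)]
  refine lintegral_mono_ae ?_
  filter_upwards [ae_chain_fst t h.mean] with z hz
  set m := γ * g * (u ⬝ᵥ (z.2.2 - (t : ℝ) • vq z.1)) + u ⬝ᵥ z.2.1 with hmdef
  have h1 := lintegral_sq_add_le (hz u z.2.1) (y := m + γ * g * (u ⬝ᵥ (z.2.1 - vq z.1)))
    (R := 0) (A := m ^ 2) le_rfl (by positivity) (by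
      rw [hu]; nlinarith [sq_nonneg (γ * (g * (u ⬝ᵥ (z.2.1 - vq z.1))))])
  rw [ENNReal.ofReal_zero, add_zero] at h1
  refine le_trans (le_of_eq ?_) h1
  refine lintegral_congr fun v' => ?_
  congr 2
  rw [hmdef]
  push_cast
  simp only [dotProduct_sub, dotProduct_add, dotProduct_smul, smul_eq_mul]
  ring

theorem sumMoment_succ (hvq : Measurable vq) (u : FeatVec M) (t : ℕ) :
    sumMoment Q D S γ vq u (t + 1) = ∫⁻ z, ENNReal.ofReal
      ((u ⬝ᵥ (z.2.2 - (t : ℝ) • vq z.1) + u ⬝ᵥ (z.2.1 - vq z.1)) ^ 2) ∂(Q.chain D S γ t) := by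
  unfold sumMoment
  rw [lintegral_chain_succ t ((measurable_sum hvq u _).pow_const 2).ennreal_ofReal]
  refine lintegral_congr fun z => ?_
  simp only [lintegral_const, measure_univ, mul_one]
  congr 2
  push_cast
  simp only [dotProduct_sub, dotProduct_add, dotProduct_smul, smul_eq_mul]
  ring

/-- Young's inequality with weight `t`, the defect being `(x - t y)² / t`. Iterated, it is
Cauchy–Schwarz for a sum of `t` terms; the weight degenerates at `t = 0`, so the induction starts at
one term. -/
theorem sumMoment_succ_le (hvq : Measurable vq) (u : FeatVec M) {t : ℕ} (ht : 1 ≤ t) :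
    sumMoment Q D S γ vq u (t + 1) ≤
      ENNReal.ofReal ((t + 1) / t) * sumMoment Q D S γ vq u t +
        ENNReal.ofReal (t + 1) * errMoment Q D S γ vq u t := by
  have ht0 : (0 : ℝ) < t := by exact_mod_cast ht
  rw [sumMoment_succ hvq]
  unfold sumMoment errMoment
  have hm1 := ((measurable_sum hvq u t).pow_const 2).ennreal_ofReal
  have hm2 := ((measurable_err hvq u).pow_const 2).ennreal_ofReal
  rw [← lintegral_const_mul _ hm1, ← lintegral_const_mul _ hm2,
    ← lintegral_add_left (hm1.const_mul _)]
  refine lintegral_mono fun z => ?_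
  rw [← ENNReal.ofReal_mul (by positivity), ← ENNReal.ofReal_mul (by positivity),
    ← ENNReal.ofReal_add (by positivity) (by positivity)]
  refine ENNReal.ofReal_le_ofReal ?_
  set x := u ⬝ᵥ (z.2.2 - (t : ℝ) • vq z.1)
  set y := u ⬝ᵥ (z.2.1 - vq z.1)
  have : (t + 1) / t * x ^ 2 + (t + 1) * y ^ 2 - (x + y) ^ 2 = (x - t * y) ^ 2 / t := by
    field_simp; ring
  have : 0 ≤ (x - t * y) ^ 2 / t := by positivity
  linarith

theorem sumMoment_one (hvq : Measurable vq) (u : FeatVec M) :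
    sumMoment Q D S γ vq u 1 = errMoment Q D S γ vq u 0 := by
  have hm : Measurable fun z : DataVec p × (FeatVec M × FeatVec M) => ENNReal.ofReal
      ((u ⬝ᵥ (z.2.2 - ((0 : ℕ) : ℝ) • vq z.1) + u ⬝ᵥ (z.2.1 - vq z.1)) ^ 2) :=
    (((measurable_sum hvq u _).add (measurable_err hvq u)).pow_const 2).ennreal_ofReal
  rw [sumMoment_succ hvq u 0, lintegral_chain_zero hm, errMoment_zero hvq]
  simp

theorem martMoment_zero (hvq : Measurable vq) (u : FeatVec M) (g : ℝ) :
    martMoment Q D S γ vq u g 0 = 0 := by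
  unfold martMoment
  rw [lintegral_chain_zero ((measurable_mart hvq u _ _).pow_const 2).ennreal_ofReal]
  simp

/-- The accumulated error, scaled by `γ g`, is the martingale part minus the current error minus the
projected minimizer. The last has the moment of the initial error since `v_0 = 0`, and the square of
three terms costs a factor 3. -/
theorem sumMoment_le_martMoment (hvq : Measurable vq) (u : FeatVec M) (g : ℝ) (t : ℕ) :
    ENNReal.ofReal (γ ^ 2 * g ^ 2) * sumMoment Q D S γ vq u t ≤
      ENNReal.ofReal 3 * (martMoment Q D S γ vq u g t + errMoment Q D S γ vq u t +
        errMoment Q D S γ vq u 0) := by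
  have hm0 : Measurable fun z : DataVec p × (FeatVec M × FeatVec M) =>
      ENNReal.ofReal ((u ⬝ᵥ vq z.1) ^ 2) := by unfold dotProduct; fun_prop
  have hm1 := ((measurable_mart hvq u (γ * g) t).pow_const 2).ennreal_ofReal
  have hm2 := ((measurable_err hvq u).pow_const 2).ennreal_ofReal
  have hm3 := ((measurable_sum hvq u t).pow_const 2).ennreal_ofReal
  rw [errMoment_zero hvq, ← lintegral_chain_fst (Q := Q) (S := S) (γ := γ) t
    (F := fun w => ENNReal.ofReal ((u ⬝ᵥ vq w) ^ 2)) (by unfold dotProduct; fun_prop)]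
  unfold sumMoment martMoment errMoment
  rw [← lintegral_const_mul _ hm3, ← lintegral_add_left hm1, ← lintegral_add_right _ hm0,
    ← lintegral_const_mul' _ _ ENNReal.ofReal_ne_top]
  refine lintegral_mono fun z => ?_
  rw [← ENNReal.ofReal_mul (by positivity), ← ENNReal.ofReal_add (by positivity) (by positivity),
    ← ENNReal.ofReal_add (by positivity) (by positivity), ← ENNReal.ofReal_mul (by positivity)]
  refine ENNReal.ofReal_le_ofReal ?_
  have h1 : u ⬝ᵥ (z.2.1 - vq z.1) = u ⬝ᵥ z.2.1 - u ⬝ᵥ vq z.1 := dotProduct_sub _ _ _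
  rw [h1]
  set x := u ⬝ᵥ (z.2.2 - (t : ℝ) • vq z.1)
  set y := u ⬝ᵥ z.2.1
  set q := u ⬝ᵥ vq z.1
  nlinarith [sq_nonneg ((γ * g * x + y) + (y - q)), sq_nonneg ((γ * g * x + y) + q),
    sq_nonneg ((y - q) - q)]

theorem incrMoment_le (h : StepControl Q D S γ G vq A₁ A₂) (u : FeatVec M) (t : ℕ) :
    incrMoment Q D S γ u t ≤ ENNReal.ofReal (γ ^ 2) *
      (∫⁻ z, ENNReal.ofReal (A₁ * quad G u * quad G (z.2.1 - vq z.1)) ∂(Q.chain D S γ t) +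
        ENNReal.ofReal (A₂ * quad G u)) := by
  obtain ⟨n, hn, hint, hle⟩ := h.second u
  unfold incrMoment
  calc _ ≤ ∫⁻ z, ENNReal.ofReal (γ ^ 2) *
        (ENNReal.ofReal (A₁ * quad G u * quad G (z.2.1 - vq z.1)) + n z.1)
          ∂(Q.chain D S γ t) := lintegral_mono fun z => hle z.1 z.2.1
    _ = ENNReal.ofReal (γ ^ 2) *
        (∫⁻ z, ENNReal.ofReal (A₁ * quad G u * quad G (z.2.1 - vq z.1)) ∂(Q.chain D S γ t) +
          ∫⁻ w, n w ∂D.prior) := by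
        have hn' : Measurable fun z : DataVec p × (FeatVec M × FeatVec M) => n z.1 :=
          hn.comp measurable_fst
        rw [lintegral_const_mul' _ _ ENNReal.ofReal_ne_top, lintegral_add_right _ hn',
          ← lintegral_chain_fst (Q := Q) (S := S) (γ := γ) t hn]
    _ ≤ _ := by gcongr

theorem measurable_quad (hvq : Measurable vq) :
    Measurable fun z : DataVec p × (FeatVec M × FeatVec M) => quad G (z.2.1 - vq z.1) := by
  unfold quad dotProduct Matrix.mulVec dotProduct; fun_prop

/-- The excess risk of the averaged iterate. -/
theorem lintegral_quad_average_le (h : StepControl Q D S γ G vq A₁ A₂) (hγ : 0 < γ)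
    (hA₁ : 0 ≤ A₁) (hA₂ : 0 ≤ A₂) {u : Fin M → FeatVec M} {g : Fin M → ℝ}
    (hE : EigenSystem G u g) {T₀ : ℝ} (hT₀ : 0 ≤ T₀)
    (hvq : ∫⁻ w, ENNReal.ofReal (quad G (vq w)) ∂D.prior ≤ ENNReal.ofReal T₀)
    (htr : γ * A₁ * G.trace ≤ 3 / 2) {N : ℕ} (hN : 1 ≤ N) :
    ∫⁻ z, ENNReal.ofReal (quad G ((N : ℝ)⁻¹ • z.2.2 - vq z.1)) ∂(Q.chain D S γ N) ≤
      ENNReal.ofReal 6 *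
        (∫⁻ w, ENNReal.ofReal (∑ i, min (g i) (1 / (γ * N)) * (u i ⬝ᵥ vq w) ^ 2) ∂D.prior +
          ENNReal.ofReal ((∑ i, min (g i) (1 / (γ * N))) * (γ * (4 * A₁ * T₀ + 4 * A₂)))) := by
  have hN0 : (0 : ℝ) < N := by exact_mod_cast hN
  have hg := hE.nonneg
  have hm := h.measurable
  obtain ⟨cE, hcE⟩ : ∃ cE : Fin M → ℕ → ℝ≥0∞, ∀ i t, errMoment Q D S γ vq (u i) t = cE i t :=
    ⟨_, fun _ _ => rfl⟩
  obtain ⟨DE, hDE⟩ : ∃ DE : Fin M → ℕ → ℝ≥0∞, ∀ i t, sumMoment Q D S γ vq (u i) t = DE i t :=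
    ⟨_, fun _ _ => rfl⟩
  obtain ⟨mE, hmE⟩ : ∃ mE : Fin M → ℕ → ℝ≥0∞, ∀ i t,
      martMoment Q D S γ vq (u i) (g i) t = mE i t := ⟨_, fun _ _ => rfl⟩
  obtain ⟨c, hc⟩ : ∃ c : Fin M → ℕ → ℝ, ∀ i t, c i t = (cE i t).toReal := ⟨_, fun _ _ => rfl⟩
  obtain ⟨T, hT⟩ : ∃ T : ℕ → ℝ, ∀ t, T t = ∑ i, g i * c i t := ⟨_, fun _ => rfl⟩
  have hc0 : ∀ i t, 0 ≤ c i t := fun i t => by rw [hc]; exact ENNReal.toReal_nonneg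
  have hTn : ∀ t, 0 ≤ T t := fun t => by rw [hT]; exact Finset.sum_nonneg fun i _ => mul_nonneg (hg i) (hc0 i t)
  have hBn : ∀ t, 0 ≤ A₁ * T t + A₂ := fun t => add_nonneg (mul_nonneg hA₁ (hTn t)) hA₂
  have hTE : ∀ t, (∀ i, 0 < g i → cE i t ≠ ∞) →
      ∫⁻ z, ENNReal.ofReal (quad G (z.2.1 - vq z.1)) ∂(Q.chain D S γ t) = ENNReal.ofReal (T t) :=
    fun t hfin => by
    have h1 : ∀ z : DataVec p × (FeatVec M × FeatVec M),
        ENNReal.ofReal (quad G (z.2.1 - vq z.1)) =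
          ∑ i, ENNReal.ofReal (g i) * ENNReal.ofReal ((u i ⬝ᵥ (z.2.1 - vq z.1)) ^ 2) := fun z => by
      unfold quad
      rw [hE.quad_eq, ENNReal.ofReal_sum_of_nonneg fun i _ => mul_nonneg (hg i) (sq_nonneg _)]
      exact Finset.sum_congr rfl fun i _ => ENNReal.ofReal_mul (hg i)
    simp_rw [h1]
    rw [lintegral_finsetSum _ fun i _ =>
        (((measurable_err hm (u i)).pow_const 2).ennreal_ofReal).const_mul _, hT,
      ENNReal.ofReal_sum_of_nonneg fun i _ => mul_nonneg (hg i) (hc0 i t)]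
    refine Finset.sum_congr rfl fun i _ => ?_
    rw [lintegral_const_mul' _ _ ENNReal.ofReal_ne_top, ENNReal.ofReal_mul (hg i)]
    rcases (hg i).eq_or_lt with hi | hi
    · rw [← hi]; simp
    · rw [hc, ENNReal.ofReal_toReal (hfin i hi), ← hcE]; rfl
  have hincr : ∀ t, (∀ i, 0 < g i → cE i t ≠ ∞) → ∀ i, incrMoment Q D S γ (u i) t ≤
      ENNReal.ofReal (γ ^ 2 * g i * (A₁ * T t + A₂)) := fun t hfin i => by
    refine (incrMoment_le h (u i) t).trans (le_of_eq ?_)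
    have hq : quad G (u i) = g i := hE.quad_self i
    rw [hq]
    have h2 : ∀ z : DataVec p × (FeatVec M × FeatVec M),
        ENNReal.ofReal (A₁ * g i * quad G (z.2.1 - vq z.1)) =
          ENNReal.ofReal (A₁ * g i) * ENNReal.ofReal (quad G (z.2.1 - vq z.1)) := fun z =>
      ENNReal.ofReal_mul (mul_nonneg hA₁ (hg i))
    simp_rw [h2]
    have h3 := hg i
    have h4 := hTn t
    rw [lintegral_const_mul' _ _ ENNReal.ofReal_ne_top, hTE t hfin,
      ← ENNReal.ofReal_mul (by positivity), ← ENNReal.ofReal_add (by positivity) (by positivity),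
      ← ENNReal.ofReal_mul (by positivity)]
    congr 1; ring
  have hcrec : ∀ t, (∀ i, 0 < g i → cE i t ≠ ∞) → ∀ i,
      cE i (t + 1) + ENNReal.ofReal (2 * γ * g i) * cE i t ≤
        cE i t + ENNReal.ofReal (γ ^ 2 * g i * (A₁ * T t + A₂)) := fun t hfin i => by
    rw [← hcE, ← hcE]
    exact (errMoment_succ_le h hγ (hg i) (hE.dotProduct_mulVec i) t).trans
      (add_le_add_right (hincr t hfin i) _)
  -- Finiteness is propagated only along directions with positive eigenvalue. In a null direction
  -- the minimizer may have infinite second moment, but such a direction enters every sum with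
  -- weight zero.
  have hfin : ∀ t i, 0 < g i → cE i t ≠ ∞ := fun t => by
    induction t with
    | zero =>
      intro i hi htop
      have h5 : ENNReal.ofReal (g i) * cE i 0 ≤ ENNReal.ofReal T₀ := by
        refine le_trans ?_ hvq
        rw [← hcE, errMoment_zero hm, ← lintegral_const_mul' _ _ ENNReal.ofReal_ne_top]
        refine lintegral_mono fun w => ?_
        rw [← ENNReal.ofReal_mul (hg i)]
        refine ENNReal.ofReal_le_ofReal ?_
        unfold quad
        rw [hE.quad_eq]
        exact Finset.single_le_sum (f := fun i => g i * (u i ⬝ᵥ vq w) ^ 2)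
          (fun j _ => mul_nonneg (hg j) (sq_nonneg _)) (Finset.mem_univ i)
      rw [htop, ENNReal.mul_top (by simpa using hi)] at h5
      exact ENNReal.ofReal_ne_top (top_le_iff.mp h5)
    | succ t ih =>
      intro i hi
      refine ne_top_of_le_ne_top ?_ (le_self_add.trans (hcrec t ih i))
      exact ENNReal.add_ne_top.mpr ⟨ih i hi, ENNReal.ofReal_ne_top⟩
  have hcr : ∀ i t, 0 < g i → cE i t = ENNReal.ofReal (c i t) := fun i t hi => by
    rw [hc, ENNReal.ofReal_toReal (hfin t i hi)]
  have hmb : ∀ i t, mE i t ≤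
      ENNReal.ofReal (γ ^ 2 * g i * ∑ s ∈ Finset.range t, (A₁ * T s + A₂)) := fun i t => by
    induction t with
    | zero => rw [← hmE, martMoment_zero hm]; exact zero_le
    | succ t ih =>
      have h6 := hg i
      have h7 : 0 ≤ ∑ s ∈ Finset.range t, (A₁ * T s + A₂) :=
        Finset.sum_nonneg fun s _ => hBn s
      have h8 := hBn t
      rw [← hmE]
      refine (martMoment_succ_le h (hE.dotProduct_mulVec i) t).trans ?_
      rw [hmE]
      rw [Finset.sum_range_succ, mul_add, ENNReal.ofReal_add (by positivity) (by positivity)]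
      exact add_le_add ih (hincr t (hfin t) i)
  have hDb : ∀ i, 0 < g i → ∀ t, DE i (t + 1) ≤
      ENNReal.ofReal ((t + 1 : ℝ) * ∑ s ∈ Finset.range (t + 1), c i s) := fun i hi t => by
    induction t with
    | zero =>
      rw [← hDE]
      simp only [zero_add, Finset.range_one, Finset.sum_singleton, Nat.cast_zero, one_mul]
      rw [sumMoment_one hm, hcE]
      exact (hcr i 0 hi).le
    | succ t ih =>
      have h7 : 0 ≤ ∑ s ∈ Finset.range (t + 1), c i s := Finset.sum_nonneg fun s _ => hc0 i s
      have h8 := hc0 i (t + 1)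
      rw [← hDE]
      refine (sumMoment_succ_le hm (u i) (t := t + 1) (by omega)).trans ?_
      rw [hcE, hDE, hcr i _ hi]
      push_cast
      calc _ ≤ ENNReal.ofReal ((t + 1 + 1 : ℝ) / (t + 1)) *
            ENNReal.ofReal ((t + 1 : ℝ) * ∑ s ∈ Finset.range (t + 1), c i s) +
            ENNReal.ofReal (t + 1 + 1) * ENNReal.ofReal (c i (t + 1)) := by
            gcongr
        _ = _ := by
            rw [← ENNReal.ofReal_mul (by positivity), ← ENNReal.ofReal_mul (by positivity),
              ← ENNReal.ofReal_add (by positivity) (by positivity), Finset.sum_range_succ _ (t + 1)]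
            congr 1
            field_simp
  have hDN : ∀ i, 0 < g i → DE i N ≤ ENNReal.ofReal (N * ∑ s ∈ Finset.range N, c i s) :=
    fun i hi => by
    have := hDb i hi (N - 1)
    rw [Nat.sub_add_cancel hN] at this
    refine this.trans (le_of_eq ?_)
    rw [Nat.cast_sub hN, Nat.cast_one, sub_add_cancel]
  have hDfin : ∀ i, 0 < g i → DE i N ≠ ∞ := fun i hi =>
    ne_top_of_le_ne_top ENNReal.ofReal_ne_top (hDN i hi)
  have hmfin : ∀ i, mE i N ≠ ∞ := fun i => ne_top_of_le_ne_top ENNReal.ofReal_ne_top (hmb i N)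
  have hSn : ∀ i, 0 ≤ ∑ s ∈ Finset.range N, c i s := fun i =>
    Finset.sum_nonneg fun s _ => hc0 i s
  have hreal := averaged_recursion_bound hg hγ hA₁ hA₂ hN (by rwa [← hE.trace_eq]) (c := c)
    (m := fun i => (mE i N).toReal) (D := fun i => (DE i N).toReal) hc0 hT
    (fun i hi t => by
      have h6 := hcrec t (hfin t) i
      have h8 := hBn t
      rw [hcr i t hi, hcr i (t + 1) hi, ← ENNReal.ofReal_mul (by positivity),
        ← ENNReal.ofReal_add (hc0 _ _) (mul_nonneg (by positivity) (hc0 _ _)),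
        ← ENNReal.ofReal_add (hc0 _ _) (by positivity),
        ENNReal.ofReal_le_ofReal_iff (add_nonneg (hc0 _ _) (by positivity))] at h6
      exact h6)
    (fun i hi => ENNReal.toReal_le_of_le_ofReal (mul_nonneg (by positivity)
      (Finset.sum_nonneg fun s _ => hBn s)) (hmb i N))
    (fun i hi => ENNReal.toReal_le_of_le_ofReal (mul_nonneg hN0.le (hSn i)) (hDN i hi))
    (fun i hi => by
      have h6 := sumMoment_le_martMoment (Q := Q) (D := D) (S := S) (γ := γ) hm (u i) (g i) N
      rw [hcE, hcE, hDE, hmE, hcr i N hi, hcr i 0 hi, ← ENNReal.ofReal_toReal (hDfin i hi),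
        ← ENNReal.ofReal_toReal (hmfin i)] at h6
      have n1 : 0 ≤ (mE i N).toReal := ENNReal.toReal_nonneg
      have n2 := hc0 i N
      have n3 := hc0 i 0
      rw [← ENNReal.ofReal_mul (by positivity),
        ← ENNReal.ofReal_add (by positivity) (by positivity),
        ← ENNReal.ofReal_add (by positivity) (by positivity),
        ← ENNReal.ofReal_mul (by positivity),
        ENNReal.ofReal_le_ofReal_iff (by positivity)] at h6
      exact h6)
  have hT0 : T 0 ≤ T₀ := by
    have h6 := hTE 0 (hfin 0)
    rw [lintegral_chain_zero (measurable_quad hm).ennreal_ofReal] at h6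
    have h7 : ∀ w, quad G ((0 : FeatVec M) - vq w) = quad G (vq w) := fun w => by
      unfold quad
      rw [zero_sub, Matrix.mulVec_neg, neg_dotProduct_neg]
    simp_rw [h7] at h6
    rw [h6, ENNReal.ofReal_le_ofReal_iff hT₀] at hvq
    exact hvq
  have hlhs : ∫⁻ z, ENNReal.ofReal (quad G ((N : ℝ)⁻¹ • z.2.2 - vq z.1)) ∂(Q.chain D S γ N) =
      ENNReal.ofReal (∑ i, g i * (DE i N).toReal / N ^ 2) := by
    have h6 : ∀ z : DataVec p × (FeatVec M × FeatVec M),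
        ENNReal.ofReal (quad G ((N : ℝ)⁻¹ • z.2.2 - vq z.1)) =
          ∑ i, ENNReal.ofReal (g i / N ^ 2) *
            ENNReal.ofReal ((u i ⬝ᵥ (z.2.2 - (N : ℝ) • vq z.1)) ^ 2) := fun z => by
      unfold quad
      rw [hE.quad_eq, ENNReal.ofReal_sum_of_nonneg fun i _ => mul_nonneg (hg i) (sq_nonneg _)]
      refine Finset.sum_congr rfl fun i _ => ?_
      rw [← ENNReal.ofReal_mul (div_nonneg (hg i) (by positivity))]
      congr 1
      simp only [dotProduct_sub, dotProduct_smul, smul_eq_mul]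
      field_simp
    simp_rw [h6]
    rw [lintegral_finsetSum _ fun i _ =>
        (((measurable_sum hm (u i) N).pow_const 2).ennreal_ofReal).const_mul _,
      ENNReal.ofReal_sum_of_nonneg fun i _ => div_nonneg (mul_nonneg (hg i)
        ENNReal.toReal_nonneg) (by positivity)]
    refine Finset.sum_congr rfl fun i _ => ?_
    rw [lintegral_const_mul' _ _ ENNReal.ofReal_ne_top, mul_div_right_comm,
      ENNReal.ofReal_mul (div_nonneg (hg i) (by positivity))]
    rcases (hg i).eq_or_lt with hi | hi
    · rw [← hi]; simp
    · rw [ENNReal.ofReal_toReal (hDfin i hi), ← hDE]; rfl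
  have hmin : ∀ i, 0 ≤ min (g i) (1 / (γ * N)) := fun i => le_min (hg i) (by positivity)
  -- Passing through `toReal` can only lose mass, so an inequality suffices even where an initial
  -- moment is infinite.
  have hbias : ENNReal.ofReal (∑ i, min (g i) (1 / (γ * N)) * c i 0) ≤
      ∫⁻ w, ENNReal.ofReal (∑ i, min (g i) (1 / (γ * N)) * (u i ⬝ᵥ vq w) ^ 2) ∂D.prior := by
    have h6 : ∀ w : DataVec p,
        ENNReal.ofReal (∑ i, min (g i) (1 / (γ * N)) * (u i ⬝ᵥ vq w) ^ 2) =
          ∑ i, ENNReal.ofReal (min (g i) (1 / (γ * N))) *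
            ENNReal.ofReal ((u i ⬝ᵥ vq w) ^ 2) := fun w => by
      rw [ENNReal.ofReal_sum_of_nonneg fun i _ => mul_nonneg (hmin i) (sq_nonneg _)]
      exact Finset.sum_congr rfl fun i _ => ENNReal.ofReal_mul (hmin i)
    have h7 : ∀ i, Measurable fun w => ENNReal.ofReal ((u i ⬝ᵥ vq w) ^ 2) := fun i => by
      unfold dotProduct; fun_prop
    simp_rw [h6]
    rw [lintegral_finsetSum _ fun i _ => (h7 i).const_mul _,
      ENNReal.ofReal_sum_of_nonneg fun i _ => mul_nonneg (hmin i) (hc0 i 0)]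
    refine Finset.sum_le_sum fun i _ => ?_
    rw [lintegral_const_mul' _ _ ENNReal.ofReal_ne_top, ENNReal.ofReal_mul (hmin i),
      ← errMoment_zero (Q := Q) (S := S) (γ := γ) hm, hcE, hc]
    gcongr
    exact ENNReal.ofReal_toReal_le
  rw [hlhs]
  calc _ ≤ ENNReal.ofReal (6 * (∑ i, min (g i) (1 / (γ * N)) * c i 0 +
        (∑ i, min (g i) (1 / (γ * N))) * (γ * (4 * A₁ * T₀ + 4 * A₂)))) := by
        refine ENNReal.ofReal_le_ofReal (hreal.trans ?_)
        rw [Finset.sum_mul, ← Finset.sum_add_distrib]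
        simp_rw [← mul_add]
        gcongr with i
        exact hmin i
    _ = ENNReal.ofReal 6 * (ENNReal.ofReal (∑ i, min (g i) (1 / (γ * N)) * c i 0) +
        ENNReal.ofReal ((∑ i, min (g i) (1 / (γ * N))) * (γ * (4 * A₁ * T₀ + 4 * A₂)))) := by
        rw [ENNReal.ofReal_mul (by positivity), ENNReal.ofReal_add
          (Finset.sum_nonneg fun i _ => mul_nonneg (hmin i) (hc0 i 0))
          (mul_nonneg (Finset.sum_nonneg fun i _ => hmin i) (by positivity))]
    _ ≤ _ := by gcongr

end StepControl

end Quantizers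

end

/-! ### Law of a quantized feature in a fixed direction -/

section

namespace MeanVar

variable {α : Type*} [MeasurableSpace α] {ν : Measure α} {X : α → ℝ} {m V : ℝ}

theorem map {β : Type*} [MeasurableSpace β] {f : α → β} (hf : Measurable f) {Y : β → ℝ}
    (hY : Measurable Y) (h : MeanVar ν (fun a => Y (f a)) m V) : MeanVar (ν.map f) Y m V where
  aesm := hY.aestronglyMeasurable
  nonneg := h.nonneg
  mean := by rw [integral_map hf.aemeasurable hY.aestronglyMeasurable, h.mean]
  variance := by
    rw [lintegral_map ((hY.sub_const m).pow_const 2).ennreal_ofReal hf]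
    exact h.variance

theorem congr {Y : α → ℝ} (h : MeanVar ν X m V) (hXY : X =ᵐ[ν] Y) : MeanVar ν Y m V where
  aesm := h.aesm.congr hXY
  nonneg := h.nonneg
  mean := by rw [← integral_congr_ae hXY, h.mean]
  variance := by
    refine le_trans (le_of_eq (lintegral_congr_ae ?_)) h.variance
    filter_upwards [hXY] with a ha
    rw [ha]

theorem mul_const (h : MeanVar ν X m V) (c : ℝ) :
    MeanVar ν (fun a => X a * c) (m * c) (V * c ^ 2) where
  aesm := h.aesm.mul_const c
  nonneg := mul_nonneg h.nonneg (sq_nonneg c)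
  mean := by rw [integral_mul_const, h.mean]
  variance := by
    have h1 : ∀ a, ENNReal.ofReal ((X a * c - m * c) ^ 2) =
        ENNReal.ofReal ((X a - m) ^ 2) * ENNReal.ofReal (c ^ 2) := fun a => by
      rw [← ENNReal.ofReal_mul (sq_nonneg _)]; congr 1; ring
    simp_rw [h1]
    rw [lintegral_mul_const' _ _ ENNReal.ofReal_ne_top, ENNReal.ofReal_mul h.nonneg]
    gcongr
    exact h.variance

end MeanVar

/-- The bias–variance identity is stated in `ℝ≥0∞` because the label quantizer is only unbiased: its
conditional variance at a given label may be infinite. -/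
theorem lintegral_sq_sub_eq {α : Type*} [MeasurableSpace α] {ν : Measure α}
    [IsProbabilityMeasure ν] {X : α → ℝ} {m : ℝ} (hX : Integrable X ν) (hm : ∫ a, X a ∂ν = m)
    (c : ℝ) : ∫⁻ a, ENNReal.ofReal ((X a - c) ^ 2) ∂ν =
      ENNReal.ofReal ((m - c) ^ 2) + ∫⁻ a, ENNReal.ofReal ((X a - m) ^ 2) ∂ν := by
  by_cases hL : MemLp X 2 ν
  · have hLc : ∀ d : ℝ, MemLp (fun a => X a - d) 2 ν := fun d => hL.sub (memLp_const d)
    rw [lintegral_sq_eq_ofReal (hLc c), lintegral_sq_eq_ofReal (hLc m),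
      ← ENNReal.ofReal_add (by positivity) (by positivity)]
    congr 1
    have h1 : ∀ a, (X a - c) ^ 2 = (X a - m) ^ 2 + ((2 * (m - c)) * (X a - m) + (m - c) ^ 2) :=
      fun a => by ring
    have h2 : Integrable (fun a => X a - m) ν := hX.sub (integrable_const m)
    have h3 : Integrable (fun a => (2 * (m - c)) * (X a - m)) ν := h2.const_mul _
    have h4 : Integrable (fun a => (2 * (m - c)) * (X a - m) + (m - c) ^ 2) ν :=
      h3.add (integrable_const _)
    simp_rw [h1]
    rw [integral_add (hLc m).integrable_sq h4, integral_add h3 (integrable_const _),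
      integral_const_mul, integral_sub hX (integrable_const m), hm]
    simp only [integral_const, probReal_univ, smul_eq_mul, one_mul]
    ring
  · have htop : ∀ d : ℝ, ∫⁻ a, ENNReal.ofReal ((X a - d) ^ 2) ∂ν = ∞ := fun d => by
      by_contra h
      refine hL ?_
      have h1 := (memLp_two_of_lintegral_sq_lt_top (hX.aestronglyMeasurable.sub
        aestronglyMeasurable_const) (Ne.lt_top h)).add (memLp_const d)
      refine h1.ae_eq (Eventually.of_forall fun a => ?_)
      simp
    rw [htop, htop, add_top]

namespace Quantizers

variable {M : ℕ} {p : ℕ∞} {Q : Quantizers M p} {D : DataModel p} {S : SketchMat M p}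

/-- Testing the matrix condition with a rank-one `A` shows that each row combination `bᵀ Q_s(S)` is
a multiplicative quantization of the vector `bᵀ S`. The random-scalar description then applies to
it. -/
theorem meanVar_rowSketch {e : ErrorLevels} (hQ : Q.Unbiased) (he : e.Nonneg)
    (hm : Q.Multiplicative e) (S : SketchMat M p) (b : FeatVec M) (c : Coord p →₀ ℝ) :
    MeanVar ((Q.sketch S).map fun T j => ∑ i, b i * T i j) (fun v => c.sum fun j t => t * v j)
      (c.sum fun j t => t * ∑ i, b i * S i j)
      (e.sketch * (c.sum fun j t => t * ∑ i, b i * S i j) ^ 2) := by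
  have hes : 0 ≤ e.sketch := he.2.1
  have hmeas : Measurable fun (T : SketchMat M p) (j : Coord p) => ∑ i, b i * T i j := by fun_prop
  refine MeanVar.map hmeas (by unfold Finsupp.sum; fun_prop) ?_
  have hi : ∀ j, Integrable (fun T : SketchMat M p => ∑ i, b i * T i j) (Q.sketch S) := fun j =>
    integrable_finsetSum _ fun i _ => (hQ.2.1 S i j).1.const_mul _
  have hmean : ∀ j, ∫ T : SketchMat M p, ∑ i, b i * T i j ∂(Q.sketch S) = ∑ i, b i * S i j :=
    fun j => by
    rw [integral_finsetSum _ fun i _ => (hQ.2.1 S i j).1.const_mul _]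
    exact Finset.sum_congr rfl fun i _ => by rw [integral_const_mul, (hQ.2.1 S i j).2]
  refine MeanVar.of_integrable ?_ ?_ (by positivity) ?_
  · unfold Finsupp.sum
    exact integrable_finsetSum _ fun j _ => (hi j).const_mul _
  · unfold Finsupp.sum
    rw [integral_finsetSum _ fun j _ => (hi j).const_mul _]
    exact Finset.sum_congr rfl fun j _ => by rw [integral_const_mul, hmean]
  · set d : c.support → ℝ := fun k => c k
    have hA : (Matrix.vecMulVec d d).PosSemidef := by
      simpa using Matrix.posSemidef_vecMulVec_self_star d
    have h := hm.2.1 S c.support _ hA b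
    have hq : ∀ r : c.support → ℝ, r ⬝ᵥ Matrix.vecMulVec d d *ᵥ r = (d ⬝ᵥ r) ^ 2 := fun r => by
      rw [Matrix.vecMulVec_mulVec, dotProduct_smul, dotProduct_comm r d]
      simp [sq]
    have hd : ∀ X : SketchMat M p, d ⬝ᵥ rowComb c.support b X =
        c.sum fun j t => t * ∑ i, b i * X i j := fun X => by
      unfold Finsupp.sum rowComb dotProduct
      rw [← Finset.sum_coe_sort c.support]
    have hsub : ∀ T : SketchMat M p, (c.sum fun j t => t * ∑ i, b i * T i j) -
        (c.sum fun j t => t * ∑ i, b i * S i j) = d ⬝ᵥ rowComb c.support b (T - S) := fun T => by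
      rw [hd]
      unfold Finsupp.sum
      rw [← Finset.sum_sub_distrib]
      refine Finset.sum_congr rfl fun j _ => ?_
      rw [← mul_sub, ← Finset.sum_sub_distrib]
      simp only [Pi.sub_apply, mul_sub]
    simp only [hq, hd S] at h
    simp_rw [hsub]
    exact h

/-- The intermediate kernel `u ↦ Q_s(S) u`. -/
def sketchKernel (Q : Quantizers M p) (S : SketchMat M p) : Kernel (DataVec p) (FeatVec M) :=
  (Kernel.const (DataVec p) (Q.sketch S) ×ₖ Kernel.id).map fun z => sketchApply z.1 z.2

instance (S : SketchMat M p) : IsMarkovKernel (Q.sketchKernel S) := by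
  unfold sketchKernel; exact Kernel.IsMarkovKernel.map _ measurable_sketchApply

theorem measurable_sketchApply_left (u : DataVec p) :
    Measurable fun T : SketchMat M p => sketchApply T u :=
  Measurable.comp (g := fun z : SketchMat M p × DataVec p => sketchApply z.1 z.2)
    (f := fun T => (T, u)) measurable_sketchApply measurable_prodMk_right

theorem measurable_sketchApply_right (S : SketchMat M p) :
    Measurable fun x : DataVec p => sketchApply S x :=
  Measurable.comp (g := fun z : SketchMat M p × DataVec p => sketchApply z.1 z.2)
    (f := fun x => (S, x)) measurable_sketchApply measurable_prodMk_left

theorem sketchKernel_apply (S : SketchMat M p) (u : DataVec p) :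
    Q.sketchKernel S u = (Q.sketch S).map fun T => sketchApply T u := by
  refine Measure.ext_of_lintegral _ fun F hF => ?_
  have hF2 : Measurable fun z : SketchMat M p × DataVec p => F (sketchApply z.1 z.2) :=
    hF.comp measurable_sketchApply
  have hF3 : ∀ T : SketchMat M p, Measurable fun u : DataVec p => F (sketchApply T u) := fun T =>
    hF.comp (measurable_sketchApply_right T)
  unfold sketchKernel
  rw [Kernel.map_apply _ measurable_sketchApply, lintegral_map hF measurable_sketchApply,
    lintegral_map hF (measurable_sketchApply_left u), Kernel.prod_apply,
    lintegral_prod _ hF2.aemeasurable, Kernel.const_apply, Kernel.id_apply]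
  exact lintegral_congr fun T => lintegral_dirac' _ (hF3 T)

/-- The three independent quantizations are reordered as data, then sketch, then feature, so that
variances accumulate stage by stage. -/
theorem featureKernel_apply (S : SketchMat M p) (x : DataVec p) :
    Q.featureKernel S x = ((Q.data x).bind (Q.sketchKernel S)).bind Q.feature := by
  unfold featureKernel
  rw [Kernel.comp_apply]
  congr 1
  refine Measure.ext_of_lintegral _ fun F hF => ?_
  have hF2 : Measurable fun z : SketchMat M p × DataVec p => F (sketchApply z.1 z.2) :=
    hF.comp measurable_sketchApply
  rw [Kernel.map_apply _ measurable_sketchApply, lintegral_map hF measurable_sketchApply,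
    Measure.lintegral_bind (Kernel.aemeasurable _) hF.aemeasurable, Kernel.prod_apply,
    lintegral_prod_symm _ hF2.aemeasurable, Kernel.const_apply]
  refine lintegral_congr fun u => ?_
  rw [sketchKernel_apply, lintegral_map hF (measurable_sketchApply_left u)]

/-- Given `u = t x`, the mean and variance of `⟨b, Q_s(S) u⟩`. -/
theorem meanVar_sketchKernel {e : ErrorLevels} (hQ : Q.Unbiased) (he : e.Nonneg)
    (hm : Q.Multiplicative e) {x : DataVec p} (hx : SketchConverges S x) (b : FeatVec M)
    {u : DataVec p} {t : ℝ} (hu : ∀ j, u j = t * x j) :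
    MeanVar (Q.sketchKernel S u) (fun f => b ⬝ᵥ f) (t * (b ⬝ᵥ sketchApply S x))
      (e.sketch * (t * (b ⬝ᵥ sketchApply S x) - 0) ^ 2) := by
  have hmeas : ∀ b : FeatVec M,
      Measurable fun (T : SketchMat M p) (j : Coord p) => ∑ i, b i * T i j := fun b => by fun_prop
  have hex : ∀ b : FeatVec M, ∃ η : SketchMat M p → ℝ,
      (∀ᵐ T ∂(Q.sketch S), ∀ j, ∑ i, b i * T i j = η T * ∑ i, b i * S i j) ∧
        MeanVar (Q.sketch S) η 1 e.sketch := fun b => by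
    have : IsProbabilityMeasure ((Q.sketch S).map fun T j => ∑ i, b i * T i j) :=
      Measure.isProbabilityMeasure_map (hmeas b).aemeasurable
    obtain ⟨η, hη, h1, h2⟩ := exists_scalar_of_multiplicative he.2.1
      (fun c => meanVar_rowSketch hQ he hm S b c)
    refine ⟨fun T => η fun j => ∑ i, b i * T i j, ae_of_ae_map (hmeas b).aemeasurable h1, ?_⟩
    exact
    { aesm := (hη.comp (hmeas b)).aestronglyMeasurable
      nonneg := h2.nonneg
      mean := by
        have := h2.mean
        rwa [integral_map (hmeas b).aemeasurable hη.aestronglyMeasurable] at this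
      variance := by
        have := h2.variance
        rwa [lintegral_map ((hη.sub_const 1).pow_const 2).ennreal_ofReal (hmeas b)] at this }
  choose η hη1 hη2 using hex
  -- Taking `b` a basis vector, each row of the quantized sketch is a random multiple of the
  -- corresponding row of `S`, so its series inherits convergence.
  have hconv : ∀ᵐ T ∂(Q.sketch S), SketchConverges T u := by
    have h1 : ∀ i, ∀ᵐ T ∂(Q.sketch S), ∀ j, T i j = η (Pi.single i 1) T * S i j := fun i => by
      filter_upwards [hη1 (Pi.single i 1)] with T hT j
      simpa [Pi.single_apply] using hT j
    filter_upwards [ae_all_iff.mpr h1] with T hT i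
    refine ⟨η (Pi.single i 1) T * t * sketchApply S x i, ?_⟩
    refine ((hx.tendsto i).const_mul _).congr fun n => ?_
    rw [Finset.mul_sum]
    refine Finset.sum_congr rfl fun j _ => ?_
    rw [hT i j, hu]; ring
  -- The random scalar of the combination `bᵀ T` factors out of the partial sums, hence out of their
  -- limit.
  have hlim : ∀ᵐ T ∂(Q.sketch S),
      η b T * (t * (b ⬝ᵥ sketchApply S x)) = b ⬝ᵥ sketchApply T u := by
    filter_upwards [hconv, hη1 b] with T hT hb
    have h1 : Tendsto (fun n => ∑ i, b i * ∑ j ∈ firstCoords p n, T i j * u j) atTop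
        (𝓝 (b ⬝ᵥ sketchApply T u)) :=
      tendsto_finsetSum _ fun i _ => (hT.tendsto i).const_mul _
    have h2 : Tendsto (fun n => ∑ i, b i * ∑ j ∈ firstCoords p n, S i j * x j) atTop
        (𝓝 (b ⬝ᵥ sketchApply S x)) :=
      tendsto_finsetSum _ fun i _ => (hx.tendsto i).const_mul _
    rw [← mul_assoc]
    refine tendsto_nhds_unique ((h2.const_mul (η b T * t)).congr fun n => ?_) h1
    · simp_rw [Finset.mul_sum]
      rw [Finset.sum_comm, Finset.sum_comm (s := Finset.univ)]
      refine Finset.sum_congr rfl fun j _ => ?_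
      have h3 := hb j
      calc ∑ i, η b T * t * (b i * (S i j * x j)) = (η b T * ∑ i, b i * S i j) * (t * x j) := by
            rw [Finset.mul_sum, Finset.sum_mul]
            exact Finset.sum_congr rfl fun i _ => by ring
        _ = ∑ i, b i * (T i j * u j) := by
            rw [← h3, Finset.sum_mul, hu]
            exact Finset.sum_congr rfl fun i _ => by ring
  rw [sketchKernel_apply]
  have h4 := ((hη2 b).mul_const (t * (b ⬝ᵥ sketchApply S x))).congr hlim
  rw [one_mul] at h4
  rw [sub_zero]
  exact h4.map (measurable_sketchApply_left u) (by unfold dotProduct; fun_prop)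

/-- Mean and variance of the quantized feature in the direction `b`. -/
theorem meanVar_featureKernel {e : ErrorLevels} (hQ : Q.Unbiased) (he : e.Nonneg)
    (hm : Q.Multiplicative e) {x : DataVec p} (hx : SketchConverges S x) (b : FeatVec M) :
    MeanVar (Q.featureKernel S x) (fun f => b ⬝ᵥ f) (b ⬝ᵥ sketchApply S x)
      ((e.featureFactor - 1) * (b ⬝ᵥ sketchApply S x) ^ 2) := by
  have hbm : Measurable fun f : FeatVec M => b ⬝ᵥ f := by unfold dotProduct; fun_prop
  obtain ⟨η, -, h1, h2⟩ := exists_scalar_of_multiplicative he.1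
    (fun c => UnbiasedVec.meanVar_finsupp he.1 hQ.1 hm.1 x c)
  set c := b ⬝ᵥ sketchApply S x with hc
  -- Data quantization has replaced `x` by a random multiple of itself, which is the form required
  -- of `u` in the sketch stage.
  have h3 := (h2.mul_const c).bind (η := Q.sketchKernel S) hbm (s := 0) he.2.1 (by
    filter_upwards [h1] with u hu
    exact meanVar_sketchKernel hQ he hm hx b hu)
  have h4 := h3.bind (η := Q.feature) hbm (s := 0) he.2.2.1 (Eventually.of_forall fun f => by
    rw [sub_zero]
    exact UnbiasedVec.meanVar he.2.2.1 hQ.2.2.1 hm.2.2.1 f b)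
  rw [featureKernel_apply]
  convert h4 using 1
  · ring
  · unfold ErrorLevels.featureFactor
    ring

end Quantizers

end

/-! ### Covariance and risk before and after quantization -/

section

namespace Quantizers

variable {M : ℕ} {p : ℕ∞} {Q : Quantizers M p} {D : DataModel p} {S : SketchMat M p}

theorem quad_nonneg (h2 : ∀ i, MemLp (fun f : FeatVec M => f i) 2 (Q.featureLaw D S))
    (d : FeatVec M) : 0 ≤ quad (Q.featureCov D S) d := by
  have := (posSemidef_featureCov h2).dotProduct_mulVec_nonneg d
  rwa [star_trivial] at this

/-- Parameter and activation errors are relative to the prediction itself, so they persist at the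
minimizer. This produces the term `α * T₀`, where `T₀` bounds the mean energy of the minimizer. -/
theorem stepControl {e : ErrorLevels} {α β γ σHi T₀ : ℝ} (hα : 0 ≤ α) (hT₀ : 0 ≤ T₀)
    (hQ : Q.Unbiased) (he : e.Nonneg) (hm : Q.Multiplicative e) (hl : Q.LabelSquareIntegrable D)
    (h4 : Q.FourthMoment D S α β) {vq : DataVec p → FeatVec M} (hvq : Measurable vq)
    (hmin : ∀ᵐ w ∂D.prior, ∀ v, Q.quantRisk D S w (vq w) ≤ Q.quantRisk D S w v)
    (hint : ∀ i j, Integrable (fun r : DataVec p × (FeatVec M × ℝ) =>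
      (r.2.2 - vq r.1 ⬝ᵥ r.2.1) ^ 2 * (r.2.1 i * r.2.1 j)) (D.prior ⊗ₘ Q.sample D S))
    (hle : (σHi ^ 2 • Q.featureCov D S - Q.noiseCov D S vq).PosSemidef)
    (hT : ∫⁻ w, ENNReal.ofReal (quad (Q.featureCov D S) (vq w)) ∂D.prior ≤ ENNReal.ofReal T₀) :
    StepControl Q D S γ (Q.featureCov D S) vq (3 / 2 * (1 + e.amplification) * α)
      (3 * (1 + e.amplification) * (σHi ^ 2 + α * T₀)) := by
  have hq := quad_nonneg h4.memLp_two
  have hκ := he.activationNoise_nonneg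
  have heo : 0 ≤ e.outGrad := he.2.2.2.2.2
  have hamp : 0 ≤ 1 + e.amplification := by rw [e.one_add_amplification]; positivity
  refine ⟨hvq, ?_, fun u => ?_⟩
  · filter_upwards [hmin, ae_memLp_label (S := S) hl] with w hw hz u v hfin
    exact integral_sgdStep hQ he hm h4.memLp_two hz hw hfin
  · have hqm : Measurable fun w => ENNReal.ofReal
        (3 * (1 + e.amplification) * α * quad (Q.featureCov D S) (vq w) *
          quad (Q.featureCov D S) u) := by
      unfold quad dotProduct Matrix.mulVec dotProduct; fun_prop
    refine ⟨fun w => ENNReal.ofReal (3 * (1 + e.amplification)) * Q.directionNoise D S vq u w +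
      ENNReal.ofReal (3 * (1 + e.amplification) * α * quad (Q.featureCov D S) (vq w) *
        quad (Q.featureCov D S) u), ?_, ?_, fun w v => ?_⟩
    · exact ((measurable_directionNoise hvq u).const_mul _).add hqm
    · rw [lintegral_add_right _ hqm, lintegral_const_mul' _ _ ENNReal.ofReal_ne_top]
      have h1 : ∀ w, ENNReal.ofReal (3 * (1 + e.amplification) * α *
          quad (Q.featureCov D S) (vq w) * quad (Q.featureCov D S) u) =
          ENNReal.ofReal (3 * (1 + e.amplification) * α * quad (Q.featureCov D S) u) *
            ENNReal.ofReal (quad (Q.featureCov D S) (vq w)) := fun w => by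
        have := hq u
        rw [← ENNReal.ofReal_mul (by positivity)]; congr 1; ring
      simp_rw [h1]
      have h3 := hq u
      rw [lintegral_const_mul' _ _ ENNReal.ofReal_ne_top]
      calc _ ≤ ENNReal.ofReal (3 * (1 + e.amplification)) *
            ENNReal.ofReal (σHi ^ 2 * quad (Q.featureCov D S) u) +
          ENNReal.ofReal (3 * (1 + e.amplification) * α * quad (Q.featureCov D S) u) *
            ENNReal.ofReal T₀ := by
            gcongr
            exact lintegral_directionNoise_le hvq hint hle u
        _ = _ := by
            rw [← ENNReal.ofReal_mul (by positivity), ← ENNReal.ofReal_mul (by positivity),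
              ← ENNReal.ofReal_add (by positivity) (by positivity)]
            congr 1; ring
    · refine (lintegral_sgdStep_sq_le hQ he hm h4 vq w u v).trans (le_of_eq ?_)
      rw [show 3 / 2 * (1 + e.amplification) * α * quad (Q.featureCov D S) (v - vq w) *
          quad (Q.featureCov D S) u = 3 / 2 * (1 + e.amplification) * α *
          quad (Q.featureCov D S) u * quad (Q.featureCov D S) (v - vq w) by ring]

/-! ### Quantized and population covariance -/

/-- By Jensen, unbiased quantization can only increase second moments, in every direction. -/
theorem lintegral_sketchApply_sq_le {e : ErrorLevels} (hQ : Q.Unbiased) (he : e.Nonneg)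
    (hm : Q.Multiplicative e) (hS : ∀ᵐ x ∂D.law, SketchConverges S x)
    (h2 : ∀ i, MemLp (fun f : FeatVec M => f i) 2 (Q.featureLaw D S)) (b : FeatVec M) :
    ∫⁻ x, ENNReal.ofReal ((b ⬝ᵥ sketchApply S x) ^ 2) ∂D.law ≤
      ENNReal.ofReal (quad (Q.featureCov D S) b) := by
  rw [← lintegral_dotProduct_sq h2, lintegral_featureLaw
    ((measurable_dotProduct_left b).pow_const 2).ennreal_ofReal]
  refine lintegral_mono_ae ?_
  filter_upwards [hS] with x hx
  simp_rw [dotProduct_comm _ b]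
  exact (meanVar_featureKernel hQ he hm hx b).le_lintegral_sq

/-- The relative variance is at most `Φ - 1`, so the second moment grows by at most the factor `Φ`.
-/
theorem ofReal_quad_featureCov_le {e : ErrorLevels} (hQ : Q.Unbiased) (he : e.Nonneg)
    (hm : Q.Multiplicative e) (hS : ∀ᵐ x ∂D.law, SketchConverges S x)
    (h2 : ∀ i, MemLp (fun f : FeatVec M => f i) 2 (Q.featureLaw D S)) (b : FeatVec M) :
    ENNReal.ofReal (quad (Q.featureCov D S) b) ≤ ENNReal.ofReal e.featureFactor *
      ∫⁻ x, ENNReal.ofReal ((b ⬝ᵥ sketchApply S x) ^ 2) ∂D.law := by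
  have hΦ := he.one_le_featureFactor
  rw [← lintegral_dotProduct_sq h2, lintegral_featureLaw
    ((measurable_dotProduct_left b).pow_const 2).ennreal_ofReal,
    ← lintegral_const_mul' _ _ ENNReal.ofReal_ne_top]
  refine lintegral_mono_ae ?_
  filter_upwards [hS] with x hx
  simp_rw [dotProduct_comm _ b]
  refine (meanVar_featureKernel hQ he hm hx b).lintegral_sq_le.trans (le_of_eq ?_)
  rw [← ENNReal.ofReal_mul (by linarith)]
  congr 1; ring

/-! ### Quantized and population risk -/

/-- Second moment of the response, given the target. -/
def _root_.QuantSGD.DataModel.responseSq (D : DataModel p) (w : DataVec p) : ℝ≥0∞ :=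
  ∫⁻ x, ∫⁻ y, ENNReal.ofReal (y ^ 2) ∂(D.label (w, x)) ∂D.law

/-- Second moment of the label quantization error, given the target. -/
def labelNoise (Q : Quantizers M p) (D : DataModel p) (w : DataVec p) : ℝ≥0∞ :=
  ∫⁻ x, ∫⁻ y, ∫⁻ z, ENNReal.ofReal ((z - y) ^ 2) ∂(Q.label y) ∂(D.label (w, x)) ∂D.law

theorem measurable_popRisk_integrand (S : SketchMat M p) (v : FeatVec M) :
    Measurable fun t : DataVec p × ℝ =>
      ENNReal.ofReal ((1 / 2) * (sketchApply S t.1 ⬝ᵥ v - t.2) ^ 2) := by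
  have h1 : Measurable fun t : DataVec p × ℝ => sketchApply S t.1 ⬝ᵥ v :=
    (measurable_dotProduct_left v).comp ((measurable_sketchApply_right S).comp measurable_fst)
  exact (((h1.sub measurable_snd).pow_const 2).const_mul _).ennreal_ofReal

theorem popRisk_eq (w : DataVec p) (v : FeatVec M) : D.popRisk S w v =
    ∫⁻ x, ∫⁻ y, ENNReal.ofReal ((1 / 2) * (sketchApply S x ⬝ᵥ v - y) ^ 2)
      ∂(D.label (w, x)) ∂D.law :=
  D.lintegral_sampleXY w (measurable_popRisk_integrand S v)

theorem measurable_popRisk_inner (w : DataVec p) (v : FeatVec M) :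
    Measurable fun x => ∫⁻ y, ENNReal.ofReal ((1 / 2) * (sketchApply S x ⬝ᵥ v - y) ^ 2)
      ∂(D.label (w, x)) :=
  Measurable.lintegral_kernel_prod_right' (κ := D.label.comap (Prod.mk w) measurable_prodMk_left)
    (measurable_popRisk_integrand S v)

theorem quantRisk_eq (w : DataVec p) (v : FeatVec M) : Q.quantRisk D S w v =
    ∫⁻ x, ∫⁻ y, ∫⁻ f, ∫⁻ z, ENNReal.ofReal ((1 / 2) * (f ⬝ᵥ v - z) ^ 2) ∂(Q.label y)
      ∂(Q.featureKernel S x) ∂(D.label (w, x)) ∂D.law :=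
  lintegral_sample w (F := fun t => ENNReal.ofReal ((1 / 2) * (t.1 ⬝ᵥ v - t.2) ^ 2))
    (by unfold dotProduct; fun_prop)

/-- The bias–variance identity is applied first to the quantized label and then to the quantized
feature; the two errors are independent and centred, so no cross term survives. -/
theorem lintegral_lintegral_risk {e : ErrorLevels} (hQ : Q.Unbiased) (he : e.Nonneg)
    (hm : Q.Multiplicative e) {x : DataVec p} (hx : SketchConverges S x) (v : FeatVec M) (y : ℝ) :
    ∫⁻ f, ∫⁻ z, ENNReal.ofReal ((1 / 2) * (f ⬝ᵥ v - z) ^ 2) ∂(Q.label y) ∂(Q.featureKernel S x) =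
      ENNReal.ofReal ((1 / 2) * (sketchApply S x ⬝ᵥ v - y) ^ 2) +
        (ENNReal.ofReal (1 / 2) * ∫⁻ f, ENNReal.ofReal ((v ⬝ᵥ f - v ⬝ᵥ sketchApply S x) ^ 2)
            ∂(Q.featureKernel S x) +
          ENNReal.ofReal (1 / 2) * ∫⁻ z, ENNReal.ofReal ((z - y) ^ 2) ∂(Q.label y)) := by
  have hz := hQ.2.2.2.1 y
  have hf := meanVar_featureKernel hQ he hm hx v
  have h1 : ∀ f : FeatVec M, ∫⁻ z, ENNReal.ofReal ((1 / 2) * (f ⬝ᵥ v - z) ^ 2) ∂(Q.label y) =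
      ENNReal.ofReal (1 / 2) * (ENNReal.ofReal ((v ⬝ᵥ f - y) ^ 2) +
        ∫⁻ z, ENNReal.ofReal ((z - y) ^ 2) ∂(Q.label y)) := fun f => by
    rw [show (v ⬝ᵥ f - y) ^ 2 = (y - v ⬝ᵥ f) ^ 2 by ring, ← lintegral_sq_sub_eq hz.1 hz.2,
      ← lintegral_const_mul' _ _ ENNReal.ofReal_ne_top]
    refine lintegral_congr fun z => ?_
    rw [← ENNReal.ofReal_mul (by norm_num), dotProduct_comm f v]
    congr 1; ring
  simp_rw [h1]
  rw [lintegral_const_mul' _ _ ENNReal.ofReal_ne_top, lintegral_add_right _ measurable_const,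
    lintegral_sq_sub_eq hf.integrable hf.mean, lintegral_const, measure_univ, mul_one, mul_add,
    mul_add, ← ENNReal.ofReal_mul (by norm_num), dotProduct_comm v, add_assoc]

theorem popRisk_add_labelNoise_le {e : ErrorLevels} (hQ : Q.Unbiased) (he : e.Nonneg)
    (hm : Q.Multiplicative e) (hS : ∀ᵐ x ∂D.law, SketchConverges S x) (w : DataVec p)
    (v : FeatVec M) :
    D.popRisk S w v + ENNReal.ofReal (1 / 2) * Q.labelNoise D w ≤ Q.quantRisk D S w v := by
  rw [quantRisk_eq, popRisk_eq, labelNoise, ← lintegral_const_mul' _ _ ENNReal.ofReal_ne_top,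
    ← lintegral_add_left (measurable_popRisk_inner w v)]
  refine lintegral_mono_ae ?_
  filter_upwards [hS] with x hx
  have hp : ∀ c : ℝ, Measurable fun y : ℝ => ENNReal.ofReal ((1 / 2) * (c - y) ^ 2) :=
    fun c => by fun_prop
  rw [← lintegral_const_mul' _ _ ENNReal.ofReal_ne_top, ← lintegral_add_left (hp _)]
  refine lintegral_mono fun y => ?_
  rw [lintegral_lintegral_risk hQ he hm hx]
  exact add_le_add le_rfl le_add_self

/-- Feature noise acts as a ridge penalty, and shrinking by `Φ⁻¹` compensates it exactly: `(X/Φ -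
y)² + (Φ - 1) (X/Φ)² = Φ⁻¹ (X - y)² + (1 - Φ⁻¹) y²`. The distortion therefore enters additively,
multiplied by the energy of the response. -/
theorem quantRisk_smul_le {e : ErrorLevels} (hQ : Q.Unbiased) (he : e.Nonneg)
    (hm : Q.Multiplicative e) (hS : ∀ᵐ x ∂D.law, SketchConverges S x) (w : DataVec p)
    (V : FeatVec M) :
    Q.quantRisk D S w (e.featureFactor⁻¹ • V) ≤ ENNReal.ofReal (1 / 2) * Q.labelNoise D w +
      (ENNReal.ofReal e.featureFactor⁻¹ * D.popRisk S w V +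
        ENNReal.ofReal (1 / 2 * e.distortion) * D.responseSq w) := by
  have hΦ := he.one_le_featureFactor
  have hε : e.distortion = 1 - e.featureFactor⁻¹ := by
    have := e.one_sub_distortion
    rw [one_div] at this; linarith
  set Φ := e.featureFactor
  have hΦi : Φ⁻¹ ≤ 1 := inv_le_one_of_one_le₀ hΦ
  have hΦ0 : 0 < Φ := by linarith
  have hΦi0 : 0 < Φ⁻¹ := inv_pos.mpr hΦ0
  have hε0 : 0 ≤ e.distortion := by rw [hε]; linarith
  have hym : Measurable fun x => ∫⁻ y, ENNReal.ofReal (y ^ 2) ∂(D.label (w, x)) :=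
    (Measurable.lintegral_kernel (κ := D.label) (f := fun y => ENNReal.ofReal (y ^ 2))
      (by fun_prop)).comp measurable_prodMk_left
  have hsm : Measurable fun x => ENNReal.ofReal Φ⁻¹ *
      ∫⁻ y, ENNReal.ofReal ((1 / 2) * (sketchApply S x ⬝ᵥ V - y) ^ 2) ∂(D.label (w, x)) +
      ENNReal.ofReal (1 / 2 * e.distortion) * ∫⁻ y, ENNReal.ofReal (y ^ 2) ∂(D.label (w, x)) :=
    ((measurable_popRisk_inner w V).const_mul _).add (hym.const_mul _)
  rw [quantRisk_eq, popRisk_eq, labelNoise, DataModel.responseSq,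
    ← lintegral_const_mul' _ _ ENNReal.ofReal_ne_top,
    ← lintegral_const_mul' _ _ ENNReal.ofReal_ne_top,
    ← lintegral_const_mul' _ _ ENNReal.ofReal_ne_top,
    ← lintegral_add_right _ (hym.const_mul _),
    ← lintegral_add_right _ hsm]
  refine lintegral_mono_ae ?_
  filter_upwards [hS] with x hx
  have hpy : ∀ c : ℝ, Measurable fun y : ℝ => ENNReal.ofReal Φ⁻¹ *
      ENNReal.ofReal ((1 / 2) * (c - y) ^ 2) + ENNReal.ofReal (1 / 2 * e.distortion) *
        ENNReal.ofReal (y ^ 2) := fun c => by fun_prop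
  have hy : Measurable fun y : ℝ => ENNReal.ofReal (1 / 2 * e.distortion) *
    ENNReal.ofReal (y ^ 2) := by fun_prop
  rw [← lintegral_const_mul' _ _ ENNReal.ofReal_ne_top,
    ← lintegral_const_mul' _ _ ENNReal.ofReal_ne_top,
    ← lintegral_const_mul' _ _ ENNReal.ofReal_ne_top,
    ← lintegral_add_right _ hy, ← lintegral_add_right _ (hpy _)]
  refine lintegral_mono fun y => ?_
  rw [lintegral_lintegral_risk hQ he hm hx, ← add_assoc,
    add_comm _ (ENNReal.ofReal (1 / 2) * ∫⁻ z, ENNReal.ofReal ((z - y) ^ 2) ∂(Q.label y))]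
  refine add_le_add le_rfl ?_
  have hv := (meanVar_featureKernel hQ he hm hx (Φ⁻¹ • V)).variance
  set X := sketchApply S x ⬝ᵥ V with hX
  have h1 : sketchApply S x ⬝ᵥ (Φ⁻¹ • V) = Φ⁻¹ * X := by rw [dotProduct_smul, smul_eq_mul]
  rw [dotProduct_comm _ (sketchApply S x), h1] at hv
  rw [h1, dotProduct_comm _ (sketchApply S x), h1]
  refine (add_le_add le_rfl (mul_le_mul_right hv _)).trans ?_
  have hΦ1 : 0 ≤ Φ - 1 := by linarith
  rw [← ENNReal.ofReal_mul (by norm_num), ← ENNReal.ofReal_mul hΦi0.le,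
    ← ENNReal.ofReal_mul (by positivity), ← ENNReal.ofReal_add (by positivity) (by positivity),
    ← ENNReal.ofReal_add (by positivity) (by positivity)]
  refine ENNReal.ofReal_le_ofReal (le_of_eq ?_)
  rw [hε]
  field_simp
  ring

/-- The quantized risk is quadratic around its minimizer. -/
theorem quantRisk_eq_add_quad
    (h2 : ∀ i, MemLp (fun f : FeatVec M => f i) 2 (Q.featureLaw D S)) {w : DataVec p}
    {vq : FeatVec M} (hz : MemLp (fun t : FeatVec M × ℝ => t.2) 2 (Q.sample D S w))
    (hmin : ∀ v, Q.quantRisk D S w vq ≤ Q.quantRisk D S w v) (v : FeatVec M) :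
    Q.quantRisk D S w v = Q.quantRisk D S w vq +
      ENNReal.ofReal (1 / 2 * quad (Q.featureCov D S) (v - vq)) := by
  have hf := memLp_dotProduct_sample h2 w
  have he : ∀ v, MemLp (fun t : FeatVec M × ℝ => t.1 ⬝ᵥ v - t.2) 2 (Q.sample D S w) :=
    fun v => (hf v).sub hz
  have hr : ∀ v, Q.quantRisk D S w v =
      ENNReal.ofReal ((1 / 2) * ∫ t, (t.1 ⬝ᵥ v - t.2) ^ 2 ∂(Q.sample D S w)) := fun v => by
    unfold quantRisk
    simp_rw [ENNReal.ofReal_mul (show (0 : ℝ) ≤ 1 / 2 by norm_num)]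
    rw [lintegral_const_mul' _ _ ENNReal.ofReal_ne_top, lintegral_sq_eq_ofReal (he v)]
  have hq := quad_nonneg h2 (v - vq)
  rw [hr, hr, ← ENNReal.ofReal_add (by positivity) (by positivity), ← mul_add]
  congr 2
  have hA : Integrable (fun t : FeatVec M × ℝ => t.2 * (t.1 ⬝ᵥ (v - vq))) (Q.sample D S w) :=
    hz.integrable_mul (hf _)
  have hB : Integrable (fun t : FeatVec M × ℝ => (t.1 ⬝ᵥ (v - vq)) * (t.1 ⬝ᵥ vq))
    (Q.sample D S w) := (hf _).integrable_mul (hf _)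
  have hC : Integrable (fun t : FeatVec M × ℝ => 2 * ((t.1 ⬝ᵥ (v - vq)) * (t.1 ⬝ᵥ vq) -
    t.2 * (t.1 ⬝ᵥ (v - vq)))) (Q.sample D S w) := (hB.sub hA).const_mul 2
  have hE : Integrable (fun t : FeatVec M × ℝ => 2 * ((t.1 ⬝ᵥ (v - vq)) * (t.1 ⬝ᵥ vq) -
    t.2 * (t.1 ⬝ᵥ (v - vq))) + (t.1 ⬝ᵥ (v - vq)) ^ 2) (Q.sample D S w) :=
    hC.add (hf _).integrable_sq
  have h1 : ∀ t : FeatVec M × ℝ, (t.1 ⬝ᵥ v - t.2) ^ 2 = (t.1 ⬝ᵥ vq - t.2) ^ 2 +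
      (2 * ((t.1 ⬝ᵥ (v - vq)) * (t.1 ⬝ᵥ vq) - t.2 * (t.1 ⬝ᵥ (v - vq))) +
        (t.1 ⬝ᵥ (v - vq)) ^ 2) := fun t => by rw [dotProduct_sub]; ring
  have h3 : ∫ t, (t.1 ⬝ᵥ (v - vq)) * (t.1 ⬝ᵥ vq) ∂(Q.sample D S w) =
      (v - vq) ⬝ᵥ Q.featureCov D S *ᵥ vq := by
    rw [← integral_dotProduct_mul_dotProduct h2]
    exact integral_sample_fst w
      ((measurable_dotProduct_left _).mul (measurable_dotProduct_left _))
  have h4 : ∫ t, (t.1 ⬝ᵥ (v - vq)) ^ 2 ∂(Q.sample D S w) = quad (Q.featureCov D S) (v - vq) := by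
    rw [← integral_dotProduct_sq h2]
    exact integral_sample_fst w ((measurable_dotProduct_left _).pow_const 2)
  simp_rw [h1]
  rw [integral_add (he vq).integrable_sq hE, integral_add hC (hf _).integrable_sq,
    integral_const_mul, integral_sub hB hA, h3, integral_label_mul_dotProduct h2 hz hmin, h4]
  ring

/-- The risk bound of a comparator `V`, shrunk by the feature factor. -/
def comparatorRisk (D : DataModel p) (S : SketchMat M p) (e : ErrorLevels) (w : DataVec p)
    (V : FeatVec M) : ℝ≥0∞ :=
  ENNReal.ofReal e.featureFactor⁻¹ * D.popRisk S w V +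
    ENNReal.ofReal (1 / 2 * e.distortion) * D.responseSq w

/-- The label noise sits in both the lower and the upper estimate of the quantized risk and cancels.
What remains is the quadratic excess around the minimizer: it bounds the distance from the shrunk
comparator to the minimizer, and transfers the comparator risk to every `v`. -/
theorem quad_le_comparatorRisk_and_popRisk_le {e : ErrorLevels} (hQ : Q.Unbiased) (he : e.Nonneg)
    (hm : Q.Multiplicative e) (hS : ∀ᵐ x ∂D.law, SketchConverges S x)
    (h2 : ∀ i, MemLp (fun f : FeatVec M => f i) 2 (Q.featureLaw D S)) {w : DataVec p}
    {vq : FeatVec M} (hz : MemLp (fun t : FeatVec M × ℝ => t.2) 2 (Q.sample D S w))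
    (hmin : ∀ v, Q.quantRisk D S w vq ≤ Q.quantRisk D S w v) (V : FeatVec M) :
    ENNReal.ofReal (1 / 2 * quad (Q.featureCov D S) (e.featureFactor⁻¹ • V - vq)) ≤
        comparatorRisk D S e w V ∧
      ∀ v, D.popRisk S w v ≤ ENNReal.ofReal (1 / 2 * quad (Q.featureCov D S) (v - vq)) +
        comparatorRisk D S e w V := by
  -- Cancelling in `ℝ≥0∞` needs finiteness, obtained from the quantized risk of the zero parameter.
  have hfin : ENNReal.ofReal (1 / 2) * Q.labelNoise D w ≠ ∞ := by
    refine ne_top_of_le_ne_top ?_ (le_add_self.trans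
      (popRisk_add_labelNoise_le hQ he hm hS w (0 : FeatVec M)))
    unfold quantRisk
    simp_rw [ENNReal.ofReal_mul (show (0 : ℝ) ≤ 1 / 2 by norm_num)]
    have hL : MemLp (fun t : FeatVec M × ℝ => t.1 ⬝ᵥ (0 : FeatVec M) - t.2) 2 (Q.sample D S w) :=
      (memLp_dotProduct_sample h2 w 0).sub hz
    rw [lintegral_const_mul' _ _ ENNReal.ofReal_ne_top, lintegral_sq_eq_ofReal hL]
    exact ENNReal.mul_ne_top ENNReal.ofReal_ne_top ENNReal.ofReal_ne_top
  have h1 := quantRisk_smul_le hQ he hm hS w V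
  rw [quantRisk_eq_add_quad h2 hz hmin] at h1
  refine ⟨?_, fun v => ?_⟩
  · have h3 := popRisk_add_labelNoise_le hQ he hm hS w vq
    have h4 := (add_le_add_left (le_add_self.trans h3) _).trans h1
    exact (ENNReal.add_le_add_iff_left hfin).mp h4
  · have h3 := popRisk_add_labelNoise_le hQ he hm hS w v
    rw [quantRisk_eq_add_quad h2 hz hmin] at h3
    have h4 := le_self_add.trans h1
    have h5 := h3.trans (add_le_add_left h4 _)
    rw [add_comm (D.popRisk S w v), add_assoc, ENNReal.add_le_add_iff_left hfin] at h5
    rw [add_comm]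
    exact h5

end Quantizers

end

section

/-! ### Tails of power series -/

/-- A discrete form of comparison with the integral of `x ^ (-a)`, from `log x ≥ 1 - 1 / x` and `exp
y ≥ 1 + y`. -/
theorem rpow_neg_le_sub {a m : ℝ} (ha : 1 < a) (hm : 0 < m) :
    (a - 1) * (m + 1) ^ (-a) ≤ m ^ (1 - a) - (m + 1) ^ (1 - a) := by
  have h1 : (m + 1) ^ (-a) = (m + 1) ^ (1 - a) * (1 / (m + 1)) := by
    rw [show -a = (1 - a) - 1 by ring, Real.rpow_sub_one (by positivity)]; ring
  have h2 : m ^ (1 - a) = (m + 1) ^ (1 - a) * ((m + 1) / m) ^ (a - 1) := by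
    rw [Real.div_rpow (by positivity) hm.le, show a - 1 = -(1 - a) by ring,
      Real.rpow_neg (by positivity), Real.rpow_neg hm.le]
    have : (0 : ℝ) < (m + 1) ^ (1 - a) := by positivity
    have : (0 : ℝ) < m ^ (1 - a) := by positivity
    field_simp
  have h3 : 1 + (a - 1) * (1 / (m + 1)) ≤ ((m + 1) / m) ^ (a - 1) := by
    have h4 := Real.one_sub_inv_le_log_of_pos (show 0 < (m + 1) / m by positivity)
    have h5 := Real.add_one_le_exp (Real.log ((m + 1) / m) * (a - 1))
    rw [← Real.rpow_def_of_pos (by positivity)] at h5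
    have h6 : 1 - ((m + 1) / m)⁻¹ = 1 / (m + 1) := by field_simp; ring
    rw [h6] at h4
    nlinarith
  have h7 : (0 : ℝ) < (m + 1) ^ (1 - a) := by positivity
  rw [h1, h2]
  nlinarith

/-- The first term is bounded by `(k + 1) ^ (1 - a)` and the rest telescopes to `1 / (a - 1)` times
the same power, whence `1 + 1 / (a - 1) = a / (a - 1)`. -/
theorem sum_rpow_neg_le {a : ℝ} (ha : 1 < a) (k n : ℕ) :
    ∑ j ∈ Finset.range n, ((k + j : ℕ) + 1 : ℝ) ^ (-a) ≤
      a / (a - 1) * ((k : ℝ) + 1) ^ (1 - a) := by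
  have ha1 : 0 < a - 1 := by linarith
  have h : ∀ n : ℕ, ∑ j ∈ Finset.range (n + 1), ((k + j : ℕ) + 1 : ℝ) ^ (-a) ≤
      ((k : ℝ) + 1) ^ (1 - a) + (((k : ℝ) + 1) ^ (1 - a) -
        ((k + n : ℕ) + 1 : ℝ) ^ (1 - a)) / (a - 1) := fun n => by
    induction n with
    | zero =>
      simp only [zero_add, Finset.range_one, Finset.sum_singleton, add_zero, sub_self, zero_div]
      exact Real.rpow_le_rpow_of_exponent_le (by simp) (by linarith)
    | succ n ih =>
      rw [Finset.sum_range_succ]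
      have h1 := rpow_neg_le_sub ha (show (0 : ℝ) < (k + n : ℕ) + 1 by positivity)
      have h2 : ((k + (n + 1) : ℕ) + 1 : ℝ) = (k + n : ℕ) + 1 + 1 := by push_cast; ring
      rw [h2]
      have h3 : ((k + n : ℕ) + 1 + 1 : ℝ) ^ (-a) ≤ (((k + n : ℕ) + 1 : ℝ) ^ (1 - a) -
          ((k + n : ℕ) + 1 + 1 : ℝ) ^ (1 - a)) / (a - 1) := by
        rw [le_div_iff₀ ha1]; linarith
      rw [sub_div] at h3 ih ⊢
      linarith
  have hk : (0 : ℝ) < ((k : ℝ) + 1) ^ (1 - a) := by positivity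
  rcases n with _ | n
  · simp only [Finset.range_zero, Finset.sum_empty]; positivity
  · refine (h n).trans ?_
    have : (0 : ℝ) < ((k + n : ℕ) + 1 : ℝ) ^ (1 - a) := by positivity
    rw [div_mul_eq_mul_div, ← sub_nonneg]
    have e : a * ((k : ℝ) + 1) ^ (1 - a) / (a - 1) - (((k : ℝ) + 1) ^ (1 - a) +
        (((k : ℝ) + 1) ^ (1 - a) - ((k + n : ℕ) + 1 : ℝ) ^ (1 - a)) / (a - 1)) =
        ((k + n : ℕ) + 1 : ℝ) ^ (1 - a) / (a - 1) := by field_simp; ring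
    rw [e]; positivity

theorem tsum_rpow_neg_le {a : ℝ} (ha : 1 < a) (p : ℕ∞) {c : ℝ} (hc : 0 ≤ c) (k : ℕ)
    {ev : Coord p → ℝ} (hev : ∀ i, ev i ≤ c * ((i.1 : ℝ) + 1) ^ (-a)) :
    ∑' l, (if l ∈ firstCoords p k then 0 else ENNReal.ofReal (ev l)) ≤
      ENNReal.ofReal (c * (a / (a - 1) * ((k : ℝ) + 1) ^ (1 - a))) := by
  set g : ℕ → ℝ≥0∞ := fun l => if l < k then 0 else ENNReal.ofReal (c * ((l : ℝ) + 1) ^ (-a))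
    with hg
  calc _ ≤ ∑' l : Coord p, g l.1 := by
        refine ENNReal.tsum_le_tsum fun l => ?_
        simp only [hg, firstCoords, Finset.mem_subtype, Finset.mem_range]
        split_ifs
        · exact le_rfl
        · exact ENNReal.ofReal_le_ofReal (hev l)
    _ ≤ ∑' l : ℕ, g l := ENNReal.tsum_comp_le_tsum_of_injective Subtype.val_injective g
    _ = ∑' j, g (j + k) := by
        rw [← Summable.sum_add_tsum_nat_add' (k := k) ENNReal.summable, Finset.sum_eq_zero, zero_add]
        intro i hi
        simp [hg, Finset.mem_range.mp hi]
    _ ≤ _ := by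
        refine ENNReal.tsum_le_of_sum_range_le fun n => ?_
        have h1 : ∀ j, g (j + k) = ENNReal.ofReal (c * ((k + j : ℕ) + 1 : ℝ) ^ (-a)) := fun j => by
          simp only [hg]
          rw [if_neg (by omega), add_comm j k]
        simp_rw [h1]
        rw [← ENNReal.ofReal_sum_of_nonneg fun j _ => by positivity, ← Finset.mul_sum]
        exact ENNReal.ofReal_le_ofReal (mul_le_mul_of_nonneg_left (sum_rpow_neg_le ha k n) hc)

/-! ### Square summable data -/

variable {p : ℕ∞}

theorem summable_mul_of_sq {ι : Type*} {x v : ι → ℝ} (hx : Summable fun j => x j ^ 2)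
    (hv : Summable fun j => v j ^ 2) : Summable fun j => x j * v j := by
  refine Summable.of_norm_bounded ((hx.add hv).mul_left (1 / 2)) fun j => ?_
  rw [Real.norm_eq_abs, abs_le]
  constructor <;> nlinarith [sq_nonneg (x j + v j), sq_nonneg (x j - v j)]

theorem sum_sq_le_normSq {x : DataVec p} (hx : Summable fun j => x j ^ 2)
    (F : Finset (Coord p)) : ∑ j ∈ F, x j ^ 2 ≤ normSq x := by
  unfold normSq
  exact hx.sum_le_tsum _ fun _ _ => sq_nonneg _

theorem sq_sum_le_normSq {x v : DataVec p} (hx : Summable fun j => x j ^ 2)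
    (hv : Summable fun j => v j ^ 2) (F : Finset (Coord p)) :
    (∑ j ∈ F, x j * v j) ^ 2 ≤ normSq x * normSq v := by
  refine (Finset.sum_mul_sq_le_sq_mul_sq F x v).trans ?_
  exact mul_le_mul (sum_sq_le_normSq hx F) (sum_sq_le_normSq hv F)
    (Finset.sum_nonneg fun _ _ => sq_nonneg _) (normSq_nonneg x)

theorem tendsto_sum_firstCoords {f : Coord p → ℝ} (hf : Summable f) :
    Tendsto (fun n => ∑ j ∈ firstCoords p n, f j) atTop (𝓝 (∑' j, f j)) :=
  hf.hasSum.comp tendsto_firstCoords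

theorem sq_tsum_le_normSq {x v : DataVec p} (hx : Summable fun j => x j ^ 2)
    (hv : Summable fun j => v j ^ 2) : (∑' j, x j * v j) ^ 2 ≤ normSq x * normSq v :=
  le_of_tendsto ((tendsto_sum_firstCoords (summable_mul_of_sq hx hv)).pow 2)
    (Eventually.of_forall fun _ => sq_sum_le_normSq hx hv _)

namespace DataModel

variable {D : DataModel p}

theorem lintegral_coord_sq (h : D.FiniteTrace) (j : Coord p) :
    ∫⁻ x, ENNReal.ofReal (x j ^ 2) ∂D.law = ENNReal.ofReal (D.cov j j) := by
  rw [lintegral_sq_eq_ofReal (h.1 j)]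
  congr 2
  ext x
  exact sq _

theorem lintegral_tsum_sq (h : D.FiniteTrace) :
    ∫⁻ x, ∑' j, ENNReal.ofReal (x j ^ 2) ∂D.law = ∑' j, ENNReal.ofReal (D.cov j j) := by
  have hm : ∀ j : Coord p, Measurable fun x : DataVec p => ENNReal.ofReal (x j ^ 2) := fun j => by
    fun_prop
  rw [lintegral_tsum fun j => (hm j).aemeasurable]
  exact tsum_congr fun j => lintegral_coord_sq h j

theorem tsum_ofReal_cov_ne_top (h : D.FiniteTrace) : ∑' j, ENNReal.ofReal (D.cov j j) ≠ ∞ :=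
  h.2.tsum_ofReal_ne_top

theorem ae_summable_sq (h : D.FiniteTrace) : ∀ᵐ x ∂D.law, Summable fun j => x j ^ 2 := by
  have h1 := ae_lt_top (Measurable.tsum fun j => by fun_prop)
    ((lintegral_tsum_sq h).trans_ne (tsum_ofReal_cov_ne_top h))
  filter_upwards [h1] with x hx
  have h2 := ENNReal.summable_toReal hx.ne
  simpa [ENNReal.toReal_ofReal, sq_nonneg] using h2

theorem lintegral_normSq (h : D.FiniteTrace) :
    ∫⁻ x, ENNReal.ofReal (normSq x) ∂D.law = ∑' j, ENNReal.ofReal (D.cov j j) := by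
  rw [← lintegral_tsum_sq h]
  refine lintegral_congr_ae ?_
  filter_upwards [ae_summable_sq h] with x hx
  exact ofReal_normSq hx

theorem integrable_normSq (h : D.FiniteTrace) : Integrable normSq D.law := by
  refine ⟨measurable_normSq.aestronglyMeasurable, ?_⟩
  rw [hasFiniteIntegral_iff_ofReal (Eventually.of_forall fun x => normSq_nonneg x),
    lintegral_normSq h]
  exact (tsum_ofReal_cov_ne_top h).lt_top

/-- The coordinate of `x` along `v`. -/
def along (v x : DataVec p) : ℝ := ∑' j, x j * v j

theorem memLp_along (h : D.FiniteTrace) {v : DataVec p} (hv : Summable fun j => v j ^ 2) :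
    MemLp (along v) 2 D.law := by
  have hm : AEStronglyMeasurable (along v) D.law := by
    refine aestronglyMeasurable_of_tendsto_ae atTop
      (f := fun n x => ∑ j ∈ firstCoords p n, x j * v j)
      (fun n => Measurable.aestronglyMeasurable (by fun_prop)) ?_
    filter_upwards [ae_summable_sq h] with x hx
    exact tendsto_sum_firstCoords (summable_mul_of_sq hx hv)
  rw [memLp_two_iff_integrable_sq hm]
  refine Integrable.mono' ((integrable_normSq h).mul_const (normSq v)) (hm.pow 2) ?_
  filter_upwards [ae_summable_sq h] with x hx
  rw [Real.norm_of_nonneg (sq_nonneg _)]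
  exact sq_tsum_le_normSq hx hv

/-- Dominated convergence, with `Y² + normSq x * normSq v` dominating all partial sums. -/
theorem tendsto_integral_mul_along (h : D.FiniteTrace) {v : DataVec p}
    (hv : Summable fun j => v j ^ 2) {Y : DataVec p → ℝ} (hY : MemLp Y 2 D.law) :
    Tendsto (fun n => ∑ j ∈ firstCoords p n, v j * ∫ x, Y x * x j ∂D.law) atTop
      (𝓝 (∫ x, Y x * along v x ∂D.law)) := by
  have h1 : ∀ n, ∑ j ∈ firstCoords p n, v j * ∫ x, Y x * x j ∂D.law =
      ∫ x, Y x * ∑ j ∈ firstCoords p n, x j * v j ∂D.law := fun n => by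
    have h2 : ∀ x : DataVec p, Y x * ∑ j ∈ firstCoords p n, x j * v j =
        ∑ j ∈ firstCoords p n, v j * (Y x * x j) := fun x => by
      rw [Finset.mul_sum]; exact Finset.sum_congr rfl fun j _ => by ring
    simp_rw [h2]
    have h3 : ∀ j, Integrable (fun x : DataVec p => v j * (Y x * x j)) D.law := fun j =>
      (hY.integrable_mul (h.1 j)).const_mul _
    rw [integral_finsetSum _ fun j _ => h3 j]
    exact Finset.sum_congr rfl fun j _ => (integral_const_mul _ _).symm
  simp_rw [h1]
  refine tendsto_integral_of_dominated_convergence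
    (fun x => (Y x ^ 2 + normSq x * normSq v)) (fun n => ?_) ?_ (fun n => ?_) ?_
  · exact hY.1.mul (Measurable.aestronglyMeasurable (by fun_prop))
  · exact hY.integrable_sq.add ((integrable_normSq h).mul_const _)
  · filter_upwards [ae_summable_sq h] with x hx
    have h4 := sq_sum_le_normSq hx hv (firstCoords p n)
    rw [Real.norm_eq_abs, abs_le]
    set s := ∑ j ∈ firstCoords p n, x j * v j
    have h5 := sq_nonneg (Y x)
    have h6 := sq_nonneg s
    constructor <;> nlinarith [sq_nonneg (Y x + s), sq_nonneg (Y x - s)]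
  · filter_upwards [ae_summable_sq h] with x hx
    exact (tendsto_sum_firstCoords (summable_mul_of_sq hx hv)).const_mul _

/-- This identifies the unconditional sum in the eigenvector equation with the limit of ordered
partial sums. Summability comes from `|x k * x l * v l| ≤ (x l² + x k² * v l²) / 2`, using the
finite trace. -/
theorem integral_coord_mul_along (h : D.FiniteTrace) {v : DataVec p}
    (hv : Summable fun j => v j ^ 2) (k : Coord p) :
    ∫ x, x k * along v x ∂D.law = ∑' l, D.cov k l * v l := by
  refine tendsto_nhds_unique (tendsto_integral_mul_along h hv (h.1 k)) ?_
  have hs : Summable fun l => D.cov k l * v l := by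
    refine Summable.of_norm_bounded ((h.2.add (hv.mul_left (D.cov k k))).mul_left (1 / 2))
      fun l => ?_
    have h1 : D.cov k l * v l = ∫ x, x k * x l * v l ∂D.law := (integral_mul_const _ _).symm
    have hi1 : Integrable (fun x : DataVec p => x l * x l) D.law := (h.1 l).integrable_mul (h.1 l)
    have hi2 : Integrable (fun x : DataVec p => x k * x k * v l ^ 2) D.law :=
      ((h.1 k).integrable_mul (h.1 k)).mul_const _
    have h2 : (1 / 2) * (D.cov l l + D.cov k k * v l ^ 2) =
        ∫ x, (1 / 2) * (x l * x l + x k * x k * v l ^ 2) ∂D.law := by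
      rw [integral_const_mul, integral_add hi1 hi2, integral_mul_const]; rfl
    rw [h1, h2]
    refine norm_integral_le_of_norm_le ((hi1.add hi2).const_mul _) (Eventually.of_forall fun x => ?_)
    rw [Real.norm_eq_abs, abs_le]
    constructor <;> nlinarith [sq_nonneg (x l + x k * v l), sq_nonneg (x l - x k * v l)]
  refine (tendsto_sum_firstCoords hs).congr fun n => Finset.sum_congr rfl fun l _ => ?_
  rw [mul_comm]; rfl

/-- The pairing formula is used twice, first against a coordinate and then against `along v` itself,
so the variance along a unit eigenvector is its eigenvalue. -/
theorem lintegral_along_sq (h : D.FiniteTrace) {v : DataVec p}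
    (hv : Summable fun j => v j ^ 2) (hv1 : normSq v = 1) {c : ℝ}
    (hc : ∀ k, ∑' l, D.cov k l * v l = c * v k) :
    ∫⁻ x, ENNReal.ofReal (along v x ^ 2) ∂D.law = ENNReal.ofReal c := by
  have hL := memLp_along h hv
  rw [lintegral_sq_eq_ofReal hL]
  congr 1
  have h1 := tendsto_integral_mul_along h hv hL
  have h2 : ∀ k, ∫ x, along v x * x k ∂D.law = c * v k := fun k => by
    rw [← hc, ← integral_coord_mul_along h hv]
    congr 1; ext x; ring
  simp_rw [h2] at h1
  have h3 : Tendsto (fun n => ∑ j ∈ firstCoords p n, v j * (c * v j)) atTop (𝓝 c) := by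
    have h4 := (tendsto_sum_firstCoords hv).const_mul c
    rw [show ∑' j, v j ^ 2 = 1 from by rw [← hv1]; unfold normSq; rfl, mul_one] at h4
    refine h4.congr fun n => ?_
    rw [Finset.mul_sum]
    exact Finset.sum_congr rfl fun j _ => by ring
  rw [tendsto_nhds_unique h3 h1]
  congr 1; ext x; ring

end DataModel

/-! ### Parseval in `ℓ²` -/

section Parseval

variable (b : HilbertBasis (Coord p) ℝ (lp (fun _ : Coord p => ℝ) 2))

theorem summable_sq_lp (X : lp (fun _ : Coord p => ℝ) 2) : Summable fun j => X j ^ 2 := by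
  simpa [sq] using lp.summable_inner (𝕜 := ℝ) X X

theorem inner_lp_eq (X Y : lp (fun _ : Coord p => ℝ) 2) :
    inner ℝ X Y = ∑' j, Y j * X j := by
  rw [lp.inner_eq_tsum]; rfl

theorem normSq_lp (X : lp (fun _ : Coord p => ℝ) 2) : normSq (X : DataVec p) = inner ℝ X X := by
  rw [inner_lp_eq]
  unfold normSq
  exact tsum_congr fun j => sq _

theorem normSq_hilbertBasis (i : Coord p) : normSq (b i : DataVec p) = 1 := by
  rw [normSq_lp, real_inner_self_eq_norm_sq, b.orthonormal.1, one_pow]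

theorem parseval_tsum (X : lp (fun _ : Coord p => ℝ) 2) :
    ENNReal.ofReal (normSq (X : DataVec p)) = ∑' m, ENNReal.ofReal (inner ℝ (b m) X ^ 2) := by
  have h := b.hasSum_inner_mul_inner X X
  have h1 : ∀ i, inner ℝ X (b i) * inner ℝ (b i) X = inner ℝ (b i) X ^ 2 := fun i => by
    rw [real_inner_comm X (b i), sq]
  simp_rw [h1] at h
  rw [normSq_lp, ← h.tsum_eq, ENNReal.ofReal_tsum_of_nonneg (fun _ => sq_nonneg _) h.summable]

theorem parseval_normSq {x : DataVec p} (hx : Summable fun j => x j ^ 2) :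
    ENNReal.ofReal (normSq x) = ∑' m, ENNReal.ofReal (DataModel.along (b m : DataVec p) x ^ 2) := by
  have hX : Memℓp (x : ∀ _ : Coord p, ℝ) 2 := by
    refine memℓp_gen ?_
    simpa using hx
  have h := parseval_tsum b ⟨x, hX⟩
  simp_rw [inner_lp_eq] at h
  exact h

/-- The best approximation of `x` by the first eigenvectors. -/
theorem sum_sq_sub_le {x : DataVec p} (hx : Summable fun j => x j ^ 2) (L F : Finset (Coord p)) :
    ENNReal.ofReal (∑ j ∈ F, (x j - ∑ l ∈ L, DataModel.along (b l : DataVec p) x * b l j) ^ 2) ≤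
      ∑' m, (if m ∈ L then 0 else ENNReal.ofReal (DataModel.along (b m : DataVec p) x ^ 2)) := by
  have hX : Memℓp (x : ∀ _ : Coord p, ℝ) 2 := by
    refine memℓp_gen ?_
    simpa using hx
  set X : lp (fun _ : Coord p => ℝ) 2 := ⟨x, hX⟩
  have hal : ∀ m, DataModel.along (b m : DataVec p) x = inner ℝ (b m) X := fun m => by
    rw [inner_lp_eq]; rfl
  set Y : lp (fun _ : Coord p => ℝ) 2 := X - ∑ l ∈ L, inner ℝ (b l) X • b l with hY
  have hYj : ∀ j, Y j = x j - ∑ l ∈ L, DataModel.along (b l : DataVec p) x * b l j := fun j => by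
    rw [hY, lp.coeFn_sub, Pi.sub_apply, lp.coeFn_sum, Finset.sum_apply]
    simp_rw [hal]
    rfl
  have hin : ∀ m, inner ℝ (b m) Y = if m ∈ L then 0 else inner ℝ (b m) X := fun m => by
    have h1 : ∀ l, inner ℝ (b m) (inner ℝ (b l) X • b l) =
        if m = l then inner ℝ (b l) X else 0 := fun l => by
      rw [inner_smul_right, orthonormal_iff_ite.mp b.orthonormal]
      split_ifs <;> simp
    rw [hY, inner_sub_right, inner_sum]
    simp_rw [h1]
    rw [Finset.sum_ite_eq]
    split_ifs <;> simp
  calc _ ≤ ENNReal.ofReal (normSq (Y : DataVec p)) := by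
        refine ENNReal.ofReal_le_ofReal ?_
        simp_rw [← hYj]
        unfold normSq
        exact (summable_sq_lp Y).sum_le_tsum _ fun _ _ => sq_nonneg _
    _ = _ := by
        rw [parseval_tsum b]
        refine tsum_congr fun m => ?_
        rw [hin, hal]
        split_ifs <;> simp

end Parseval

/-- The component of `x` orthogonal to a finite orthonormal family. -/
def residual {k : ℕ} (f : Fin k → DataVec p) (F : Finset (Coord p)) (x : DataVec p) : DataVec p :=
  fun j => x j - ∑ l, (∑ i ∈ F, x i * f l i) * f l j

/-- Orthonormalization of the truncations of finitely many vectors. -/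
theorem exists_finiteOrthonormal_le (g : Coord p → DataVec p) (L F : Finset (Coord p)) :
    ∃ k ≤ L.card, ∃ f : Fin k → DataVec p, FiniteOrthonormal f F ∧ ∀ (x c : DataVec p),
      ∑ j ∈ F, residual f F x j ^ 2 ≤ ∑ j ∈ F, (x j - ∑ l ∈ L, c l * g l j) ^ 2 := by
  -- Truncated eigenvectors need not be orthonormal or even independent, so an orthonormal basis of
  -- their span is taken. The residual is then the distance to a subspace, at most the distance to
  -- any combination of the truncated vectors.
  set G : L → EuclideanSpace ℝ F := fun l => WithLp.toLp 2 fun j => g l j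
  set W := Submodule.span ℝ (Set.range G)
  set B := stdOrthonormalBasis ℝ W
  have hk : Module.finrank ℝ W ≤ L.card := by
    have := finrank_range_le_card (R := ℝ) G
    rwa [Fintype.card_coe] at this
  set f : Fin (Module.finrank ℝ W) → DataVec p := fun l j =>
    if h : j ∈ F then (B l : EuclideanSpace ℝ F) ⟨j, h⟩ else 0 with hf
  have hfF : ∀ l (j : F), f l j = (B l : EuclideanSpace ℝ F) j := fun l j => dif_pos j.2
  have hinner : ∀ (l) (y : EuclideanSpace ℝ F), inner ℝ (B l : EuclideanSpace ℝ F) y =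
      ∑ j : F, y j * f l j := fun l y => by
    rw [EuclideanSpace.inner_eq_star_dotProduct]
    exact Finset.sum_congr rfl fun j _ => by rw [hfF]; rfl
  refine ⟨_, hk, f, ⟨fun l j hj => dif_neg hj, fun l m => ?_⟩, fun x c => ?_⟩
  · rw [← Finset.sum_coe_sort F fun j => f l j * f m j]
    have h1 := orthonormal_iff_ite.mp B.orthonormal m l
    rw [Submodule.coe_inner, hinner] at h1
    simp_rw [← hfF] at h1
    rw [h1]
    simp [eq_comm]
  · set v : EuclideanSpace ℝ F := WithLp.toLp 2 fun j => x j
    set w : EuclideanSpace ℝ F := ∑ l : L, c l • G l with hw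
    have hwW : w ∈ W := Submodule.sum_mem _ fun l _ =>
      Submodule.smul_mem _ _ (Submodule.subset_span ⟨l, rfl⟩)
    have hproj : W.starProjection v = ∑ l, inner ℝ (B l : EuclideanSpace ℝ F) v •
        (B l : EuclideanSpace ℝ F) := by
      rw [B.starProjection_eq_sum_rankOne]
      simp
    have hmin : ‖v - W.starProjection v‖ ≤ ‖v - w‖ := by
      rw [Submodule.starProjection_minimal]
      exact ciInf_le ⟨0, by rintro _ ⟨y, rfl⟩; positivity⟩ (⟨w, hwW⟩ : W)
    have h2 := pow_le_pow_left₀ (norm_nonneg _) hmin 2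
    rw [EuclideanSpace.norm_sq_eq, EuclideanSpace.norm_sq_eq] at h2
    rw [← Finset.sum_coe_sort F fun j => residual f F x j ^ 2,
      ← Finset.sum_coe_sort F fun j => (x j - ∑ l ∈ L, c l * g l j) ^ 2]
    have h3 : ∀ j : F, ‖(v - W.starProjection v).ofLp j‖ ^ 2 = residual f F x j ^ 2 := fun j => by
      rw [Real.norm_eq_abs, sq_abs, hproj]
      congr 1
      simp only [residual, PiLp.sub_apply, WithLp.ofLp_sum, Finset.sum_apply, PiLp.smul_apply,
        smul_eq_mul]
      congr 1
      refine Finset.sum_congr rfl fun l _ => ?_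
      rw [hinner, hfF, ← Finset.sum_coe_sort F fun i => x i * f l i]
    have h4 : ∀ j : F, ‖(v - w).ofLp j‖ ^ 2 = (x j - ∑ l ∈ L, c l * g l j) ^ 2 := fun j => by
      rw [Real.norm_eq_abs, sq_abs, hw]
      congr 1
      simp only [PiLp.sub_apply, WithLp.ofLp_sum, Finset.sum_apply, PiLp.smul_apply, smul_eq_mul]
      rw [← Finset.sum_coe_sort L fun l => c l * g l j]
    simp_rw [h3, h4] at h2
    exact h2

end

/-! ### Low-dimensional approximation of the data; energy of the response -/

section

variable {p : ℕ∞} {D : DataModel p}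

section Residual

variable {k : ℕ} {f : Fin k → DataVec p} {F : Finset (Coord p)}

theorem residual_apply_of_notMem (hf : FiniteOrthonormal f F) (x : DataVec p) {j : Coord p}
    (hj : j ∉ F) : residual f F x j = x j := by
  unfold residual
  rw [Finset.sum_eq_zero fun l _ => by rw [hf.support l j hj, mul_zero], sub_zero]

theorem measurable_residual (f : Fin k → DataVec p) (F : Finset (Coord p)) :
    Measurable (residual f F) := by
  unfold residual; fun_prop

theorem ofReal_residual_sq (hf : FiniteOrthonormal f F) (x : DataVec p) (j : Coord p) :
    ENNReal.ofReal (residual f F x j ^ 2) =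
      (if j ∈ F then ENNReal.ofReal (residual f F x j ^ 2) else 0) +
        (if j ∈ F then 0 else ENNReal.ofReal (x j ^ 2)) := by
  split_ifs with h
  · rw [add_zero]
  · rw [zero_add, residual_apply_of_notMem hf x h]

theorem summable_residual_sq (hf : FiniteOrthonormal f F) {x : DataVec p}
    (hx : Summable fun j => x j ^ 2) : Summable fun j => residual f F x j ^ 2 := by
  refine (summable_congr_cofinite ?_).mp hx
  filter_upwards [F.finite_toSet.compl_mem_cofinite] with j hj
  rw [residual_apply_of_notMem hf x fun h => hj (Finset.mem_coe.mpr h)]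

theorem ofReal_normSq_residual (hf : FiniteOrthonormal f F) {x : DataVec p}
    (hx : Summable fun j => x j ^ 2) :
    ENNReal.ofReal (normSq (residual f F x)) =
      ENNReal.ofReal (∑ j ∈ F, residual f F x j ^ 2) +
        ∑' j, (if j ∈ F then 0 else ENNReal.ofReal (x j ^ 2)) := by
  rw [ofReal_normSq (summable_residual_sq hf hx)]
  rw [tsum_congr (ofReal_residual_sq hf x)]
  rw [ENNReal.tsum_add, ENNReal.ofReal_sum_of_nonneg fun _ _ => sq_nonneg _]
  congr 1
  rw [tsum_eq_sum (s := F) fun j hj => if_neg hj]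
  exact Finset.sum_congr rfl fun j hj => if_pos hj

end Residual

namespace DataModel

theorem tendsto_tail (h : D.FiniteTrace) :
    Tendsto (fun n => ∑' j, (if j ∈ firstCoords p n then 0 else ENNReal.ofReal (D.cov j j)))
      atTop (𝓝 0) := by
  have h1 := (ENNReal.tendsto_tsum_compl_atTop_zero (tsum_ofReal_cov_ne_top h)).comp
    (tendsto_firstCoords (p := p))
  refine h1.congr fun n => ?_
  simp only [Function.comp]
  rw [← tsum_subtype_eq_of_support_subset (s := {j | j ∉ firstCoords p n})
    (f := fun j => if j ∈ firstCoords p n then 0 else ENNReal.ofReal (D.cov j j))]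
  · exact tsum_congr fun j => (if_neg j.2).symm
  · intro j hj
    by_contra hjn
    exact hj (if_pos (by simpa using hjn))

/-- Approximation of the data by finitely supported orthonormal families. -/
theorem exists_finiteOrthonormal (h : D.FiniteTrace) {a cLo cHi : ℝ} (ha : 1 < a) (hc : 0 ≤ cHi)
    (hs : D.PowerLawSpectrum a cLo cHi) (k : ℕ) {δ : ℝ≥0∞} (hδ : 0 < δ) :
    ∀ᶠ n in atTop, ∃ m ≤ k, ∃ f : Fin m → DataVec p, FiniteOrthonormal f (firstCoords p n) ∧
      ∫⁻ x, ENNReal.ofReal (normSq (residual f (firstCoords p n) x)) ∂D.law ≤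
        ENNReal.ofReal (cHi * (a / (a - 1) * ((k : ℝ) + 1) ^ (1 - a))) + δ := by
  obtain ⟨b, ev, -, hev, hb⟩ := hs
  filter_upwards [(tendsto_tail h).eventually (eventually_le_nhds hδ)] with n hn
  set F := firstCoords p n
  set L := firstCoords p k
  have hL : L.card ≤ k := by
    calc L.card ≤ (Finset.range k).card := by
          simp only [L, firstCoords]
          rw [Finset.card_subtype]
          exact Finset.card_filter_le _ _
      _ = k := Finset.card_range k
  obtain ⟨m, hm, f, hf, hle⟩ := exists_finiteOrthonormal_le (fun l => (b l : DataVec p)) L F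
  refine ⟨m, hm.trans hL, f, hf, ?_⟩
  have hxm : ∀ j : Coord p, Measurable fun x : DataVec p =>
      if j ∈ F then (0 : ℝ≥0∞) else ENNReal.ofReal (x j ^ 2) := fun j => by
    split_ifs <;> fun_prop
  have ham : ∀ j : Coord p, AEMeasurable (fun x : DataVec p =>
      if j ∈ L then (0 : ℝ≥0∞) else ENNReal.ofReal (along (b j : DataVec p) x ^ 2)) D.law :=
    fun j => by
    split_ifs
    · exact aemeasurable_const
    · exact ((memLp_along h (summable_sq_lp (b j))).1.aemeasurable.pow_const 2).ennreal_ofReal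
  -- On `F` the residual is no larger than the error of the truncated eigenexpansion, whose mean is
  -- an eigenvalue tail. Off `F` it is `x` itself, whose mean energy is a tail of the trace, made
  -- small by the choice of `n`.
  calc ∫⁻ x, ENNReal.ofReal (normSq (residual f F x)) ∂D.law
      ≤ ∫⁻ x, (∑' j, (if j ∈ L then 0 else ENNReal.ofReal (along (b j : DataVec p) x ^ 2)) +
          ∑' j, (if j ∈ F then 0 else ENNReal.ofReal (x j ^ 2))) ∂D.law := by
        refine lintegral_mono_ae ?_
        filter_upwards [ae_summable_sq h] with x hx
        rw [ofReal_normSq_residual hf hx]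
        refine add_le_add ?_ le_rfl
        exact (ENNReal.ofReal_le_ofReal (hle x fun l => along (b l : DataVec p) x)).trans
          (sum_sq_sub_le b hx L F)
    _ = ∑' j, (if j ∈ L then 0 else ENNReal.ofReal (ev j)) +
          ∑' j, (if j ∈ F then 0 else ENNReal.ofReal (D.cov j j)) := by
        rw [lintegral_add_right _ (Measurable.tsum hxm), lintegral_tsum ham,
          lintegral_tsum fun j => (hxm j).aemeasurable]
        congr 1
        · refine tsum_congr fun j => ?_
          split_ifs
          · simp
          · exact lintegral_along_sq h (summable_sq_lp (b j)) (normSq_hilbertBasis b j) (hev j)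
        · refine tsum_congr fun j => ?_
          split_ifs
          · simp
          · exact lintegral_coord_sq h j
    _ ≤ _ := add_le_add (tsum_rpow_neg_le ha p hc k fun i => (hb i).2) hn

/-- Parseval turns the energy into the sum of the eigenvalues: the tail bound at level zero. -/
theorem lintegral_normSq_le (h : D.FiniteTrace) {a cLo cHi : ℝ} (ha : 1 < a) (hc : 0 ≤ cHi)
    (hs : D.PowerLawSpectrum a cLo cHi) :
    ∫⁻ x, ENNReal.ofReal (normSq x) ∂D.law ≤ ENNReal.ofReal (cHi * (a / (a - 1))) := by
  obtain ⟨b, ev, -, hev, hb⟩ := hs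
  have h1 := tsum_rpow_neg_le ha p hc 0 fun i => (hb i).2
  simp only [Nat.cast_zero, zero_add, Real.one_rpow, mul_one] at h1
  refine le_trans (le_of_eq ?_) h1
  have ham : ∀ j : Coord p, AEMeasurable (fun x : DataVec p =>
      ENNReal.ofReal (along (b j : DataVec p) x ^ 2)) D.law := fun j =>
    ((memLp_along h (summable_sq_lp (b j))).1.aemeasurable.pow_const 2).ennreal_ofReal
  calc _ = ∫⁻ x, ∑' j, ENNReal.ofReal (along (b j : DataVec p) x ^ 2) ∂D.law := by
        refine lintegral_congr_ae ?_
        filter_upwards [ae_summable_sq h] with x hx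
        exact parseval_normSq b hx
    _ = _ := by
        rw [lintegral_tsum ham]
        refine tsum_congr fun j => ?_
        rw [lintegral_along_sq h (summable_sq_lp (b j)) (normSq_hilbertBasis b j) (hev j),
          if_neg (by simp [firstCoords])]

/-- The component along the top eigenvector already has mean energy at least `cLo`; a first
coordinate must exist, hence `0 < p`. -/
theorem le_lintegral_normSq (h : D.FiniteTrace) {a cLo cHi : ℝ} (hp : 0 < p)
    (hs : D.PowerLawSpectrum a cLo cHi) :
    ENNReal.ofReal cLo ≤ ∫⁻ x, ENNReal.ofReal (normSq x) ∂D.law := by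
  obtain ⟨b, ev, -, hev, hb⟩ := hs
  set j : Coord p := ⟨0, by simpa using hp⟩
  have h1 := (hb j).1
  simp only [j, Nat.cast_zero, zero_add, Real.one_rpow, mul_one] at h1
  refine (ENNReal.ofReal_le_ofReal h1).trans ?_
  rw [← lintegral_along_sq h (summable_sq_lp (b j)) (normSq_hilbertBasis b j) (hev j)]
  refine lintegral_mono_ae ?_
  filter_upwards [ae_summable_sq h] with x hx
  refine ENNReal.ofReal_le_ofReal ?_
  have h2 := sq_tsum_le_normSq hx (summable_sq_lp (b j))
  rwa [normSq_hilbertBasis, mul_one] at h2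

/-! ### The prior and the response -/

theorem lintegral_prior_sq (h : D.IsotropicPrior) (F : Finset (Coord p)) (c : Coord p → ℝ) :
    ∫⁻ w, ENNReal.ofReal ((∑ j ∈ F, c j * w j) ^ 2) ∂D.prior =
      ENNReal.ofReal (∑ j ∈ F, c j ^ 2) := by
  have heq : ∀ w : DataVec p, (∑ j ∈ F, c j * w j) ^ 2 =
      ∑ i ∈ F, ∑ j ∈ F, c i * c j * (w i * w j) := fun w => by
    rw [sq, Finset.sum_mul_sum]
    exact Finset.sum_congr rfl fun i _ => Finset.sum_congr rfl fun j _ => by ring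
  have hi : ∀ i j, Integrable (fun w : DataVec p => c i * c j * (w i * w j)) D.prior :=
    fun i j => (h i j).1.const_mul _
  have hI : Integrable (fun w : DataVec p => (∑ j ∈ F, c j * w j) ^ 2) D.prior := by
    simp_rw [heq]
    exact integrable_finsetSum _ fun i _ => integrable_finsetSum _ fun j _ => hi i j
  rw [← ofReal_integral_eq_lintegral_ofReal hI (Eventually.of_forall fun w => sq_nonneg _)]
  congr 1
  simp_rw [heq]
  rw [integral_finsetSum _ fun i _ => integrable_finsetSum _ fun j _ => hi i j]
  refine Finset.sum_congr rfl fun i hiF => ?_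
  rw [integral_finsetSum _ fun j _ => hi i j]
  simp_rw [integral_const_mul, (h _ _).2]
  simp [hiF, sq]

theorem lintegral_prod_prior_sq (h : D.IsotropicPrior) (F : Finset (Coord p))
    {c : DataVec p → Coord p → ℝ} (hc : Measurable c) :
    ∫⁻ z, ENNReal.ofReal ((∑ j ∈ F, c z.2 j * z.1 j) ^ 2) ∂(D.prior.prod D.law) =
      ∫⁻ x, ENNReal.ofReal (∑ j ∈ F, c x j ^ 2) ∂D.law := by
  have hm : Measurable fun z : DataVec p × DataVec p =>
      ENNReal.ofReal ((∑ j ∈ F, c z.2 j * z.1 j) ^ 2) := by fun_prop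
  rw [lintegral_prod_symm _ hm.aemeasurable]
  exact lintegral_congr fun x => lintegral_prior_sq h F (c x)

theorem measurable_regression : Measurable D.regression := by
  have h : StronglyMeasurable fun z : DataVec p × DataVec p => ∫ y, y ∂(D.label z) :=
    MeasureTheory.StronglyMeasurable.integral_kernel_prod_right' (κ := D.label)
      (f := fun t : (DataVec p × DataVec p) × ℝ => t.2) measurable_snd.stronglyMeasurable
  exact h.measurable

/-- The truncated target function. -/
def partialTarget (p : ℕ∞) (n : ℕ) (z : DataVec p × DataVec p) : ℝ :=
  ∑ j ∈ firstCoords p n, z.2 j * z.1 j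

theorem measurable_partialTarget (n : ℕ) : Measurable (partialTarget p n) := by
  unfold partialTarget; fun_prop

/-- Second moment of the truncation error of the target function. -/
def truncationError (D : DataModel p) (n : ℕ) : ℝ≥0∞ :=
  ∫⁻ z, ENNReal.ofReal ((D.regression z - partialTarget p n z) ^ 2) ∂(D.prior.prod D.law)

theorem tendsto_truncationError (h : D.WellSpecified) :
    Tendsto D.truncationError atTop (𝓝 0) := by
  have h1 := (ENNReal.continuous_pow 2).tendsto 0 |>.comp h.2
  simp only [ne_eq, OfNat.ofNat_ne_zero, not_false_eq_true, zero_pow] at h1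
  refine h1.congr fun n => ?_
  have h2 := eLpNorm_nnreal_pow_eq_lintegral (μ := D.prior.prod D.law) (p := 2)
    (f := fun z : DataVec p × DataVec p =>
      D.regression z - ∑ j ∈ firstCoords p n, z.2 j * z.1 j) (by norm_num)
  simp only [NNReal.coe_ofNat, ENNReal.rpow_ofNat, ENNReal.coe_ofNat] at h2
  simp only [Function.comp]
  rw [h2]
  unfold truncationError partialTarget
  refine lintegral_congr fun z => ?_
  rw [← ofReal_norm, ← ENNReal.ofReal_pow (norm_nonneg _), Real.norm_eq_abs, sq_abs]

theorem lintegral_partialTarget_sq_le (hF : D.FiniteTrace) (h : D.IsotropicPrior) (n : ℕ) :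
    ∫⁻ z, ENNReal.ofReal (partialTarget p n z ^ 2) ∂(D.prior.prod D.law) ≤
      ∫⁻ x, ENNReal.ofReal (normSq x) ∂D.law := by
  have h1 := lintegral_prod_prior_sq h (firstCoords p n) (c := fun x => x) measurable_id
  unfold partialTarget
  rw [h1]
  refine lintegral_mono_ae ?_
  filter_upwards [ae_summable_sq hF] with x hx
  exact ENNReal.ofReal_le_ofReal (sum_sq_le_normSq hx _)

theorem lintegral_joint_fst {G : DataVec p × DataVec p → ℝ≥0∞} (hG : Measurable G) :
    ∫⁻ t, G t.1 ∂D.joint = ∫⁻ z, G z ∂(D.prior.prod D.law) := by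
  have h1 : D.joint.map Prod.fst = D.prior.prod D.law := Measure.fst_compProd _ _
  rw [← h1, lintegral_map hG measurable_fst]

theorem memLp_regression (hF : D.FiniteTrace) (hI : D.IsotropicPrior) (h : D.WellSpecified) :
    MemLp D.regression 2 (D.prior.prod D.law) := by
  obtain ⟨n, hn⟩ := ((tendsto_truncationError h).eventually
    (eventually_lt_nhds ENNReal.zero_lt_top)).exists
  have h1 : MemLp (fun z => D.regression z - partialTarget p n z) 2 (D.prior.prod D.law) :=
    memLp_two_of_lintegral_sq_lt_top
      (measurable_regression.sub (measurable_partialTarget n)).aestronglyMeasurable hn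
  have h2 : MemLp (partialTarget p n) 2 (D.prior.prod D.law) :=
    memLp_two_of_lintegral_sq_lt_top (measurable_partialTarget n).aestronglyMeasurable
      ((lintegral_partialTarget_sq_le hF hI n).trans_lt
        ((lintegral_normSq hF).trans_ne (tsum_ofReal_cov_ne_top hF)).lt_top)
  refine (h1.add h2).ae_eq (Eventually.of_forall fun z => ?_)
  simp

theorem lintegral_noise (hF : D.FiniteTrace) (hI : D.IsotropicPrior) (h : D.WellSpecified) :
    ∫⁻ t, ENNReal.ofReal ((t.2 - D.regression t.1) ^ 2) ∂D.joint = ENNReal.ofReal D.noiseVar := by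
  have hmp : MeasurePreserving Prod.fst D.joint (D.prior.prod D.law) :=
    ⟨measurable_fst, Measure.fst_compProd _ _⟩
  have h1 : MemLp (fun t : (DataVec p × DataVec p) × ℝ => t.2 - D.regression t.1) 2 D.joint :=
    h.1.sub ((memLp_regression hF hI h).comp_measurePreserving hmp)
  rw [lintegral_sq_eq_ofReal h1]
  rfl

theorem noiseVar_nonneg : 0 ≤ D.noiseVar := integral_nonneg fun _ => sq_nonneg _

/-- The response is noise plus truncation error plus truncated target, and by isotropy the last has
at most the energy of the data. -/
theorem lintegral_responseSq_le (hF : D.FiniteTrace) (hI : D.IsotropicPrior)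
    (h : D.WellSpecified) (n : ℕ) :
    ∫⁻ w, D.responseSq w ∂D.prior ≤ 3 * (ENNReal.ofReal D.noiseVar + D.truncationError n +
      ∫⁻ x, ENNReal.ofReal (normSq x) ∂D.law) := by
  have h1 : ∫⁻ w, D.responseSq w ∂D.prior = ∫⁻ t, ENNReal.ofReal (t.2 ^ 2) ∂D.joint := by
    rw [D.lintegral_joint (F := fun t => ENNReal.ofReal (t.2 ^ 2)) (by fun_prop)]
    rfl
  have hr := measurable_regression (D := D)
  have hs := measurable_partialTarget (p := p) n
  have m1 : Measurable fun t : (DataVec p × DataVec p) × ℝ =>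
      ENNReal.ofReal ((t.2 - D.regression t.1) ^ 2) := by fun_prop
  have m2 : Measurable fun z : DataVec p × DataVec p =>
      ENNReal.ofReal ((D.regression z - partialTarget p n z) ^ 2) := by fun_prop
  have m3 : Measurable fun z : DataVec p × DataVec p =>
      ENNReal.ofReal (partialTarget p n z ^ 2) := by fun_prop
  have m3' : Measurable fun t : (DataVec p × DataVec p) × ℝ =>
      ENNReal.ofReal (partialTarget p n t.1 ^ 2) := m3.comp measurable_fst
  calc _ ≤ ∫⁻ t, 3 * (ENNReal.ofReal ((t.2 - D.regression t.1) ^ 2) +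
        ENNReal.ofReal ((D.regression t.1 - partialTarget p n t.1) ^ 2) +
        ENNReal.ofReal (partialTarget p n t.1 ^ 2)) ∂D.joint := by
        rw [h1]
        refine lintegral_mono fun t => ?_
        rw [← ENNReal.ofReal_add (by positivity) (by positivity),
          ← ENNReal.ofReal_add (by positivity) (by positivity),
          show (3 : ℝ≥0∞) = ENNReal.ofReal 3 by simp, ← ENNReal.ofReal_mul (by norm_num)]
        refine ENNReal.ofReal_le_ofReal ?_
        set r := D.regression t.1
        set s := partialTarget p n t.1
        nlinarith [sq_nonneg ((t.2 - r) - (r - s)), sq_nonneg ((t.2 - r) - s),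
          sq_nonneg ((r - s) - s)]
    _ = 3 * (ENNReal.ofReal D.noiseVar + D.truncationError n +
        ∫⁻ z, ENNReal.ofReal (partialTarget p n z ^ 2) ∂(D.prior.prod D.law)) := by
        rw [lintegral_const_mul' _ _ (by norm_num), lintegral_add_right _ m3',
          lintegral_add_left m1, lintegral_noise hF hI h, lintegral_joint_fst m2,
          lintegral_joint_fst m3]
        rfl
    _ ≤ _ := by
        gcongr
        exact lintegral_partialTarget_sq_le hF hI n

end DataModel

end

/-! ### A comparator of small risk and controlled norm -/

section

/-- A pseudo-inverse of the transpose of a matrix that is bounded below. -/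
theorem exists_transpose_pseudoinverse {M k : ℕ} (T : Matrix (Fin M) (Fin k) ℝ) {s : ℝ}
    (hs : 0 < s) (hT : ∀ c : Fin k → ℝ, s ^ 2 * (c ⬝ᵥ c) ≤ (T *ᵥ c) ⬝ᵥ (T *ᵥ c)) :
    ∃ B : Matrix (Fin M) (Fin k) ℝ, (∀ χ ω : Fin k → ℝ, (T *ᵥ χ) ⬝ᵥ (B *ᵥ ω) = χ ⬝ᵥ ω) ∧
      (∀ r : Fin M → ℝ, s ^ 2 * ((r ᵥ* B) ⬝ᵥ (r ᵥ* B)) ≤ r ⬝ᵥ r) ∧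
      ∀ ω : Fin k → ℝ, s ^ 2 * ((B *ᵥ ω) ⬝ᵥ (B *ᵥ ω)) ≤ ω ⬝ᵥ ω := by
  have hnn : ∀ {n : ℕ} (v : Fin n → ℝ), 0 ≤ v ⬝ᵥ v := fun v =>
    Finset.sum_nonneg fun i _ => mul_self_nonneg (v i)
  have hTT : ∀ c d : Fin k → ℝ, (T *ᵥ c) ⬝ᵥ (T *ᵥ d) = c ⬝ᵥ ((Tᵀ * T) *ᵥ d) := fun c d => by
    rw [← Matrix.mulVec_mulVec, Matrix.dotProduct_mulVec c Tᵀ, Matrix.vecMul_transpose]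
  have hunit : IsUnit (Tᵀ * T) := by
    rw [← Matrix.mulVec_injective_iff_isUnit]
    intro c d hcd
    have h1 : (Tᵀ * T) *ᵥ (c - d) = 0 := by rw [Matrix.mulVec_sub]; exact sub_eq_zero.mpr hcd
    have h2 := hT (c - d)
    rw [hTT, h1, dotProduct_zero] at h2
    have h3 : (c - d) ⬝ᵥ (c - d) = 0 := by
      have := hnn (c - d)
      have hs2 : 0 < s ^ 2 := by positivity
      nlinarith
    exact sub_eq_zero.mp (dotProduct_self_eq_zero.mp h3)
  have hdet : IsUnit (Tᵀ * T).det := (Matrix.isUnit_iff_isUnit_det _).mp hunit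
  set A := (Tᵀ * T)⁻¹ with hA
  have hTTA : (Tᵀ * T) * A = 1 := Matrix.mul_nonsing_inv _ hdet
  have hmul : ∀ χ ω : Fin k → ℝ, (T *ᵥ χ) ⬝ᵥ ((T * A) *ᵥ ω) = χ ⬝ᵥ ω := fun χ ω => by
    rw [← Matrix.mulVec_mulVec, hTT, Matrix.mulVec_mulVec, hTTA, Matrix.one_mulVec]
  have hcs : ∀ {n : ℕ} (u v : Fin n → ℝ), (u ⬝ᵥ v) ^ 2 ≤ (u ⬝ᵥ u) * (v ⬝ᵥ v) := fun u v => by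
    have := Finset.sum_mul_sq_le_sq_mul_sq Finset.univ u v
    simpa only [dotProduct, sq] using this
  -- The witness is `T (Tᵀ T)⁻¹`, for which `Tᵀ B` is the identity; `r ↦ T (Bᵀ r)` is the orthogonal
  -- projection onto the range of `T`.
  refine ⟨T * A, hmul, fun r => ?_, fun ω => ?_⟩
  · set c := r ᵥ* (T * A) with hc
    have h1 : (T *ᵥ c) ⬝ᵥ (T *ᵥ c) = r ⬝ᵥ (T *ᵥ c) := by
      have hAT : Aᵀ = A := by
        rw [hA, Matrix.transpose_nonsing_inv, Matrix.transpose_mul, Matrix.transpose_transpose]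
      have h2 : (Tᵀ * T) *ᵥ c = r ᵥ* T := by
        rw [hc, ← Matrix.vecMul_vecMul, ← Matrix.mulVec_transpose A, hAT, Matrix.mulVec_mulVec,
          hTTA, Matrix.one_mulVec]
      rw [hTT, h2, Matrix.dotProduct_mulVec, dotProduct_comm]
    have h3 := hcs r (T *ᵥ c)
    rw [← h1] at h3
    have h4 : (T *ᵥ c) ⬝ᵥ (T *ᵥ c) ≤ r ⬝ᵥ r := by
      have h5 := hnn (T *ᵥ c)
      rcases h5.eq_or_lt with h6 | h6
      · rw [← h6]; exact hnn r
      · nlinarith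
    exact (hT c).trans h4
  · set c := A *ᵥ ω with hc
    have hV : (T * A) *ᵥ ω = T *ᵥ c := (Matrix.mulVec_mulVec _ _ _).symm
    have h1 : (T *ᵥ c) ⬝ᵥ (T *ᵥ c) = c ⬝ᵥ ω := by
      rw [← hV, ← hmul c ω, hV]
    rw [hV]
    have h2 := hcs c ω
    have h3 := hT c
    rw [h1] at h3 ⊢
    have h4 := hnn ω
    have h5 := hnn c
    have h6 : 0 ≤ c ⬝ᵥ ω := by rw [← h1]; exact hnn _
    have hs2 : 0 < s ^ 2 := by positivity
    rcases h6.eq_or_lt with h7 | h7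
    · rw [← h7, mul_zero]; exact h4
    · have h8 : s ^ 2 * (c ⬝ᵥ ω) ^ 2 ≤ (c ⬝ᵥ ω) * (ω ⬝ᵥ ω) := by nlinarith
      nlinarith

variable {M k : ℕ} {p : ℕ∞} {D : DataModel p} {S : SketchMat M p}

theorem sketchNormSq_eq (S : SketchMat M p) (u : DataVec p) :
    sketchNormSq S u = sketchApply S u ⬝ᵥ sketchApply S u := by
  unfold sketchNormSq dotProduct
  exact Finset.sum_congr rfl fun i _ => sq _

/-- Coordinates of `x` in a finite family. -/
def coords (f : Fin k → DataVec p) (F : Finset (Coord p)) (x : DataVec p) : Fin k → ℝ :=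
  fun l => ∑ i ∈ F, x i * f l i

theorem measurable_coords (f : Fin k → DataVec p) (F : Finset (Coord p)) :
    Measurable (coords f F) := by
  unfold coords; fun_prop

theorem sketchApply_eq_add_residual {f : Fin k → DataVec p} {F : Finset (Coord p)}
    (hf : FiniteOrthonormal f F) {x : DataVec p} (hx : SketchConverges S x) :
    sketchApply S x = sketchedFamily S f *ᵥ coords f F x + sketchApply S (residual f F x) := by
  ext i
  set u : DataVec p := fun j => ∑ l, coords f F x l * f l j with hu
  have h1 := tendsto_sum_firstCoords_of_support (hf.support_sum (coords f F x)) (S i)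
  have h2 : Tendsto (fun n => ∑ j ∈ firstCoords p n, S i j * residual f F x j) atTop
      (𝓝 (sketchApply S x i - ∑ j ∈ F, S i j * u j)) := by
    refine ((hx.tendsto i).sub h1).congr fun n => ?_
    rw [← Finset.sum_sub_distrib]
    exact Finset.sum_congr rfl fun j _ => by unfold residual coords; ring
  have h3 : sketchApply S (residual f F x) i = sketchApply S x i - ∑ j ∈ F, S i j * u j :=
    h2.limUnder_eq
  rw [Pi.add_apply, h3, ← hf.sketchApply_sum S, sketchApply_eq_sum (hf.support_sum _)]
  ring

theorem partialTarget_eq {f : Fin k → DataVec p} {n : ℕ}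
    (z : DataVec p × DataVec p) : DataModel.partialTarget p n z =
      coords f (firstCoords p n) z.2 ⬝ᵥ coords f (firstCoords p n) z.1 +
        ∑ j ∈ firstCoords p n, residual f (firstCoords p n) z.2 j * z.1 j := by
  have h1 : coords f (firstCoords p n) z.2 ⬝ᵥ coords f (firstCoords p n) z.1 =
      ∑ j ∈ firstCoords p n, (∑ l, coords f (firstCoords p n) z.2 l * f l j) * z.1 j := by
    simp_rw [Finset.sum_mul]
    rw [Finset.sum_comm]
    refine Finset.sum_congr rfl fun l _ => ?_
    rw [show coords f (firstCoords p n) z.1 l = ∑ i ∈ firstCoords p n, z.1 i * f l i from rfl,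
      Finset.mul_sum]
    exact Finset.sum_congr rfl fun j _ => by ring
  rw [h1, ← Finset.sum_add_distrib]
  unfold DataModel.partialTarget
  exact Finset.sum_congr rfl fun j _ => by unfold residual coords; ring

theorem lintegral_coords_sq (hI : D.IsotropicPrior) {f : Fin k → DataVec p} {n : ℕ}
    (hf : FiniteOrthonormal f (firstCoords p n)) (c : Fin k → ℝ) :
    ∫⁻ w, ENNReal.ofReal ((c ⬝ᵥ coords f (firstCoords p n) w) ^ 2) ∂D.prior =
      ENNReal.ofReal (c ⬝ᵥ c) := by
  have h1 : ∀ w : DataVec p, c ⬝ᵥ coords f (firstCoords p n) w =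
      ∑ j ∈ firstCoords p n, (∑ l, c l * f l j) * w j := fun w => by
    simp_rw [Finset.sum_mul]
    rw [Finset.sum_comm]
    refine Finset.sum_congr rfl fun l _ => ?_
    rw [show coords f (firstCoords p n) w l = ∑ i ∈ firstCoords p n, w i * f l i from rfl,
      Finset.mul_sum]
    exact Finset.sum_congr rfl fun j _ => by ring
  simp_rw [h1]
  rw [DataModel.lintegral_prior_sq hI, hf.sum_sq]
  congr 1
  exact Finset.sum_congr rfl fun l _ => sq _

set_option maxHeartbeats 400000 in
/-- A comparator of small risk and norm. -/
theorem exists_comparator (hF : D.FiniteTrace) (hI : D.IsotropicPrior) (hW : D.WellSpecified)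
    (hS : ∀ᵐ x ∂D.law, SketchConverges S x) {f : Fin k → DataVec p} {n : ℕ}
    (hf : FiniteOrthonormal f (firstCoords p n)) {s : ℝ} (hs : 0 < s)
    (hT : ∀ c : Fin k → ℝ, s ^ 2 * ∑ l, c l ^ 2 ≤ ∑ i, (sketchedFamily S f *ᵥ c) i ^ 2) :
    ∃ V : DataVec p → FeatVec M, Measurable V ∧
      ∫⁻ w, D.popRisk S w (V w) ∂D.prior ≤
        2 * (ENNReal.ofReal D.noiseVar + D.truncationError n +
          ∫⁻ x, ENNReal.ofReal (normSq (residual f (firstCoords p n) x)) ∂D.law +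
          ENNReal.ofReal (s⁻¹ ^ 2) *
            ∫⁻ x, ENNReal.ofReal (sketchNormSq S (residual f (firstCoords p n) x)) ∂D.law) ∧
      ∫⁻ w, ENNReal.ofReal (V w ⬝ᵥ V w) ∂D.prior ≤ ENNReal.ofReal (s⁻¹ ^ 2 * k) := by
  set F := firstCoords p n with hFdef
  obtain ⟨B, hB1, hB2, hB3⟩ := exists_transpose_pseudoinverse (sketchedFamily S f) hs fun c => by
    have := hT c
    simpa only [dotProduct, sq] using this
  have hs2 : 0 < s ^ 2 := by positivity
  have hωm := measurable_coords f F
  have hVm : Measurable fun w => B *ᵥ coords f F w := by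
    unfold Matrix.mulVec dotProduct; fun_prop
  -- On the span of the family this parameter predicts the target exactly. The residual of `x` leaks
  -- through the sketch into the coordinates of the target, and isotropy turns this leakage into
  -- `s⁻²` times the sketched residual energy.
  refine ⟨fun w => B *ᵥ coords f F w, hVm, ?_, ?_⟩
  · have hSm := Quantizers.measurable_sketchApply_right S
    have hRm : Measurable fun x : DataVec p => sketchApply S (residual f F x) :=
      hSm.comp (measurable_residual f F)
    have hdm : Measurable fun q : FeatVec M × FeatVec M => q.1 ⬝ᵥ q.2 := by
      unfold dotProduct; fun_prop
    have h0 : ∫⁻ w, D.popRisk S w (B *ᵥ coords f F w) ∂D.prior = ∫⁻ t, ENNReal.ofReal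
        ((1 / 2) * (sketchApply S t.1.2 ⬝ᵥ (B *ᵥ coords f F t.1.1) - t.2) ^ 2) ∂D.joint := by
      have hm : Measurable fun t : (DataVec p × DataVec p) × ℝ => ENNReal.ofReal
          ((1 / 2) * (sketchApply S t.1.2 ⬝ᵥ (B *ᵥ coords f F t.1.1) - t.2) ^ 2) := by
        have h1 : Measurable fun t : (DataVec p × DataVec p) × ℝ =>
            sketchApply S t.1.2 ⬝ᵥ (B *ᵥ coords f F t.1.1) :=
          hdm.comp ((hSm.comp (measurable_snd.comp measurable_fst)).prodMk
            (hVm.comp (measurable_fst.comp measurable_fst)))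
        exact (((h1.sub measurable_snd).pow_const 2).const_mul _).ennreal_ofReal
      rw [D.lintegral_joint hm]
      exact lintegral_congr fun w => Quantizers.popRisk_eq w _
    have hae : ∀ᵐ t ∂D.joint, SketchConverges S t.1.2 := by
      have h1 : (D.joint.map Prod.fst).map Prod.snd = D.law := by
        rw [show D.joint.map Prod.fst = D.prior.prod D.law from Measure.fst_compProd _ _]
        exact Measure.snd_prod
      rw [← h1] at hS
      exact ae_of_ae_map measurable_fst.aemeasurable (ae_of_ae_map measurable_snd.aemeasurable hS)
    have hr := DataModel.measurable_regression (D := D)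
    have hp := DataModel.measurable_partialTarget (p := p) n
    have hres := measurable_residual f F
    have m1 : Measurable fun t : (DataVec p × DataVec p) × ℝ =>
        ENNReal.ofReal ((t.2 - D.regression t.1) ^ 2) := by fun_prop
    have m2 : Measurable fun z : DataVec p × DataVec p =>
        ENNReal.ofReal ((D.regression z - DataModel.partialTarget p n z) ^ 2) := by fun_prop
    have m3 : Measurable fun z : DataVec p × DataVec p =>
        ENNReal.ofReal ((∑ j ∈ F, residual f F z.2 j * z.1 j) ^ 2) := by fun_prop
    have m4 : Measurable fun z : DataVec p × DataVec p =>
        ENNReal.ofReal (((sketchApply S (residual f F z.2) ᵥ* B) ⬝ᵥ coords f F z.1) ^ 2) := by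
      have h1 : Measurable fun q : FeatVec M × (Fin k → ℝ) => (q.1 ᵥ* B) ⬝ᵥ q.2 := by
        unfold Matrix.vecMul dotProduct; fun_prop
      exact ((h1.comp ((hRm.comp measurable_snd).prodMk
        (hωm.comp measurable_fst))).pow_const 2).ennreal_ofReal
    have m3' : Measurable fun t : (DataVec p × DataVec p) × ℝ =>
        ENNReal.ofReal ((∑ j ∈ F, residual f F t.1.2 j * t.1.1 j) ^ 2) := m3.comp measurable_fst
    have m4' : Measurable fun t : (DataVec p × DataVec p) × ℝ => ENNReal.ofReal
        (((sketchApply S (residual f F t.1.2) ᵥ* B) ⬝ᵥ coords f F t.1.1) ^ 2) :=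
      m4.comp measurable_fst
    rw [h0]
    -- The error has four parts: label noise, truncation of the target, the unsketched residual and
    -- the leakage. The constant is `4 / 2`.
    calc _ ≤ ∫⁻ t, 2 * (ENNReal.ofReal ((t.2 - D.regression t.1) ^ 2) +
          ENNReal.ofReal ((D.regression t.1 - DataModel.partialTarget p n t.1) ^ 2) +
          ENNReal.ofReal ((∑ j ∈ F, residual f F t.1.2 j * t.1.1 j) ^ 2) +
          ENNReal.ofReal (((sketchApply S (residual f F t.1.2) ᵥ* B) ⬝ᵥ
            coords f F t.1.1) ^ 2)) ∂D.joint := by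
          refine lintegral_mono_ae ?_
          filter_upwards [hae] with t ht
          rw [← ENNReal.ofReal_add (by positivity) (by positivity),
            ← ENNReal.ofReal_add (by positivity) (by positivity),
            ← ENNReal.ofReal_add (by positivity) (by positivity),
            show (2 : ℝ≥0∞) = ENNReal.ofReal 2 by simp, ← ENNReal.ofReal_mul (by norm_num)]
          refine ENNReal.ofReal_le_ofReal ?_
          have h1 := partialTarget_eq (f := f) (n := n) t.1
          rw [← hFdef] at h1
          rw [sketchApply_eq_add_residual hf ht, add_dotProduct, hB1,
            Matrix.dotProduct_mulVec]
          set A := coords f F t.1.2 ⬝ᵥ coords f F t.1.1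
          set R := ∑ j ∈ F, residual f F t.1.2 j * t.1.1 j
          set W := (sketchApply S (residual f F t.1.2) ᵥ* B) ⬝ᵥ coords f F t.1.1
          rw [h1]
          set r := D.regression t.1
          have h2 : A + W - t.2 = -(t.2 - r) - (r - (A + R)) - R + W := by ring
          rw [h2]
          set x1 := t.2 - r
          set x2 := r - (A + R)
          nlinarith [sq_nonneg (x1 - x2), sq_nonneg (x1 - R), sq_nonneg (x1 + W),
            sq_nonneg (x2 - R), sq_nonneg (x2 + W), sq_nonneg (R + W)]
      _ = 2 * (ENNReal.ofReal D.noiseVar + D.truncationError n +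
          ∫⁻ x, ENNReal.ofReal (∑ j ∈ F, residual f F x j ^ 2) ∂D.law +
          ∫⁻ x, ENNReal.ofReal ((sketchApply S (residual f F x) ᵥ* B) ⬝ᵥ
            (sketchApply S (residual f F x) ᵥ* B)) ∂D.law) := by
          rw [lintegral_const_mul' _ _ (by norm_num), lintegral_add_right _ m4',
            lintegral_add_right _ m3', lintegral_add_left m1,
            DataModel.lintegral_noise hF hI hW, DataModel.lintegral_joint_fst m2,
            DataModel.lintegral_joint_fst m3, DataModel.lintegral_joint_fst m4,
            DataModel.lintegral_prod_prior_sq hI F hres, lintegral_prod_symm _ m4.aemeasurable,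
            lintegral_congr fun x => lintegral_coords_sq hI hf
              (sketchApply S (residual f F x) ᵥ* B), DataModel.truncationError]
      _ ≤ _ := by
          have e1 : ∫⁻ x, ENNReal.ofReal (∑ j ∈ F, residual f F x j ^ 2) ∂D.law ≤
              ∫⁻ x, ENNReal.ofReal (normSq (residual f F x)) ∂D.law := by
            refine lintegral_mono_ae ?_
            filter_upwards [DataModel.ae_summable_sq hF] with x hx
            exact ENNReal.ofReal_le_ofReal (sum_sq_le_normSq (summable_residual_sq hf hx) F)
          have e2 : ∫⁻ x, ENNReal.ofReal ((sketchApply S (residual f F x) ᵥ* B) ⬝ᵥ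
              (sketchApply S (residual f F x) ᵥ* B)) ∂D.law ≤ ENNReal.ofReal (s⁻¹ ^ 2) *
              ∫⁻ x, ENNReal.ofReal (sketchNormSq S (residual f F x)) ∂D.law := by
            rw [← lintegral_const_mul' _ _ ENNReal.ofReal_ne_top]
            refine lintegral_mono fun x => ?_
            rw [← ENNReal.ofReal_mul (by positivity), sketchNormSq_eq]
            refine ENNReal.ofReal_le_ofReal ?_
            have h1 := hB2 (sketchApply S (residual f F x))
            rw [inv_pow, inv_mul_eq_div, le_div_iff₀ hs2]
            linarith
          exact mul_le_mul_right (add_le_add (add_le_add le_rfl e1) e2) _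
  · calc _ ≤ ∫⁻ w, ENNReal.ofReal (s⁻¹ ^ 2) *
          ∑ l, ENNReal.ofReal ((Pi.single l 1 ⬝ᵥ coords f F w) ^ 2) ∂D.prior := by
          refine lintegral_mono fun w => ?_
          rw [← ENNReal.ofReal_sum_of_nonneg fun _ _ => sq_nonneg _,
            ← ENNReal.ofReal_mul (by positivity)]
          refine ENNReal.ofReal_le_ofReal ?_
          have h1 := hB3 (coords f F w)
          have h2 : ∑ l, (Pi.single l 1 ⬝ᵥ coords f F w) ^ 2 = coords f F w ⬝ᵥ coords f F w :=
            Finset.sum_congr rfl fun l _ => by rw [single_dotProduct, one_mul, sq]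
          rw [h2, inv_pow, inv_mul_eq_div, le_div_iff₀ hs2]
          linarith
      _ = _ := by
          have hm : ∀ l : Fin k, Measurable fun w =>
              ENNReal.ofReal ((Pi.single l 1 ⬝ᵥ coords f F w) ^ 2) := fun l => by
            unfold dotProduct; fun_prop
          rw [lintegral_const_mul' _ _ ENNReal.ofReal_ne_top, lintegral_finsetSum _ fun l _ => hm l]
          simp_rw [hFdef, lintegral_coords_sq hI hf]
          rw [ENNReal.ofReal_mul (sq_nonneg s⁻¹)]
          simp

end

/-! ### Excess risk, bias and capped trace in terms of the residual -/

section

namespace Quantizers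

variable {M k : ℕ} {p : ℕ∞} {Q : Quantizers M p} {D : DataModel p} {S : SketchMat M p}
  {e : ErrorLevels}

theorem measurable_comp_sketchApply {φ : DataVec p → DataVec p} (hφ : Measurable φ)
    (b : FeatVec M) :
    Measurable fun x => ENNReal.ofReal ((b ⬝ᵥ sketchApply S (φ x)) ^ 2) := by
  have h1 : Measurable fun v : FeatVec M => ENNReal.ofReal ((b ⬝ᵥ v) ^ 2) := by
    unfold dotProduct; fun_prop
  exact h1.comp ((measurable_sketchApply_right S).comp hφ)

/-- The sketched data have less energy than the quantized features. -/
theorem lintegral_sketchNormSq_le_trace (hQ : Q.Unbiased) (he : e.Nonneg)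
    (hm : Q.Multiplicative e) (hS : ∀ᵐ x ∂D.law, SketchConverges S x)
    (h2 : ∀ i, MemLp (fun f : FeatVec M => f i) 2 (Q.featureLaw D S)) :
    ∫⁻ x, ENNReal.ofReal (sketchNormSq S x) ∂D.law ≤ ENNReal.ofReal (Q.featureCov D S).trace := by
  have h0 : (Q.featureCov D S).trace = ∑ i, quad (Q.featureCov D S) (Pi.single i 1) := by
    unfold quad Matrix.trace
    exact Finset.sum_congr rfl fun i _ => by simp
  have h1 : ∀ x : DataVec p, ENNReal.ofReal (sketchNormSq S x) =
      ∑ i, ENNReal.ofReal ((Pi.single i 1 ⬝ᵥ sketchApply S x) ^ 2) := fun x => by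
    rw [← ENNReal.ofReal_sum_of_nonneg fun _ _ => sq_nonneg _]
    simp [sketchNormSq]
  simp_rw [h1]
  rw [lintegral_finsetSum _ fun i _ => measurable_comp_sketchApply (φ := fun x => x)
    measurable_id _, h0,
    ENNReal.ofReal_sum_of_nonneg fun _ _ => quad_nonneg h2 _]
  exact Finset.sum_le_sum fun i _ => lintegral_sketchApply_sq_le hQ he hm hS h2 _

/-- The capped trace of the feature covariance is controlled by the sketched residual. -/
theorem ofReal_sum_min_le (hQ : Q.Unbiased) (he : e.Nonneg)
    (hm : Q.Multiplicative e) (hS : ∀ᵐ x ∂D.law, SketchConverges S x)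
    (h2 : ∀ i, MemLp (fun f : FeatVec M => f i) 2 (Q.featureLaw D S))
    {u : Fin M → FeatVec M} {g : Fin M → ℝ} (hE : EigenSystem (Q.featureCov D S) u g)
    {f : Fin k → DataVec p} {F : Finset (Coord p)} (hf : FiniteOrthonormal f F)
    {η : ℝ} (hη : 0 ≤ η) :
    ENNReal.ofReal (∑ i, min (g i) η) ≤ ENNReal.ofReal (k * η) +
      ENNReal.ofReal e.featureFactor *
        ∫⁻ x, ENNReal.ofReal (sketchNormSq S (residual f F x)) ∂D.law := by
  -- All but at most `k` basis vectors are orthogonal to the sketched family, so in those directions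
  -- the sketched data reduce to the sketched residual.
  obtain ⟨b, J, hJ, hb⟩ := exists_orthonormalBasis_orthogonal
    (fun l i => sketchedFamily S f i l : Fin k → Fin M → ℝ)
  have hq := quad_nonneg h2
  have h1 : ∀ j ∈ Jᶜ, ENNReal.ofReal (quad (Q.featureCov D S) (b j).ofLp) ≤
      ENNReal.ofReal e.featureFactor *
        ∫⁻ x, ENNReal.ofReal (((b j).ofLp ⬝ᵥ sketchApply S (residual f F x)) ^ 2) ∂D.law := by
    intro j hj
    refine (ofReal_quad_featureCov_le hQ he hm hS h2 _).trans (le_of_eq ?_)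
    congr 1
    refine lintegral_congr_ae ?_
    filter_upwards [hS] with x hx
    have h3 : (b j).ofLp ᵥ* sketchedFamily S f = 0 := by
      ext l; exact hb j (Finset.mem_compl.mp hj) l
    rw [sketchApply_eq_add_residual hf hx, dotProduct_add, Matrix.dotProduct_mulVec, h3,
      zero_dotProduct, zero_add]
  have h4 : ∑ i, min (g i) η ≤ k * η + ∑ j ∈ Jᶜ, quad (Q.featureCov D S) (b j).ofLp := by
    refine (hE.sum_min_le η b J).trans (add_le_add ?_ le_rfl)
    exact mul_le_mul_of_nonneg_right (by exact_mod_cast hJ) hη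
  refine (ENNReal.ofReal_le_ofReal h4).trans (ENNReal.ofReal_add_le.trans (add_le_add le_rfl ?_))
  rw [ENNReal.ofReal_sum_of_nonneg fun _ _ => hq _]
  refine (Finset.sum_le_sum h1).trans ?_
  rw [← Finset.mul_sum, ← lintegral_finsetSum _ fun j _ =>
    measurable_comp_sketchApply (measurable_residual f F) _]
  refine mul_le_mul_right (lintegral_mono fun x => ?_) _
  rw [← ENNReal.ofReal_sum_of_nonneg fun _ _ => sq_nonneg _]
  refine ENNReal.ofReal_le_ofReal ?_
  rw [sketchNormSq_eq, sum_dotProduct_mul_dotProduct b]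
  refine (Finset.sum_le_univ_sum_of_nonneg fun j => sq_nonneg _).trans (le_of_eq ?_)
  exact Finset.sum_congr rfl fun j _ => sq _

theorem popRisk_zero (w : DataVec p) :
    D.popRisk S w 0 = ENNReal.ofReal (1 / 2) * D.responseSq w := by
  rw [popRisk_eq, DataModel.responseSq, ← lintegral_const_mul' _ _ ENNReal.ofReal_ne_top]
  refine lintegral_congr fun x => ?_
  rw [← lintegral_const_mul' _ _ ENNReal.ofReal_ne_top]
  refine lintegral_congr fun y => ?_
  rw [← ENNReal.ofReal_mul (by norm_num)]
  simp

theorem comparatorRisk_le (he : e.Nonneg) (w : DataVec p) (V : FeatVec M) :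
    comparatorRisk D S e w V ≤ D.popRisk S w V +
      ENNReal.ofReal (1 / 2 * e.distortion) * D.responseSq w := by
  unfold comparatorRisk
  refine add_le_add (mul_le_of_le_one_left' ?_) le_rfl
  exact ENNReal.ofReal_le_one.mpr (inv_le_one_of_one_le₀ he.one_le_featureFactor)

theorem distortion_mem (he : e.Nonneg) : 0 ≤ e.distortion ∧ e.distortion < 1 := by
  have h1 := e.one_sub_distortion
  have h2 := he.one_le_featureFactor
  have h3 : 0 < 1 / e.featureFactor := by positivity
  have h4 : 1 / e.featureFactor ≤ 1 := by rw [div_le_one (by linarith)]; exact h2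
  constructor <;> linarith

/-- The energy of the quantized minimizer is at most that of the response. -/
theorem quad_minimizer_le_responseSq (hQ : Q.Unbiased) (he : e.Nonneg)
    (hm : Q.Multiplicative e) (hS : ∀ᵐ x ∂D.law, SketchConverges S x)
    (h2 : ∀ i, MemLp (fun f : FeatVec M => f i) 2 (Q.featureLaw D S)) {w : DataVec p}
    {vq : FeatVec M} (hz : MemLp (fun t : FeatVec M × ℝ => t.2) 2 (Q.sample D S w))
    (hmin : ∀ v, Q.quantRisk D S w vq ≤ Q.quantRisk D S w v) :
    ENNReal.ofReal (quad (Q.featureCov D S) vq) ≤ D.responseSq w := by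
  -- The zero comparator: its weights `(1 - ε̄₃) / 2` and `ε̄₃ / 2` on the response energy add up to
  -- one half.
  have h1 := (quad_le_comparatorRisk_and_popRisk_le hQ he hm hS h2 hz hmin 0).1
  obtain ⟨h3, h4⟩ := distortion_mem he
  have h5 : comparatorRisk D S e w (0 : FeatVec M) =
      ENNReal.ofReal (1 / 2) * D.responseSq w := by
    unfold comparatorRisk
    have h6 := e.one_sub_distortion
    rw [one_div] at h6
    rw [popRisk_zero, ← mul_assoc, ← add_mul, ← ENNReal.ofReal_mul (by rw [← h6]; linarith),
      ← ENNReal.ofReal_add (by rw [← h6]; nlinarith) (by linarith), ← h6]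
    congr 2; ring
  have h7 : quad (Q.featureCov D S) (e.featureFactor⁻¹ • (0 : FeatVec M) - vq) =
      quad (Q.featureCov D S) vq := by
    unfold quad; rw [smul_zero, zero_sub, Matrix.mulVec_neg, neg_dotProduct_neg]
  rw [h5, h7, ENNReal.ofReal_mul (by norm_num)] at h1
  exact (ENNReal.mul_le_mul_iff_right (by simp) ENNReal.ofReal_ne_top).mp h1

/-- The expected risk of the averaged iterate splits into excess and comparator risks. -/
theorem expectedRisk_le {γ : ℝ} (hQ : Q.Unbiased) (he : e.Nonneg)
    (hm : Q.Multiplicative e) (hl : Q.LabelSquareIntegrable D)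
    (hS : ∀ᵐ x ∂D.law, SketchConverges S x)
    (h2 : ∀ i, MemLp (fun f : FeatVec M => f i) 2 (Q.featureLaw D S))
    {vq : DataVec p → FeatVec M} (hvq : Measurable vq)
    (hmin : ∀ᵐ w ∂D.prior, ∀ v, Q.quantRisk D S w (vq w) ≤ Q.quantRisk D S w v)
    (V : DataVec p → FeatVec M) (N : ℕ) :
    Q.expectedRisk D S γ N ≤ ENNReal.ofReal (1 / 2) *
      ∫⁻ z, ENNReal.ofReal (quad (Q.featureCov D S) ((N : ℝ)⁻¹ • z.2.2 - vq z.1))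
        ∂(Q.chain D S γ N) + ∫⁻ w, comparatorRisk D S e w (V w) ∂D.prior := by
  have hqm : Measurable fun z : DataVec p × (FeatVec M × FeatVec M) =>
      ENNReal.ofReal (quad (Q.featureCov D S) ((N : ℝ)⁻¹ • z.2.2 - vq z.1)) := by
    unfold quad dotProduct Matrix.mulVec dotProduct; fun_prop
  have hqi : Measurable fun w => ENNReal.ofReal (1 / 2) *
      ∫⁻ r, ENNReal.ofReal (quad (Q.featureCov D S) ((N : ℝ)⁻¹ • r.2 - vq w))
        ∂(Q.trajectory D S γ N w) :=
    (Measurable.lintegral_kernel_prod_right' (κ := Q.trajectory D S γ N) hqm).const_mul _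
  unfold expectedRisk chain
  rw [Measure.lintegral_compProd hqm, ← lintegral_const_mul' _ _ ENNReal.ofReal_ne_top,
    ← lintegral_add_left hqi]
  refine lintegral_mono_ae ?_
  filter_upwards [hmin, ae_memLp_label (S := S) hl] with w hw hz
  have h1 := (quad_le_comparatorRisk_and_popRisk_le hQ he hm hS h2 hz hw (V w)).2
  refine (lintegral_mono fun r => h1 _).trans (le_of_eq ?_)
  rw [lintegral_add_right _ measurable_const, ← lintegral_const_mul' _ _ ENNReal.ofReal_ne_top,
    lintegral_const, measure_univ, mul_one]
  congr 1
  exact lintegral_congr fun r => ENNReal.ofReal_mul (by norm_num)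

/-- The bias of the averaged iterate is controlled by any comparator. -/
theorem lintegral_bias_le (hQ : Q.Unbiased) (he : e.Nonneg)
    (hm : Q.Multiplicative e) (hl : Q.LabelSquareIntegrable D)
    (hS : ∀ᵐ x ∂D.law, SketchConverges S x)
    (h2 : ∀ i, MemLp (fun f : FeatVec M => f i) 2 (Q.featureLaw D S))
    {u : Fin M → FeatVec M} {g : Fin M → ℝ} (hE : EigenSystem (Q.featureCov D S) u g)
    {vq : DataVec p → FeatVec M}
    (hmin : ∀ᵐ w ∂D.prior, ∀ v, Q.quantRisk D S w (vq w) ≤ Q.quantRisk D S w v)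
    {V : DataVec p → FeatVec M} (hV : Measurable V) {η : ℝ} (hη : 0 ≤ η) :
    ∫⁻ w, ENNReal.ofReal (∑ i, min (g i) η * (u i ⬝ᵥ vq w) ^ 2) ∂D.prior ≤
      4 * ∫⁻ w, comparatorRisk D S e w (V w) ∂D.prior +
        ENNReal.ofReal (2 * η) * ∫⁻ w, ENNReal.ofReal (V w ⬝ᵥ V w) ∂D.prior := by
  have hVm : Measurable fun w => ENNReal.ofReal (2 * η) * ENNReal.ofReal (V w ⬝ᵥ V w) := by
    unfold dotProduct; fun_prop
  rw [← lintegral_const_mul' _ _ (by norm_num), ← lintegral_const_mul' _ _ ENNReal.ofReal_ne_top,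
    ← lintegral_add_right _ hVm]
  refine lintegral_mono_ae ?_
  filter_upwards [hmin, ae_memLp_label (S := S) hl] with w hw hz
  have h1 := (quad_le_comparatorRisk_and_popRisk_le hQ he hm hS h2 hz hw (V w)).1
  have hq := quad_nonneg h2
  have hΦ : e.featureFactor⁻¹ ≤ 1 := inv_le_one_of_one_le₀ he.one_le_featureFactor
  have hΦ0 : 0 ≤ e.featureFactor⁻¹ := inv_nonneg.mpr (by linarith [he.one_le_featureFactor])
  have h3 := hE.sum_min_mul_le hη (vq w) (e.featureFactor⁻¹ • V w)
  have h4 : (e.featureFactor⁻¹ • V w) ⬝ᵥ (e.featureFactor⁻¹ • V w) ≤ V w ⬝ᵥ V w := by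
    rw [smul_dotProduct, dotProduct_smul, smul_eq_mul, smul_eq_mul]
    have h5 : 0 ≤ V w ⬝ᵥ V w := Finset.sum_nonneg fun i _ => mul_self_nonneg _
    nlinarith [mul_le_one₀ hΦ hΦ0 hΦ]
  have h5 : (vq w - e.featureFactor⁻¹ • V w) ⬝ᵥ Q.featureCov D S *ᵥ
      (vq w - e.featureFactor⁻¹ • V w) =
      quad (Q.featureCov D S) (e.featureFactor⁻¹ • V w - vq w) := by
    unfold quad
    rw [← neg_sub (e.featureFactor⁻¹ • V w), Matrix.mulVec_neg, neg_dotProduct_neg]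
  rw [h5] at h3
  have h6 : ∑ i, min (g i) η * (u i ⬝ᵥ vq w) ^ 2 ≤
      4 * (1 / 2 * quad (Q.featureCov D S) (e.featureFactor⁻¹ • V w - vq w)) +
        2 * η * (V w ⬝ᵥ V w) := by
    have := mul_le_mul_of_nonneg_left h4 (show 0 ≤ 2 * η by linarith)
    linarith
  refine (ENNReal.ofReal_le_ofReal h6).trans (ENNReal.ofReal_add_le.trans ?_)
  rw [ENNReal.ofReal_mul (p := 4) (by norm_num), ENNReal.ofReal_mul (p := 2 * η) (by linarith),
    show ENNReal.ofReal 4 = 4 by simp]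
  exact add_le_add (mul_le_mul_right h1 _) le_rfl

end Quantizers

end

/-! ### The risk bound for a fixed good sketch -/

section

namespace Quantizers

variable {M k : ℕ} {p : ℕ∞} {Q : Quantizers M p} {D : DataModel p} {S : SketchMat M p}
  {e : ErrorLevels}

theorem _root_.QuantSGD.DataModel.measurable_responseSq : Measurable D.responseSq := by
  have h1 : Measurable fun z : DataVec p × DataVec p =>
      ∫⁻ y, ENNReal.ofReal (y ^ 2) ∂(D.label z) :=
    Measurable.lintegral_kernel (by fun_prop)
  exact h1.lintegral_prod_right'

/-- Either the features are distorted by a factor at most two, or the distortion is large. -/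
theorem sum_min_le_of_residual (hQ : Q.Unbiased) (he : e.Nonneg)
    (hm : Q.Multiplicative e) (hS : ∀ᵐ x ∂D.law, SketchConverges S x)
    (h2 : ∀ i, MemLp (fun f : FeatVec M => f i) 2 (Q.featureLaw D S))
    {u : Fin M → FeatVec M} {g : Fin M → ℝ} (hE : EigenSystem (Q.featureCov D S) u g)
    {f : Fin k → DataVec p} {F : Finset (Coord p)} (hf : FiniteOrthonormal f F)
    {η τ B : ℝ} (hη : 0 ≤ η) (hτ₀ : 0 ≤ τ) (hB : (Q.featureCov D S).trace ≤ B)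
    (hτ : ∫⁻ x, ENNReal.ofReal (sketchNormSq S (residual f F x)) ∂D.law ≤ ENNReal.ofReal τ) :
    ∑ i, min (g i) η ≤ k * η + 2 * τ + 2 * e.distortion * B := by
  obtain ⟨h3, h4⟩ := distortion_mem he
  have hΦ := he.one_le_featureFactor
  have hB0 : 0 ≤ B := le_trans (hE.trace_eq ▸ Finset.sum_nonneg fun i _ => hE.nonneg i) hB
  have hkη : 0 ≤ k * η := by positivity
  rcases le_or_gt e.featureFactor 2 with h | h
  · have h5 := (ofReal_sum_min_le hQ he hm hS h2 hE hf hη).trans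
      (add_le_add le_rfl (mul_le_mul (ENNReal.ofReal_le_ofReal h) hτ zero_le zero_le))
    rw [← ENNReal.ofReal_mul (by norm_num), ← ENNReal.ofReal_add hkη (by positivity),
      ENNReal.ofReal_le_ofReal_iff (by positivity)] at h5
    have : 0 ≤ 2 * e.distortion * B := by positivity
    linarith
  -- When `Φ > 2` the distortion exceeds one half, so the full trace is already at most `2 ε̄₃ B`.
  · have h5 : 1 / 2 ≤ e.distortion := by
      have h6 : 1 / e.featureFactor ≤ 1 / 2 := one_div_le_one_div_of_le (by norm_num) h.le
      linarith [e.one_sub_distortion]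
    have := hE.sum_min_le_trace η
    nlinarith

/-- The variance term under the stepsize condition. -/
theorem variance_le {m T₀ α γ A t c₀ γ₀ σ H v m' : ℝ} (hα : 0 < α)
    (hγ₀ : 0 < γ₀) (hγ : γ₀ ≤ γ) (hA : 1 ≤ A) (hc₀ : 0 < c₀) (ht : c₀ ≤ t)
    (hst : γ < 1 / (A * α * t)) (hm0 : 0 ≤ m) (hmt : m ≤ t) (hmm : m ≤ m')
    (hT : T₀ ≤ 3 * v + 3 * (1 + H)) (hT₀ : 0 ≤ T₀) (hv : 0 ≤ v) (hH : 0 ≤ H) :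
    m * (γ * (4 * (3 / 2 * A * α) * T₀ + 4 * (3 * A * (σ ^ 2 + α * T₀)))) ≤
      m' * ((54 * α * (1 + H) + 12 * σ ^ 2) / (α * c₀)) + 54 / (α * γ₀ * c₀) * v := by
  have hγ0 : 0 < γ := by linarith
  have ht0 : 0 < t := by linarith
  rw [lt_div_iff₀ (by positivity)] at hst
  -- The lower bound on the trace lets the stepsize condition absorb the amplification.
  have h1 : γ * A ≤ 1 / (α * c₀) := by
    rw [le_div_iff₀ (by positivity)]
    have : γ * A * (α * c₀) ≤ γ * A * (α * t) := by gcongr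
    linarith
  -- The part proportional to the noise variance `v` needs no decay, so a constant bound on the
  -- capped trace is enough there.
  have h2 : m ≤ 1 / (α * γ₀) := by
    rw [le_div_iff₀ (by positivity)]
    have h3 : m * (α * γ₀) ≤ t * (α * γ) := by gcongr
    have h4 : t * (α * γ) * 1 ≤ t * (α * γ) * A := by gcongr
    linarith
  have h5 : γ * (4 * (3 / 2 * A * α) * T₀ + 4 * (3 * A * (σ ^ 2 + α * T₀))) =
      (γ * A) * (18 * α * T₀ + 12 * σ ^ 2) := by ring
  rw [h5]
  have h6 : 18 * α * T₀ + 12 * σ ^ 2 ≤ (54 * α * (1 + H) + 12 * σ ^ 2) + 54 * α * v := by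
    nlinarith
  have h7 : 0 ≤ 54 * α * (1 + H) + 12 * σ ^ 2 := by positivity
  calc m * ((γ * A) * (18 * α * T₀ + 12 * σ ^ 2))
      ≤ m * ((1 / (α * c₀)) * ((54 * α * (1 + H) + 12 * σ ^ 2) + 54 * α * v)) := by
        gcongr
    _ = m * ((54 * α * (1 + H) + 12 * σ ^ 2) / (α * c₀)) + m * (54 / c₀ * v) := by
        field_simp
    _ ≤ m' * ((54 * α * (1 + H) + 12 * σ ^ 2) / (α * c₀)) + 1 / (α * γ₀) * (54 / c₀ * v) := by
        gcongr
    _ = _ := by field_simp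

/-- The bound for sketches that satisfy the Gaussian events. -/
def riskBound (s c₀ α γ₀ σ H v ε δ τ τ' : ℝ) (k N : ℕ) : ℝ :=
  -- The excess risk is `1 / 2` of `6` times bias plus variance, and the bias is at most `4 R + 2 η
  -- ‖V‖²` with comparator risk `R`. With the direct contribution of `R` this gives `12 + 1 = 13`,
  -- then `6` for the norm and `3` for the variance.
  13 * (2 * (v + δ + τ + s⁻¹ ^ 2 * τ') + 3 / 2 * ε * (v + δ + H)) +
    6 * (1 / (γ₀ * N)) * (s⁻¹ ^ 2 * k) +
    3 * ((k * (1 / (γ₀ * N)) + 2 * τ' + 2 * ε * (1 / (α * γ₀))) *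
      ((54 * α * (1 + H) + 12 * σ ^ 2) / (α * c₀)) + 54 / (α * γ₀ * c₀) * v)

/-- The sketch enters only through convergence of its series, the singular value bound `hT`, the
residual bound `hτ'` and the energy bound `hc`; a comparator then bounds both the approximation
error and the bias of SGD. -/
theorem expectedRisk_le_riskBound {α β γ γ₀ σLo σHi s c₀ δ τ τ' H : ℝ} {N n : ℕ}
    (hα : 0 < α) (hγ₀ : 0 < γ₀) (hγ : γ₀ ≤ γ) (hN : 1 ≤ N)
    (hF : D.FiniteTrace) (hI : D.IsotropicPrior) (hW : D.WellSpecified)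
    (hQ : Q.Unbiased) (he : e.Nonneg) (hm : Q.Multiplicative e) (hl : Q.LabelSquareIntegrable D)
    (hS : ∀ᵐ x ∂D.law, SketchConverges S x)
    (h4 : Q.FourthMoment D S α β) (hn : Q.NoiseCondition D S σLo σHi)
    (hst : γ < 1 / ((1 + e.amplification) * α * (Q.featureCov D S).trace))
    {f : Fin k → DataVec p} (hf : FiniteOrthonormal f (firstCoords p n)) (hs : 0 < s)
    (hT : ∀ c : Fin k → ℝ, s ^ 2 * ∑ l, c l ^ 2 ≤ ∑ i, (sketchedFamily S f *ᵥ c) i ^ 2)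
    (hδ₀ : 0 ≤ δ) (hδ₁ : δ ≤ 1) (hδ : D.truncationError n ≤ ENNReal.ofReal δ)
    (hτ₀ : 0 ≤ τ) (hτ : ∫⁻ x, ENNReal.ofReal (normSq (residual f (firstCoords p n) x)) ∂D.law ≤
      ENNReal.ofReal τ)
    (hτ'₀ : 0 ≤ τ') (hτ' : ∫⁻ x, ENNReal.ofReal (sketchNormSq S (residual f (firstCoords p n) x))
      ∂D.law ≤ ENNReal.ofReal τ')
    (hH₀ : 0 ≤ H) (hH : ∫⁻ x, ENNReal.ofReal (normSq x) ∂D.law ≤ ENNReal.ofReal H)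
    (hc₀ : 0 < c₀) (hc : ENNReal.ofReal c₀ ≤ ∫⁻ x, ENNReal.ofReal (sketchNormSq S x) ∂D.law) :
    Q.expectedRisk D S γ N ≤ ENNReal.ofReal
      (riskBound s c₀ α γ₀ σHi H D.noiseVar e.distortion δ τ τ' k N) := by
  obtain ⟨vq, hvq, hmin, hint, -, hle⟩ := hn
  have h2 := h4.memLp_two
  obtain ⟨hε0, hε1⟩ := distortion_mem he
  have hv := D.noiseVar_nonneg
  have hA : 1 ≤ 1 + e.amplification := by
    have h5 : 0 ≤ e.outGrad := he.2.2.2.2.2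
    have h6 := he.activationNoise_nonneg
    rw [e.one_add_amplification]; nlinarith
  obtain ⟨u, g, hE⟩ := exists_eigenSystem (posSemidef_featureCov h2)
  obtain ⟨V, hV, hV1, hV2⟩ := exists_comparator hF hI hW hS hf hs hT
  have hγ0 : 0 < γ := by linarith
  have hN0 : (0 : ℝ) < N := by exact_mod_cast hN
  -- the trace
  obtain ⟨t, ht⟩ : ∃ t, (Q.featureCov D S).trace = t := ⟨_, rfl⟩
  have htr0 : 0 ≤ t := ht ▸ hE.trace_eq ▸ Finset.sum_nonneg fun i _ => hE.nonneg i
  have hct : c₀ ≤ t := by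
    have := hc.trans (lintegral_sketchNormSq_le_trace hQ he hm hS h2)
    rwa [ht, ENNReal.ofReal_le_ofReal_iff htr0] at this
  have ht0 : 0 < t := by linarith
  rw [ht] at hst
  have hst' := hst
  rw [lt_div_iff₀ (by positivity)] at hst'
  -- A stepsize bounded below makes the stepsize condition an upper bound on the trace.
  have htB : (Q.featureCov D S).trace ≤ 1 / (α * γ₀) := by
    rw [ht, le_div_iff₀ (by positivity)]
    have h3 : t * (α * γ₀) ≤ t * (α * γ) := by gcongr
    have h4 : t * (α * γ) * 1 ≤ t * (α * γ) * (1 + e.amplification) := by gcongr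
    linarith
  -- the energy of the response
  have hY : ∫⁻ w, D.responseSq w ∂D.prior ≤ ENNReal.ofReal (3 * (D.noiseVar + δ + H)) := by
    refine (DataModel.lintegral_responseSq_le hF hI hW n).trans ?_
    rw [ENNReal.ofReal_mul (by norm_num), ENNReal.ofReal_add (by positivity) hH₀,
      ENNReal.ofReal_add hv hδ₀, show ENNReal.ofReal 3 = 3 by simp]
    gcongr
  obtain ⟨T₀, hT₀⟩ : ∃ T₀, 3 * (D.noiseVar + δ + H) = T₀ := ⟨_, rfl⟩
  have hT₀0 : 0 ≤ T₀ := by rw [← hT₀]; positivity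
  have hvT : ∫⁻ w, ENNReal.ofReal (quad (Q.featureCov D S) (vq w)) ∂D.prior ≤
      ENNReal.ofReal T₀ := by
    rw [← hT₀]
    refine le_trans (lintegral_mono_ae ?_) hY
    filter_upwards [hmin, ae_memLp_label (S := S) hl] with w hw hz
    exact quad_minimizer_le_responseSq hQ he hm hS h2 hz hw
  have hR : ∫⁻ w, comparatorRisk D S e w (V w) ∂D.prior ≤ ENNReal.ofReal
      (2 * (D.noiseVar + δ + τ + s⁻¹ ^ 2 * τ') + 1 / 2 * e.distortion * T₀) := by
    have hYm : Measurable fun w => ENNReal.ofReal (1 / 2 * e.distortion) * D.responseSq w :=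
      DataModel.measurable_responseSq.const_mul _
    refine (lintegral_mono fun w => comparatorRisk_le he w (V w)).trans ?_
    rw [lintegral_add_right _ hYm, lintegral_const_mul' _ _ ENNReal.ofReal_ne_top,
      ENNReal.ofReal_add (by positivity) (by positivity),
      ENNReal.ofReal_mul (p := 1 / 2 * e.distortion) (by positivity)]
    refine add_le_add (hV1.trans ?_) (mul_le_mul_right (hT₀ ▸ hY) _)
    rw [ENNReal.ofReal_mul (p := 2) (by norm_num), ENNReal.ofReal_add (by positivity) (by positivity),
      ENNReal.ofReal_add (by positivity) hτ₀, ENNReal.ofReal_add hv hδ₀,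
      ENNReal.ofReal_mul (p := s⁻¹ ^ 2) (by positivity), show ENNReal.ofReal 2 = 2 by simp]
    gcongr
  obtain ⟨R, hRdef⟩ : ∃ R, 2 * (D.noiseVar + δ + τ + s⁻¹ ^ 2 * τ') +
    1 / 2 * e.distortion * T₀ = R := ⟨_, rfl⟩
  have hR0 : 0 ≤ R := by rw [← hRdef]; positivity
  rw [hRdef] at hR
  -- stepsize
  obtain ⟨η, hη⟩ : ∃ η, 1 / (γ * N) = η := ⟨_, rfl⟩
  have hη0 : 0 ≤ η := by rw [← hη]; positivity
  have hη1 : η ≤ 1 / (γ₀ * N) := by rw [← hη]; gcongr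
  have hbias := lintegral_bias_le hQ he hm hl hS h2 hE hmin hV hη0
  have hstep := stepControl (γ := γ) hα.le hT₀0 hQ he hm hl h4 hvq hmin hint hle hvT
  -- The stepsize condition reads `γ (1 + ε̄₂) α tr G < 1`; multiplied by 3/2 it is the trace
  -- condition of the recursion.
  have havg := hstep.lintegral_quad_average_le hγ0 (by positivity) (by positivity) hE hT₀0 hvT
    (by rw [ht]; nlinarith) hN
  rw [hη] at havg
  obtain ⟨m, hmdef⟩ : ∃ m, ∑ i, min (g i) η = m := ⟨_, rfl⟩
  have hm0 : 0 ≤ m := hmdef ▸ Finset.sum_nonneg fun i _ => le_min (hE.nonneg i) hη0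
  have hmt : m ≤ t := hmdef ▸ ht ▸ hE.sum_min_le_trace η
  have hmm : m ≤ k * (1 / (γ₀ * N)) + 2 * τ' + 2 * e.distortion * (1 / (α * γ₀)) := by
    have h5 := sum_min_le_of_residual hQ he hm hS h2 hE hf hη0 hτ'₀ htB hτ'
    rw [hmdef] at h5
    have h6 : (k : ℝ) * η ≤ k * (1 / (γ₀ * N)) := by gcongr
    linarith
  have hvar := variance_le (σ := σHi) hα hγ₀ hγ hA hc₀ hct hst hm0 hmt hmm
    (T₀ := T₀) (v := D.noiseVar) (H := H) (by rw [← hT₀]; linarith) hT₀0 hv hH₀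
  rw [hmdef] at havg
  obtain ⟨X, hX⟩ : ∃ X, m * (γ * (4 * (3 / 2 * (1 + e.amplification) * α) * T₀ +
    4 * (3 * (1 + e.amplification) * (σHi ^ 2 + α * T₀)))) = X := ⟨_, rfl⟩
  have hX0 : 0 ≤ X := by rw [← hX]; positivity
  rw [hX] at havg hvar
  have hfin : Q.expectedRisk D S γ N ≤ ENNReal.ofReal
      (1 / 2 * (6 * (4 * R + 2 * η * (s⁻¹ ^ 2 * k) + X)) + R) := by
    refine (expectedRisk_le hQ he hm hl hS h2 hvq hmin V N).trans ?_
    rw [ENNReal.ofReal_add (by positivity) hR0, ENNReal.ofReal_mul (p := 1 / 2) (by norm_num),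
      ENNReal.ofReal_mul (p := 6) (by norm_num), ENNReal.ofReal_add (by positivity) hX0,
      ENNReal.ofReal_add (by positivity) (by positivity), ENNReal.ofReal_mul (p := 4) (by norm_num),
      ENNReal.ofReal_mul (p := 2 * η) (by positivity)]
    refine add_le_add (mul_le_mul_right (havg.trans (mul_le_mul_right
      (add_le_add (hbias.trans (add_le_add ?_ (mul_le_mul_right hV2 _))) le_rfl) _)) _) hR
    rw [show ENNReal.ofReal 4 = 4 by simp]
    exact mul_le_mul_right hR _
  refine hfin.trans (ENNReal.ofReal_le_ofReal ?_)
  have h7 : η * (s⁻¹ ^ 2 * k) ≤ 1 / (γ₀ * N) * (s⁻¹ ^ 2 * k) := by gcongr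
  unfold riskBound
  rw [← hRdef, ← hT₀]
  linarith

end Quantizers

end

/-! ### Good sketches and the choice of scales -/

section

variable {M : ℕ} {p : ℕ∞} {Q : Quantizers M p} {D : DataModel p} {e : ErrorLevels}

/-- Each square summable data point is good for almost every sketch; Fubini exchanges the
quantifiers. -/
theorem DataModel.ae_ae_sketchConverges (hF : D.FiniteTrace) :
    ∀ᵐ S ∂(gaussianSketch M p), ∀ᵐ x ∂D.law, SketchConverges S x := by
  refine (Measure.ae_ae_comm measurableSet_sketchConverges).mpr ?_
  filter_upwards [DataModel.ae_summable_sq hF] with x hx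
  exact ae_sketchConverges hx

/-- Without coordinates the sketched data vanish, and multiplicative quantization of zero is zero.
This disposes of `p = 0`, where the energy has no positive lower bound. -/
theorem Quantizers.trace_featureCov_eq_zero {S : SketchMat M p} {α β : ℝ} (hp : p = 0)
    (hQ : Q.Unbiased) (he : e.Nonneg) (hm : Q.Multiplicative e) (h4 : Q.FourthMoment D S α β) :
    (Q.featureCov D S).trace = 0 := by
  have h2 := h4.memLp_two
  have hempty : IsEmpty (Coord p) := ⟨fun j => by simpa [hp] using j.2⟩
  have hsum : ∀ (x : DataVec p) (i : Fin M) (n : ℕ), ∑ j ∈ firstCoords p n, S i j * x j = 0 :=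
    fun x i n => by rw [Finset.eq_empty_of_isEmpty (firstCoords p n), Finset.sum_empty]
  have hlim : ∀ (x : DataVec p) (i : Fin M),
      Tendsto (fun n => ∑ j ∈ firstCoords p n, S i j * x j) atTop (𝓝 0) := fun x i => by
    simp_rw [hsum]; exact tendsto_const_nhds
  have hS : ∀ᵐ x ∂D.law, SketchConverges S x := ae_of_all _ fun x i => ⟨0, hlim x i⟩
  have h0 : ∀ x : DataVec p, sketchApply S x = 0 := fun x => by
    ext i; exact (hlim x i).limUnder_eq
  have h1 : (Q.featureCov D S).trace = ∑ i, quad (Q.featureCov D S) (Pi.single i 1) := by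
    unfold quad Matrix.trace
    exact Finset.sum_congr rfl fun i _ => by simp
  rw [h1]
  refine Finset.sum_eq_zero fun i _ => ?_
  have h3 := Quantizers.ofReal_quad_featureCov_le hQ he hm hS h2 (Pi.single i 1)
  simp only [h0, dotProduct_zero, ne_eq, OfNat.ofNat_ne_zero, not_false_eq_true, zero_pow,
    ENNReal.ofReal_zero, lintegral_zero, mul_zero, nonpos_iff_eq_zero, ENNReal.ofReal_eq_zero] at h3
  exact le_antisymm h3 (Quantizers.quad_nonneg h2 _)

/-- The three Gaussian events fail with small probability. -/
theorem exceptional_probability_le {M : ℕ} (hM : 1 ≤ M) :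
    ENNReal.ofReal ((√2 * Real.exp (-(20 / 4))) ^ M) +
      ENNReal.ofReal ((Real.exp 1 * √(2 * Real.exp (-10) / 2)) ^ M) +
      ENNReal.ofReal (2 * Real.exp (-(4 * M))) ≤ ENNReal.ofReal (Real.exp (-1 * M)) := by
  have hM1 : (1 : ℝ) ≤ M := by exact_mod_cast hM
  have hE : ∀ x : ℝ, Real.exp x ^ M = Real.exp (x * M) := fun x => by
    rw [← Real.exp_nat_mul, mul_comm]
  have h2 : √2 ≤ Real.exp 1 := by
    have : √2 ≤ 2 := by rw [Real.sqrt_le_left (by norm_num)]; norm_num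
    linarith [Real.add_one_le_exp 1]
  -- The levels `K = 20` and `ρ = 2 e ^ (-10)` make the first two probabilities at most `e ^ (-4 M)`
  -- each; with the third the total is `4 e ^ (-4 M) ≤ e ^ (-M)`.
  have h1 : (√2 * Real.exp (-(20 / 4))) ^ M ≤ Real.exp (-(4 * M)) := by
    have : √2 * Real.exp (-(20 / 4)) ≤ Real.exp (-4) := by
      rw [show (-4 : ℝ) = 1 + -(20 / 4) by norm_num, Real.exp_add]
      gcongr
    refine (pow_le_pow_left₀ (by positivity) this M).trans (le_of_eq ?_)
    rw [hE]; ring_nf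
  have h3 : (Real.exp 1 * √(2 * Real.exp (-10) / 2)) ^ M = Real.exp (-(4 * M)) := by
    rw [mul_div_cancel_left₀ _ (two_ne_zero' ℝ), ← Real.exp_half, ← Real.exp_add, hE]
    ring_nf
  rw [← ENNReal.ofReal_add (by positivity) (by positivity),
    ← ENNReal.ofReal_add (by positivity) (by positivity)]
  refine ENNReal.ofReal_le_ofReal ?_
  have h4 : 4 ≤ Real.exp (3 * M) := by
    have := Real.add_one_le_exp (3 * (M : ℝ))
    linarith
  have h5 : Real.exp (-1 * M) = Real.exp (3 * M) * Real.exp (-(4 * M)) := by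
    rw [← Real.exp_add]; ring_nf
  have h6 := mul_le_mul_of_nonneg_right h4 (Real.exp_pos (-(4 * (M : ℝ)))).le
  rw [h3, h5]
  linarith

/-- All but exponentially few sketches satisfy any risk bound that dominates `riskBound`. -/
theorem gaussianSketch_not_le_riskBound {N : ℕ} {a cLo cHi α β σLo σHi γ₀ γ : ℝ} (ha : 1 < a)
    (hcLo : 0 < cLo) (hcHi : 0 < cHi) (hα : 0 < α) (hγ₀ : 0 < γ₀) (hM : 1 ≤ M) (hN : 1 ≤ N)
    (hγ : γ₀ ≤ γ) (hp : 0 < p) (hF : D.FiniteTrace) (hP : D.PowerLawSpectrum a cLo cHi)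
    (hI : D.IsotropicPrior) (hW : D.WellSpecified) (hQ : Q.Unbiased) (he : e.Nonneg)
    (hm : Q.Multiplicative e) (hl : Q.LabelSquareIntegrable D) {k : ℕ} (hk : 2 * k ≤ M)
    {d : ℝ} (hd : d = ((k : ℝ) + 1) ^ (1 - a)) {B : ℝ}
    (hB : ∀ m ≤ k, Quantizers.riskBound (1 / 10 ^ 7) (2 * Real.exp (-10) * cLo) α γ₀ σHi
      (cHi * (a / (a - 1))) D.noiseVar e.distortion d ((cHi * (a / (a - 1)) + 1) * d)
      (20 * ((cHi * (a / (a - 1)) + 1) * d)) m N ≤ B) :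
    gaussianSketch M p {S | ¬ (Q.FourthMoment D S α β → Q.NoiseCondition D S σLo σHi →
        γ < 1 / ((1 + e.amplification) * α * (Q.featureCov D S).trace) →
        Q.expectedRisk D S γ N ≤ ENNReal.ofReal B)} ≤ ENNReal.ofReal (Real.exp (-1 * M)) := by
  obtain ⟨H, hHdef⟩ : ∃ H, cHi * (a / (a - 1)) = H := ⟨_, rfl⟩
  have hH0 : 0 < H := by
    rw [← hHdef]; exact mul_pos hcHi (div_pos (by linarith) (by linarith))
  have hd0 : 0 < d := by rw [hd]; positivity
  have hd1 : d ≤ 1 := by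
    rw [hd]
    exact Real.rpow_le_one_of_one_le_of_nonpos (by linarith [Nat.cast_nonneg (α := ℝ) k])
      (by linarith)
  have hdE : 0 < ENNReal.ofReal d := ENNReal.ofReal_pos.mpr hd0
  -- The coordinate level `n` depends on the data model and not on the sketch. It makes both the
  -- tail of the data and the truncation of the target smaller than `d`, the order of the eigenvalue
  -- tail.
  obtain ⟨n, ⟨m, hmk, f, hf, hres⟩, hn⟩ := ((DataModel.exists_finiteOrthonormal hF ha hcHi.le hP k
    hdE).and ((DataModel.tendsto_truncationError hW).eventually (eventually_le_nhds hdE))).exists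
  have hres' : ∫⁻ x, ENNReal.ofReal (normSq (residual f (firstCoords p n) x)) ∂D.law ≤
      ENNReal.ofReal ((H + 1) * d) := by
    refine hres.trans (le_of_eq ?_)
    rw [← hd, ← mul_assoc, hHdef, ← ENNReal.ofReal_add (by positivity) hd0.le]
    congr 1; ring
  have hup := DataModel.lintegral_normSq_le hF ha hcHi.le hP
  have hlow := DataModel.le_lintegral_normSq hF hp hP
  rw [hHdef] at hup hB
  obtain ⟨tr, htr⟩ : ∃ tr, (∫⁻ x, ENNReal.ofReal (normSq x) ∂D.law).toReal = tr := ⟨_, rfl⟩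
  have htr' : ∫⁻ x, ENNReal.ofReal (normSq x) ∂D.law = ENNReal.ofReal tr := by
    rw [← htr, ENNReal.ofReal_toReal (ne_top_of_le_ne_top ENNReal.ofReal_ne_top hup)]
  have hctr : cLo ≤ tr := by
    rw [htr', ENNReal.ofReal_le_ofReal_iff'] at hlow
    rcases hlow with h | h
    · exact h
    · linarith
  have hsum := DataModel.ae_summable_sq hF
  have e1 := gaussianSketch_energy_gt_le (M := M) (K := 20) hM (measurable_residual f (firstCoords p n))
    (hsum.mono fun x hx => summable_residual_sq hf hx) (show 0 < (H + 1) * d by positivity)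
    (by norm_num) hres'
  have e2 := gaussianSketch_energy_lt_le (M := M) (φ := fun x => x) hM measurable_id hsum
    (show 0 < tr by linarith) (show 0 < 2 * Real.exp (-10) by positivity) htr'
  have e3 := gaussianSketch_exists_mulVec_lt_le hM (show 2 * m ≤ M by omega) hf
  have e0 : gaussianSketch M p {S | ¬ ∀ᵐ x ∂D.law, SketchConverges S x} = 0 :=
    ae_iff.mp (DataModel.ae_ae_sketchConverges hF)
  refine le_trans (measure_mono (fun S hS => ?_)) (le_trans (measure_union_le _ _) (le_trans
    (add_le_add (le_trans (measure_union_le _ _) (add_le_add (le_trans (measure_union_le _ _)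
      (add_le_add e0.le e1)) e2)) e3) ?_))
  · by_contra hcon
    simp only [Set.mem_union, Set.mem_ofPred_eq, not_or, not_not, not_lt, not_exists] at hcon
    obtain ⟨⟨⟨c0, c1⟩, c2⟩, c3⟩ := hcon
    refine hS fun h4 hnoise hst => ?_
    refine (Quantizers.expectedRisk_le_riskBound hα hγ₀ hγ hN hF hI hW hQ he hm hl c0 h4 hnoise
      hst hf (by norm_num) c3 hd0.le hd1 hn (by positivity) hres' (by positivity) c1 hH0.le hup
      (by positivity) ?_).trans (ENNReal.ofReal_le_ofReal (hB m hmk))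
    refine le_trans (ENNReal.ofReal_le_ofReal ?_) c2
    gcongr
  · rw [zero_add]
    exact exceptional_probability_le hM

/-- The risk bound, up to constants. -/
theorem exists_riskBound_le {s c₀ α γ₀ σ H : ℝ} (hc₀ : 0 < c₀) (hα : 0 < α)
    (hγ₀ : 0 < γ₀) (hH : 0 ≤ H) : ∃ C > 0, ∀ (v ε d : ℝ) (m N : ℕ), 0 ≤ v → 0 ≤ ε → ε ≤ 1 →
      0 ≤ d → d ≤ 1 → Quantizers.riskBound s c₀ α γ₀ σ H v ε d ((H + 1) * d)
        (20 * ((H + 1) * d)) m N ≤ C * (v + ε + d + (m : ℝ) / N) := by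
  obtain ⟨K, hK⟩ : ∃ K, (54 * α * (1 + H) + 12 * σ ^ 2) / (α * c₀) = K := ⟨_, rfl⟩
  obtain ⟨L, hL⟩ : ∃ L, 54 / (α * γ₀ * c₀) = L := ⟨_, rfl⟩
  have hK0 : 0 ≤ K := by rw [← hK]; positivity
  have hL0 : 0 ≤ L := by rw [← hL]; positivity
  obtain ⟨Cv, hCv⟩ : ∃ Cv, 26 + 39 / 2 + 3 * L = Cv := ⟨_, rfl⟩
  obtain ⟨Cd, hCd⟩ : ∃ Cd, 26 * (1 + (H + 1) * (1 + 20 * s⁻¹ ^ 2)) + 120 * (H + 1) * K = Cd :=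
    ⟨_, rfl⟩
  obtain ⟨Ce, hCe⟩ : ∃ Ce, 39 / 2 * (1 + H) + 6 * (1 / (α * γ₀)) * K = Ce := ⟨_, rfl⟩
  obtain ⟨Cq, hCq⟩ : ∃ Cq, 6 * (1 / γ₀) * s⁻¹ ^ 2 + 3 * (1 / γ₀) * K = Cq := ⟨_, rfl⟩
  have hCv0 : 0 < Cv := by rw [← hCv]; positivity
  have hCd0 : 0 ≤ Cd := by rw [← hCd]; positivity
  have hCe0 : 0 ≤ Ce := by rw [← hCe]; positivity
  have hCq0 : 0 ≤ Cq := by rw [← hCq]; positivity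
  refine ⟨Cv + Cd + Ce + Cq, by positivity, fun v ε d m N hv hε hε1 hd hd1 => ?_⟩
  obtain ⟨q, hq⟩ : ∃ q, (m : ℝ) / N = q := ⟨_, rfl⟩
  have hq0 : 0 ≤ q := by rw [← hq]; positivity
  have h1 : (m : ℝ) * (1 / (γ₀ * N)) = 1 / γ₀ * q := by rw [← hq]; field_simp
  have h2 : 6 * (1 / (γ₀ * N)) * (s⁻¹ ^ 2 * m) = 6 * (1 / γ₀) * s⁻¹ ^ 2 * q := by
    rw [← hq]; field_simp
  -- The mixed terms are absorbed because the distortion and the tail `d` are both at most one.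
  have h3 : ε * v ≤ v := mul_le_of_le_one_left hv hε1
  have h4 : ε * d ≤ ε := mul_le_of_le_one_right hε hd1
  have h5 : Quantizers.riskBound s c₀ α γ₀ σ H v ε d ((H + 1) * d) (20 * ((H + 1) * d)) m N ≤
      Cv * v + Ce * ε + Cd * d + Cq * q := by
    unfold Quantizers.riskBound
    rw [h1, h2, hK, hL, ← hCv, ← hCd, ← hCe, ← hCq]
    linarith
  rw [hq]
  refine h5.trans ?_
  have t1 := mul_nonneg hCv0.le hε
  have t2 := mul_nonneg hCv0.le hd
  have t3 := mul_nonneg hCv0.le hq0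
  have t4 := mul_nonneg hCd0 hv
  have t5 := mul_nonneg hCd0 hε
  have t6 := mul_nonneg hCd0 hq0
  have t7 := mul_nonneg hCe0 hv
  have t8 := mul_nonneg hCe0 hd
  have t9 := mul_nonneg hCe0 hq0
  have t10 := mul_nonneg hCq0 hv
  have t11 := mul_nonneg hCq0 hε
  have t12 := mul_nonneg hCq0 hd
  linarith

/-- The bracket in the effective data size is at least one and its exponent negative, so `N_eff ≤
N`. -/
theorem rpow_le_one_div_effData {a : ℝ} (ha : 1 < a) (he : e.Nonneg) {N : ℕ} (hN : 1 ≤ N) :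
    (N : ℝ) ^ (-((a - 1) / a)) ≤ 1 / effData a e N ^ ((a - 1) / a) := by
  have hN0 : (0 : ℝ) < N := by exact_mod_cast hN
  obtain ⟨h1, h2⟩ := Quantizers.distortion_mem he
  have hA : 1 ≤ 1 + e.amplification := by
    have h5 : 0 ≤ e.outGrad := he.2.2.2.2.2
    have h6 := he.activationNoise_nonneg
    rw [e.one_add_amplification]; nlinarith
  have h3 : 0 < (1 - e.distortion) ^ (1 / a) := Real.rpow_pos_of_pos (by linarith) _
  have h4 : (1 - e.distortion) ^ (1 / a) ≤ 1 :=
    Real.rpow_le_one (by linarith) (by linarith) (by positivity)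
  obtain ⟨B, hB⟩ : ∃ B, (1 + e.amplification) / (1 - e.distortion) ^ (1 / a) = B := ⟨_, rfl⟩
  have hB1 : 1 ≤ B := by rw [← hB, le_div_iff₀ h3]; linarith
  have hB2 : B ^ (-(a / (a - 1))) ≤ 1 := Real.rpow_le_one_of_one_le_of_nonpos hB1
    (neg_nonpos.mpr (div_nonneg (by linarith) (by linarith)))
  have hB3 : 0 < B ^ (-(a / (a - 1))) := Real.rpow_pos_of_pos (by linarith) _
  unfold effData
  rw [hB, Real.rpow_neg hN0.le, ← one_div]
  refine one_div_le_one_div_of_le (Real.rpow_pos_of_pos (by positivity) _) ?_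
  exact Real.rpow_le_rpow (by positivity) (mul_le_of_le_one_right hN0.le hB2)
    (div_nonneg (by linarith) (by linarith))

/-- The truncation level balances the approximation and sample errors. -/
theorem truncation_rates {a : ℝ} (ha : 1 < a) {M N k : ℕ} (hM : 1 ≤ M) (hN : 1 ≤ N)
    (hk : k = min (M / 2) ⌈(N : ℝ) ^ (1 / a)⌉₊) :
    ((k : ℝ) + 1) ^ (1 - a) ≤ 2 ^ (a - 1) * (1 / (M : ℝ) ^ (a - 1)) + (N : ℝ) ^ (-((a - 1) / a)) ∧
      (k : ℝ) / N ≤ 2 * (N : ℝ) ^ (-((a - 1) / a)) := by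
  have hM0 : (0 : ℝ) < M := by exact_mod_cast hM
  have hN1 : (1 : ℝ) ≤ N := by exact_mod_cast hN
  have hN0 : (0 : ℝ) < N := by linarith
  have ha0 : 0 < a := by linarith
  have hp1 : (1 : ℝ) ≤ (N : ℝ) ^ (1 / a) := Real.one_le_rpow hN1 (by positivity)
  have hexp : ((N : ℝ) ^ (1 / a)) ^ (1 - a) = (N : ℝ) ^ (-((a - 1) / a)) := by
    rw [← Real.rpow_mul hN0.le]; congr 1; ring
  have hMe : ((M : ℝ) / 2) ^ (1 - a) = 2 ^ (a - 1) * (1 / (M : ℝ) ^ (a - 1)) := by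
    rw [show 1 - a = -(a - 1) by ring, Real.rpow_neg (by positivity),
      Real.div_rpow hM0.le (by norm_num)]
    field_simp
  have hpM : 0 ≤ 2 ^ (a - 1) * (1 / (M : ℝ) ^ (a - 1)) := by positivity
  have hpN : 0 ≤ (N : ℝ) ^ (-((a - 1) / a)) := by positivity
  constructor
  -- Whichever argument attains the minimum supplies its own rate; the `+ 1` makes up for rounding
  -- `M / 2` down.
  · rcases min_choice (M / 2) ⌈(N : ℝ) ^ (1 / a)⌉₊ with h | h
    · have h1 : (M : ℝ) / 2 ≤ (k : ℝ) + 1 := by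
        rw [hk, h]
        have h2 : M ≤ 2 * (M / 2) + 1 := by omega
        have h3 : (M : ℝ) ≤ 2 * ((M / 2 : ℕ) : ℝ) + 1 := by exact_mod_cast h2
        linarith
      have := Real.rpow_le_rpow_of_nonpos (by positivity) h1 (show 1 - a ≤ 0 by linarith)
      linarith
    · have h1 : (N : ℝ) ^ (1 / a) ≤ (k : ℝ) + 1 := by
        rw [hk, h]
        linarith [Nat.le_ceil ((N : ℝ) ^ (1 / a))]
      have := Real.rpow_le_rpow_of_nonpos (by positivity) h1 (show 1 - a ≤ 0 by linarith)
      linarith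
  · have h1 : (k : ℝ) ≤ 2 * (N : ℝ) ^ (1 / a) := by
      have h2 : k ≤ ⌈(N : ℝ) ^ (1 / a)⌉₊ := hk ▸ min_le_right _ _
      have h3 : (k : ℝ) ≤ (⌈(N : ℝ) ^ (1 / a)⌉₊ : ℝ) := by exact_mod_cast h2
      linarith [Nat.ceil_lt_add_one (show 0 ≤ (N : ℝ) ^ (1 / a) by positivity)]
    have h4 : (N : ℝ) ^ (-((a - 1) / a)) = (N : ℝ) ^ (1 / a) / N := by
      rw [← Real.rpow_sub_one hN0.ne']; congr 1; field_simp; ring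
    rw [h4, ← mul_div_assoc]
    gcongr

end

end QuantSGD

end

/-! ### Assembling the scaling law -/

open QuantSGD
theorem mainTheorem1
    (a cLo cHi α β σLo σHi γ₀ : ℝ) (ha : 1 < a) (hcLo : 0 < cLo) (hcHi : 0 < cHi)
    (hα : 0 < α) (hβ : 0 < β) (hσLo : 0 < σLo) (hσHi : 0 < σHi) (hγ₀ : 0 < γ₀) :
    ∃ C > (0 : ℝ), ∃ c > (0 : ℝ),
      ∀ (p : ℕ∞) (M N : ℕ), 1 ≤ M → 1 ≤ N →
      ∀ (D : DataModel p) (Q : Quantizers M p) (e : ErrorLevels) (γ : ℝ), γ₀ ≤ γ →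
        D.FiniteTrace → D.PowerLawSpectrum a cLo cHi → D.IsotropicPrior → D.WellSpecified →
        Q.Unbiased → e.Nonneg → Q.Multiplicative e → Q.LabelSquareIntegrable D →
        gaussianSketch M p
          {S | ¬ (Q.FourthMoment D S α β → Q.NoiseCondition D S σLo σHi →
              γ < 1 / ((1 + e.amplification) * α * (Q.featureCov D S).trace) →
              Commute (Q.featureCov D S) (D.sketchedCov S) →
              Q.expectedRisk D S γ N ≤ ENNReal.ofReal
                (C * (1 / effModel M ^ (a - 1) + 1 / effData a e N ^ ((a - 1) / a)
                  + D.noiseVar + e.distortion)))}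
          ≤ ENNReal.ofReal (Real.exp (-c * M)) := by
  obtain ⟨C, hC, hbound⟩ := exists_riskBound_le (s := 1 / 10 ^ 7) (σ := σHi)
    (H := cHi * (a / (a - 1))) (c₀ := 2 * Real.exp (-10) * cLo) (by positivity) hα hγ₀
    (mul_nonneg hcHi.le (div_nonneg (by linarith) (by linarith)))
  -- Rounding `M / 2` costs `2 ^ (a - 1)`. The sample rate occurs once in the tail `(k + 1) ^ (1 -
  -- a)` and twice in `k / N`, which makes 3.
  refine ⟨C * (2 ^ (a - 1) + 3), by positivity, 1, one_pos, ?_⟩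
  intro p M N hM hN D Q e γ hγ hF hP hI hW hQ he hm hl
  rcases (zero_le : 0 ≤ p).eq_or_lt with hp | hp
  · refine le_trans (le_of_eq ?_) zero_le
    refine measure_mono_null (fun S hS => hS fun h4 _ hst _ => ?_) (measure_empty)
    -- For `p = 0` the trace is zero and division by zero gives zero, so the stepsize condition
    -- reads `γ < 0` and contradicts `γ ≥ γ₀ > 0`.
    rw [Quantizers.trace_featureCov_eq_zero hp.symm hQ he hm h4, mul_zero, div_zero] at hst
    linarith
  obtain ⟨hε0, hε1⟩ := Quantizers.distortion_mem he
  obtain ⟨k, hk⟩ : ∃ k, k = min (M / 2) ⌈(N : ℝ) ^ (1 / a)⌉₊ := ⟨_, rfl⟩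
  obtain ⟨hr1, hr2⟩ := truncation_rates ha hM hN hk
  have hN0 : (0 : ℝ) < N := by exact_mod_cast hN
  have hkM : 2 * k ≤ M := by
    have : k ≤ M / 2 := hk ▸ min_le_left _ _
    omega
  refine le_trans (measure_mono fun S hS => ?_) (gaussianSketch_not_le_riskBound (β := β)
    (σLo := σLo) (σHi := σHi) (B := C * (2 ^ (a - 1) + 3) * (1 / effModel M ^ (a - 1) +
      1 / effData a e N ^ ((a - 1) / a) + D.noiseVar + e.distortion)) ha hcLo hcHi hα hγ₀ hM hN hγ hp hF hP hI hW hQ he hm hl hkM rfl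
    fun m hmk => (hbound _ _ _ m N D.noiseVar_nonneg hε0 hε1.le (by positivity)
      (Real.rpow_le_one_of_one_le_of_nonpos (by linarith [Nat.cast_nonneg (α := ℝ) k])
        (by linarith))).trans ?_)
  · exact fun h => hS fun h4 hn hst _ => h h4 hn hst
  · have hv := D.noiseVar_nonneg
    have hmk' : (m : ℝ) / N ≤ k / N := by gcongr
    have hE := rpow_le_one_div_effData ha he hN
    have hpN : 0 ≤ (N : ℝ) ^ (-((a - 1) / a)) := by positivity
    have hpM : 0 ≤ 1 / (M : ℝ) ^ (a - 1) := by positivity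
    have h2 : (0 : ℝ) ≤ 2 ^ (a - 1) := by positivity
    unfold effModel
    rw [mul_assoc]
    refine mul_le_mul_of_nonneg_left ?_ hC.le
    have t1 := mul_nonneg h2 (hpN.trans hE)
    have t2 := mul_nonneg h2 hv
    have t3 := mul_nonneg h2 hε0
    linarith
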